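/- **Setting.** For all integers $k\ge 1$, $n\ge 0$ and every bit string $p$ (holding any further parameters, such as size or degree bounds) let $C=C_{p,k,n}$ be a class of Boolean functions $\{0,1\}^n\to\{0,1\}$ given by representations: each $f\in C$ is the function of at least one representation in the class. Assume that every $f\in C$ depends on at most $k$ coordinates; that $C$ is closed under variable projections ($f(x_{\pi(1)},\dots,x_{\pi(n)})\in C$ for $f\in C$ and every $\pi:[n]\to[n]$) and under zero projections (substituting $0$ for one variable); and that there are deterministic algorithms, running in time polynomial in $|p|,k,n$ and the length of the representation, which decide whether a given representation is in the class and evaluate a represented function at a given point. For $q\le\min(k,n)$ and $Y=\{y_1,\dots,y_q\}$, let $C(Y)$ be the set of functions of $y_1,\dots,y_q$ that depend on all these variables and lie in $C$ when $y_1,\dots,y_q$ are taken to be $x_1,\dots,x_q$. A membership query (MQ) returns the value of the target function at a point chosen by the algorithm. An example query (ExQ) returns a point drawn from the underlying distribution $D$, which is uniform in the uniform model and arbitrary and unknown in the distribution-free model. Parameters $\epsilon$ and $\delta$ are rational. The quantities $M,Q$ below may depend on $p,k,n$, and are computable in polynomial time for each constant $\delta$. Polynomial time means, for each constant $\delta$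 where there is a $\delta$: worst-case time polynomial in $|p|$, $k$, $n$ and, where there is an $\epsilon$, in $1/\epsilon$ and the bit lengths of its numerator and denominator. All algorithms receive $p,k,n$ as input, learners also $q$. *Learners.* A *proper learner* for $C(Y)$ in one of the two models is a randomized algorithm that, for every $q\le\min(k,n)$, every target $g\in C(Y)$, every admissible distribution $D$ on $\{0,1\}^q$ and all $\epsilon,\delta\in(0,1)$, runs in polynomial time, always makes at most $M(\epsilon,\delta)$ MQ and $Q(\epsilon,\delta)$ ExQ, and with probability at least $1-\delta$ outputs a representation in $C$ of a function $h$ of the variables $Y$ only, with $\Pr_{D}[h\ne g]\le\epsilon$. A *proper exact learner* for $C(Y)$ is the same without $\epsilon$ and without ExQ: it makes at most $M(\delta)$ MQ, and with probability at least $1-\delta$ outputs a representation in $C$ of $g$ itself. *Testers.* A *polynomial-time tester* for $C$ in one of the two models, with query bound $B$, is a randomized algorithm with MQ and ExQ access that, for every $\epsilon\in(0,1]$, every $f:\{0,1\}^n\to\{0,1\}$ and every admissible distribution $D$ on $\{0,1\}^n$, runs in polynomial time, always makes at most $B$ queries in total, accepts with probability at least $2/3$ if $f\in C$, and rejects with probability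 at least $2/3$ if $\Pr_{D}[f\neq g]\ge\epsilon$ for every $g\in C$. For $T\ge1$, $\tilde O(T)$ denotes a quantity of the form $c\,T(1+\log T)^{c}$; the constant $c$ here is absolute, the same for all classes and learners. **Theorem.** 1. If there is a polynomial-time proper exact learner for $C(Y)$ that makes $M(\delta)$ membership queries, then, both in the uniform and in the distribution-free model, $C$ has a polynomial-time tester that makes at most $M(1/24)+\tilde O(k/\epsilon)$ queries. 2. If there is a polynomial-time proper learner for $C(Y)$ in the uniform model that makes $M(\epsilon,\delta)$ membership and $Q(\epsilon,\delta)$ example queries, then $C$ has a polynomial-time tester in the uniform model that makes at most $$\tilde O\bigl(M(\epsilon/12,1/24)+Q(\epsilon/12,1/24)+k/\epsilon\bigr)$$ queries. 3. If there is a polynomial-time proper learner for $C(Y)$ in the distribution-free model that makes $M(\epsilon,\delta)$ membership and $Q(\epsilon,\delta)$ example queries, then $C$ has a polynomial-time tester in the distribution-free model that makes at most $$\tilde O\bigl(M(\epsilon/12,1/24)+k\,Q(\epsilon/12,1/24)+k/\epsilon\bigr)$$ queries. -/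

import Mathlib

noncomputable section

namespace ConciseTest

/-! ## A programming language with a step count

Randomized oracle algorithms are programs of a WHILE language whose finitely many variables hold
binary trees.  Every command is charged one unit plus the size of the value it writes, so a
running time also bounds the size of all data produced; up to polynomial factors this is the time
of a probabilistic oracle Turing machine. -/

/-- Binary trees, the data type of the language. -/
inductive Data : Type
  | nil : Data
  | cons : Data → Data → Data

namespace Data

/-- Number of nodes of a tree. -/
def size : Data → ℕ
  | nil => 1
  | cons l r => 1 + l.size + r.size

def hd : Data → Data
  | nil => nil
  | cons l _ => l

def tl : Data → Data
  | nil => nil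
  | cons _ r => r

/-- The truth value of a tree: `nil` is false and every other tree is true. -/
def truth : Data → Bool
  | nil => false
  | cons _ _ => true

def ofBool : Bool → Data
  | false => nil
  | true => cons nil nil

/-- A string of bits, as a right-nested list. -/
def ofBits : List Bool → Data
  | [] => nil
  | b :: l => cons (ofBool b) (ofBits l)

/-- A natural number in unary. -/
def unary (m : ℕ) : Data := ofBits (List.replicate m true)

/-- A natural number in binary, least significant bit first. -/
def binary (m : ℕ) : Data := ofBits m.bits

/-- A vector in `{0,1}^m`. -/
def ofVec {m : ℕ} (x : Fin m → Bool) : Data := ofBits (List.ofFn x)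

/-- Reading a tree as a vector in `{0,1}^m`; it inverts `ofVec`. -/
def toVec (m : ℕ) (d : Data) : Fin m → Bool := fun i => (hd (tl^[i.val] d)).truth

end Data

/-- Expressions. -/
inductive Expr : Type
  | var : ℕ → Expr
  | nil : Expr
  | cons : Expr → Expr → Expr
  | hd : Expr → Expr
  | tl : Expr → Expr

def Expr.eval (σ : ℕ → Data) : Expr → Data
  | .var x => σ x
  | .nil => Data.nil
  | .cons e e' => Data.cons (e.eval σ) (e'.eval σ)
  | .hd e => (e.eval σ).hd
  | .tl e => (e.eval σ).tl

/-- Programs. -/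
inductive Cmd : Type
  | skip : Cmd
  /-- `x := e` -/
  | assign (x : ℕ) (e : Expr) : Cmd
  | seq (c c' : Cmd) : Cmd
  /-- if `e` is true then `c` else `c'` -/
  | cond (e : Expr) (c c' : Cmd) : Cmd
  /-- while `e` is true do `c` -/
  | loop (e : Expr) (c : Cmd) : Cmd
  /-- `x :=` a fair random bit -/
  | flip (x : ℕ) : Cmd
  /-- membership query: `x := f(e)` -/
  | query (x : ℕ) (e : Expr) : Cmd
  /-- example query: `x :=` a string drawn from the distribution -/
  | sample (x : ℕ) : Cmd

/-- The two oracles: a Boolean function (for membership queries) and a distribution (for example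
queries) on `{0,1}^m`. -/
structure Oracle where
  m : ℕ
  f : (Fin m → Bool) → Bool
  D : PMF (Fin m → Bool)

/-- A state: contents of the variables, elapsed time, numbers of membership and of example queries
made so far. -/
structure St where
  store : ℕ → Data
  time : ℕ
  mq : ℕ
  exq : ℕ

def St.tick (s : St) : St := { s with time := s.time + 1 }

/-- Write `d` into the variable `x`, at a cost of one plus the size of `d`. -/
def St.put (s : St) (x : ℕ) (d : Data) : St :=
  { s with store := Function.update s.store x d, time := s.time + (1 + d.size) }

/-- Iterate `body` while `e` is true; `none` if the exit test has not been reached among the first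
`fuel` tests. -/
def iter (e : Expr) (body : St → PMF (Option St)) : ℕ → St → PMF (Option St)
  | 0, _ => PMF.pure none
  | fuel + 1, s =>
    if (e.eval s.store).truth then
      (body s.tick).bind fun o =>
        match o with
        | none => PMF.pure none
        | some s' => iter e body fuel s'
    else PMF.pure (some s.tick)

/-- The distribution of the final state of a program; `none` stands for a run in which the test of
some loop is executed more than `fuel` times in a row.  A run that takes at most `fuel` time
units is never cut off, since every test costs one unit. -/
def exec (O : Oracle) (fuel : ℕ) : Cmd → St → PMF (Option St)
  | .skip, s => PMF.pure (some s.tick)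
  | .assign x e, s => PMF.pure (some (s.put x (e.eval s.store)))
  | .seq c c', s => (exec O fuel c s).bind fun o =>
      match o with
      | none => PMF.pure none
      | some s' => exec O fuel c' s'
  | .cond e c c', s =>
      if (e.eval s.store).truth then exec O fuel c s.tick else exec O fuel c' s.tick
  | .loop e c, s => iter e (exec O fuel c) fuel s
  | .flip x, s => (PMF.uniformOfFintype Bool).bind fun b => PMF.pure (some (s.put x (Data.ofBool b)))
  | .query x e, s =>
      PMF.pure (some
        { s.put x (Data.ofBool (O.f ((e.eval s.store).toVec O.m))) with mq := s.mq + 1 })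
  | .sample x, s => O.D.bind fun v =>
      PMF.pure (some { s.put x (Data.ofVec v) with exq := s.exq + 1 })

/-- Run a program on an input: variable `0` holds the input at the start and the output at the end;
all other variables are `nil` at the start. -/
def run (c : Cmd) (O : Oracle) (input : Data) (fuel : ℕ) : PMF (Option St) :=
  exec O fuel c ⟨Function.update (fun _ => Data.nil) 0 input, 0, 0, 0⟩

/-- Probability of an event. -/
def prob {α : Type} (μ : PMF α) (E : Set α) : ℝ := (μ.toOuterMeasure E).toReal

/-- The event that a run halts with an output in `S`. -/
def outputIn (S : Set Data) : Set (Option St) := {o | ∃ s, o = some s ∧ s.store 0 ∈ S}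

/-- On the given input, the program computes `out` within time `T` without any oracle query,
whatever the coins. -/
def ComputesIn (c : Cmd) (input out : Data) (T : ℕ) : Prop :=
  ∀ O : Oracle, ∀ o ∈ (run c O input T).support,
    ∃ s, o = some s ∧ s.time ≤ T ∧ s.mq = 0 ∧ s.exq = 0 ∧ s.store 0 = out

/-! ## Boolean functions -/

/-- `x_i` is a relevant variable of `f`. -/
def Relevant {n : ℕ} (f : (Fin n → Bool) → Bool) (i : Fin n) : Prop :=
  ∃ a b, f a ≠ f (Function.update a i b)

/-- `f` depends on at most `k` coordinates. -/
def IsJunta {n : ℕ} (k : ℕ) (f : (Fin n → Bool) → Bool) : Prop :=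
  ∃ S : Finset (Fin n), S.card ≤ k ∧ ∀ x y, (∀ i ∈ S, x i = y i) → f x = f y

def ClosedVarProj {n : ℕ} (C : Set ((Fin n → Bool) → Bool)) : Prop :=
  ∀ π : Fin n → Fin n, ∀ f ∈ C, (fun x => f fun j => x (π j)) ∈ C

def ClosedZeroProj {n : ℕ} (C : Set ((Fin n → Bool) → Bool)) : Prop :=
  ∀ i : Fin n, ∀ f ∈ C, (fun x => f (Function.update x i false)) ∈ C

/-- `Pr_{x ∈ D}[f(x) ≠ g(x)]`. -/
def errProb {n : ℕ} (D : PMF (Fin n → Bool)) (f g : (Fin n → Bool) → Bool) : ℝ :=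
  prob D {x | f x ≠ g x}

/-- A function of `x_1, …, x_q` as a function of `x_1, …, x_n`. -/
def lift {q n : ℕ} (h : q ≤ n) (g : (Fin q → Bool) → Bool) : (Fin n → Bool) → Bool :=
  fun x => g fun i => x (Fin.castLE h i)

/-- The uniform distribution on `{0,1}^n`. -/
def unif (n : ℕ) : PMF (Fin n → Bool) := PMF.uniformOfFintype _

/-- The uniform model and the distribution-free model. -/
inductive Model : Type
  | uniform : Model
  | distFree : Model

/-- The distributions that can occur in a model. -/
def Model.dists : Model → (n : ℕ) → Set (PMF (Fin n → Bool))
  | .uniform, n => {unif n}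
  | .distFree, _ => Set.univ

/-! ## Classes of representations -/

/-- An index of a family of classes: the number `n` of variables, the junta parameter `k ≥ 1` and
a string `p` that holds all other parameters of the class (sizes, degrees, …). -/
structure Idx where
  p : List Bool
  k : ℕ
  n : ℕ
  one_le_k : 1 ≤ k

def Idx.len (i : Idx) : ℕ := i.p.length + i.k + i.n

/-- The index as an input: `p` as a string, `k` and `n` in unary. -/
def Idx.enc (i : Idx) : Data :=
  Data.cons (Data.ofBits i.p) (Data.cons (Data.unary i.k) (Data.unary i.n))

/-- A family of classes of representations of Boolean functions: for every index, which trees are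
representations in the class, and which function on `{0,1}^n` they represent. -/
structure RepClass where
  valid : Idx → Data → Prop
  val : (i : Idx) → Data → (Fin i.n → Bool) → Bool

/-- The class `C` of the functions that have a representation in the class. -/
def RepClass.fns (R : RepClass) (i : Idx) : Set ((Fin i.n → Bool) → Bool) :=
  {f | ∃ r, R.valid i r ∧ R.val i r = f}

/-- `C(Y)` for `Y = {y_1, …, y_q}`: the functions of `y_1, …, y_q` that depend on all these
variables and that belong to `C` when `y_1, …, y_q` are taken to be `x_1, …, x_q`. -/
def RepClass.onVars (R : RepClass) (i : Idx) {q : ℕ} (hq : q ≤ i.n) :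
    Set ((Fin q → Bool) → Bool) :=
  {g | (∀ j, Relevant g j) ∧ lift hq g ∈ R.fns i}

/-- Whether a tree is a representation in the class is decided in time polynomial in its size. -/
def RepClass.Verifiable (R : RepClass) : Prop :=
  ∃ (c : Cmd) (P : Polynomial ℕ), ∀ (i : Idx) (r : Data),
    (R.valid i r → ComputesIn c (Data.cons i.enc r) (Data.ofBool true) (P.eval (i.len + r.size))) ∧
    (¬ R.valid i r →
      ComputesIn c (Data.cons i.enc r) (Data.ofBool false) (P.eval (i.len + r.size)))

/-- Represented functions are evaluated in time polynomial in the size of the representation. -/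
def RepClass.Evaluable (R : RepClass) : Prop :=
  ∃ (c : Cmd) (P : Polynomial ℕ), ∀ (i : Idx) (r : Data) (x : Fin i.n → Bool), R.valid i r →
    ComputesIn c (Data.cons i.enc (Data.cons r (Data.ofVec x))) (Data.ofBool (R.val i r x))
      (P.eval (i.len + r.size))

/-! ## Learners and testers

Rational parameters `ε = a / b` and `δ = c / d` are given by their numerators and denominators in
binary. -/

def frac (a b : ℕ) : Data := Data.cons (Data.binary a) (Data.binary b)

/-- The length `⌈1/ε⌉ + (bit lengths)` of a parameter `ε = a / b`. -/
def fracLen (a b : ℕ) : ℕ := ⌈(b : ℚ) / a⌉₊ + a.size + b.size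

/-- For every constant `δ`, the number `M i ε δ` is computed in polynomial time. -/
def PolyBound (M : Idx → ℚ → ℚ → ℕ) : Prop :=
  ∃ A : Cmd, ∀ c d : ℕ, 0 < c → c < d → ∃ P : Polynomial ℕ,
    ∀ (i : Idx) (a b : ℕ), 0 < a → a < b →
      ComputesIn A (Data.cons i.enc (Data.cons (frac a b) (frac c d)))
        (Data.binary (M i (a / b) (c / d))) (P.eval (i.len + fracLen a b))

/-- For every constant `δ`, the number `M i δ` is computed in polynomial time. -/
def PolyBoundExact (M : Idx → ℚ → ℕ) : Prop :=
  ∃ A : Cmd, ∀ c d : ℕ, 0 < c → c < d → ∃ P : Polynomial ℕ, ∀ i : Idx,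
    ComputesIn A (Data.cons i.enc (frac c d)) (Data.binary (M i (c / d))) (P.eval i.len)

/-- `A` is a proper learning algorithm for `C(Y)`, `|Y| ≤ k`, in the given model: on input
`(index, |Y|), ε, δ` and with access to a target `g ∈ C(Y)` and to a distribution `D` on `{0,1}^Y`,
it always makes at most `M(ε, δ)` membership and `Q(ε, δ)` example queries and runs in polynomial
time for constant `δ`; and with probability at least `1 - δ` it outputs a representation in `C` of
a function `h` of the variables `Y` that is `ε`-close to `g` with respect to `D`. -/
def PACLearns (mod : Model) (R : RepClass) (A : Cmd) (M Q : Idx → ℚ → ℚ → ℕ) : Prop :=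
  ∀ c d : ℕ, 0 < c → c < d → ∃ P : Polynomial ℕ,
    ∀ (i : Idx) (a b : ℕ), 0 < a → a < b → ∀ (q : ℕ) (hq : q ≤ i.n), q ≤ i.k →
      ∀ g ∈ R.onVars i hq, ∀ D ∈ mod.dists q,
        let T := P.eval (i.len + fracLen a b)
        let μ := run A ⟨q, g, D⟩
          (Data.cons (Data.cons i.enc (Data.unary q)) (Data.cons (frac a b) (frac c d))) T
        (∀ o ∈ μ.support, ∃ s, o = some s ∧ s.time ≤ T ∧
          s.mq ≤ M i (a / b) (c / d) ∧ s.exq ≤ Q i (a / b) (c / d)) ∧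
        1 - (c : ℝ) / d ≤ prob μ (outputIn
          {r | R.valid i r ∧ ∃ h, R.val i r = lift hq h ∧ errProb D h g ≤ (a : ℝ) / b})

/-- `A` is a proper exact learning algorithm for `C(Y)`, `|Y| ≤ k`: on input `(index, |Y|), δ` and
with access to a target `g ∈ C(Y)`, it always makes at most `M(δ)` membership queries and no
example query and runs in polynomial time for constant `δ`; and with probability at least `1 - δ`
it outputs a representation in `C` of `g`.  (The distribution in the oracle is never used.) -/
def ExactLearns (R : RepClass) (A : Cmd) (M : Idx → ℚ → ℕ) : Prop :=
  ∀ c d : ℕ, 0 < c → c < d → ∃ P : Polynomial ℕ,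
    ∀ (i : Idx) (q : ℕ) (hq : q ≤ i.n), q ≤ i.k → ∀ g ∈ R.onVars i hq,
      let T := P.eval i.len
      let μ := run A ⟨q, g, unif q⟩ (Data.cons (Data.cons i.enc (Data.unary q)) (frac c d)) T
      (∀ o ∈ μ.support, ∃ s, o = some s ∧ s.time ≤ T ∧ s.mq ≤ M i (c / d) ∧ s.exq = 0) ∧
      1 - (c : ℝ) / d ≤ prob μ (outputIn {r | R.valid i r ∧ R.val i r = lift hq g})

/-- `B` is a polynomial-time tester for `C` in the given model that makes at most `bound i ε`
queries (of both kinds together) on every Boolean function: a true output means "accept", a false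
output means "reject". -/
def IsPolyTester (mod : Model) (R : RepClass) (B : Cmd) (bound : Idx → ℚ → ℝ) : Prop :=
  ∃ P : Polynomial ℕ, ∀ (i : Idx) (a b : ℕ), 0 < a → a ≤ b →
    ∀ (f : (Fin i.n → Bool) → Bool), ∀ D ∈ mod.dists i.n,
      let T := P.eval (i.len + fracLen a b)
      let μ := run B ⟨i.n, f, D⟩ (Data.cons i.enc (frac a b)) T
      (∀ o ∈ μ.support, ∃ s, o = some s ∧ s.time ≤ T ∧
        ((s.mq + s.exq : ℕ) : ℝ) ≤ bound i (a / b)) ∧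
      (f ∈ R.fns i → 2 / 3 ≤ prob μ (outputIn {r | r.truth = true})) ∧
      ((∀ g ∈ R.fns i, (a : ℝ) / b ≤ errProb D f g) →
        2 / 3 ≤ prob μ (outputIn {r | r.truth = false}))

/-- `c T (1 + log T)^c`, an explicit member of `Õ(T)` for `T ≥ 1`. -/
def softO (c : ℕ) (T : ℝ) : ℝ := c * T * (1 + Real.log T) ^ c

end ConciseTest

end

open scoped ENNReal
noncomputable section
namespace ConciseTest

-- The tester looks for disjoint sets of coordinates (blocks), each containing one relevant variable
-- of `f`, lets the learner learn the function of the blocks, and checks the hypothesis against `f`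
-- on fresh examples.
--
-- Finding blocks. Let `X` be the union of the blocks found so far, and cut a point `u` down to `X`
-- by setting all other coordinates to zero. If `f` changes, `u` reveals a relevant variable outside
-- `X`. Random masks, drawn once for the whole run, then bisect the set on which the two points may
-- differ until every mask is constant on what is left (`search_spec`). If `f` is a `k`-junta, the
-- masks probably separate all relevant variables (`pr_not_separates`), so the block found contains
-- exactly one of them (`search_isolates`). A series of examples without a new block is evidence
-- that cutting down to `X` rarely changes `f` (`pr_findBlks_miss`). The learner needs a target that
-- depends on all its variables, so each block also keeps two points that vanish outside `X`, agree
-- on all other relevant variables, and have different values. If cutting the points of a block down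
-- to `X` spoils this, one of them reveals a further block (`PState.Good.verify`). The tester
-- rejects when it has found `k + 1` blocks.
--
-- Coordinates. In the good case, the restriction of `f` to a block is a literal of its relevant
-- variable `τ`. A test for linearity, multiplicativity and oddness enforces an approximate form of
-- this on every `f` (`exists_isDict`). The bit `u τ` is then read off from differences `g (b + u) +
-- g b` at random `b`, although `τ` is unknown; repetition makes errors rare, and contradictory
-- answers lead to rejection (`decode_wrong`).
--
-- Learning and checking. The learner gets the function of the blocks as target. Its examples are
-- coins in the uniform model, and decoded examples of `f` in the distribution-free model. Its
-- hypothesis must be a valid representation; it is evaluated at decoded points and compared with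
-- `f`, with a threshold on the number of mismatches.
--
-- Completeness. For `f` in `C`, the closure properties put the target in `C(Y)`
-- (`Found.mem_onVars`), decoding is exact and no dictator test fails. The remaining errors come
-- from the masks, the search, the learner and the final count, and are at most `1/12` each
-- (`testDist_complete`).
--
-- Soundness. Neither the search nor the learner is trusted. If some block is not close to a
-- literal, the dictator test rejects. Otherwise every valid hypothesis, with its variables replaced
-- by the variables of the blocks and by zero, is a function in `C`, hence far from `f`, and the
-- comparison shows this (`judge_sound`).
--
-- Cost. With `U` about `1/ε` and `L` about `log (k/ε)`, search and check need `O(k U L²)` queries;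
-- one decoded example costs `1 + 2 k L` queries, which explains the factor `k` in the
-- distribution-free bound (`TIx.rest_le`).
--
-- The rest of the work is to write the tester as a program. Specifications of programs are composed
-- together with their time and query bounds, uniformly over all inputs. On a general `f` the
-- learner has no guarantees, so it is interpreted with a clock and query budgets
-- (`SimSpec.simulate`); within its bounds the interpretation has the same output distribution as
-- the learner.

infixr:68 " :+ " => Data.cons
infixr:68 " :* " => Expr.cons

abbrev Pt (n : ℕ) : Type := Fin n → Bool

/-! ## Expectations and probabilities of discrete distributions -/

theorem bind_congr_support {α β : Type} (p : PMF α) {f g : α → PMF β}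
    (h : ∀ a ∈ p.support, f a = g a) : p.bind f = p.bind g := by
  ext b
  simp only [PMF.bind_apply]
  refine tsum_congr fun a => ?_
  by_cases ha : a ∈ p.support
  · rw [h a ha]
  · rw [PMF.mem_support_iff, not_not] at ha
    simp [ha]

theorem map_congr_support {α β : Type} (p : PMF α) {f g : α → β}
    (h : ∀ a ∈ p.support, f a = g a) : p.map f = p.map g :=
  bind_congr_support p fun a ha => by simp [h a ha]

theorem forall_support_map {α β : Type} {p : PMF α} {f : α → β} {E : β → Prop} :
    (∀ b ∈ (p.map f).support, E b) ↔ ∀ a ∈ p.support, E (f a) := by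
  simp only [PMF.mem_support_map_iff]
  aesop

/-- Lets a continuation that is indexed by mathematical objects act on their codes: off the range of
`enc` the extension takes the value of `g`, which is never reached. -/
theorem bind_extend {α β γ : Type} {enc : α → β} (hinj : Function.Injective enc) (μ : PMF α)
    (ν : α → PMF γ) (g : β → PMF γ) : (μ.map enc).bind (Function.extend enc ν g) = μ.bind ν := by
  rw [PMF.bind_map]
  congr 1
  exact funext (hinj.extend_apply ν g)

/-- Expectation of a nonnegative function. -/
def ex {α : Type} (μ : PMF α) (V : α → ℝ≥0∞) : ℝ≥0∞ := ∑' a, μ a * V a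

open Classical in
/-- Probability of a predicate. -/
def pr {α : Type} (μ : PMF α) (E : α → Prop) : ℝ≥0∞ := ex μ fun a => if E a then 1 else 0

section
variable {α β : Type} (μ : PMF α)

@[simp] theorem ex_pure (a : α) (V : α → ℝ≥0∞) : ex (PMF.pure a) V = V a := by
  classical
  unfold ex
  rw [tsum_eq_single a]
  · simp
  · intro b hb
    simp [hb]

theorem ex_bind (κ : α → PMF β) (V : β → ℝ≥0∞) :
    ex (μ.bind κ) V = ex μ fun a => ex (κ a) V := by
  unfold ex
  simp only [PMF.bind_apply, ← ENNReal.tsum_mul_right, ← ENNReal.tsum_mul_left]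
  rw [ENNReal.tsum_comm]
  simp only [mul_assoc]

theorem ex_map (g : α → β) (V : β → ℝ≥0∞) : ex (μ.map g) V = ex μ fun a => V (g a) := by
  rw [PMF.map, ex_bind]
  simp

variable {μ}

theorem ex_mono {V W : α → ℝ≥0∞} (h : ∀ a ∈ μ.support, V a ≤ W a) : ex μ V ≤ ex μ W := by
  refine ENNReal.tsum_le_tsum fun a => ?_
  by_cases ha : a ∈ μ.support
  · exact mul_le_mul_right (h a ha) _
  · rw [PMF.mem_support_iff, not_not] at ha
    simp [ha]

theorem ex_congr {V W : α → ℝ≥0∞} (h : ∀ a ∈ μ.support, V a = W a) : ex μ V = ex μ W :=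
  le_antisymm (ex_mono fun a ha => (h a ha).le) (ex_mono fun a ha => (h a ha).ge)

variable (μ)

@[simp] theorem ex_const (c : ℝ≥0∞) : ex μ (fun _ => c) = c := by
  unfold ex
  rw [ENNReal.tsum_mul_right, PMF.tsum_coe, one_mul]

theorem ex_add (V W : α → ℝ≥0∞) : ex μ (fun a => V a + W a) = ex μ V + ex μ W := by
  unfold ex
  simp only [mul_add]
  exact ENNReal.tsum_add

theorem ex_mul (c : ℝ≥0∞) (V : α → ℝ≥0∞) : ex μ (fun a => c * V a) = c * ex μ V := by
  unfold ex
  rw [← ENNReal.tsum_mul_left]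
  refine tsum_congr fun a => ?_
  ring

theorem ex_le_of_support {V : α → ℝ≥0∞} {c : ℝ≥0∞} (h : ∀ a ∈ μ.support, V a ≤ c) :
    ex μ V ≤ c := (ex_mono h).trans (ex_const μ c).le

theorem pr_bind (κ : α → PMF β) (E : β → Prop) :
    pr (μ.bind κ) E = ex μ fun a => pr (κ a) E := ex_bind _ _ _

theorem pr_map (g : α → β) (E : β → Prop) : pr (μ.map g) E = pr μ fun a => E (g a) :=
  ex_map _ _ _

theorem pr_le_one (E : α → Prop) : pr μ E ≤ 1 :=
  ex_le_of_support μ fun a _ => by split_ifs <;> simp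

variable {μ}

theorem pr_mono {E E' : α → Prop} (h : ∀ a ∈ μ.support, E a → E' a) : pr μ E ≤ pr μ E' := by
  refine ex_mono fun a ha => ?_
  by_cases h1 : E a
  · simp [h1, h a ha h1]
  · simp [h1]

theorem pr_congr {E E' : α → Prop} (h : ∀ a ∈ μ.support, (E a ↔ E' a)) : pr μ E = pr μ E' :=
  le_antisymm (pr_mono fun a ha => (h a ha).1) (pr_mono fun a ha => (h a ha).2)

theorem pr_eq_zero {E : α → Prop} (h : ∀ a ∈ μ.support, ¬ E a) : pr μ E = 0 :=
  le_antisymm (ex_le_of_support μ fun a ha => by simp [h a ha]) zero_le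

theorem pr_eq_one {E : α → Prop} (h : ∀ a ∈ μ.support, E a) : pr μ E = 1 := by
  unfold pr
  rw [ex_congr (W := fun _ => 1) fun a ha => by simp [h a ha]]
  simp

theorem pr_or_le (E E' : α → Prop) : pr μ (fun a => E a ∨ E' a) ≤ pr μ E + pr μ E' := by
  unfold pr
  rw [← ex_add]
  refine ex_mono fun a _ => ?_
  by_cases h : E a <;> by_cases h' : E' a <;> simp [h, h']

theorem pr_add_not (E : α → Prop) : pr μ E + pr μ (fun a => ¬ E a) = 1 := by
  unfold pr
  rw [← ex_add, ← ex_const μ 1]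
  refine ex_congr fun a _ => ?_
  by_cases h : E a <;> simp [h]

theorem pr_exists_mem_le {ι : Type} (s : Finset ι) (E : ι → α → Prop) :
    pr μ (fun a => ∃ i ∈ s, E i a) ≤ ∑ i ∈ s, pr μ (E i) := by
  classical
  induction s using Finset.induction_on with
  | empty => simp [pr]
  | insert i s hi ih =>
    rw [Finset.sum_insert hi]
    refine le_trans (le_trans (pr_mono ?_) (pr_or_le (E i) fun a => ∃ j ∈ s, E j a))
      (add_le_add le_rfl ih)
    rintro a _ ⟨j, hj, h⟩
    rcases Finset.mem_insert.1 hj with rfl | hj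
    · exact Or.inl h
    · exact Or.inr ⟨j, hj, h⟩

/-- Union bound for two consecutive experiments. -/
theorem pr_bind_le {κ : α → PMF β} {E : α → Prop} {E' : β → Prop} {b c : ℝ≥0∞}
    (h1 : pr μ E ≤ b) (h2 : ∀ a ∈ μ.support, ¬ E a → pr (κ a) E' ≤ c) :
    pr (μ.bind κ) E' ≤ b + c := by
  rw [pr_bind]
  calc ex μ (fun a => pr (κ a) E') ≤ pr μ E + ex μ (fun _ => c) := by
        unfold pr
        rw [← ex_add]
        refine ex_mono fun a ha => ?_
        by_cases h : E a
        · simp only [h, if_true]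
          exact (pr_le_one _ _).trans le_self_add
        · simp only [h, if_false, zero_add]
          exact h2 a ha h
    _ ≤ b + c := by simpa using add_le_add_left h1 c

/-- Markov's inequality. -/
theorem pr_le_ex {E : α → Prop} {V : α → ℝ≥0∞} (h : ∀ a ∈ μ.support, E a → 1 ≤ V a) :
    pr μ E ≤ ex μ V := by
  refine ex_mono fun a ha => ?_
  by_cases hE : E a
  · simpa [hE] using h a ha hE
  · simp [hE]

theorem prob_eq (μ : PMF α) (E : Set α) : prob μ E = (pr μ (· ∈ E)).toReal := by
  unfold prob pr ex
  rw [PMF.toOuterMeasure_apply]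
  congr 1
  refine tsum_congr fun a => ?_
  by_cases h : a ∈ E <;> simp [h]

theorem pr_ne_top (μ : PMF α) (E : α → Prop) : pr μ E ≠ ⊤ :=
  ne_top_of_le_ne_top ENNReal.one_ne_top (pr_le_one μ E)

/-- A lower bound of a probability from an upper bound for the complement. -/
theorem le_prob_of_pr_not_le {E : Set α} {b : ℝ} (hb : 0 ≤ b)
    (h : pr μ (fun a => a ∉ E) ≤ ENNReal.ofReal b) : 1 - b ≤ prob μ E := by
  rw [prob_eq]
  have h1 := congrArg ENNReal.toReal (pr_add_not (μ := μ) (· ∈ E))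
  rw [ENNReal.toReal_add (pr_ne_top _ _) (pr_ne_top _ _)] at h1
  have h2 := ENNReal.toReal_mono ENNReal.ofReal_ne_top h
  rw [ENNReal.toReal_ofReal hb] at h2
  simp only [ENNReal.toReal_one] at h1
  linarith

theorem pr_not_le_of_le_prob {E : Set α} {b : ℝ} (hb : 0 ≤ b) (h : 1 - b ≤ prob μ E) :
    pr μ (fun a => a ∉ E) ≤ ENNReal.ofReal b := by
  rw [prob_eq] at h
  have h1 := congrArg ENNReal.toReal (pr_add_not (μ := μ) (· ∈ E))
  rw [ENNReal.toReal_add (pr_ne_top _ _) (pr_ne_top _ _)] at h1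
  simp only [ENNReal.toReal_one] at h1
  rw [ENNReal.le_ofReal_iff_toReal_le (pr_ne_top _ _) hb]
  linarith

end

/-! ## Uniform distributions -/

theorem ex_uniform {α : Type} [Fintype α] [Nonempty α] (V : α → ℝ≥0∞) :
    ex (PMF.uniformOfFintype α) V = (Fintype.card α : ℝ≥0∞)⁻¹ * ∑ a, V a := by
  unfold ex
  simp only [PMF.uniformOfFintype_apply]
  rw [ENNReal.tsum_mul_left, tsum_fintype]

theorem pmf_ext_ex {α : Type} {μ ν : PMF α} (h : ∀ V, ex μ V = ex ν V) : μ = ν := by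
  classical
  ext a
  have := h (fun b => if b = a then 1 else 0)
  unfold ex at this
  rw [tsum_eq_single a (by intro b hb; simp [hb]), tsum_eq_single a (by intro b hb; simp [hb])]
    at this
  simpa using this

theorem uniform_map_equiv {α β : Type} [Fintype α] [Nonempty α] [Fintype β] [Nonempty β]
    (e : α ≃ β) : (PMF.uniformOfFintype α).map e = PMF.uniformOfFintype β := by
  refine pmf_ext_ex fun V => ?_
  rw [ex_map, ex_uniform, ex_uniform, Fintype.card_congr e, Equiv.sum_comp e V]

theorem uniform_prod {α β : Type} [Fintype α] [Nonempty α] [Fintype β] [Nonempty β] :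
    ((PMF.uniformOfFintype α).bind fun a => (PMF.uniformOfFintype β).map (Prod.mk a)) =
      PMF.uniformOfFintype (α × β) := by
  refine pmf_ext_ex fun V => ?_
  rw [ex_bind]
  simp only [ex_map, ex_uniform]
  rw [← Finset.mul_sum, ← mul_assoc, Fintype.card_prod, Nat.cast_mul,
    ENNReal.mul_inv (Or.inr (ENNReal.natCast_ne_top _)) (Or.inl (ENNReal.natCast_ne_top _)),
    Fintype.sum_prod_type]

/-- The last coordinate is split off because a program that puts coin after coin in front of a list
builds the vector from its end. -/
theorem unif_succ (n : ℕ) :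
    unif (n + 1) = (PMF.uniformOfFintype Bool).bind fun b =>
      (unif n).map fun v => (Fin.snoc v b : Pt (n + 1)) := by
  unfold unif
  rw [← uniform_map_equiv (Fin.snocEquiv fun _ : Fin (n + 1) => Bool), ← uniform_prod,
    PMF.map_bind]
  congr 1
  funext b
  rw [PMF.map_comp]
  rfl

infixr:65 " ;; " => Cmd.seq

/-! ## General properties of executions -/

def Expr.bnd : Expr → ℕ
  | .var x => x + 1
  | .nil => 0
  | e :* e' => max e.bnd e'.bnd
  | .hd e => e.bnd
  | .tl e => e.bnd

/-- All variables of a program are smaller than its bound. -/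
def Cmd.bnd : Cmd → ℕ
  | .skip => 0
  | .assign x e => max (x + 1) e.bnd
  | .seq c c' => max c.bnd c'.bnd
  | .cond e c c' => max e.bnd (max c.bnd c'.bnd)
  | .loop e c => max e.bnd c.bnd
  | .flip x => x + 1
  | .query x e => max (x + 1) e.bnd
  | .sample x => x + 1

theorem Expr.eval_congr {σ σ' : ℕ → Data} : ∀ {e : Expr}, (∀ x < e.bnd, σ x = σ' x) →
    e.eval σ = e.eval σ'
  | .var x, h => h x (Nat.lt_succ_self x)
  | .nil, _ => rfl
  | e :* e', h => by
    rw [Expr.eval, Expr.eval, eval_congr fun x hx => h x (lt_of_lt_of_le hx (le_max_left _ _)),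
      eval_congr fun x hx => h x (lt_of_lt_of_le hx (le_max_right _ _))]
  | .hd e, h => congrArg Data.hd (eval_congr (e := e) h)
  | .tl e, h => congrArg Data.tl (eval_congr (e := e) h)

theorem Data.one_le_size (d : Data) : 1 ≤ d.size := by
  cases d <;> simp only [Data.size] <;> omega

/-- The continuation of a run that may have been cut off. -/
def andThen (g : St → PMF (Option St)) : Option St → PMF (Option St)
  | none => PMF.pure none
  | some s => g s

@[simp] theorem andThen_some (g : St → PMF (Option St)) (s : St) : andThen g (some s) = g s := rfl

section
variable (O : Oracle) (F : ℕ)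

theorem exec_skip (s : St) : exec O F .skip s = PMF.pure (some s.tick) := by simp [exec]

theorem exec_assign (x : ℕ) (e : Expr) (s : St) :
    exec O F (.assign x e) s = PMF.pure (some (s.put x (e.eval s.store))) := by simp [exec]

theorem exec_seq (c c' : Cmd) (s : St) :
    exec O F (c ;; c') s = (exec O F c s).bind (andThen (exec O F c')) := by
  rw [exec]
  rfl

theorem exec_cond (e : Expr) (c c' : Cmd) (s : St) : exec O F (.cond e c c') s =
    if (e.eval s.store).truth then exec O F c s.tick else exec O F c' s.tick := by simp [exec]

theorem exec_loop (e : Expr) (c : Cmd) (s : St) :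
    exec O F (.loop e c) s = iter e (exec O F c) F s := by simp [exec]

theorem iter_succ (e : Expr) (body : St → PMF (Option St)) (fuel : ℕ) (s : St) :
    iter e body (fuel + 1) s = if (e.eval s.store).truth then
      (body s.tick).bind (andThen (iter e body fuel)) else PMF.pure (some s.tick) := by
  rw [iter]
  rfl

theorem exec_assign_seq (x : ℕ) (e : Expr) (c : Cmd) (s : St) :
    exec O F (.assign x e ;; c) s = exec O F c (s.put x (e.eval s.store)) := by
  rw [exec_seq, exec_assign, PMF.pure_bind]
  rfl

end

theorem mem_support_bind_andThen {μ : PMF (Option St)} {g : St → PMF (Option St)} {s' : St} :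
    some s' ∈ (μ.bind (andThen g)).support ↔ ∃ s1, some s1 ∈ μ.support ∧ some s' ∈
      (g s1).support := by
  rw [PMF.mem_support_bind_iff]
  constructor
  · rintro ⟨o, ho, h⟩
    cases o with
    | none => simp [andThen] at h
    | some s1 => exact ⟨s1, ho, h⟩
  · rintro ⟨s1, h1, h⟩
    exact ⟨some s1, h1, h⟩

theorem none_mem_support_bind_andThen {μ : PMF (Option St)} {g : St → PMF (Option St)} :
    none ∈ (μ.bind (andThen g)).support ↔
      none ∈ μ.support ∨ ∃ s1, some s1 ∈ μ.support ∧ none ∈ (g s1).support := by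
  rw [PMF.mem_support_bind_iff]
  constructor
  · rintro ⟨o, ho, h⟩
    cases o with
    | none => exact Or.inl ho
    | some s1 => exact Or.inr ⟨s1, ho, h⟩
  · rintro (h | ⟨s1, h1, h⟩)
    · exact ⟨none, h, by simp [andThen]⟩
    · exact ⟨some s1, h1, h⟩

theorem mem_support_of_map {γ : Type} {p : PMF (Option St)} {abs : St → γ} {μ : PMF γ}
    (h : p.map (Option.map abs) = μ.map some) {s : St} (hs : some s ∈ p.support) :
    abs s ∈ μ.support := by
  have : some (abs s) ∈ (p.map (Option.map abs)).support := by
    rw [PMF.mem_support_map_iff]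
    exact ⟨_, hs, rfl⟩
  rw [h, PMF.mem_support_map_iff] at this
  obtain ⟨d, hd, h⟩ := this
  exact Option.some.inj h ▸ hd

/-- Composition of runs whose final states are known up to `abs`. -/
theorem map_bind_andThen {γ : Type} {p : PMF (Option St)} {abs : St → γ} {μ : PMF γ}
    {g : St → PMF (Option St)} {ν : γ → PMF γ} (h : p.map (Option.map abs) = μ.map some)
    (hg : ∀ s, some s ∈ p.support → (g s).map (Option.map abs) = (ν (abs s)).map some) :
    (p.bind (andThen g)).map (Option.map abs) = (μ.bind ν).map some := by
  have hν : μ.bind (fun c => (ν c).map some) = (μ.map some).bind fun o => match o with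
      | none => PMF.pure none
      | some c => (ν c).map some := by rw [PMF.bind_map]; rfl
  rw [PMF.map_bind, PMF.map_bind, hν, ← h, PMF.bind_map]
  refine bind_congr_support _ fun o ho => ?_
  cases o with
  | none => exact PMF.pure_map _ _
  | some s => exact hg s ho

/-- A relation between states that every command preserves. -/
theorem exec_rel (Rel : St → St → Prop) (O : Oracle) (F m : ℕ)
    (htrans : ∀ s1 s2 s3, Rel s1 s2 → Rel s2 s3 → Rel s1 s3)
    (htick : ∀ s, Rel s s.tick) (hput : ∀ s x d, x < m → Rel s (s.put x d))
    (hmq : ∀ s x b, x < m → Rel s { s.put x (Data.ofBool b) with mq := s.mq + 1 })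
    (hexq : ∀ s x d, x < m → Rel s { s.put x d with exq := s.exq + 1 }) :
    ∀ c : Cmd, c.bnd ≤ m → ∀ s s', some s' ∈ (exec O F c s).support → Rel s s' := by
  intro c
  induction c with
  | skip =>
    intro _ s s' h
    rw [exec_skip] at h
    simp at h
    exact h ▸ htick s
  | assign x e =>
    intro hm s s' h
    rw [exec_assign] at h
    simp at h
    subst h
    exact hput _ _ _ (by simp [Cmd.bnd] at hm; omega)
  | seq c c' ih ih' =>
    intro hm s s' h
    simp only [Cmd.bnd, max_le_iff] at hm
    rw [exec_seq, mem_support_bind_andThen] at h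
    obtain ⟨s1, h1, h2⟩ := h
    exact htrans _ _ _ (ih hm.1 _ _ h1) (ih' hm.2 _ _ h2)
  | cond e c c' ih ih' =>
    intro hm s s' h
    simp only [Cmd.bnd, max_le_iff] at hm
    rw [exec_cond] at h
    split_ifs at h
    · exact htrans _ _ _ (htick s) (ih hm.2.1 _ _ h)
    · exact htrans _ _ _ (htick s) (ih' hm.2.2 _ _ h)
  | loop e c ih =>
    intro hm s s' h
    simp only [Cmd.bnd, max_le_iff] at hm
    rw [exec_loop] at h
    have : ∀ fuel s, some s' ∈ (iter e (exec O F c) fuel s).support → Rel s s' := by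
      intro fuel
      induction fuel with
      | zero => intro s h; simp [iter] at h
      | succ fuel ihf =>
        intro s h
        rw [iter_succ] at h
        split_ifs at h
        · rw [mem_support_bind_andThen] at h
          obtain ⟨s1, h1, h2⟩ := h
          exact htrans _ _ _ (htick s) (htrans _ _ _ (ih hm.2 _ _ h1) (ihf _ h2))
        · simp at h
          exact h ▸ htick s
    exact this _ _ h
  | flip x =>
    intro hm s s' h
    rw [exec, PMF.mem_support_bind_iff] at h
    obtain ⟨b, _, h⟩ := h
    simp at h
    subst h
    exact hput _ _ _ hm
  | query x e =>
    intro hm s s' h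
    rw [exec] at h
    simp at h
    subst h
    exact hmq _ _ _ (by simp [Cmd.bnd] at hm; omega)
  | sample x =>
    intro hm s s' h
    rw [exec, PMF.mem_support_bind_iff] at h
    obtain ⟨b, _, h⟩ := h
    simp at h
    subst h
    exact hexq _ _ _ hm

/-- Time and query counts grow, and queries take time. -/
theorem exec_mono {O : Oracle} {F : ℕ} {c : Cmd} {s s' : St}
    (h : some s' ∈ (exec O F c s).support) :
    s.time ≤ s'.time ∧ s.mq ≤ s'.mq ∧ s.exq ≤ s'.exq ∧
      s'.mq + s.time ≤ s.mq + s'.time ∧ s'.exq + s.time ≤ s.exq + s'.time := by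
  refine exec_rel (fun s s' => s.time ≤ s'.time ∧ s.mq ≤ s'.mq ∧ s.exq ≤ s'.exq ∧
      s'.mq + s.time ≤ s.mq + s'.time ∧ s'.exq + s.time ≤ s.exq + s'.time) O F c.bnd
    ?_ ?_ ?_ ?_ ?_ c le_rfl s s' h
  · intro s1 s2 s3 h1 h2; omega
  · intro s; simp [St.tick]
  · intro s x d _; simp [St.put]
  · intro s x d _; simp [St.put]; omega
  · intro s x d _; simp [St.put]; omega

/-- If `none` is unreachable, every test that is executed happens within the smaller fuel, so both
iterations unfold in the same way. -/
theorem iter_congr_fuel {e : Expr} {g g' : St → PMF (Option St)} :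
    ∀ (fuel fuel' : ℕ) (s : St), fuel ≤ fuel' → (∀ s, none ∉ (g s).support → g' s = g s) →
      none ∉ (iter e g fuel s).support → iter e g' fuel' s = iter e g fuel s
  | 0, _, s, _, _, h => by simp [iter] at h
  | fuel + 1, 0, s, hf, _, _ => by omega
  | fuel + 1, fuel' + 1, s, hf, hg, h => by
    rw [iter_succ] at h ⊢
    rw [iter_succ]
    split_ifs at h ⊢ with ht
    · rw [none_mem_support_bind_andThen, not_or] at h
      rw [hg _ h.1]
      refine bind_congr_support _ fun o ho => ?_
      cases o with
      | none => rfl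
      | some s1 =>
        exact iter_congr_fuel fuel fuel' s1 (by omega) hg fun h' => h.2 ⟨s1, ho, h'⟩
    · rfl

/-- More fuel does not change a run that is not cut off. -/
theorem exec_fuel (O : Oracle) {F F' : ℕ} (hF : F ≤ F') : ∀ (c : Cmd) (s : St),
    none ∉ (exec O F c s).support → exec O F' c s = exec O F c s
  | .skip, s, _ => by simp [exec]
  | .assign x e, s, _ => by simp [exec]
  | .seq c c', s, h => by
    rw [exec_seq, none_mem_support_bind_andThen, not_or] at h
    rw [exec_seq, exec_seq, exec_fuel O hF c s h.1]
    refine bind_congr_support _ fun o ho => ?_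
    cases o with
    | none => rfl
    | some s1 => exact exec_fuel O hF c' s1 fun h' => h.2 ⟨s1, ho, h'⟩
  | .cond e c c', s, h => by
    rw [exec_cond] at h ⊢
    rw [exec_cond]
    split_ifs at h ⊢
    · exact exec_fuel O hF c _ h
    · exact exec_fuel O hF c' _ h
  | .loop e c, s, h => by
    rw [exec_loop] at h ⊢
    rw [exec_loop]
    exact iter_congr_fuel F F' s hF (fun s hs => exec_fuel O hF c s hs) h
  | .flip x, s, _ => by simp [exec]
  | .query x e, s, _ => by simp [exec]
  | .sample x, s, _ => by simp [exec]

/-- The state `t` on the variables below `m` and the store of `s` on the others; time and queries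
are counted from `s` on. -/
def embed (m : ℕ) (s t : St) : St :=
  ⟨fun x => if x < m then t.store x else s.store x, s.time + t.time, s.mq + t.mq, s.exq + t.exq⟩

/-- A program does not see the variables beyond its bound, nor the time and the query counts at
its start. -/
theorem exec_embed (O : Oracle) (F m : ℕ) (s : St) : ∀ (c : Cmd), c.bnd ≤ m → ∀ t : St,
    exec O F c (embed m s t) = (exec O F c t).map (Option.map (embed m s)) := by
  have htick : ∀ t, (embed m s t).tick = embed m s t.tick := fun t => by
    simp [embed, St.tick]; omega
  have hput : ∀ t x d, x < m → (embed m s t).put x d = embed m s (t.put x d) := fun t x d hx => by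
    simp only [embed, St.put, St.mk.injEq]
    refine ⟨?_, by omega, trivial, trivial⟩
    funext y
    by_cases hy : y = x
    · subst hy; simp [hx]
    · simp [hy]
  have heval : ∀ (e : Expr) t, e.bnd ≤ m → e.eval (embed m s t).store = e.eval t.store :=
    fun e t he => Expr.eval_congr fun x hx => by
      simp [embed, lt_of_lt_of_le hx he]
  have hbind : ∀ (μ : PMF (Option St)) (g g' : St → PMF (Option St)),
      (∀ t, g' (embed m s t) = (g t).map (Option.map (embed m s))) →
      (μ.map (Option.map (embed m s))).bind (andThen g') =
        (μ.bind (andThen g)).map (Option.map (embed m s)) := by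
    intro μ g g' h
    rw [PMF.map_bind, PMF.bind_map]
    congr 1
    funext o
    cases o with
    | none => simp [andThen, PMF.pure_map]
    | some t => exact h t
  intro c
  induction c with
  | skip => intro _ t; rw [exec_skip, exec_skip, PMF.pure_map, htick]; rfl
  | assign x e =>
    intro hm t
    simp only [Cmd.bnd, max_le_iff] at hm
    rw [exec_assign, exec_assign, PMF.pure_map, heval e t hm.2, hput t x _ hm.1]; rfl
  | seq c c' ih ih' =>
    intro hm t
    simp only [Cmd.bnd, max_le_iff] at hm
    rw [exec_seq, exec_seq, ih hm.1]
    exact hbind _ _ _ (ih' hm.2)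
  | cond e c c' ih ih' =>
    intro hm t
    simp only [Cmd.bnd, max_le_iff] at hm
    rw [exec_cond, exec_cond, heval e t hm.1, htick, ih hm.2.1, ih' hm.2.2]
    split_ifs <;> rfl
  | loop e c ih =>
    intro hm t
    simp only [Cmd.bnd, max_le_iff] at hm
    rw [exec_loop, exec_loop]
    have : ∀ fuel t, iter e (exec O F c) fuel (embed m s t) =
        (iter e (exec O F c) fuel t).map (Option.map (embed m s)) := by
      intro fuel
      induction fuel with
      | zero => intro t; simp [iter, PMF.pure_map]
      | succ fuel ihf =>
        intro t
        rw [iter_succ, iter_succ, heval e t hm.1, htick, ih hm.2]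
        split_ifs
        · exact hbind _ _ _ ihf
        · rw [PMF.pure_map]; rfl
    exact this F t
  | flip x =>
    intro hm t
    rw [exec, exec, PMF.map_bind]
    congr 1
    funext b
    rw [hput t x _ hm, PMF.pure_map]; rfl
  | query x e =>
    intro hm t
    simp only [Cmd.bnd, max_le_iff] at hm
    rw [exec, exec, heval e t hm.2, hput t x _ hm.1, PMF.pure_map]
    simp [embed, St.put, add_assoc]
  | sample x =>
    intro hm t
    rw [exec, exec, PMF.map_bind]
    congr 1
    funext b
    rw [hput t x _ hm, PMF.pure_map]
    simp [embed, St.put, add_assoc]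

/-! ## Specifications of programs that work on the variable `0` only -/

/-- The output of a run. -/
def outD (o : Option St) : Option Data := o.map fun s => s.store 0

/-- The run `p` from `s` ends with a value of the variable `0` that is distributed as `μ`, it leaves
the other variables as they are, and its time and queries fit into `T` and `Q` even after adding
the potentials `pT` and `pQ` of the output. -/
def Meets (p : PMF (Option St)) (s : St) (μ : PMF Data) (T Q : ℕ) (pT pQ : Data → ℕ) : Prop :=
  p.map outD = μ.map some ∧ ∀ o ∈ p.support, ∃ s', o = some s' ∧
    s'.store = Function.update s.store 0 (s'.store 0) ∧ s'.time + pT (s'.store 0) ≤ s.time + T ∧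
    s'.mq + s'.exq + pQ (s'.store 0) ≤ s.mq + s.exq + Q

/-- The program `c` turns the value `d` of the variable `0` into a value distributed as `μ`, where
all other variables of `c` are `nil` before and after. -/
def PSpec (O : Oracle) (c : Cmd) (d : Data) (μ : PMF Data) (T Q : ℕ) (pT pQ : Data → ℕ) : Prop :=
  ∀ F s, T ≤ F → s.store 0 = d → (∀ x, 0 < x → x < c.bnd → s.store x = Data.nil) →
    Meets (exec O F c s) s μ T Q pT pQ

def Spec (O : Oracle) (c : Cmd) (d : Data) (μ : PMF Data) (T Q : ℕ) : Prop :=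
  PSpec O c d μ T Q (fun _ => 0) (fun _ => 0)

theorem Meets.mem_support {p : PMF (Option St)} {s : St} {μ : PMF Data} {T Q : ℕ} {pT pQ : Data → ℕ}
    (h : Meets p s μ T Q pT pQ) {s' : St} (hs : some s' ∈ p.support) : s'.store 0 ∈ μ.support :=
  mem_support_of_map (abs := fun s => s.store 0) h.1 hs

/-- The potential that the first run leaves behind is exactly the allowance of the second one. This
is amortised accounting in which the cost of the second run may depend on the value that it
receives. -/
theorem Meets.bind {p : PMF (Option St)} {s : St} {μ : PMF Data} {T Q : ℕ} {pT pQ pT' pQ' : Data →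
  ℕ}
    {g : St → PMF (Option St)} {ν : Data → PMF Data} (h : Meets p s μ T Q pT pQ)
    (hg : ∀ s1, some s1 ∈ p.support →
      Meets (g s1) s1 (ν (s1.store 0)) (pT (s1.store 0)) (pQ (s1.store 0)) pT' pQ') :
    Meets (p.bind (andThen g)) s (μ.bind ν) T Q pT' pQ' := by
  refine ⟨map_bind_andThen (abs := fun s => s.store 0) h.1 fun s1 hs => (hg s1 hs).1, ?_⟩
  intro o ho
  rw [PMF.mem_support_bind_iff] at ho
  obtain ⟨o1, ho1, ho⟩ := ho
  obtain ⟨s1, rfl, h1, h2, h3⟩ := h.2 o1 ho1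
  obtain ⟨s2, rfl, h4, h5, h6⟩ := (hg s1 ho1).2 o ho
  exact ⟨s2, rfl, by rw [h4, h1]; simp, by omega, by omega⟩

theorem Meets.bindM {α : Type} {p : PMF (Option St)} {s : St} {μ : PMF α} {enc : α → Data}
    {T Q : ℕ} {pT pQ pT' pQ' : Data → ℕ} {g : St → PMF (Option St)} {ν : α → PMF Data}
    (hinj : Function.Injective enc) (h : Meets p s (μ.map enc) T Q pT pQ)
    (hg : ∀ a ∈ μ.support, ∀ s1, some s1 ∈ p.support → s1.store 0 = enc a →
      Meets (g s1) s1 (ν a) (pT (enc a)) (pQ (enc a)) pT' pQ') :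
    Meets (p.bind (andThen g)) s (μ.bind ν) T Q pT' pQ' := by
  rw [← bind_extend hinj μ ν PMF.pure]
  refine h.bind fun s1 hs1 => ?_
  obtain ⟨a, ha, h2⟩ := (PMF.mem_support_map_iff _ _ _).1 (h.mem_support hs1)
  rw [← h2, hinj.extend_apply]
  exact hg a ha s1 hs1 h2.symm

theorem Meets.mono {p : PMF (Option St)} {s : St} {μ : PMF Data} {T Q T' Q' : ℕ}
    {pT pQ pT' pQ' : Data → ℕ} (h : Meets p s μ T Q pT pQ)
    (hT : ∀ d ∈ μ.support, T + pT' d ≤ T' + pT d) (hQ : ∀ d ∈ μ.support, Q + pQ' d ≤ Q' + pQ d) :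
    Meets p s μ T' Q' pT' pQ' := by
  refine ⟨h.1, fun o ho => ?_⟩
  obtain ⟨s', rfl, h1, h2, h3⟩ := h.2 o ho
  have := hT _ (h.mem_support ho)
  have := hQ _ (h.mem_support ho)
  exact ⟨s', rfl, h1, by omega, by omega⟩

section
variable {O : Oracle}

theorem PSpec.mono {c : Cmd} {d : Data} {μ : PMF Data} {T Q T' Q' : ℕ} {pT pQ pT' pQ' : Data → ℕ}
    (h : PSpec O c d μ T Q pT pQ) (h0 : T ≤ T') (hT : ∀ d ∈ μ.support, T + pT' d ≤ T' + pT d)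
    (hQ : ∀ d ∈ μ.support, Q + pQ' d ≤ Q' + pQ d) : PSpec O c d μ T' Q' pT' pQ' :=
  fun F s hF h1 h2 => (h F s (h0.trans hF) h1 h2).mono hT hQ

theorem Spec.mono {c : Cmd} {d : Data} {μ : PMF Data} {T Q T' Q' : ℕ} (h : Spec O c d μ T Q)
    (hT : T ≤ T') (hQ : Q ≤ Q') : Spec O c d μ T' Q' :=
  PSpec.mono h hT (fun _ _ => by simpa) (fun _ _ => by simpa)

theorem Spec.potential {c : Cmd} {d : Data} {μ : PMF Data} {T Q : ℕ} (h : Spec O c d μ T Q)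
    {T' Q' : ℕ} {pT pQ : Data → ℕ} (h0 : T ≤ T') (hT : ∀ d ∈ μ.support, T + pT d ≤ T')
    (hQ : ∀ d ∈ μ.support, Q + pQ d ≤ Q') : PSpec O c d μ T' Q' pT pQ :=
  PSpec.mono h h0 (fun d hd => by simpa using hT d hd) (fun d hd => by simpa using hQ d hd)

theorem PSpec.seqM {α : Type} {c c' : Cmd} {d : Data} {μ : PMF α} {enc : α → Data}
    {ν : α → PMF Data} {T Q : ℕ} {pT pQ pT' pQ' : Data → ℕ} (hinj : Function.Injective enc)
    (h : PSpec O c d (μ.map enc) T Q pT pQ)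
    (h' : ∀ a ∈ μ.support, PSpec O c' (enc a) (ν a) (pT (enc a)) (pQ (enc a)) pT' pQ') :
    PSpec O (c ;; c') d (μ.bind ν) T Q pT' pQ' := by
  intro F s hF h1 h2
  have hc := h F s hF h1 fun x hx hx' => h2 x hx (lt_of_lt_of_le hx' (le_max_left _ _))
  rw [exec_seq]
  refine hc.bindM hinj fun a ha s1 hs1 hs10 => ?_
  obtain ⟨_, h0, h4, h5, h6⟩ := hc.2 _ hs1
  cases h0
  refine h' a ha F s1 ?_ hs10 fun x hx hx' => ?_
  -- Time never decreases, so the potential left is at most `T`, and the fuel suffices for the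
  -- second program.
  · have := (exec_mono hs1).1
    rw [hs10] at h5
    omega
  · rw [h4, Function.update_of_ne (by omega)]
    exact h2 x hx (lt_of_lt_of_le hx' (le_max_right _ _))

theorem Spec.seqM {α : Type} {c c' : Cmd} {d : Data} {μ : PMF α} {enc : α → Data}
    {ν : α → PMF Data} {T Q T' Q' : ℕ} (hinj : Function.Injective enc)
    (h : Spec O c d (μ.map enc) T Q) (h' : ∀ a ∈ μ.support, Spec O c' (enc a) (ν a) T' Q') :
    Spec O (c ;; c') d (μ.bind ν) (T + T') (Q + Q') :=
  PSpec.seqM (pT := fun _ => T') (pQ := fun _ => Q') hinj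
    (Spec.potential h (Nat.le_add_right _ _) (fun _ _ => le_rfl) fun _ _ => le_rfl) h'

/-- Composition when the first program is deterministic. -/
theorem Spec.seqP {c c' : Cmd} {d d1 : Data} {ν : PMF Data} {T Q T' Q' : ℕ} {pT pQ : Data → ℕ}
    (h : Spec O c d (PMF.pure d1) T Q) (h' : PSpec O c' d1 ν T' Q' pT pQ) :
    PSpec O (c ;; c') d ν (T + T') (Q + Q') pT pQ := by
  have := PSpec.seqM (μ := PMF.pure d1) (enc := id) (ν := fun _ => ν) (pT := fun _ => T')
    (pQ := fun _ => Q') (pT' := pT) (pQ' := pQ) (c' := c') Function.injective_id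
    (Spec.potential (by rwa [PMF.map_id]) (Nat.le_add_right _ _) (fun _ _ => le_rfl)
      fun _ _ => le_rfl) (by simpa using h')
  rwa [PMF.pure_bind] at this

theorem Spec.seqD {c c' : Cmd} {d d1 : Data} {ν : PMF Data} {T Q T' Q' : ℕ}
    (h : Spec O c d (PMF.pure d1) T Q) (h' : Spec O c' d1 ν T' Q') :
    Spec O (c ;; c') d ν (T + T') (Q + Q') := Spec.seqP h h'

theorem Spec.potentialD {c : Cmd} {d d1 : Data} {T Q T' Q' : ℕ} {pT pQ : Data → ℕ}
    (h : Spec O c d (PMF.pure d1) T Q) (hT : T + pT d1 ≤ T') (hQ : Q + pQ d1 ≤ Q') :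
    PSpec O c d (PMF.pure d1) T' Q' pT pQ :=
  h.potential (by omega) (by simpa) (by simpa)

theorem Spec.congr {c : Cmd} {d : Data} {μ μ' : PMF Data} {T Q : ℕ} (h : Spec O c d μ T Q)
    (e : μ = μ') : Spec O c d μ' T Q := e ▸ h

theorem Spec.skip (d : Data) : Spec O .skip d (PMF.pure d) 1 0 := by
  rintro F s - rfl -
  rw [exec_skip]
  constructor
  · rw [PMF.pure_map, PMF.pure_map]; rfl
  · intro o ho
    simp at ho
    exact ⟨_, ho, by simp [St.tick], by simp [St.tick], by simp [St.tick]⟩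

theorem Spec.assign {e : Expr} {d d' : Data} (h : ∀ σ : ℕ → Data, σ 0 = d → e.eval σ = d') :
    Spec O (.assign 0 e) d (PMF.pure d') (1 + d'.size) 0 := by
  rintro F s - hd -
  rw [exec_assign]
  constructor
  · rw [PMF.pure_map, PMF.pure_map, h _ hd]; simp [outD, St.put]
  · intro o ho
    simp at ho
    exact ⟨_, ho, by simp [St.put], by simp [St.put, h _ hd], by simp [St.put]⟩

theorem PSpec.cond {e : Expr} {c c' : Cmd} {d : Data} {μ : PMF Data} {T Q : ℕ} {pT pQ : Data → ℕ}
    (b : Bool) (h : ∀ σ : ℕ → Data, σ 0 = d → (e.eval σ).truth = b)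
    (h1 : b = true → PSpec O c d μ T Q pT pQ) (h2 : b = false → PSpec O c' d μ T Q pT pQ) :
    PSpec O (.cond e c c') d μ (T + 1) Q pT pQ := by
  intro F s hF hd hs
  rw [exec_cond, h _ hd]
  have key : ∀ c'' : Cmd, c''.bnd ≤ (Cmd.cond e c c').bnd → PSpec O c'' d μ T Q pT pQ →
      Meets (exec O F c'' s.tick) s μ (T + 1) Q pT pQ := by
    intro c'' hb hc
    have := hc F s.tick (by omega) (by simpa [St.tick]) fun x hx hx' => hs x hx (by omega)
    refine ⟨this.1, fun o ho => ?_⟩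
    obtain ⟨s', rfl, h1, h2, h3⟩ := this.2 o ho
    simp [St.tick] at h1 h2 h3
    exact ⟨s', rfl, h1, by omega, by omega⟩
  cases b with
  | true => exact key c (by simp [Cmd.bnd]) (h1 rfl)
  | false => exact key c' (by simp [Cmd.bnd]) (h2 rfl)

theorem Spec.cond {e : Expr} {c c' : Cmd} {d : Data} {μ : PMF Data} {T Q : ℕ}
    (b : Bool) (h : ∀ σ : ℕ → Data, σ 0 = d → (e.eval σ).truth = b)
    (h1 : b = true → Spec O c d μ T Q) (h2 : b = false → Spec O c' d μ T Q) :
    Spec O (.cond e c c') d μ (T + 1) Q := PSpec.cond b h h1 h2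

/-- Writing a value costs more than its size, so no variable can grow by more than the time that
passes. -/
theorem exec_size {F : ℕ} {c : Cmd} {s s' : St} (h : some s' ∈ (exec O F c s).support) (x : ℕ) :
    (s'.store x).size + s.time ≤ (s.store x).size + s'.time := by
  have hput : ∀ (s : St) (y : ℕ) (d : Data) (x : ℕ),
      (Function.update s.store y d x).size + s.time ≤
        (s.store x).size + (s.time + (1 + d.size)) := by
    intro s y d x
    by_cases hx : x = y
    · subst hx; simp; omega
    · simp [hx]
  refine exec_rel (fun s s' => ∀ x, (s'.store x).size + s.time ≤ (s.store x).size + s'.time) O F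
    c.bnd ?_ ?_ ?_ ?_ ?_ c le_rfl s s' h x
  · intro s1 s2 s3 h1 h2 x
    have := h1 x
    have := h2 x
    omega
  · intro s x; simp [St.tick]
  · intro s x d _ y; exact hput _ _ _ _
  · intro s x d _ y; exact hput _ _ _ _
  · intro s x d _ y; exact hput _ _ _ _

/-- Apply `c` to the first component of a pair. -/
def Cmd.onFst (c : Cmd) : Cmd :=
  .assign (max 1 c.bnd) (.tl (.var 0)) ;; .assign 0 (.hd (.var 0)) ;; c ;;
    .assign 0 (.var 0 :* .var (max 1 c.bnd)) ;; .assign (max 1 c.bnd) .nil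

/-- The second component waits in the variable `max 1 c.bnd`, which `c` cannot touch. The time `T`
enters twice: once for the run of `c`, and once because the result, of size at most `a.size + T`, is
copied into the new pair. -/
theorem Spec.onFst {c : Cmd} {a b : Data} {μ : PMF Data} {T Q : ℕ} (h : Spec O c a μ T Q) :
    Spec O (.onFst c) (Data.cons a b) (μ.map fun a' => Data.cons a' b)
      (2 * T + 2 * a.size + 2 * b.size + 10) Q := by
  intro F s hF hd hs
  unfold Cmd.onFst at hs ⊢
  set m := max 1 c.bnd with hm
  have hm1 : 1 ≤ m := le_max_left _ _
  have hmc : c.bnd ≤ m := le_max_right _ _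
  have hs' : ∀ x, 0 < x → x ≤ m → s.store x = Data.nil := by
    intro x hx hx'
    refine hs x hx ?_
    simp only [Cmd.bnd]
    exact lt_of_lt_of_le (Nat.lt_succ_of_le hx') ((le_max_left (m + 1) _).trans (le_max_left _ _))
  rw [exec_assign_seq, exec_assign_seq, exec_seq]
  simp only [Expr.eval, hd, Data.tl]
  set s1 := (s.put m b).put 0 (((s.put m b).store 0).hd) with hs1
  have h10 : s1.store 0 = a := by
    have : (s.put m b).store 0 = s.store 0 := by
      simp only [St.put]; rw [Function.update_of_ne (by omega)]
    simp [hs1, St.put] at this ⊢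
    rw [this, hd]; rfl
  have h1m : s1.store m = b := by
    simp only [hs1, St.put]
    rw [Function.update_of_ne (by omega)]
    simp
  have h1x : ∀ x, x ≠ 0 → x ≠ m → s1.store x = s.store x := by
    intro x hx hxm
    simp [hs1, St.put, hx, hxm]
  have h1t : s1.time = s.time + (1 + b.size) + (1 + a.size) := by
    have : ((s.put m b).store 0).hd = a := by
      have : (s.put m b).store 0 = s.store 0 := by
        simp only [St.put]; rw [Function.update_of_ne (by omega)]
      rw [this, hd]; rfl
    rw [hs1, this]; simp [St.put]
  have h1q : s1.mq = s.mq ∧ s1.exq = s.exq := by simp [hs1, St.put]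
  have hc := h F s1 (by omega) h10 fun x hx hx' => by
    rw [h1x x (by omega) (by omega)]; exact hs' x hx (by omega)
  have hg : ∀ s2, exec O F (.assign 0 (.var 0 :* .var m) ;; .assign m .nil) s2 =
      PMF.pure (some ((s2.put 0 (s2.store 0 :+ s2.store m)).put m .nil)) := by
    intro s2
    rw [exec_assign_seq, exec_assign]
    rfl
  constructor
  · rw [PMF.map_bind]
    have : ((exec O F c s1).bind fun o => (andThen (exec O F
        (.assign 0 (.var 0 :* .var m) ;; .assign m .nil)) o).map outD) =
        ((exec O F c s1).map outD).map fun o => o.map fun a' => Data.cons a' b := by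
      rw [PMF.map, PMF.bind_map]
      refine bind_congr_support _ fun o ho => ?_
      obtain ⟨s2, rfl, h2, -⟩ := hc.2 o ho
      rw [andThen_some, hg, PMF.pure_map]
      have h2m : s2.store m = b := by
        rw [h2, Function.update_of_ne (by omega), h1m]
      have hm0 : (0 : ℕ) ≠ m := by omega
      simp [outD, St.put, h2m, hm0]
    rw [this, hc.1, PMF.map_comp, PMF.map_comp]
    rfl
  · intro o ho
    rw [PMF.mem_support_bind_iff] at ho
    obtain ⟨o1, ho1, ho⟩ := ho
    obtain ⟨s2, rfl, h2, h3, h4⟩ := hc.2 o1 ho1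
    have hsz := exec_size ho1 0
    have h2m : s2.store m = b := by
      rw [h2, Function.update_of_ne (by omega), h1m]
    rw [andThen_some, hg] at ho
    simp at ho
    have hm0 : (0 : ℕ) ≠ m := by omega
    refine ⟨_, ho, ?_, ?_, ?_⟩
    · funext x
      by_cases hx : x = 0
      · subst hx; simp [St.put, hm0]
      · by_cases hxm : x = m
        · subst hxm; simp [St.put, hx, hs' _ (by omega) le_rfl]
        · simp only [St.put, Function.update_of_ne hxm, Function.update_of_ne hx]
          rw [h2, Function.update_of_ne hx, h1x x hx hxm]
    · simp [St.put, h2m, Data.size]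
      rw [h10] at hsz
      omega
    · simp [St.put]
      omega

/-- Apply `c` to the value of `e`, and put the result in front. -/
def Cmd.push (e : Expr) (c : Cmd) : Cmd := .assign 0 (e :* .var 0) ;; .onFst c

/-! ### Black boxes -/

/-- Set the variables `1, …, m` to `nil`. -/
def Cmd.clear : ℕ → Cmd
  | 0 => .skip
  | m + 1 => .clear m ;; .assign (m + 1) .nil

theorem exec_clear (F : ℕ) (m : ℕ) (s : St) : exec O F (.clear m) s = PMF.pure (some
    ⟨fun x => if 0 < x ∧ x ≤ m then .nil else s.store x, s.time + (1 + 2 * m), s.mq, s.exq⟩) := by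
  induction m with
  | zero =>
    rw [Cmd.clear, exec_skip]
    congr 2
    simp only [St.tick, St.mk.injEq]
    refine ⟨?_, by simp, trivial, trivial⟩
    funext x
    rw [if_neg]
    omega
  | succ m ih =>
    rw [Cmd.clear, exec_seq, ih, PMF.pure_bind, andThen_some, exec_assign]
    congr 2
    simp only [St.put, St.mk.injEq, Expr.eval, Data.size]
    refine ⟨?_, by omega, trivial, trivial⟩
    funext x
    by_cases hx : x = m + 1
    · subst hx; simp
    · simp only [Function.update_of_ne hx]
      by_cases h : 0 < x ∧ x ≤ m
      · rw [if_pos h, if_pos (by omega)]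
      · rw [if_neg h, if_neg (by omega)]

/-- A program given from outside may leave data in its variables; clearing them restores the
convention that all variables except `0` are `nil` between commands. -/
def Cmd.clean (c : Cmd) : Cmd := c ;; .clear c.bnd

theorem le_clear_bnd {m : ℕ} (h : m ≠ 0) : m + 1 ≤ (Cmd.clear m).bnd := by
  cases m with
  | zero => simp at h
  | succ m => simp [Cmd.clear, Cmd.bnd, Expr.bnd]

/-- The run of a program on a large store that holds the input. -/
theorem exec_eq_run {F : ℕ} (c : Cmd) (s : St)
    (hs : ∀ x, 0 < x → x < c.bnd → s.store x = Data.nil) :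
    exec O F c s = (run c O (s.store 0) F).map (Option.map (embed (max 1 c.bnd) s)) := by
  unfold run
  rw [← exec_embed O F _ s c (le_max_right _ _)]
  congr 1
  simp only [embed]
  cases s
  simp only [St.mk.injEq, add_zero, and_true]
  funext x
  by_cases h0 : x = 0
  · subst h0; simp
  · simp only [Function.update_of_ne h0]
    split_ifs with h
    · exact hs x (by omega) (by omega)
    · rfl

/-- The hypothesis speaks of a run from a fresh store with fuel `T`. It carries over because a run
that is not cut off is unchanged by more fuel, and because a program does not see the variables
beyond its bound. -/
theorem ComputesIn.spec {c : Cmd} {d d' : Data} {T : ℕ} (h : ComputesIn c d d' T) :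
    Spec O (.clean c) d (PMF.pure d') (T + 2 * c.bnd + 1) 0 := by
  intro F s hF hd hs
  have hs1 : ∀ x, 0 < x → x < c.bnd → s.store x = Data.nil := fun x hx hx' =>
    hs x hx (lt_of_lt_of_le hx' (le_max_left _ _))
  have hrun : run c O d F = run c O d T := by
    refine exec_fuel O (by omega) c _ fun hn => ?_
    obtain ⟨s', h', -⟩ := h O none hn
    cases h'
  have key : ∀ o ∈ (exec O F (.clean c) s).support, ∃ s', o = some s' ∧
      s'.store = Function.update s.store 0 d' ∧ s'.time ≤ s.time + (T + 2 * c.bnd + 1) ∧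
      s'.mq + s'.exq = s.mq + s.exq := by
    intro o ho
    unfold Cmd.clean at ho
    rw [exec_seq, exec_eq_run c s hs1, hd, hrun, PMF.bind_map, PMF.mem_support_bind_iff] at ho
    obtain ⟨o1, ho1, ho⟩ := ho
    obtain ⟨s1, rfl, h1, h2, h3, h4⟩ := h O o1 ho1
    simp only [Function.comp, Option.map_some, andThen_some, exec_clear, PMF.support_pure,
      Set.mem_singleton_iff] at ho
    refine ⟨_, ho, ?_, ?_, ?_⟩
    · funext x
      by_cases h0 : x = 0
      · subst h0; simp [embed, h4]
      · simp only [Function.update_of_ne h0, embed]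
        split_ifs with h5 h6
        · by_cases hb : x < c.bnd
          · rw [hs1 x h5.1 hb]
          -- `clear` also writes the variable `c.bnd`, which `c` itself does not use; it was `nil`
          -- before because it lies below the bound of the clearing part.
          · have hx : x = c.bnd := by omega
            refine (hs x h5.1 (lt_of_lt_of_le ?_ (le_max_right _ _))).symm
            have := le_clear_bnd (m := c.bnd) (by omega)
            omega
        · omega
        · rfl
    · simp [embed]; omega
    · simp [embed, h2, h3]
  constructor
  · rw [PMF.map, bind_congr_support (g := fun _ => PMF.pure (some d'))]
    · simp [PMF.pure_map]
    · intro o ho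
      obtain ⟨s', rfl, h1, -⟩ := key o ho
      simp [outD, h1]
  · intro o ho
    obtain ⟨s', rfl, h1, h2, h3⟩ := key o ho
    refine ⟨s', rfl, ?_, by simpa using h2, by simpa using h3.le⟩
    rw [h1]; simp

/-! ### Loops over lists -/

namespace Data

def ofList : List Data → Data
  | [] => nil
  | d :: l => cons d (ofList l)

end Data

/-- Run through a list; the state is `(list, accumulator, environment)`, and `c` computes the new
accumulator from `(element, accumulator, environment)`. -/
def Cmd.forEach (c : Cmd) : Cmd :=
  .loop (.hd (.var 0))
    (.assign 0 ((.hd (.hd (.var 0)) :* .tl (.var 0)) :*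
      .tl (.hd (.var 0)) :* .tl (.tl (.var 0))) ;;
    Cmd.onFst c ;;
    .assign 0 (.hd (.tl (.var 0)) :* .hd (.var 0) :* .tl (.tl (.var 0)))) ;;
  .assign 0 (.hd (.tl (.var 0)))

/-- Monadic left fold. -/
def foldK {α β : Type} (st : β → α → PMF α) : List β → α → PMF α
  | [], a => PMF.pure a
  | b :: l, a => (st b a).bind (foldK st l)

theorem foldK_pure {α β : Type} (g : β → α → α) (l : List β) (a : α) :
    foldK (fun b a => PMF.pure (g b a)) l a = PMF.pure (l.foldl (fun a b => g b a) a) := by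
  induction l generalizing a with
  | nil => rfl
  | cons b l ih => rw [foldK, PMF.pure_bind, ih]; rfl

/-- The index of the invariant counts the iterations still to come. So a bound such as `length + j ≤
n`, where each round adds one element, is preserved. -/
theorem foldK_support {α β : Type} {st : β → α → PMF α} (Inv : ℕ → α → Prop) (l0 : List β)
    (hInv : ∀ j, ∀ b ∈ l0, ∀ a, Inv (j + 1) a → ∀ a' ∈ (st b a).support, Inv j a') :
    ∀ (l : List β), (∀ b ∈ l, b ∈ l0) → ∀ a, Inv l.length a →
      ∀ a' ∈ (foldK st l a).support, Inv 0 a'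
  | [], _, a, ha, a', h => by simp [foldK] at h; exact h ▸ ha
  | b :: l, hl, a, ha, a', h => by
    rw [foldK, PMF.mem_support_bind_iff] at h
    obtain ⟨a1, h1, h⟩ := h
    exact foldK_support Inv l0 hInv l (fun b hb => hl b (by simp [hb])) a1
      (hInv _ b (hl b (by simp)) a ha a1 h1) a' h

theorem Meets.mono_start {p : PMF (Option St)} {s s0 : St} {μ : PMF Data} {T Q T' Q' : ℕ}
    {pT pQ : Data → ℕ} (h : Meets p s μ T Q pT pQ)
    (h1 : ∀ d, Function.update s.store 0 d = Function.update s0.store 0 d)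
    (h2 : s.time + T ≤ s0.time + T') (h3 : s.mq + s.exq + Q ≤ s0.mq + s0.exq + Q') :
    Meets p s0 μ T' Q' pT pQ := by
  refine ⟨h.1, fun o ho => ?_⟩
  obtain ⟨s', rfl, h4, h5, h6⟩ := h.2 o ho
  exact ⟨s', rfl, by rw [← h1]; exact h4, by omega, by omega⟩

/-- The loop consumes the list at the head of the state, and its test is true as long as that list
is nonempty. Size bounds on the accumulator come from the invariant, not from the running time of
the body; this avoids a bound that multiplies with every round. -/
theorem Spec.forEach {α β : Type} {c : Cmd} (encA : α → Data) (encB : β → Data)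
    (hinj : Function.Injective encA) (Inv : ℕ → α → Prop)
    (st : β → α → PMF α) (l : List β) (a : α) (env : Data) (Sa S Tb Qb : ℕ)
    (hstep : ∀ j, ∀ b ∈ l, ∀ a, Inv (j + 1) a →
      Spec O c (encB b :+ encA a :+ env) ((st b a).map encA) Tb Qb)
    (hInv : ∀ j, ∀ b ∈ l, ∀ a, Inv (j + 1) a → ∀ a' ∈ (st b a).support, Inv j a')
    (hSa : ∀ j a, Inv j a → (encA a).size ≤ Sa)
    (hS : (Data.ofList (l.map encB)).size + Sa + env.size ≤ S)
    (ha : Inv l.length a) :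
    Spec O (.forEach c) (.ofList (l.map encB) :+ encA a :+ env)
      ((foldK st l a).map encA) ((l.length + 1) * (2 * Tb + 8 * S + 40)) (l.length * Qb) := by
  -- The cost of one round: `onFst` doubles the time of the body, and the remaining terms pay for
  -- the test and for copying states of size at most `S`.
  set K := 2 * Tb + 8 * S + 40 with hK
  set body : Cmd := .assign 0 ((.hd (.hd (.var 0)) :* .tl (.var 0)) :*
      .tl (.hd (.var 0)) :* .tl (.tl (.var 0))) ;; Cmd.onFst c ;;
    .assign 0 (.hd (.tl (.var 0)) :* .hd (.var 0) :* .tl (.tl (.var 0))) with hbody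
  have hbodyS : ∀ j l', ∀ b ∈ l, ∀ a, Inv (j + 1) a →
      (Data.ofList ((b :: l').map encB)).size + Sa + env.size ≤ S →
      Spec O body (.ofList ((b :: l').map encB) :+ encA a :+ env)
        ((st b a).map fun a' => .ofList (l'.map encB) :+ encA a' :+ env)
        (K - 1) Qb := by
    intro j l' b hb a ha hS
    have h1 := hSa _ _ ha
    have h2 := (hstep j b hb a ha).onFst (b := .ofList (l'.map encB) :+ env)
    rw [PMF.map_comp] at h2
    have hdsz : (encB b).size + (Data.ofList (l'.map encB)).size + Sa + env.size + 1 ≤ S := by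
      simp [Data.ofList, Data.size] at hS; omega
    have h3 : ∀ a' ∈ (st b a).support, Spec O
        (.assign 0 (.hd (.tl (.var 0)) :* .hd (.var 0) :* .tl (.tl (.var 0))))
        (((fun a' => Data.cons a' (.ofList (l'.map encB) :+ env)) ∘ encA) a')
        (PMF.pure (.ofList (l'.map encB) :+ encA a' :+ env)) (S + 4) 0 := by
      intro a' ha'
      have := hSa _ _ (hInv j b hb a ha a' ha')
      refine Spec.mono (Spec.assign fun σ hσ => ?_) ?_ le_rfl
      · simp [Expr.eval, hσ, Data.hd, Data.tl]
      · simp [Data.size]; omega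
    have hinj' : Function.Injective
        ((fun a' => Data.cons a' (.ofList (l'.map encB) :+ env)) ∘ encA) := by
      exact fun x y hxy => hinj (by simpa using hxy)
    refine Spec.mono (Spec.seqD (Spec.assign (d' := (encB b :+ encA a :+ env) :+
      .ofList (l'.map encB) :+ env) fun σ hσ => ?_) (Spec.seqM hinj' h2 h3)) ?_ ?_
    · simp [Expr.eval, hσ, Data.hd, Data.tl, Data.ofList]
    · simp [Data.size]
      omega
    · omega
  have hloop : ∀ (l' : List β), (∀ b ∈ l', b ∈ l) → ∀ (a : α) (fuel F : ℕ) (s : St),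
      Inv l'.length a → (Data.ofList (l'.map encB)).size + Sa + env.size ≤ S →
      l'.length * K + 1 ≤ F → l'.length + 1 ≤ fuel →
      s.store 0 = .ofList (l'.map encB) :+ encA a :+ env →
      (∀ x, 0 < x → x < body.bnd → s.store x = .nil) →
      Meets (iter (.hd (.var 0)) (exec O F body) fuel s) s
        ((foldK st l' a).map fun a' => .nil :+ encA a' :+ env)
        (l'.length * K + 1) (l'.length * Qb) (fun _ => 0) (fun _ => 0) := by
    intro l'
    induction l' with
    | nil =>
      intro _ a fuel F s ha _ hF hfuel hs0 hs
      obtain ⟨fuel, rfl⟩ : ∃ f, fuel = f + 1 := ⟨fuel - 1, by simp at hfuel; omega⟩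
      have ht : ((Expr.hd (.var 0)).eval s.store).truth = false := by
        simp [Expr.eval, hs0, Data.hd, Data.ofList, Data.truth]
      rw [iter_succ, ht, if_neg (by simp)]
      constructor
      · rw [PMF.pure_map, foldK, PMF.pure_map, PMF.pure_map]
        simp [outD, St.tick, hs0, Data.ofList]
      · intro o ho
        simp at ho
        exact ⟨_, ho, by simp [St.tick], by simp [St.tick], by simp [St.tick]⟩
    | cons b l' ih =>
      intro hmem a fuel F s ha hS' hF hfuel hs0 hs
      obtain ⟨fuel, rfl⟩ : ∃ f, fuel = f + 1 := ⟨fuel - 1, by simp at hfuel; omega⟩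
      have ht : ((Expr.hd (.var 0)).eval s.store).truth = true := by
        simp [Expr.eval, hs0, Data.hd, Data.ofList, Data.truth]
      have hlen : (b :: l').length * K = l'.length * K + K := by simp; ring
      have hlenQ : (b :: l').length * Qb = l'.length * Qb + Qb := by simp; ring
      have hK1 : 1 ≤ K := by omega
      rw [iter_succ, ht, if_pos rfl]
      have hb := hbodyS l'.length l' b (hmem b (by simp)) a ha hS' F s.tick (by omega)
        (by simpa [St.tick] using hs0) (by simpa [St.tick] using hs)
      have hb' := hb.mono (T' := K - 1 + (l'.length * K + 1)) (Q' := Qb + l'.length * Qb)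
        (pT' := fun _ => l'.length * K + 1) (pQ' := fun _ => l'.length * Qb)
        (fun _ _ => by simp) (fun _ _ => by simp)
      set encS : α → Data := fun a' => .ofList (l'.map encB) :+ encA a' :+ env
        with hencS
      have hinj' : Function.Injective encS := fun x y hxy => hinj (by simpa [hencS] using hxy)
      have h := Meets.bindM (g := iter (.hd (.var 0)) (exec O F body) fuel)
        (ν := fun a' => (foldK st l' a').map fun a' => .nil :+ encA a' :+ env)
        (pT' := fun _ => 0) (pQ' := fun _ => 0) hinj' hb' ?_
      · rw [foldK, PMF.map_bind]
        refine h.mono_start (fun d => by simp [St.tick]) ?_ ?_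
        · simp only [St.tick]; omega
        · simp only [St.tick]; omega
      · intro a' ha' s1 hs1 hs10
        obtain ⟨_, h0, hst, -⟩ := hb.2 _ hs1
        cases h0
        refine ih (fun b hb => hmem b (by simp [hb])) a' fuel F s1
          (hInv _ b (hmem b (by simp)) a ha a' ha') ?_ (by omega) (by simp at hfuel; omega)
          hs10 fun x hx hx' => ?_
        · simp [Data.ofList, Data.size] at hS' ⊢; omega
        · rw [hst, Function.update_of_ne (by omega)]
          exact hs x hx hx'
  have hfin : ∀ a' ∈ (foldK st l a).support, Spec O (.assign 0 (.hd (.tl (.var 0))))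
      (.nil :+ encA a' :+ env) (PMF.pure (encA a')) (1 + Sa) 0 := by
    intro a' ha'
    have := hSa _ _ (foldK_support Inv l hInv l (fun _ h => h) a ha a' ha')
    refine Spec.mono (Spec.assign fun σ hσ => ?_) (Nat.add_le_add_left this 1) le_rfl
    simp [Expr.eval, hσ, Data.hd, Data.tl]
  have hinj' : Function.Injective fun a' => Data.cons .nil (encA a' :+ env) :=
    fun x y hxy => hinj (by simpa using hxy)
  have h1 : Spec O (.loop (.hd (.var 0)) body) (.ofList (l.map encB) :+ encA a :+ env)
      ((foldK st l a).map fun a' => .nil :+ encA a' :+ env)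
      (l.length * K + 1) (l.length * Qb) := by
    intro F s hF hs0 hs
    rw [exec_loop]
    refine hloop l (fun _ h => h) a F F s ha hS hF ?_ hs0 fun x hx hx' => hs x hx ?_
    · have : l.length * 1 ≤ l.length * K := Nat.mul_le_mul_left _ (by omega)
      omega
    · exact lt_of_lt_of_le hx' (le_max_right _ _)
  refine Spec.mono (Spec.congr (Spec.seqM hinj' h1 hfin) rfl) ?_ (by omega)
  rw [Nat.add_mul]
  omega

end

/-! ## Polynomial time -/

/-- `g` is bounded by a polynomial in the measure `W`. -/
def Bdd {ι : Type} (W g : ι → ℕ) : Prop := ∃ P : Polynomial ℕ, ∀ x, g x ≤ P.eval (W x)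

/-- Sizes bounded by a polynomial. -/
def SBdd {ι : Type} (W : ι → ℕ) (d : ι → Data) : Prop := Bdd W fun x => (d x).size

/-- A family of specifications of one program with polynomial time, if the inputs have polynomial
size. -/
def Poly {ι : Type} (W : ι → ℕ) (O : ι → Oracle) (c : Cmd) (inp : ι → Data) (μ : ι → PMF Data)
    (Q : ι → ℕ) : Prop :=
  SBdd W inp → ∃ P : Polynomial ℕ, ∀ x, Spec (O x) c (inp x) (μ x) (P.eval (W x)) (Q x)

/-- Deterministic programs without queries. -/
def PolyD {ι : Type} (W : ι → ℕ) (O : ι → Oracle) (c : Cmd) (inp out : ι → Data) : Prop :=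
  Poly W O c inp (fun x => PMF.pure (out x)) fun _ => 0

theorem eval_mono (P : Polynomial ℕ) {a b : ℕ} (h : a ≤ b) : P.eval a ≤ P.eval b := by
  rw [Polynomial.eval_eq_sum, Polynomial.eval_eq_sum]
  exact Finset.sum_le_sum fun i _ => Nat.mul_le_mul_left _ (Nat.pow_le_pow_left h i)

section
variable {ι : Type} {W : ι → ℕ}

theorem Bdd.mono {g g' : ι → ℕ} (h : Bdd W g) (hg : ∀ x, g' x ≤ g x) : Bdd W g' :=
  let ⟨P, hP⟩ := h
  ⟨P, fun x => (hg x).trans (hP x)⟩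

theorem Bdd.const (m : ℕ) : Bdd W fun _ => m := ⟨Polynomial.C m, by simp⟩

theorem Bdd.self : Bdd W W := ⟨Polynomial.X, by simp⟩

theorem Bdd.add {g g' : ι → ℕ} (h : Bdd W g) (h' : Bdd W g') : Bdd W fun x => g x + g' x :=
  let ⟨P, hP⟩ := h
  let ⟨P', hP'⟩ := h'
  ⟨P + P', fun x => by rw [Polynomial.eval_add]; exact add_le_add (hP x) (hP' x)⟩

theorem Bdd.mul {g g' : ι → ℕ} (h : Bdd W g) (h' : Bdd W g') : Bdd W fun x => g x * g' x :=
  let ⟨P, hP⟩ := h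
  let ⟨P', hP'⟩ := h'
  ⟨P * P', fun x => by rw [Polynomial.eval_mul]; exact Nat.mul_le_mul (hP x) (hP' x)⟩

theorem Bdd.eval {g : ι → ℕ} (h : Bdd W g) (P : Polynomial ℕ) : Bdd W fun x => P.eval (g x) :=
  let ⟨P', hP'⟩ := h
  ⟨P.comp P', fun x => by rw [Polynomial.eval_comp]; exact eval_mono P (hP' x)⟩

theorem Bdd.comp {κ : Type} {g : ι → ℕ} (h : Bdd W g) (φ : κ → ι) :
    Bdd (fun y => W (φ y)) fun y => g (φ y) :=
  let ⟨P, hP⟩ := h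
  ⟨P, fun y => hP (φ y)⟩

theorem SBdd.of_le {d d' : ι → Data} (h : SBdd W d) (hd : ∀ x, (d' x).size ≤ (d x).size) :
    SBdd W d' := Bdd.mono h hd

theorem SBdd.comp {κ : Type} {d : ι → Data} (h : SBdd W d) (φ : κ → ι) :
    SBdd (fun y => W (φ y)) fun y => d (φ y) := Bdd.comp h φ

theorem SBdd.cons {d d' : ι → Data} (h : SBdd W d) (h' : SBdd W d') :
    SBdd W fun x => Data.cons (d x) (d' x) :=
  (((Bdd.const 1).add h).add h').mono fun _ => le_rfl

theorem SBdd.const (d : Data) : SBdd W fun _ => d := Bdd.const _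

theorem SBdd.fst {d d' : ι → Data} (h : SBdd W fun x => Data.cons (d x) (d' x)) : SBdd W d :=
  h.of_le fun x => by simp [Data.size]; omega

theorem SBdd.snd {d d' : ι → Data} (h : SBdd W fun x => Data.cons (d x) (d' x)) : SBdd W d' :=
  h.of_le fun x => by simp [Data.size]

end

/-- An expression has a fixed shape, so it can duplicate its input only a fixed number of times; the
growth is linear. -/
theorem Expr.exists_size_eval_le (e : Expr) : ∃ K : ℕ, ∀ d : Data,
    (e.eval fun _ => d).size ≤ K * d.size := by
  induction e with
  | var x => exact ⟨1, fun d => by simp [Expr.eval]⟩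
  | nil => exact ⟨1, fun d => by simpa [Expr.eval, Data.size] using d.one_le_size⟩
  | cons e e' ih ih' =>
    obtain ⟨K, hK⟩ := ih
    obtain ⟨K', hK'⟩ := ih'
    refine ⟨1 + K + K', fun d => ?_⟩
    have := hK d
    have := hK' d
    have := d.one_le_size
    simp only [Expr.eval, Data.size, add_mul]
    omega
  | hd e ih =>
    obtain ⟨K, hK⟩ := ih
    refine ⟨K, fun d => le_trans ?_ (hK d)⟩
    simp only [Expr.eval]
    cases e.eval fun _ => d <;> simp only [Data.hd, Data.size] <;> omega
  | tl e ih =>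
    obtain ⟨K, hK⟩ := ih
    refine ⟨K, fun d => le_trans ?_ (hK d)⟩
    simp only [Expr.eval]
    cases e.eval fun _ => d <;> simp [Data.tl, Data.size]

/-- A value in the support is the output of an actual run of time at most `T`, and `exec_size`
applies to that run. Thus time bounds yield size bounds for the input of the next program. -/
theorem Spec.size_le {O : Oracle} {c : Cmd} {d d' : Data} {μ : PMF Data} {T Q : ℕ}
    (h : Spec O c d μ T Q) (hd : d' ∈ μ.support) : d'.size ≤ d.size + T := by
  have hm := h T ⟨Function.update (fun _ => Data.nil) 0 d, 0, 0, 0⟩ le_rfl (by simp)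
    (fun x hx _ => by simp [Nat.pos_iff_ne_zero.1 hx])
  have : some d' ∈ ((exec O T c ⟨Function.update (fun _ => Data.nil) 0 d, 0, 0, 0⟩).map
      outD).support := by
    rw [hm.1, PMF.mem_support_map_iff]
    exact ⟨d', hd, rfl⟩
  rw [PMF.mem_support_map_iff] at this
  obtain ⟨o, ho, h1⟩ := this
  obtain ⟨s', rfl, -, h2, -⟩ := hm.2 o ho
  have := exec_size ho 0
  simp [outD] at h1 this h2
  rw [h1] at this
  omega

section
variable {ι : Type} {W : ι → ℕ} {O : ι → Oracle} {inp : ι → Data}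

theorem Poly.congr {c : Cmd} {μ μ' : ι → PMF Data} {Q : ι → ℕ} (h : Poly W O c inp μ Q)
    (e : ∀ x, μ x = μ' x) : Poly W O c inp μ' Q := by
  rwa [show μ' = μ from (funext e).symm]

theorem PolyD.congr {c : Cmd} {out out' : ι → Data} (h : PolyD W O c inp out)
    (e : ∀ x, out x = out' x) : PolyD W O c inp out' :=
  Poly.congr h fun x => by rw [e x]

theorem Poly.intro {c : Cmd} {μ : ι → PMF Data} {Q : ι → ℕ} (h : SBdd W inp → Poly W O c inp μ Q) :
    Poly W O c inp μ Q := fun hs => h hs hs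

theorem Poly.mono {c : Cmd} {μ : ι → PMF Data} {Q Q' : ι → ℕ} (h : Poly W O c inp μ Q)
    (hQ : ∀ x, Q x ≤ Q' x) : Poly W O c inp μ Q' := fun hs =>
  let ⟨P, hP⟩ := h hs
  ⟨P, fun x => (hP x).mono le_rfl (hQ x)⟩

theorem Poly.of_bdd {c : Cmd} {μ : ι → PMF Data} {Q T : ι → ℕ} (hT : Bdd W T)
    (h : ∀ x, Spec (O x) c (inp x) (μ x) (T x) (Q x)) : Poly W O c inp μ Q := fun _ =>
  let ⟨P, hP⟩ := hT
  ⟨P, fun x => (h x).mono (hP x) le_rfl⟩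

theorem Poly.out_bdd {α : ι → Type} {c : Cmd} {μ : ∀ x, PMF (α x)} {enc : ∀ x, α x → Data}
    {Q : ι → ℕ} (h : Poly W O c inp (fun x => (μ x).map (enc x)) Q) (hs : SBdd W inp) :
    ∃ P : Polynomial ℕ, ∀ x, ∀ a ∈ (μ x).support, (enc x a).size ≤ P.eval (W x) := by
  obtain ⟨P, hP⟩ := h hs
  obtain ⟨P', hP'⟩ := hs
  refine ⟨P' + P, fun x a ha => ((hP x).size_le ?_).trans ?_⟩
  · rw [PMF.mem_support_map_iff]
    exact ⟨a, ha, rfl⟩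
  · rw [Polynomial.eval_add]
    exact Nat.add_le_add_right (hP' x) _

theorem PolyD.out_bdd {c : Cmd} {out : ι → Data} (h : PolyD W O c inp out) (hs : SBdd W inp) :
    SBdd W out := by
  obtain ⟨P, hP⟩ := Poly.out_bdd (α := fun _ => Data) (μ := fun x => PMF.pure (out x))
    (enc := fun _ => id) (Poly.congr h fun x => (PMF.map_id _).symm) hs
  exact ⟨P, fun x => hP x _ (by simp)⟩

theorem PolyD.assign {e : Expr} {out : ι → Data}
    (h : ∀ x, ∀ σ : ℕ → Data, σ 0 = inp x → e.eval σ = out x) :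
    PolyD W O (.assign 0 e) inp out := Poly.intro fun hs => by
  obtain ⟨K, hK⟩ := e.exists_size_eval_le
  refine Poly.of_bdd ((Bdd.const 1).add ((Bdd.const K).mul hs)) fun x =>
    (Spec.assign (h x)).mono ?_ le_rfl
  have := hK (inp x)
  -- The value is determined by the variable `0` alone, so it may be computed in the store that
  -- holds the input everywhere.
  rw [h x _ rfl] at this
  omega

theorem PolyD.skip : PolyD W O .skip inp inp :=
  Poly.of_bdd (Bdd.const 1) fun x => Spec.skip (inp x)

theorem Poly.seqD {c c' : Cmd} {mid : ι → Data} {ν : ι → PMF Data} {Q : ι → ℕ}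
    (h : PolyD W O c inp mid) (h' : Poly W O c' mid ν Q) : Poly W O (c ;; c') inp ν Q := fun hs =>
      by
  obtain ⟨P', hP'⟩ := h' (h.out_bdd hs)
  obtain ⟨P, hP⟩ := h hs
  refine ⟨P + P', fun x => ?_⟩
  rw [Polynomial.eval_add]
  exact ((hP x).seqD (hP' x)).mono le_rfl (by simp)

theorem PolyD.seq {c c' : Cmd} {mid out : ι → Data} (h : PolyD W O c inp mid)
    (h' : PolyD W O c' mid out) : PolyD W O (c ;; c') inp out := Poly.seqD h h'

/-- Composition with a first program that may be random and ask queries. -/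
theorem Poly.seqM {α : ι → Type} {c c' : Cmd} {μ : ∀ x, PMF (α x)} {enc : ∀ x, α x → Data}
    {ν : ∀ x, α x → PMF Data} {Q Q' : ι → ℕ} (hinj : ∀ x, Function.Injective (enc x))
    (h : Poly W O c inp (fun x => (μ x).map (enc x)) Q)
    (h' : Poly (fun y : Σ x, {a // a ∈ (μ x).support} => W y.1) (fun y => O y.1) c'
        (fun y => enc y.1 y.2.1) (fun y => ν y.1 y.2.1) (fun y => Q' y.1)) :
    Poly W O (c ;; c') inp (fun x => (μ x).bind (ν x)) (fun x => Q x + Q' x) := fun hs => by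
  obtain ⟨S, hS⟩ := h.out_bdd hs
  obtain ⟨P', hP'⟩ := h' ⟨S, fun y => hS y.1 y.2.1 y.2.2⟩
  obtain ⟨P, hP⟩ := h hs
  refine ⟨P + P', fun x => ?_⟩
  rw [Polynomial.eval_add]
  exact (hP x).seqM (hinj x) fun a ha => hP' ⟨x, a, ha⟩

theorem Poly.onFst {c : Cmd} {a b : ι → Data} {μ : ι → PMF Data} {Q : ι → ℕ} (h : Poly W O c a μ Q)
  :
    Poly W O (.onFst c) (fun x => a x :+ b x) (fun x => (μ x).map fun d => d :+ b x) Q := by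
  intro hs
  obtain ⟨P, hP⟩ := h hs.fst
  obtain ⟨P', hP'⟩ := hs
  refine ⟨2 * P + 2 * P' + 10, fun x => (hP x).onFst.mono ?_ le_rfl⟩
  have := hP' x
  simp [Data.size] at this ⊢
  omega

theorem PolyD.onFst {c : Cmd} {a a' b : ι → Data} (h : PolyD W O c a a') :
    PolyD W O (.onFst c) (fun x => a x :+ b x) (fun x => a' x :+ b x) :=
  (Poly.onFst h).congr fun x => by rw [PMF.pure_map]

theorem Poly.push {c : Cmd} {e : Expr} {a : ι → Data} {μ : ι → PMF Data} {Q : ι → ℕ}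
    (he : ∀ x, ∀ σ : ℕ → Data, σ 0 = inp x → e.eval σ = a x) (h : Poly W O c a μ Q) :
    Poly W O (.push e c) inp (fun x => (μ x).map fun d => d :+ inp x) Q :=
  Poly.seqD (PolyD.assign (out := fun x => a x :+ inp x) fun x σ hσ => by
    simp [Expr.eval, he x σ hσ, hσ]) (Poly.onFst h)

theorem PolyD.push {c : Cmd} {e : Expr} {a a' : ι → Data}
    (he : ∀ x, ∀ σ : ℕ → Data, σ 0 = inp x → e.eval σ = a x) (h : PolyD W O c a a') :
    PolyD W O (.push e c) inp (fun x => a' x :+ inp x) :=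
  (Poly.push he h).congr fun x => by rw [PMF.pure_map]

/-- The index type is split into two subtypes, so that each branch is specified only for the inputs
that reach it and may use the outcome of the test. -/
theorem Poly.cond {e : Expr} {c c' : Cmd} {μ : ι → PMF Data} {Q : ι → ℕ} (b : ι → Bool)
    (he : ∀ x, ∀ σ : ℕ → Data, σ 0 = inp x → (e.eval σ).truth = b x)
    (h : Poly (fun y : {x // b x = true} => W y) (fun y => O y) c (fun y => inp y) (fun y => μ y)
      (fun y => Q y))
    (h' : Poly (fun y : {x // b x = false} => W y) (fun y => O y) c' (fun y => inp y) (fun y => μ y)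
      (fun y => Q y)) :
    Poly W O (.cond e c c') inp μ Q := fun hs => by
  obtain ⟨P, hP⟩ := h (hs.comp _)
  obtain ⟨P', hP'⟩ := h' (hs.comp _)
  refine ⟨P + P' + 1, fun x => ?_⟩
  refine Spec.mono (T := P.eval (W x) + P'.eval (W x) + 1) (Spec.cond (b x) (he x) (fun hb => ?_)
    fun hb => ?_) (by simp) le_rfl
  · exact (hP ⟨x, hb⟩).mono (Nat.le_add_right _ _) le_rfl
  · exact (hP' ⟨x, hb⟩).mono (Nat.le_add_left _ _) le_rfl

theorem Poly.comp {κ : Type} {c : Cmd} {μ : ι → PMF Data} {Q : ι → ℕ} (h : Poly W O c inp μ Q)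
    (hs : SBdd W inp) (φ : κ → ι) : Poly (fun y => W (φ y)) (fun y => O (φ y)) c
      (fun y => inp (φ y)) (fun y => μ (φ y)) (fun y => Q (φ y)) := fun _ =>
  let ⟨P, hP⟩ := h hs
  ⟨P, fun y => hP (φ y)⟩

theorem length_le_size (l : List Data) : l.length ≤ (Data.ofList l).size := by
  induction l with
  | nil => simp
  | cons d l ih => simp [Data.ofList, Data.size]; omega

/-- The index type for the body of a loop over the lists `l x`. -/
structure LoopIx (ι : Type) (α β : ι → Type) (l : ∀ x, List (β x)) (Inv : ∀ x, ℕ → α x → Prop) where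
  x : ι
  j : ℕ
  b : β x
  a : α x
  mem : b ∈ l x
  inv : Inv x (j + 1) a

/-- The body is one family indexed by all rounds of all inputs, measured by `W` of the original
input. Its time polynomial therefore does not depend on the round, provided that the invariant keeps
all accumulators polynomial in `W`. -/
theorem Poly.loop {α β : ι → Type} {c : Cmd} {μ : ι → PMF Data} {Q : ι → ℕ}
    (encA : ∀ x, α x → Data) (encB : ∀ x, β x → Data)
    (hinj : ∀ x, Function.Injective (encA x)) (l : ∀ x, List (β x)) (Inv : ∀ x, ℕ → α x → Prop)
    (st : ∀ x, β x → α x → PMF (α x)) (a : ∀ x, α x) (env : ι → Data) (Qb : ι → ℕ)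
    (hinp : ∀ x, inp x = .ofList ((l x).map (encB x)) :+ encA x (a x) :+ env x)
    (hout : ∀ x, (foldK (st x) (l x) (a x)).map (encA x) = μ x)
    (hQ : ∀ x, (l x).length * Qb x ≤ Q x)
    (hacc : ∃ P : Polynomial ℕ, ∀ x j a, Inv x j a → (encA x a).size ≤ P.eval (W x))
    (hInv : ∀ x j, ∀ b ∈ l x, ∀ a, Inv x (j + 1) a → ∀ a' ∈ (st x b a).support, Inv x j a')
    (ha : ∀ x, Inv x (l x).length (a x))
    (hbody : Poly (fun y : LoopIx ι α β l Inv => W y.x) (fun y => O y.x) c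
        (fun y => encB y.x y.b :+ encA y.x y.a :+ env y.x)
        (fun y => (st y.x y.b y.a).map (encA y.x)) (fun y => Qb y.x)) :
    Poly W O (.forEach c) inp μ Q := by
  refine fun hs => ?_
  obtain rfl : inp = _ := funext hinp
  obtain rfl : _ = μ := funext hout
  obtain ⟨Pa, hPa⟩ := hacc
  obtain ⟨Ps, hPs⟩ := hs
  have hel : ∀ (x : ι) (b : β x) (l : List (β x)), b ∈ l →
      (encB x b).size ≤ (Data.ofList (l.map (encB x))).size := by
    intro x b l hb
    induction l with
    | nil => simp at hb
    | cons b' l ih =>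
      rcases List.mem_cons.1 hb with rfl | hb
      · simp [Data.ofList, Data.size]; omega
      · have := ih hb
        simp [Data.ofList, Data.size]; omega
  obtain ⟨Pb, hPb⟩ := hbody ⟨Ps + Pa + 3, fun y => by
    have h1 := hPs y.x
    have h2 := hPa _ _ _ y.inv
    have h3 := hel _ _ _ y.mem
    simp [Data.size] at h1 h2 ⊢
    omega⟩
  refine ⟨(Ps + 1) * (2 * Pb + 8 * (Ps + Pa) + 40), fun x => ?_⟩
  have h1 := hPs x
  simp only [Data.size] at h1
  refine Spec.mono (Spec.forEach (encA x) (encB x) (hinj x) (Inv x) (st x) (l x) (a x) (env x)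
    (Pa.eval (W x)) (Ps.eval (W x) + Pa.eval (W x)) (Pb.eval (W x)) (Qb x)
    (fun j b hb a ha => hPb ⟨x, j, b, a, hb, ha⟩) (hInv x) (hPa x) (by omega) (ha x)) ?_ (hQ x)
  have h2 := length_le_size ((l x).map (encB x))
  simp only [List.length_map] at h2
  simp only [Polynomial.eval_mul, Polynomial.eval_add, Polynomial.eval_one, Polynomial.eval_ofNat]
  exact Nat.mul_le_mul_right _ (by omega)

theorem PolyD.loop {α β : ι → Type} {c : Cmd} {out : ι → Data}
    (encA : ∀ x, α x → Data) (encB : ∀ x, β x → Data)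
    (hinj : ∀ x, Function.Injective (encA x)) (l : ∀ x, List (β x)) (Inv : ∀ x, ℕ → α x → Prop)
    (st : ∀ x, β x → α x → α x) (a : ∀ x, α x) (env : ι → Data)
    (hinp : ∀ x, inp x = .ofList ((l x).map (encB x)) :+ encA x (a x) :+ env x)
    (hout : ∀ x, encA x ((l x).foldl (fun a b => st x b a) (a x)) = out x)
    (hacc : ∃ P : Polynomial ℕ, ∀ x j a, Inv x j a → (encA x a).size ≤ P.eval (W x))
    (hInv : ∀ x j, ∀ b ∈ l x, ∀ a, Inv x (j + 1) a → Inv x j (st x b a))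
    (ha : ∀ x, Inv x (l x).length (a x))
    (hbody : PolyD (fun y : LoopIx ι α β l Inv => W y.x) (fun y => O y.x) c
        (fun y => encB y.x y.b :+ encA y.x y.a :+ env y.x)
        (fun y => encA y.x (st y.x y.b y.a))) :
    PolyD W O (.forEach c) inp out :=
  Poly.loop encA encB hinj l Inv (fun x b a => PMF.pure (st x b a)) a env (fun _ => 0) hinp
    (fun x => by rw [foldK_pure, PMF.pure_map, hout]) (fun x => by simp) hacc
    (fun x j b hb a ha a' ha' => by
      simp at ha'
      exact ha' ▸ hInv x j b hb a ha)
    ha (Poly.congr hbody fun y => by rw [PMF.pure_map])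

end

/-! ## Elementary programs -/

attribute [simp] Expr.eval Data.ofBits Data.ofList Data.size

namespace Expr

/-- The input without its first `k` list entries. -/
def rest : ℕ → Expr
  | 0 => .var 0
  | k + 1 => .tl (rest k)

/-- The list entry `k` of the input. -/
def nth (k : ℕ) : Expr := .hd (rest k)

/-- The expression with a constant value. -/
def lit : Data → Expr
  | .nil => .nil
  | a :+ b => lit a :* lit b

@[simp] theorem eval_lit (σ : ℕ → Data) : ∀ d, (lit d).eval σ = d
  | .nil => rfl
  | a :+ b => by simp [lit, eval_lit σ a, eval_lit σ b]

/-- The constant `true`. -/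
def tt : Expr := .cons .nil .nil

end Expr

attribute [simp] Expr.rest Expr.nth Expr.tt

namespace Data

@[simp] theorem hd_nil : nil.hd = nil := rfl
@[simp] theorem hd_cons (a b : Data) : (cons a b).hd = a := rfl
@[simp] theorem tl_nil : nil.tl = nil := rfl
@[simp] theorem tl_cons (a b : Data) : (cons a b).tl = b := rfl
@[simp] theorem truth_nil : nil.truth = false := rfl
@[simp] theorem truth_cons (a b : Data) : (cons a b).truth = true := rfl
@[simp] theorem ofBool_true : ofBool true = cons nil nil := rfl
@[simp] theorem ofBool_false : ofBool false = nil := rfl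

theorem ofList_injective : Function.Injective ofList := by
  intro l
  induction l with
  | nil => intro l' h; cases l' <;> simp_all
  | cons d l ih =>
    intro l' h
    cases l' with
    | nil => simp at h
    | cons d' l' =>
      simp at h
      rw [h.1, ih h.2]

theorem ofBool_injective : Function.Injective ofBool := by
  intro a b; cases a <;> cases b <;> simp

theorem ofBits_eq (l : List Bool) : ofBits l = ofList (l.map ofBool) := by
  induction l with
  | nil => rfl
  | cons b l ih => simp [ih]

theorem ofBits_injective : Function.Injective ofBits := by
  intro l l' h
  rw [ofBits_eq, ofBits_eq] at h
  exact List.map_injective_iff.2 ofBool_injective (ofList_injective h)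

@[simp] theorem truth_ofBool (b : Bool) : (ofBool b).truth = b := by cases b <;> rfl

theorem unary_zero : unary 0 = nil := rfl

theorem unary_succ (m : ℕ) : unary (m + 1) = cons (cons nil nil) (unary m) := by
  simp [unary, List.replicate_succ]

theorem unary_eq (m : ℕ) : unary m = ofList (List.replicate m (cons nil nil)) := by
  simp [unary, ofBits_eq]

@[simp] theorem size_unary (m : ℕ) : (unary m).size = 4 * m + 1 := by
  induction m with
  | zero => rfl
  | succ m ih => rw [unary_succ]; simp [ih]; omega

theorem unary_injective : Function.Injective unary := by
  intro a b h
  have := congrArg size h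
  simp at this
  omega

theorem truth_unary (m : ℕ) : (unary m).truth = decide (0 < m) := by
  cases m with
  | zero => rfl
  | succ m => rw [unary_succ]; simp

theorem ofVec_injective (n : ℕ) : Function.Injective (ofVec (m := n)) := fun _ _ h =>
  List.ofFn_injective (ofBits_injective h)

theorem ofVec_eq {n : ℕ} (v : Pt n) : ofVec v = ofList ((List.ofFn v).map ofBool) :=
  ofBits_eq _

theorem size_ofBool_le (b : Bool) : (ofBool b).size ≤ 3 := by cases b <;> simp

theorem size_ofBits_le (l : List Bool) : (ofBits l).size ≤ 4 * l.length + 1 := by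
  induction l with
  | nil => simp
  | cons b l ih => have := size_ofBool_le b; simp; omega

theorem size_ofVec_le {n : ℕ} (v : Pt n) : (ofVec v).size ≤ 4 * n + 1 := by
  simpa [ofVec] using size_ofBits_le (List.ofFn v)

theorem length_le_size_ofBits (l : List Bool) : l.length ≤ (ofBits l).size := by
  rw [ofBits_eq]
  simpa using length_le_size (l.map ofBool)

theorem le_size_ofVec {n : ℕ} (v : Pt n) : n ≤ (ofVec v).size := by
  simpa [ofVec] using length_le_size_ofBits (List.ofFn v)

theorem size_mem_le {l : List Data} {d : Data} (h : d ∈ l) : d.size ≤ (ofList l).size := by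
  induction l with
  | nil => simp at h
  | cons d' l ih =>
    rcases List.mem_cons.1 h with rfl | h
    · simp; omega
    · have := ih h
      simp; omega

theorem size_ofList_le {l : List Data} {B : ℕ} (h : ∀ d ∈ l, d.size ≤ B) :
    (ofList l).size ≤ 1 + l.length * (B + 1) := by
  induction l with
  | nil => simp
  | cons d l ih =>
    have h1 := h d (by simp)
    have h2 := ih fun d hd => h d (by simp [hd])
    simp [Nat.add_mul]
    omega

theorem toVec_ofVec {n : ℕ} (v : Pt n) : toVec n (ofVec v) = v := by
  have : ∀ (l : List Bool) (i : ℕ) (hi : i < l.length),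
      (hd (tl^[i] (ofBits l))).truth = l[i] := by
    intro l
    induction l with
    | nil => intro i hi; simp at hi
    | cons b l ih =>
      intro i hi
      cases i with
      | zero => simp
      | succ i => simpa using ih i (by simpa using hi)
  funext i
  have h := this (List.ofFn v) i.val (by simp)
  simpa [toVec, ofVec] using h

theorem tl_iterate_nil (i : ℕ) : tl^[i] nil = nil := by
  induction i with
  | zero => rfl
  | succ i ih => simpa using ih

theorem tl_iterate_ofList (l : List Data) (i : ℕ) : tl^[i] (ofList l) = ofList (l.drop i) := by
  induction l generalizing i with
  | nil => simp [tl_iterate_nil]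
  | cons d l ih =>
    cases i with
    | zero => simp
    | succ i => simpa using ih i

end Data

theorem Bdd.acc {ι : Type} {W : ι → ℕ} {α : ι → Type} {encA : ∀ x, α x → Data}
    {Inv : ∀ x, ℕ → α x → Prop} {g : ι → ℕ} (h : Bdd W g)
    (hg : ∀ x j a, Inv x j a → (encA x a).size ≤ g x) :
    ∃ P : Polynomial ℕ, ∀ x j a, Inv x j a → (encA x a).size ≤ P.eval (W x) :=
  let ⟨P, hP⟩ := h
  ⟨P, fun x j a ha => (hg x j a ha).trans (hP x)⟩

section
variable {ι : Type} {W : ι → ℕ} {O : ι → Oracle}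

theorem SBdd.length {l : ι → List Data} (h : SBdd W fun x => .ofList (l x)) :
    Bdd W fun x => (l x).length := Bdd.mono h fun _ => length_le_size _

theorem SBdd.unary {g : ι → ℕ} (h : Bdd W g) : SBdd W fun x => Data.unary (g x) :=
  (((Bdd.const 4).mul h).add (Bdd.const 1)).mono fun x => by simp

theorem SBdd.of_unary {g : ι → ℕ} (h : SBdd W fun x => Data.unary (g x)) : Bdd W g :=
  Bdd.mono h fun x => by simp; omega

theorem SBdd.of_ofVec {n : ι → ℕ} {v : ∀ x, Pt (n x)} (h : SBdd W fun x => Data.ofVec (v x)) :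
    Bdd W n := Bdd.mono h fun _ => Data.le_size_ofVec _

theorem SBdd.ofBool (b : ι → Bool) : SBdd W fun x => Data.ofBool (b x) :=
  (Bdd.const 3).mono fun _ => Data.size_ofBool_le _

/-- Reverse a list. -/
def pRev : Cmd :=
  .assign 0 (.var 0 :* .nil :* .nil) ;; .forEach (.assign 0 (.nth 0 :* .nth 1))

theorem pRev_poly {l : ι → List Data} :
    PolyD W O pRev (fun x => .ofList (l x)) (fun x => .ofList (l x).reverse) := Poly.intro
      fun hs => by
  refine PolyD.seq (mid := fun x => .ofList (l x) :+ .nil :+ .nil)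
    (PolyD.assign fun x σ h => by simp [h]) ?_
  refine PolyD.loop (α := fun _ => List Data) (β := fun _ => Data)
    (fun _ => Data.ofList) (fun _ d => d) (fun _ => Data.ofList_injective) l
    (fun x j a => a.length + j ≤ (l x).length ∧ ∀ d ∈ a, d ∈ l x) (fun _ d a => d :: a)
    (fun _ => []) (fun _ => .nil) (fun x => by simp) (fun x => by simp) ?_ ?_ ?_ ?_
  · refine Bdd.acc ((Bdd.const 1).add (hs.length.mul (Bdd.add hs (Bdd.const 1)))) ?_
    rintro x j a ⟨h1, h2⟩
    refine (Data.size_ofList_le fun d hd => Data.size_mem_le (h2 d hd)).trans ?_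
    exact Nat.add_le_add_left (Nat.mul_le_mul_right _ (by omega)) _
  · rintro x j b hb a ⟨h1, h2⟩
    refine ⟨by simp; omega, fun d hd => ?_⟩
    rcases List.mem_cons.1 hd with rfl | hd
    · exact hb
    · exact h2 d hd
  · intro x; simp
  · exact PolyD.assign fun x σ h => by simp [h]

/-- Unary addition: put `true` in front of the second list for each entry of the first. -/
def pAdd : Cmd :=
  .assign 0 (.hd (.var 0) :* .tl (.var 0) :* .nil) ;;
    .forEach (.assign 0 (.tt :* .nth 1))

theorem pAdd_poly {l : ι → List Data} {b : ι → ℕ} :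
    PolyD W O pAdd (fun x => .ofList (l x) :+ .unary (b x))
      (fun x => .unary ((l x).length + b x)) := Poly.intro fun hs => by
  refine PolyD.seq (mid := fun x => .ofList (l x) :+ .unary (b x) :+ .nil)
    (PolyD.assign fun x σ h => by simp [h]) ?_
  refine PolyD.loop (α := fun _ => ℕ) (β := fun _ => Data)
    (fun _ => Data.unary) (fun _ d => d) (fun _ => Data.unary_injective) l
    (fun x j a => a + j ≤ (l x).length + b x) (fun _ _ a => a + 1)
    b (fun _ => .nil) (fun x => by simp) (fun x => by simp [add_comm]) ?_ ?_ ?_ ?_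
  · refine Bdd.acc (((Bdd.const 4).mul (hs.fst.length.add hs.snd.of_unary)).add (Bdd.const 1)) ?_
    intro x j a h
    simp
    omega
  · intro x j d hd a h
    omega
  · intro x; omega
  · exact PolyD.assign fun x σ h => by simp [h, Data.unary_succ]

/-- Unary multiplication of the lengths of two lists. -/
def pMul : Cmd :=
  .assign 0 (.hd (.var 0) :* .nil :* .tl (.var 0)) ;;
    .forEach (.assign 0 (.rest 2 :* .nth 1) ;; pAdd)

theorem pMul_poly {l l' : ι → List Data} :
    PolyD W O pMul (fun x => .ofList (l x) :+ .ofList (l' x))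
      (fun x => .unary ((l x).length * (l' x).length)) := Poly.intro fun hs => by
  refine PolyD.seq (mid := fun x => .ofList (l x) :+ .unary 0 :+ .ofList (l' x))
    (PolyD.assign fun x σ h => by simp [h, Data.unary_zero]) ?_
  refine PolyD.loop (α := fun _ => ℕ) (β := fun _ => Data)
    (fun _ => Data.unary) (fun _ d => d) (fun _ => Data.unary_injective) l
    (fun x j a => a + j * (l' x).length ≤ (l x).length * (l' x).length)
    (fun x _ a => (l' x).length + a)
    (fun _ => 0) (fun x => .ofList (l' x)) (fun x => by simp) (fun x => ?_) ?_ ?_ ?_ ?_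
  · have : ∀ (l : List Data) (m a : ℕ), l.foldl (fun a d => m + a) a = l.length * m + a := by
      intro l
      induction l with
      | nil => intro m a; simp
      | cons d l ih => intro m a; simp [ih]; ring
    rw [this, add_zero]
  · refine Bdd.acc (((Bdd.const 4).mul (hs.fst.length.mul hs.snd.length)).add (Bdd.const 1)) ?_
    intro x j a h
    simp
    omega
  · intro x j d hd a h
    rw [add_mul] at h
    omega
  · intro x; omega
  · exact PolyD.seq (mid := fun y => .ofList (l' y.x) :+ .unary y.a)
      (PolyD.assign fun x σ h => by simp [h]) pAdd_poly

end

/-- Put a bit, computed from the truth values of expressions, in front of the input. -/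
def pBit : (List Bool → Bool) → List Expr → Cmd
  | φ, [] => .assign 0 (.lit (Data.ofBool (φ [])) :* .var 0)
  | φ, e :: es => .cond e (pBit (fun l => φ (true :: l)) es) (pBit (fun l => φ (false :: l)) es)

/-- The command is a decision tree over the given truth values with the constants `φ l` at its
leaves, so every Boolean function of a fixed number of bits is available. -/
theorem pBit_poly : ∀ (es : List Expr) (φ : List Bool → Bool) {ι : Type} {W : ι → ℕ}
    {O : ι → Oracle} {inp : ι → Data} (bs : ι → List Bool),
    (∀ x, ∀ σ : ℕ → Data, σ 0 = inp x → es.map (fun e => (e.eval σ).truth) = bs x) →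
      PolyD W O (pBit φ es) inp fun x => .ofBool (φ (bs x)) :+ inp x
  | [], φ, ι, W, O, inp, bs, h => by
    refine PolyD.assign fun x σ hσ => ?_
    rw [← h x σ hσ]
    simp [hσ]
  | e :: es, φ, ι, W, O, inp, bs, h => by
    refine Poly.cond (fun x => (bs x).headD false) (fun x σ hσ => by rw [← h x σ hσ]; simp) ?_ ?_
    · refine Poly.congr (pBit_poly es _ (ι := {x // (bs x).headD false = true})
        (fun y => (bs y.1).tail) fun y σ hσ => ?_) fun y => ?_
      · rw [← h y.1 σ hσ]; simp
      · have h1 := h y.1 (fun _ => inp y.1) rfl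
        have h2 := y.2
        simp only [← h1] at h2 ⊢
        simp at h2
        simp [h2]
    · refine Poly.congr (pBit_poly es _ (ι := {x // (bs x).headD false = false})
        (fun y => (bs y.1).tail) fun y σ hσ => ?_) fun y => ?_
      · rw [← h y.1 σ hσ]; simp
      · have h1 := h y.1 (fun _ => inp y.1) rfl
        have h2 := y.2
        simp only [← h1] at h2 ⊢
        simp at h2
        simp [h2]

theorem Poly.bit {es : List Expr} {φ : List Bool → Bool} {ι : Type} {W : ι → ℕ} {O : ι → Oracle}
    {inp : ι → Data} {c : Cmd} {ν : ι → PMF Data} {Q : ι → ℕ} (bs : ι → List Bool)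
    (h : ∀ x, ∀ σ : ℕ → Data, σ 0 = inp x → es.map (fun e => (e.eval σ).truth) = bs x)
    (h' : Poly W O c (fun x => .ofBool (φ (bs x)) :+ inp x) ν Q) :
    Poly W O (pBit φ es ;; c) inp ν Q := Poly.seqD (pBit_poly es φ bs h) h'

section
variable {ι : Type} {W : ι → ℕ} {O : ι → Oracle}

/-- Combine three vectors coordinatewise; the length is that of the first one. -/
def pZip (φ : List Bool → Bool) : Cmd :=
  .assign 0 (.hd (.var 0) :* (.nth 1 :* .rest 2 :* .nil) :* .nil) ;;
    .forEach (pBit φ [.nth 0, .hd (.hd (.nth 1)), .hd (.hd (.tl (.nth 1)))] ;;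
      .assign 0 (.tl (.hd (.nth 2)) :* .tl (.hd (.tl (.nth 2))) :*
        .nth 0 :* .tl (.tl (.nth 2)))) ;;
    .assign 0 (.tl (.tl (.var 0))) ;; pRev

end

section
variable {ι : Type} {W : ι → ℕ} {O : ι → Oracle}

theorem Data.size_tl_le (d : Data) : d.tl.size ≤ d.size := by cases d <;> simp

/-- The coordinatewise combination of a list of bits and two trees. -/
def zipL (φ : List Bool → Bool) : List Bool → Data → Data → List Bool
  | [], _, _ => []
  | b :: l, B, C => φ [b, B.hd.truth, C.hd.truth] :: zipL φ l B.tl C.tl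

theorem zipL_ofFn (φ : List Bool → Bool) : ∀ {n : ℕ} (A : Pt n) (B C : Data),
    zipL φ (List.ofFn A) B C =
      List.ofFn fun i => φ [A i, Data.toVec n B i, Data.toVec n C i]
  | 0, A, B, C => by simp [zipL]
  | n + 1, A, B, C => by
    rw [List.ofFn_succ, zipL, zipL_ofFn φ, List.ofFn_succ]
    simp [Data.toVec]

theorem zip_foldl (φ : List Bool → Bool) : ∀ (l : List Bool) (B C : Data) (out : List Bool),
    (l.foldl (fun (a : Data × Data × List Bool) b =>
      (a.1.tl, a.2.1.tl, φ [b, a.1.hd.truth, a.2.1.hd.truth] :: a.2.2)) (B, C, out)).2.2 =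
      (zipL φ l B C).reverse ++ out
  | [], B, C, out => rfl
  | b :: l, B, C, out => by
    rw [List.foldl_cons, zip_foldl φ l, zipL]
    simp

/-- Only the first argument has to be a vector. The other two are read through `hd` and `tl`, and
missing entries count as false; hence `nil` can stand for an unused argument. -/
theorem pZip_poly (φ : List Bool → Bool) {n : ι → ℕ} {A : ∀ x, Pt (n x)} {B C : ι → Data} :
    PolyD W O (pZip φ) (fun x => .ofVec (A x) :+ B x :+ C x)
      (fun x => .ofVec fun i =>
        φ [A x i, Data.toVec (n x) (B x) i, Data.toVec (n x) (C x) i]) := Poly.intro fun hs => by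
  let st : Bool → Data × Data × List Bool → Data × Data × List Bool := fun b a =>
    (a.1.tl, a.2.1.tl, φ [b, a.1.hd.truth, a.2.1.hd.truth] :: a.2.2)
  let enc : Data × Data × List Bool → Data := fun a => a.1 :+ a.2.1 :+ .ofBits a.2.2
  have hinj : Function.Injective enc := by
    rintro ⟨a, b, l⟩ ⟨a', b', l'⟩ h
    simp only [enc, Data.cons.injEq] at h
    rw [h.1, h.2.1, Data.ofBits_injective h.2.2]
  have hn : Bdd W n := hs.fst.of_ofVec
  refine PolyD.seq (mid := fun x => .ofVec (A x) :+ enc (B x, C x, []) :+ .nil)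
    (PolyD.assign fun x σ h => by simp [h, enc]) ?_
  refine PolyD.seq (mid := fun x => enc ((List.ofFn (A x)).foldl (fun a b => st b a)
    (B x, C x, []))) ?_ ?_
  · refine PolyD.loop (α := fun _ => Data × Data × List Bool) (β := fun _ => Bool)
      (fun _ => enc) (fun _ => Data.ofBool) (fun _ => hinj) (fun x => List.ofFn (A x))
      (fun x j a => a.1.size ≤ (B x).size ∧ a.2.1.size ≤ (C x).size ∧ a.2.2.length + j ≤ n x)
      (fun _ => st) (fun x => (B x, C x, [])) (fun _ => .nil) (fun x => by rw [Data.ofVec_eq])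
      (fun x => rfl) ?_ ?_ ?_ ?_
    · refine Bdd.acc (((Bdd.const 4).mul hn).add (((Bdd.const 1).add hs.snd.fst).add
        (((Bdd.const 1).add hs.snd.snd).add (Bdd.const 1)))) ?_
      rintro x j ⟨a, b, l⟩ ⟨h1, h2, h3⟩
      have := Data.size_ofBits_le l
      simp [enc] at h1 h2 h3 ⊢
      omega
    · rintro x j b hb ⟨a, c, l⟩ ⟨h1, h2, h3⟩
      refine ⟨(Data.size_tl_le _).trans h1, (Data.size_tl_le _).trans h2, ?_⟩
      simp [st] at h3 ⊢
      omega
    · intro x; simp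
    · exact Poly.bit (fun y => [y.b, y.a.1.hd.truth, y.a.2.1.hd.truth])
        (fun y σ h => by simp [h, enc])
        (PolyD.assign fun y σ h => by simp [h, enc, st])
  · refine PolyD.seq (mid := fun x => .ofList ((zipL φ (List.ofFn (A x)) (B x) (C x)).reverse.map
      Data.ofBool)) (PolyD.assign fun x σ h => ?_) ?_
    · simp only [Expr.eval, h, enc, st, Data.tl_cons]
      rw [zip_foldl, List.append_nil, Data.ofBits_eq]
    · refine PolyD.congr pRev_poly fun x => ?_
      rw [← List.map_reverse, List.reverse_reverse, zipL_ofFn, Data.ofVec_eq]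

/-- A uniformly random vector; the length is that of the input list. -/
def pRnd : Cmd :=
  .assign 0 (.var 0 :* .nil :* .nil) ;;
    .forEach (.flip 1 ;; .assign 0 (.var 1 :* .nth 1) ;; .assign 1 .nil)

/-- Clearing the variable `1` after writing the variable `0`. -/
theorem St.store_put_put (s : St) (hs : s.store 1 = .nil) (b d : Data) :
    (((s.put 1 b).put 0 d).put 1 .nil).store = Function.update s.store 0 d := by
  funext y
  by_cases h1 : y = 1
  · subst h1; simp [St.put, hs]
  · by_cases h0 : y = 0
    · subst h0; simp [St.put]
    · simp [St.put, h0, h1]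

theorem spec_flip (d : Data) (e : Expr) (g : Bool → Data) (O : Oracle)
    (he : ∀ b, ∀ σ : ℕ → Data, σ 0 = d → σ 1 = .ofBool b → e.eval σ = g b) (T : ℕ)
    (hT : ∀ b, (g b).size ≤ T) :
    Spec O (.flip 1 ;; .assign 0 e ;; .assign 1 .nil) d ((PMF.uniformOfFintype Bool).map g)
      (T + 10) 0 := by
  intro F s hF hd hs
  have hs1 : s.store 1 = .nil := hs 1 one_pos (by simp [Cmd.bnd])
  have key : exec O F (.flip 1 ;; .assign 0 e ;; .assign 1 .nil) s =
      (PMF.uniformOfFintype Bool).bind fun b => PMF.pure (some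
        (((s.put 1 (.ofBool b)).put 0 (g b)).put 1 .nil)) := by
    rw [exec_seq, exec, PMF.bind_bind]
    congr 1
    funext b
    rw [PMF.pure_bind, andThen_some, exec_assign_seq, exec_assign]
    rw [he b _ (by simpa [St.put] using hd) (by simp [St.put])]
    rfl
  rw [key]
  constructor
  · rw [PMF.map_bind, PMF.map_comp]
    simp [PMF.map, PMF.pure_bind, outD, St.put, Function.comp_def]
  · intro o ho
    rw [PMF.mem_support_bind_iff] at ho
    obtain ⟨b, -, ho⟩ := ho
    simp at ho
    refine ⟨_, ho, ?_, ?_, ?_⟩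
    · exact (St.store_put_put _ hs1 _ _).trans (by simp [St.put])
    · have := hT b
      have := Data.size_ofBool_le b
      simp [St.put]
      omega
    · simp [St.put]

/-- Each coin goes in front of the later part of the vector, so the first coin becomes the last
coordinate, in accordance with `unif_succ`. -/
theorem foldK_rnd (l : List Data) (a : List Bool) :
    foldK (fun _ a => (PMF.uniformOfFintype Bool).map fun b => b :: a) l a =
      (unif l.length).map fun v => List.ofFn v ++ a := by
  induction l generalizing a with
  | nil =>
    rw [foldK]
    have : unif ([] : List Data).length = PMF.pure fun i => i.elim0 := by
      refine pmf_ext_ex fun V => ?_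
      unfold unif
      rw [ex_uniform]
      simp only [List.length_nil, ex_pure]
      rw [Fintype.sum_unique]
      simp
      congr 1
    rw [this, PMF.pure_map]
    rfl
  | cons d l ih =>
    rw [foldK, PMF.bind_map]
    change _ = (unif (l.length + 1)).map _
    rw [unif_succ, PMF.map_bind]
    congr 1
    funext b
    rw [Function.comp, ih, PMF.map_comp]
    congr 1
    funext v
    change List.ofFn v ++ b :: a = List.ofFn (Fin.snoc v b : Pt (l.length + 1)) ++ a
    rw [List.ofFn_succ']
    simp

theorem pRnd_poly {l : ι → List Data} :
    Poly W O pRnd (fun x => .ofList (l x))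
      (fun x => (unif (l x).length).map fun v => .ofVec v) (fun _ => 0) := Poly.intro fun hs => by
  refine Poly.seqD (mid := fun x => .ofList (l x) :+ .nil :+ .nil)
    (PolyD.assign fun x σ h => by simp [h]) ?_
  refine Poly.loop (α := fun _ => List Bool) (β := fun _ => Data) (fun _ => Data.ofBits)
    (fun _ d => d) (fun _ => Data.ofBits_injective) l
    (fun x j a => a.length + j ≤ (l x).length)
    (fun _ _ a => (PMF.uniformOfFintype Bool).map fun b => b :: a) (fun _ => []) (fun _ => .nil)
    (fun _ => 0) (fun x => by simp) (fun x => ?_) (fun x => by simp) ?_ ?_ ?_ ?_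
  · rw [foldK_rnd, PMF.map_comp]
    congr 1
    funext v
    simp [Data.ofVec]
  · refine Bdd.acc (((Bdd.const 4).mul hs.length).add (Bdd.const 1)) ?_
    intro x j a h
    have := Data.size_ofBits_le a
    omega
  · intro x j d hd a ha a' ha'
    rw [PMF.mem_support_map_iff] at ha'
    obtain ⟨b, -, rfl⟩ := ha'
    simp
    omega
  · intro x; simp
  · refine Poly.intro fun hs'' => Poly.of_bdd
      (T := fun y => ((Data.cons y.b (.ofBits y.a :+ .nil)).size + 3) + 10)
      ((Bdd.add hs'' (Bdd.const 3)).add (Bdd.const 10)) fun y => ?_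
    rw [PMF.map_comp]
    refine spec_flip _ _ _ _ (fun b σ h0 h1 => ?_) _ fun b => ?_
    · simp [h0, h1]
    · have := Data.size_ofBool_le b
      simp
      omega

/-- Put the value of the target function at a point in front of the input. -/
def pQuery (e : Expr) : Cmd := .query 1 e ;; .assign 0 (.var 1 :* .var 0) ;; .assign 1 .nil

theorem spec_query (d y : Data) (e : Expr) (O : Oracle)
    (he : ∀ σ : ℕ → Data, σ 0 = d → e.eval σ = y) :
    Spec O (pQuery e) d (PMF.pure (.ofBool (O.f (y.toVec O.m)) :+ d)) (d.size + 13) 1 := by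
  intro F s hF hd hs
  have hs1 : s.store 1 = .nil := hs 1 one_pos (by simp [Cmd.bnd, pQuery])
  set b := Data.ofBool (O.f (y.toVec O.m)) with hb
  have key : exec O F (pQuery e) s = PMF.pure (some
        (({ s.put 1 b with mq := s.mq + 1 } : St).put 0 (b :+ d) |>.put 1 .nil)) := by
    rw [pQuery, exec_seq, exec, PMF.pure_bind, andThen_some, exec_assign_seq, exec_assign,
      he _ hd, ← hb]
    simp [St.put, hd]
  have hbs : b.size ≤ 3 := Data.size_ofBool_le _
  rw [key]
  constructor
  · rw [PMF.pure_map, PMF.pure_map]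
    simp [outD, St.put]
  · intro o ho
    simp at ho
    refine ⟨_, ho, ?_, ?_, ?_⟩
    · exact (St.store_put_put _ hs1 _ _).trans (by simp [St.put])
    · simp [St.put]
      omega
    · simp [St.put]
      omega

theorem pQuery_poly {inp y : ι → Data} {e : Expr}
    (he : ∀ x, ∀ σ : ℕ → Data, σ 0 = inp x → e.eval σ = y x) :
    Poly W O (pQuery e) inp
      (fun x => PMF.pure (.ofBool ((O x).f ((y x).toVec (O x).m)) :+ inp x))
        (fun _ => 1) := Poly.intro fun hs =>
  Poly.of_bdd (Bdd.add hs (Bdd.const 13)) fun x => spec_query _ _ _ _ (he x)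

/-- Put an example in front of the input. -/
def pSample : Cmd := .sample 1 ;; .assign 0 (.var 1 :* .var 0) ;; .assign 1 .nil

theorem spec_sample (d : Data) (O : Oracle) :
    Spec O pSample d (O.D.map fun v => .ofVec v :+ d) (d.size + 8 * O.m + 13) 1 := by
  intro F s hF hd hs
  have hs1 : s.store 1 = .nil := hs 1 one_pos (by simp [Cmd.bnd, pSample])
  have key : exec O F pSample s = O.D.bind fun v => PMF.pure (some
        (({ s.put 1 (.ofVec v) with exq := s.exq + 1 } : St).put 0 (.ofVec v :+ d)
          |>.put 1 .nil)) := by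
    rw [pSample, exec_seq, exec, PMF.bind_bind]
    congr 1
    funext v
    rw [PMF.pure_bind, andThen_some, exec_assign_seq, exec_assign]
    simp [St.put, hd]
  rw [key]
  constructor
  · rw [PMF.map_bind, PMF.map_comp]
    simp [PMF.map, PMF.pure_bind, outD, St.put, Function.comp_def]
  · intro o ho
    rw [PMF.mem_support_bind_iff] at ho
    obtain ⟨v, -, ho⟩ := ho
    simp at ho
    have := Data.size_ofVec_le v
    refine ⟨_, ho, ?_, ?_, ?_⟩
    · exact (St.store_put_put _ hs1 _ _).trans (by simp [St.put])
    · simp [St.put]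
      omega
    · simp [St.put]
      omega

theorem pSample_poly {inp : ι → Data} (hm : Bdd W fun x => (O x).m) :
    Poly W O pSample inp (fun x => (O x).D.map fun v => .ofVec v :+ inp x)
      (fun _ => 1) := Poly.intro fun hs =>
  Poly.of_bdd ((Bdd.add hs ((Bdd.const 8).mul hm)).add (Bdd.const 13)) fun _ => spec_sample _ _

end

/-! ## Simulation of a program with a clock and query budgets -/

/-- `tl` applied `x` times. -/
def Expr.drop : ℕ → Expr → Expr
  | 0, B => B
  | x + 1, B => .tl (Expr.drop x B)

theorem Expr.eval_drop (σ : ℕ → Data) (B : Expr) : ∀ x, (Expr.drop x B).eval σ =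
    Data.tl^[x] (B.eval σ)
  | 0 => rfl
  | x + 1 => by rw [Expr.drop, Expr.eval, eval_drop σ B x, Function.iterate_succ_apply']

/-- The expression `e` on the store that is packed into the list `B`. -/
def Expr.sub (B : Expr) : Expr → Expr
  | .var x => .hd (.drop x B)
  | .nil => .nil
  | e :* e' => Expr.sub B e :* Expr.sub B e'
  | .hd e => .hd (Expr.sub B e)
  | .tl e => .tl (Expr.sub B e)

/-- The list `B` with the entry `x` replaced by `v`. -/
def Expr.upd (v : Expr) : ℕ → Expr → Expr
  | 0, B => v :* .tl B
  | x + 1, B => .hd B :* Expr.upd v x (.tl B)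

theorem Expr.eval_sub {σ τ : ℕ → Data} {B : Expr} {l : List Data} (hB : B.eval σ = .ofList l) :
    ∀ (e : Expr), (∀ x < e.bnd, l[x]? = some (τ x)) → (Expr.sub B e).eval σ = e.eval τ
  | .var x, h => by
    have h1 := h x (Nat.lt_succ_self x)
    simp only [Expr.sub, Expr.eval, Expr.eval_drop, hB, Data.tl_iterate_ofList]
    obtain ⟨hx, hx'⟩ := List.getElem?_eq_some_iff.1 h1
    rw [List.drop_eq_getElem_cons hx, hx']
    rfl
  | .nil, _ => rfl
  | e :* e', h => by
    rw [Expr.sub, Expr.eval, Expr.eval,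
      eval_sub hB e fun x hx => h x (lt_of_lt_of_le hx (le_max_left _ _)),
      eval_sub hB e' fun x hx => h x (lt_of_lt_of_le hx (le_max_right _ _))]
  | .hd e, h => congrArg Data.hd (eval_sub hB e h)
  | .tl e, h => congrArg Data.tl (eval_sub hB e h)

theorem Expr.eval_upd {σ : ℕ → Data} {v : Expr} : ∀ {x : ℕ} {B : Expr} {l : List Data},
    B.eval σ = .ofList l → x < l.length → (Expr.upd v x B).eval σ = .ofList (l.set x (v.eval σ))
  | 0, B, d :: l, hB, _ => by simp [Expr.upd, hB]
  | x + 1, B, d :: l, hB, hx => by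
    have := eval_upd (σ := σ) (v := v) (x := x) (B := .tl B) (l := l) (by simp [hB])
      (by simpa using hx)
    simp [Expr.upd, hB, this]

/-- The number of entries of a tree that is read as a list. -/
def Data.len : Data → ℕ
  | .nil => 0
  | _ :+ r => r.len + 1

@[simp] theorem Data.len_unary (m : ℕ) : (Data.unary m).len = m := by
  induction m with
  | zero => rfl
  | succ m ih => rw [Data.unary_succ, Data.len, ih]

section charge
variable {ι : Type} {W : ι → ℕ} {O : ι → Oracle}

/-- One step of a traversal of the trees on a stack, at a cost of one unit. -/
def travStep : List Data × ℕ → List Data × ℕ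
  | ([], r) => ([], r)
  | (.nil :: l, r) => (l, r - 1)
  | (a :+ b :: l, r) => (a :: b :: l, r - 1)

theorem travStep_spec (p : List Data × ℕ) :
    ((travStep p).1.map Data.size).sum = (p.1.map Data.size).sum - 1 ∧
      (travStep p).2 = p.2 - min 1 (p.1.map Data.size).sum := by
  obtain ⟨l, r⟩ := p
  match l with
  | [] => simp [travStep]
  | .nil :: l => simp [travStep]
  | a :+ b :: l =>
    simp only [travStep, List.map_cons, List.sum_cons, Data.size]
    omega

theorem trav_foldl {β : Type} (l : List β) (p : List Data × ℕ) :
    (l.foldl (fun p _ => travStep p) p).2 = p.2 - min l.length (p.1.map Data.size).sum := by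
  induction l generalizing p with
  | nil => simp
  | cons d l ih =>
    rw [List.foldl_cons, ih, (travStep_spec p).1, (travStep_spec p).2, List.length_cons]
    omega

theorem size_ofList_le_sum (l : List Data) :
    (Data.ofList l).size ≤ 1 + 2 * (l.map Data.size).sum := by
  induction l with
  | nil => simp
  | cons d l ih => have := d.one_le_size; simp; omega

/-- From a clock and a tree to the clock minus the size of the tree. -/
def pCharge : Cmd :=
  .assign 0 (.hd (.var 0) :* ((.rest 1 :* .nil) :* .nth 0) :* .nil) ;;
    .forEach (.cond (.hd (.nth 1))
      (.cond (.hd (.hd (.nth 1)))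
        (.assign 0 ((.hd (.hd (.hd (.nth 1))) :* .tl (.hd (.hd (.nth 1))) :*
          .tl (.hd (.nth 1))) :* .tl (.tl (.nth 1))))
        (.assign 0 (.tl (.hd (.nth 1)) :* .tl (.tl (.nth 1)))))
      (.assign 0 (.nth 1))) ;;
    .assign 0 (.tl (.var 0))

theorem tl_unary (m : ℕ) : (Data.unary m).tl = .unary (m - 1) := by
  cases m with
  | zero => rfl
  | succ m => simp [Data.unary_succ]

/-- One round per unit of the clock removes one node from a stack of subtrees, so `k` rounds take
away `min k v.size` units. The total size of the stack never grows, which bounds the state. -/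
theorem pCharge_poly {k : ι → ℕ} {v : ι → Data} :
    PolyD W O pCharge (fun x => .unary (k x) :+ v x) (fun x => .unary
      (k x - (v x).size)) := Poly.intro fun hs => by
  let enc : List Data × ℕ → Data := fun p => .ofList p.1 :+ .unary p.2
  have hinj : Function.Injective enc := by
    rintro ⟨a, b⟩ ⟨a', b'⟩ h
    simp only [enc, Data.cons.injEq] at h
    rw [Data.ofList_injective h.1, Data.unary_injective h.2]
  refine PolyD.seq (mid := fun x => .unary (k x) :+ enc ([v x], k x) :+ .nil)
    (PolyD.assign fun x σ h => by simp [h, enc]) ?_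
  refine PolyD.seq (mid := fun x => enc ((List.replicate (k x) ()).foldl (fun p _ => travStep p)
    ([v x], k x))) ?_ <| PolyD.assign fun x σ h => ?_
  · refine PolyD.loop (α := fun _ => List Data × ℕ) (β := fun _ => Unit)
      (fun _ => enc) (fun _ _ => .nil :+ .nil) (fun _ => hinj) (fun x => List.replicate (k x) ())
      (fun x j p => (p.1.map Data.size).sum ≤ (v x).size ∧ p.2 ≤ k x)
      (fun _ _ p => travStep p) (fun x => ([v x], k x)) (fun _ => .nil)
      (fun x => by rw [Data.unary_eq, List.map_replicate]) (fun x => rfl) ?_ ?_ ?_ ?_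
    · refine Bdd.acc ((((Bdd.const 1).add ((Bdd.const 2).mul hs.snd)).add
        ((Bdd.const 4).mul hs.fst.of_unary)).add (Bdd.const 2)) ?_
      rintro x j ⟨l, r⟩ ⟨h1, h2⟩
      have := size_ofList_le_sum l
      simp [enc] at h1 h2 ⊢
      omega
    · rintro x j b hb p ⟨h1, h2⟩
      rw [(travStep_spec p).1, (travStep_spec p).2]
      omega
    · intro x; simp
    · refine Poly.cond (fun y => (Data.ofList y.a.1).truth) (fun y σ h => by simp [h, enc]) ?_ ?_
      · refine Poly.cond (fun y => (Data.ofList y.1.a.1).hd.truth)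
          (fun y σ h => by simp [h, enc]) ?_ ?_
        · refine PolyD.assign ?_
          rintro ⟨⟨y, h1⟩, h2⟩ σ h
          obtain ⟨x, j, b, ⟨l, r⟩, h3, h4⟩ := y
          match l with
          | [] => simp at h1
          | .nil :: l => simp at h2
          | a :+ b :: l => simp [h, enc, travStep, tl_unary]
        · refine PolyD.assign ?_
          rintro ⟨⟨y, h1⟩, h2⟩ σ h
          obtain ⟨x, j, b, ⟨l, r⟩, h3, h4⟩ := y
          match l with
          | [] => simp at h1
          | .nil :: l => simp [h, enc, travStep, tl_unary]
          | a :+ b :: l => simp at h2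
      · refine PolyD.assign ?_
        rintro ⟨y, h1⟩ σ h
        obtain ⟨x, j, b, ⟨l, r⟩, h3, h4⟩ := y
        match l with
        | [] => simp [h, enc, travStep]
        | d :: l => simp at h1
  · simp only [Expr.eval, h, enc, Data.tl_cons]
    rw [trav_foldl]
    simp only [List.length_replicate, List.map_cons, List.map_nil, List.sum_cons, List.sum_nil]
    congr 1
    omega

end charge

/-- The state of a simulation: remaining time, remaining membership and example queries, and the
store. -/
@[ext] structure Sim where
  clk : ℕ
  mq : ℕ
  ex : ℕ
  st : List Data

namespace Sim

def enc (ctx : Data) (a : Sim) : Data :=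
  .unary a.clk :+ .unary a.mq :+ .unary a.ex :+ .ofList a.st :+ ctx

theorem enc_injective (ctx : Data) : Function.Injective (enc ctx) := by
  intro a b h
  simp only [enc, Data.cons.injEq] at h
  exact Sim.ext (Data.unary_injective h.1) (Data.unary_injective h.2.1)
    (Data.unary_injective h.2.2.1) (Data.ofList_injective h.2.2.2.1)

/-- A clock at zero means that the simulation has been stopped: nothing is written any more, and
every loop exits. The clock starts at one more than the time bound, so a run within the bound never
gets there. -/
def tick (a : Sim) : Sim := { a with clk := a.clk - 1 }

/-- Write `v` into the variable `x`, or stop if there is not enough time. -/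
def wr (a : Sim) (x : ℕ) (v : Data) : Sim :=
  if v.size + 1 < a.clk then { a with clk := a.clk - v.size - 1, st := a.st.set x v }
  else { a with clk := 0 }

def pay (i j : ℕ) (a : Sim) : Sim := { a with mq := a.mq - i, ex := a.ex - j }

/-- The value of an expression in the store. -/
def val (a : Sim) (e : Expr) : Data := e.eval fun z => (a.st[z]?).getD .nil

end Sim

section
variable {ι : Type} {W : ι → ℕ} {O : ι → Oracle}

def pTick : Cmd := .assign 0 (.tl (.nth 0) :* .rest 1)

theorem pTick_poly {a : ι → Sim} {ctx : ι → Data} :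
    PolyD W O pTick (fun x => (a x).enc (ctx x)) (fun x => (a x).tick.enc (ctx x)) :=
  PolyD.assign fun x σ h => by simp [h, Sim.enc, Sim.tick, tl_unary]

/-- Write the value in front of the state into the variable `x`. -/
def pWrite (x : ℕ) : Cmd :=
  .push (.nth 1 :* .nth 0) pCharge ;;
  .cond (.tl (.nth 0))
    (.assign 0 (.tl (.nth 0) :* .nth 3 :* .nth 4 :*
      .upd (.nth 1) x (.nth 5) :* .rest 6))
    (.assign 0 (.nil :* .rest 3))

theorem pWrite_poly {z : ℕ} {a : ι → Sim} {v ctx : ι → Data} (hz : ∀ x, z < (a x).st.length) :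
    PolyD W O (pWrite z) (fun x => v x :+ (a x).enc (ctx x))
      (fun x => ((a x).wr z (v x)).enc (ctx x)) := by
  refine PolyD.seq (PolyD.push (a := fun x => .unary (a x).clk :+ v x)
    (fun x σ h => by simp [h, Sim.enc]) pCharge_poly) ?_
  refine Poly.cond (fun x => decide ((v x).size + 1 < (a x).clk)) (fun x σ h => ?_) ?_ ?_
  · simp only [Expr.nth, Expr.rest, Expr.eval, h, Data.hd_cons, tl_unary, Data.truth_unary]
    congr 1
    apply propext
    omega
  · refine PolyD.assign ?_
    rintro ⟨x, hx⟩ σ h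
    simp only [decide_eq_true_eq] at hx
    have := Expr.eval_upd (σ := σ) (v := .nth 1) (x := z) (B := .nth 5) (l := (a x).st)
      (by simp [h, Sim.enc]) (hz x)
    simp only [Expr.eval, this]
    simp [h, Sim.enc, Sim.wr, hx, tl_unary]
  · refine PolyD.assign ?_
    rintro ⟨x, hx⟩ σ h
    simp only [decide_eq_false_iff_not] at hx
    simp [h, Sim.enc, Sim.wr, hx, Data.unary_zero]

end

/-- Put in front of the state after a tick whether time is left and `e` is true. -/
def pTest (e : Expr) : Cmd :=
  pTick ;; .cond (.nth 0) (.cond (.sub (.nth 3) e) (.assign 0 (.tt :* .var 0))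
    (.assign 0 (.nil :* .var 0))) (.assign 0 (.nil :* .var 0))

/-- If the budgets suffice by `t`, then pay by `d` and write the answer of `hnd` on the value of `e`
into the variable `x`; otherwise stop. -/
def pAsk (t d e : Expr) (hnd : Cmd) (x : ℕ) : Cmd :=
  .cond t (.assign 0 d ;; .push e hnd ;; pWrite x) (.assign 0 (.nil :* .rest 1))

/-- The simulation of a program, where `qh` answers membership queries and `sh` draws examples. -/
def simulate (qh sh : Cmd) : Cmd → Cmd
  | .skip => pTick
  | .assign x e => pAsk .tt (.var 0) (.sub (.nth 3) e) .skip x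
  | .seq c c' => simulate qh sh c ;; simulate qh sh c'
  | .cond e c c' => .cond (.sub (.nth 3) e) (pTick ;; simulate qh sh c) (pTick ;; simulate qh sh c')
  | .loop e c => pTest e ;;
      .loop (.hd (.var 0)) (.assign 0 (.tl (.var 0)) ;; simulate qh sh c ;; pTest e) ;;
      .assign 0 (.tl (.var 0))
  | .flip x => pAsk .tt (.var 0) .nil (.flip 1 ;; .assign 0 (.var 1) ;; .assign 1 .nil) x
  | .query x e => pAsk (.nth 1) (.nth 0 :* .tl (.nth 1) :* .rest 2)
      (.sub (.nth 3) e :* .rest 4) qh x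
  | .sample x => pAsk (.nth 2) (.nth 0 :* .nth 1 :* .tl (.nth 2) :* .rest 3)
      (.rest 4) sh x

theorem iter_mono {e : Expr} {O : Oracle} {F : ℕ} {c : Cmd} : ∀ (fuel : ℕ) {s s' : St},
    some s' ∈ (iter e (exec O F c) fuel s).support →
      s.time + 1 ≤ s'.time ∧ s.mq ≤ s'.mq ∧ s.exq ≤ s'.exq
  | 0, s, s', h => by simp [iter] at h
  | fuel + 1, s, s', h => by
    rw [iter_succ] at h
    split_ifs at h
    · rw [mem_support_bind_andThen] at h
      obtain ⟨s1, h1, h2⟩ := h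
      have h3 := exec_mono h1
      have h4 := iter_mono fuel h2
      simp only [St.tick] at h3
      omega
    · simp at h
      subst h
      simp [St.tick]

/-- No run is cut off, takes more than `T` time units, or makes too many queries. -/
def AllOK (T M Q : ℕ) (p : PMF (Option St)) : Prop :=
  ∀ o ∈ p.support, ∃ s, o = some s ∧ s.time ≤ T ∧ s.mq ≤ M ∧ s.exq ≤ Q

/-- Every continuation has some outcome, and the counters never decrease; so a violation in the
first part would persist to the end. -/
theorem AllOK.left {T M Q : ℕ} {p : PMF (Option St)} {g : St → PMF (Option St)}
    (hg : ∀ s s', some s' ∈ (g s).support → s.time ≤ s'.time ∧ s.mq ≤ s'.mq ∧ s.exq ≤ s'.exq)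
    (h : AllOK T M Q (p.bind (andThen g))) : AllOK T M Q p := by
  intro o ho
  cases o with
  | none =>
    obtain ⟨s, hs, -⟩ := h none (none_mem_support_bind_andThen.2 (Or.inl ho))
    cases hs
  | some s1 =>
    obtain ⟨o, ho'⟩ := (g s1).support_nonempty
    have hmem : o ∈ (p.bind (andThen g)).support := by
      rw [PMF.mem_support_bind_iff]
      exact ⟨some s1, ho, ho'⟩
    obtain ⟨s, rfl, h1, h2, h3⟩ := h o hmem
    have := hg _ _ ho'
    exact ⟨s1, rfl, by omega, by omega, by omega⟩

theorem AllOK.right {T M Q : ℕ} {p : PMF (Option St)} {g : St → PMF (Option St)}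
    (h : AllOK T M Q (p.bind (andThen g))) {s1 : St} (hs : some s1 ∈ p.support) :
    AllOK T M Q (g s1) := by
  intro o ho
  refine h o ?_
  rw [PMF.mem_support_bind_iff]
  exact ⟨some s1, hs, ho⟩

theorem AllOK.time_lt {T M Q F fuel : ℕ} {e : Expr} {c : Cmd} {O : Oracle} {s : St}
    (h : AllOK T M Q (iter e (exec O F c) fuel s)) : s.time + 1 ≤ T := by
  obtain ⟨o, ho⟩ := (iter e (exec O F c) fuel s).support_nonempty
  obtain ⟨s1, rfl, h1, -⟩ := h o ho
  exact (iter_mono fuel ho).1.trans h1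

/-- Time and queries left, and the first `m` variables. -/
def absSt (T M Q m : ℕ) (s : St) : Sim :=
  ⟨T + 1 - s.time, M - s.mq, Q - s.exq, (List.range m).map s.store⟩

theorem absSt_tick (T M Q m : ℕ) (s : St) : absSt T M Q m s.tick = (absSt T M Q m s).tick := by
  simp [absSt, St.tick, Sim.tick]; omega

theorem set_map_range (m x : ℕ) (σ : ℕ → Data) (d : Data) :
    (List.range m).map (Function.update σ x d) = ((List.range m).map σ).set x d := by
  refine List.ext_getElem (by simp) fun i h1 h2 => ?_
  simp only [List.length_map, List.length_range] at h1
  rw [List.getElem_set]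
  by_cases h : x = i
  · subst h; simp
  · simp [h, Function.update_of_ne (Ne.symm h)]

/-- The data of a simulation: the oracles of the simulated program, the context with which the two
handlers work, and the number of queries for an example. -/
structure SimCtx where
  O : Oracle
  O' : Oracle
  ctx : Data
  κ : ℕ

section
variable {ι : Type} {W : ι → ℕ} {X : ι → SimCtx}

/-- The number of real queries that the remaining budgets still allow, if producing one example
costs `κ` queries; it is read off from the encoded state. -/
def potQ (κ : ℕ) (d : Data) : ℕ := d.tl.hd.len + κ * d.tl.tl.hd.len

@[simp] theorem potQ_enc (κ : ℕ) (ctx : Data) (a : Sim) : potQ κ (a.enc ctx) = a.mq + κ * a.ex := by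
  simp [potQ, Sim.enc]

@[simp] theorem len_hd_enc (ctx : Data) (a : Sim) : (a.enc ctx).hd.len = a.clk := by
  simp [Sim.enc]

/-- Sizes in a simulation stay bounded. -/
def SimInv (W : ι → ℕ) (m : ℕ) (x : ι) (a : Sim) : Prop :=
  a.st.length = m ∧ (Data.ofList a.st).size + a.clk ≤ W x ∧ a.mq ≤ W x ∧ a.ex ≤ W x

theorem size_set_le : ∀ (l : List Data) (z : ℕ) (v : Data),
    (Data.ofList (l.set z v)).size ≤ (Data.ofList l).size + v.size
  | [], z, v => by simp
  | d :: l, 0, v => by simp; omega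
  | d :: l, z + 1, v => by have := size_set_le l z v; simp; omega

theorem SimInv.tick {m : ℕ} {x : ι} {a : Sim} (h : SimInv W m x a) : SimInv W m x a.tick :=
  ⟨h.1, by have := h.2.1; simp only [Sim.tick]; omega, h.2.2.1, h.2.2.2⟩

/-- A write enlarges the store by at most the size that it takes from the clock, so the sum of both
does not increase. -/
theorem SimInv.wr {m : ℕ} {x : ι} {a : Sim} (h : SimInv W m x a) (z : ℕ) (v : Data) :
    SimInv W m x (a.wr z v) := by
  have h1 := h.2.1
  have := size_set_le a.st z v
  unfold Sim.wr
  split_ifs with hv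
  · exact ⟨by simpa using h.1, by simp only; omega, h.2.2.1, h.2.2.2⟩
  · exact ⟨h.1, by simp only; omega, h.2.2.1, h.2.2.2⟩

theorem Sim.wr_clk_le (a : Sim) (z : ℕ) (v : Data) : (a.wr z v).clk ≤ a.clk := by
  unfold Sim.wr; split_ifs <;> simp; omega

theorem Sim.wr_mq (a : Sim) (z : ℕ) (v : Data) : (a.wr z v).mq = a.mq := by
  unfold Sim.wr; split_ifs <;> rfl

theorem Sim.wr_ex (a : Sim) (z : ℕ) (v : Data) : (a.wr z v).ex = a.ex := by
  unfold Sim.wr; split_ifs <;> rfl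

/-- The index type for one step of the simulation. -/
structure SimIx (ι : Type) (W : ι → ℕ) (m : ℕ) where
  x : ι
  a : Sim
  inv : SimInv W m x a

theorem SimIx.sbdd {m : ℕ} (hctx : SBdd W fun x => (X x).ctx) :
    SBdd (fun y : SimIx ι W m => W y.x) fun y => y.a.enc (X y.x).ctx := by
  refine ((Bdd.add ((Bdd.const 20).mul Bdd.self) (hctx.comp SimIx.x)).add (Bdd.const 20)).mono
    fun y => ?_
  obtain ⟨-, h1, h2, h3⟩ := y.inv
  simp [Sim.enc]
  omega

/-- The simulation `p` takes `a` to a state distributed as `μ`, with time and queries paid from the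
clock and the budgets. -/
def SimStep (W : ι → ℕ) (X : ι → SimCtx) (m : ℕ) (p : Cmd) (x : ι) (a : Sim) (K : ℕ) (μ : PMF Sim) :
    Prop :=
  PSpec (X x).O p (a.enc (X x).ctx) (μ.map (Sim.enc (X x).ctx)) (K * (1 + a.clk))
    (a.mq + (X x).κ * a.ex) (fun d => K * d.hd.len) (potQ (X x).κ) ∧
  ∀ a' ∈ μ.support, SimInv W m x a' ∧ a'.clk ≤ a.clk

/-- The correctness of a simulation. -/
def SimSpec (W : ι → ℕ) (X : ι → SimCtx) (m : ℕ) (p : Cmd) (c : Cmd) : Prop :=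
  ∃ P : Polynomial ℕ, ∀ x a, SimInv W m x a → ∃ μ : PMF Sim, SimStep W X m p x a (P.eval (W x)) μ ∧
    ∀ T M Q F s, absSt T M Q m s = a → AllOK T M Q (exec (X x).O' F c s) →
      (exec (X x).O' F c s).map (Option.map (absSt T M Q m)) = μ.map some

/-- A simulation of a single step. -/
theorem SimSpec.of_poly {m : ℕ} {p c : Cmd} {μ : ι → Sim → PMF Sim} {Qb : SimIx ι W m → ℕ}
    (hctx : SBdd W fun x => (X x).ctx)
    (h : Poly (fun y : SimIx ι W m => W y.x) (fun y => (X y.x).O) p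
      (fun y => y.a.enc (X y.x).ctx) (fun y => (μ y.x y.a).map (Sim.enc (X y.x).ctx)) Qb)
    (hμ : ∀ x a, (h : SimInv W m x a) → ∀ a' ∈ (μ x a).support, SimInv W m x a' ∧ a'.clk ≤ a.clk ∧
      Qb ⟨x, a, h⟩ + (a'.mq + (X x).κ * a'.ex) ≤ a.mq + (X x).κ * a.ex)
    (hc : ∀ x a T M Q F s, absSt T M Q m s = a → AllOK T M Q (exec (X x).O' F c s) →
      (exec (X x).O' F c s).map (Option.map (absSt T M Q m)) = (μ x a).map some) :
    SimSpec W X m p c := by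
  obtain ⟨P, hP⟩ := h (SimIx.sbdd hctx)
  refine ⟨P, fun x a ha => ⟨μ x a, ⟨(hP ⟨x, a, ha⟩).potential (Nat.le_mul_of_pos_right _ (by omega))
    (forall_support_map.2 fun a' ha' => ?_) (forall_support_map.2 fun a' ha' => ?_),
    fun a' ha' => ⟨(hμ x a ha a' ha').1, (hμ x a ha a' ha').2.1⟩⟩, fun T M Q F s => hc x a T M Q F
      s⟩⟩
  · have := Nat.mul_le_mul_left (P.eval (W x)) (hμ x a ha a' ha').2.1
    rw [len_hd_enc, mul_add, mul_one]
    exact Nat.add_le_add_left this _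
  · rw [potQ_enc]
    exact (hμ x a ha a' ha').2.2

theorem SimSpec.skip {m : ℕ} (hctx : SBdd W fun x => (X x).ctx) :
    SimSpec W X m pTick .skip := by
  refine SimSpec.of_poly hctx (μ := fun _ a => PMF.pure a.tick) (Qb := fun _ => 0)
    (Poly.congr pTick_poly fun y => by rw [PMF.pure_map]) ?_ ?_
  · intro x a ha a' ha'
    simp at ha'
    subst ha'
    exact ⟨ha.tick, by simp [Sim.tick], by simp [Sim.tick]⟩
  · intro x a T M Q F s hs _
    rw [exec_skip, PMF.pure_map, PMF.pure_map, Option.map_some, absSt_tick, hs]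

theorem SimInv.sub_eval {m : ℕ} {x : ι} {a : Sim} (h : SimInv W m x a) {σ : ℕ → Data}
    {B : Expr} (hB : B.eval σ = .ofList a.st) {e : Expr} (he : e.bnd ≤ m) :
    (Expr.sub B e).eval σ = a.val e := by
  refine Expr.eval_sub hB e fun z hz => ?_
  have : z < a.st.length := by rw [h.1]; omega
  simp [this]

theorem absSt_val (T M Q : ℕ) {m : ℕ} (s : St) {e : Expr} (he : e.bnd ≤ m) :
    (absSt T M Q m s).val e = e.eval s.store :=
  Expr.eval_congr fun z hz => by simp [absSt, lt_of_lt_of_le hz he]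

/-- `qh` answers membership queries at the point in front of the context. -/
def Answers (W : ι → ℕ) (X : ι → SimCtx) (qh : Cmd) : Prop :=
  ∃ P : Polynomial ℕ, ∀ x y, Spec (X x).O qh (y :+ (X x).ctx)
    (PMF.pure (.ofBool ((X x).O'.f (y.toVec (X x).O'.m)))) (P.eval (W x + y.size)) 1

/-- `sh` draws an example. -/
def Draws (W : ι → ℕ) (X : ι → SimCtx) (sh : Cmd) : Prop :=
  Poly W (fun x => (X x).O) sh (fun x => (X x).ctx)
    (fun x => (X x).O'.D.map fun v => .ofVec v) (fun x => (X x).κ)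

/-- The simulation of a step that asks `i` membership and `j` example queries and writes an answer
distributed as `ν` into the variable `z`. -/
theorem SimSpec.ask {m z i j : ℕ} {hnd c : Cmd} {t d e : Expr} (hz : z < m)
    (hctx : SBdd W fun x => (X x).ctx) {arg : ι → Sim → Data} {ν : ι → Sim → PMF Data}
    (ht : ∀ x (a : Sim) (σ : ℕ → Data), σ 0 = a.enc (X x).ctx →
      (t.eval σ).truth = decide (i ≤ a.mq ∧ j ≤ a.ex))
    (hd : ∀ x (a : Sim) (σ : ℕ → Data), σ 0 = a.enc (X x).ctx →
      d.eval σ = (a.pay i j).enc (X x).ctx)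
    (he : ∀ x a, SimInv W m x a → ∀ σ : ℕ → Data, σ 0 = (a.pay i j).enc (X x).ctx →
      e.eval σ = arg x a)
    (hh : Poly (fun y : SimIx ι W m => W y.x) (fun y => (X y.x).O) hnd (fun y => arg y.x y.a)
        (fun y => ν y.x y.a) (fun y => i + (X y.x).κ * j))
    (hc : ∀ x F s T M Q, exec (X x).O' F c s = (ν x (absSt T M Q m s)).map fun v =>
      some { s.put z v with mq := s.mq + i, exq := s.exq + j }) :
    SimSpec W X m (pAsk t d e hnd z) c := by
  have hs := SimIx.sbdd (m := m) hctx
  have hpay := (PolyD.assign (O := fun y => (X y.x).O) fun (y : SimIx ι W m) σ h =>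
    hd _ y.a σ h).out_bdd hs
  have harg := (PolyD.assign (O := fun y => (X y.x).O) fun (y : SimIx ι W m) σ h =>
    he _ _ y.inv σ h).out_bdd hpay
  refine SimSpec.of_poly hctx (μ := fun x a => if i ≤ a.mq ∧ j ≤ a.ex then
      (ν x a).map fun v => (a.pay i j).wr z v else PMF.pure { a with clk := 0 })
    (Qb := fun y => if i ≤ y.a.mq ∧ j ≤ y.a.ex then i + (X y.x).κ * j else 0) ?_ ?_ ?_
  · refine Poly.cond (fun y => decide (i ≤ y.a.mq ∧ j ≤ y.a.ex)) (fun y σ h => ht _ _ σ h) ?_ ?_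
    · refine Poly.mono (Q := fun y => i + (X y.1.x).κ * j + 0) (Poly.congr (Poly.seqD
        (PolyD.assign fun y σ h => hd _ _ σ h) <| Poly.seqM (α := fun _ => Data)
          (enc := fun y v => v :+ (y.1.a.pay i j).enc (X y.1.x).ctx)
          (ν := fun y v => PMF.pure (((y.1.a.pay i j).wr z v).enc (X y.1.x).ctx))
          (Q' := fun _ => 0) (fun y v v' h => by simpa using h)
          (Poly.push (fun y σ h => he _ _ y.1.inv σ h) (hh.comp harg Subtype.val)) ?_)
          fun y => ?_) fun y => ?_
      · exact pWrite_poly (fun y => lt_of_lt_of_eq hz y.1.1.inv.1.symm)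
      · rw [if_pos (of_decide_eq_true y.2), PMF.map_comp]; rfl
      · rw [if_pos (of_decide_eq_true y.2)]; rfl
    · refine Poly.mono (Q := fun _ => 0) (Poly.congr (PolyD.assign
        (out := fun y => Sim.enc (X y.1.x).ctx { y.1.a with clk := 0 })
        fun y σ h => by simp [h, Sim.enc, Data.unary_zero]) fun y => ?_) fun _ => Nat.zero_le _
      rw [if_neg (of_decide_eq_false y.2), PMF.pure_map]
  · intro x a ha
    obtain ⟨h1, h2, h3, h4⟩ := id ha
    dsimp only
    split_ifs with h
    · refine forall_support_map.2 fun v _ => ?_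
      have h5 : SimInv W m x (a.pay i j) := ⟨h1, h2, by simp only [Sim.pay]; omega, by
        simp only [Sim.pay]; omega⟩
      refine ⟨h5.wr _ _, Sim.wr_clk_le (a.pay i j) _ _, ?_⟩
      simp only [Sim.wr_mq, Sim.wr_ex, Sim.pay]
      obtain ⟨r, hr⟩ := Nat.exists_eq_add_of_le h.2
      rw [hr, Nat.add_sub_cancel_left, mul_add]
      omega
    · intro a' ha'
      simp at ha'
      subst ha'
      exact ⟨⟨h1, by simp only; omega, h3, h4⟩, Nat.zero_le _, by simp⟩
  · intro x a T M Q F s hs hok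
    rw [hc x F s T M Q, hs] at hok ⊢
    rw [AllOK, forall_support_map] at hok
    -- Any possible answer leads to a state within the bounds; this shows that the budgets had not
    -- been used up before the step.
    obtain ⟨v0, hv0⟩ := (ν x a).support_nonempty
    obtain ⟨_, h0, h1, h2, h3⟩ := hok v0 hv0
    cases h0
    simp only [St.put] at h1 h2 h3
    rw [if_pos (by rw [← hs]; simp only [absSt]; omega), PMF.map_comp, PMF.map_comp]
    refine map_congr_support _ fun v hv => ?_
    obtain ⟨_, h4, h5, -⟩ := hok v hv
    cases h4
    rw [Function.comp, Function.comp, Option.map_some, ← hs]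
    simp only [St.put] at h5
    rw [Sim.wr, if_pos (by simp [absSt, Sim.pay]; omega)]
    simp [absSt, St.put, Sim.pay, set_map_range]
    omega

/-- The two parts are charged to `K` and `K'` separately. Because the clock does not increase, the
`K'`-share survives the first part, and the unused `K`-share is carried past the second. -/
theorem SimSpec.seq {m : ℕ} {p c p' c' : Cmd} (h : SimSpec W X m p c) (h' : SimSpec W X m p' c') :
    SimSpec W X m (p ;; p') (c ;; c') := by
  obtain ⟨P, hP⟩ := h
  obtain ⟨P', hP'⟩ := h'
  refine ⟨P + P', fun x a ha => ?_⟩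
  obtain ⟨μ, ⟨h1, h2⟩, h3⟩ := hP x a ha
  classical
  choose! ν hν1 hν3 using fun a' (ha' : a' ∈ μ.support) => hP' x a' (h2 a' ha').1
  refine ⟨μ.bind ν, ⟨?_, ?_⟩, ?_⟩
  · rw [Polynomial.eval_add, PMF.map_bind]
    set K := P.eval (W x)
    set K' := P'.eval (W x)
    refine PSpec.seqM (Sim.enc_injective _) (pT := fun d => K' * (1 + d.hd.len) + K * d.hd.len)
      (pQ := potQ (X x).κ) (h1.mono (Nat.mul_le_mul_right _ (by omega))
        (forall_support_map.2 fun a' ha' => ?_) fun _ _ => le_rfl) fun a' ha' => ?_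
    · have := Nat.mul_le_mul_left K' (h2 a' ha').2
      rw [len_hd_enc]
      ring_nf at this ⊢
      omega
    · rw [len_hd_enc, potQ_enc]
      refine (hν1 a' ha').1.mono (Nat.le_add_right _ _) (forall_support_map.2 fun a'' ha'' => ?_)
        fun _ _ => le_rfl
      have := Nat.mul_le_mul_left K ((hν1 a' ha').2 a'' ha'').2
      rw [len_hd_enc]
      ring_nf at this ⊢
      omega
  · intro a'' ha''
    rw [PMF.mem_support_bind_iff] at ha''
    obtain ⟨a', ha', ha''⟩ := ha''
    have h5 := (hν1 a' ha').2 a'' ha''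
    exact ⟨h5.1, h5.2.trans (h2 a' ha').2⟩
  · intro T M Q F s hs hok
    rw [exec_seq] at hok ⊢
    have h6 := h3 T M Q F s hs (hok.left fun s s' hs => by have := exec_mono hs; omega)
    exact map_bind_andThen h6 fun s1 hs1 =>
      hν3 _ (mem_support_of_map h6 hs1) T M Q F s1 rfl (hok.right hs1)

end

section
variable {ι : Type} {W : ι → ℕ} {X : ι → SimCtx}

theorem SimSpec.assign {m z : ℕ} {e : Expr} (hm : (Cmd.assign z e).bnd ≤ m)
    (hctx : SBdd W fun x => (X x).ctx) (qh sh : Cmd) :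
    SimSpec W X m (simulate qh sh (.assign z e)) (.assign z e) := by
  simp only [Cmd.bnd, max_le_iff] at hm
  refine SimSpec.ask (i := 0) (j := 0) (arg := fun _ a => a.val e) (ν := fun _ a => .pure (a.val e))
    hm.1 hctx (fun x a σ h => by simp [Data.truth]) (fun x a σ h => h)
    (fun x a ha σ h => ha.sub_eval (by simp [h, Sim.enc, Sim.pay]) hm.2)
    (PolyD.skip.mono fun _ => Nat.zero_le _) fun x F s T M Q => ?_
  rw [exec_assign, absSt_val _ _ _ _ hm.2, PMF.pure_map]
  rfl

theorem SimSpec.flip {m z : ℕ} (hm : (Cmd.flip z).bnd ≤ m) (hctx : SBdd W fun x => (X x).ctx)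
    (qh sh : Cmd) : SimSpec W X m (simulate qh sh (.flip z)) (.flip z) := by
  refine SimSpec.ask (i := 0) (j := 0) (arg := fun _ _ => .nil)
    (ν := fun _ _ => (PMF.uniformOfFintype Bool).map .ofBool)
    hm hctx (fun x a σ h => by simp [Data.truth]) (fun x a σ h => h) (fun x a ha σ h => rfl)
    (Poly.of_bdd (Bdd.const (4 + 10)) fun y => (spec_flip _ (.var 1) .ofBool _
      (fun b σ _ h => h) 4 fun b => by cases b <;> simp [Data.ofBool]).mono le_rfl (Nat.zero_le _))
    fun x F s T M Q => ?_
  rw [exec, PMF.map_comp]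
  rfl

theorem SimSpec.query {m z : ℕ} {e : Expr} (hm : (Cmd.query z e).bnd ≤ m)
    (hctx : SBdd W fun x => (X x).ctx) {qh : Cmd} (hq : Answers W X qh) (sh : Cmd) :
    SimSpec W X m (simulate qh sh (.query z e)) (.query z e) := by
  simp only [Cmd.bnd, max_le_iff] at hm
  refine SimSpec.ask (i := 1) (j := 0) (arg := fun x a => a.val e :+ (X x).ctx)
    (ν := fun x a => .pure (.ofBool ((X x).O'.f ((a.val e).toVec (X x).O'.m))))
    hm.1 hctx (fun x a σ h => by simp [h, Sim.enc, Data.truth_unary, Nat.one_le_iff_ne_zero,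
      Nat.pos_iff_ne_zero]) (fun x a σ h => by simp [h, Sim.enc, Sim.pay, tl_unary])
    (fun x a ha σ h => ?_) ?_ fun x F s T M Q => ?_
  · have := ha.sub_eval (σ := σ) (B := .nth 3) (by simp [h, Sim.enc, Sim.pay]) hm.2
    simp only [Expr.eval, this]
    simp [h, Sim.enc]
  · obtain ⟨P, hP⟩ := hq
    exact Poly.intro fun hs => Poly.of_bdd ((Bdd.add Bdd.self hs.fst).eval P) fun y =>
      (hP _ _).mono le_rfl (by simp)
  · rw [exec, absSt_val _ _ _ _ hm.2, PMF.pure_map]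
    rfl

theorem SimSpec.sample {m z : ℕ} (hm : (Cmd.sample z).bnd ≤ m)
    (hctx : SBdd W fun x => (X x).ctx) {sh : Cmd} (hsh : Draws W X sh) (qh : Cmd) :
    SimSpec W X m (simulate qh sh (.sample z)) (.sample z) := by
  refine SimSpec.ask (i := 0) (j := 1) (arg := fun x _ => (X x).ctx)
    (ν := fun x _ => (X x).O'.D.map fun v => .ofVec v)
    hm hctx (fun x a σ h => by simp [h, Sim.enc, Data.truth_unary, Nat.one_le_iff_ne_zero,
      Nat.pos_iff_ne_zero]) (fun x a σ h => by simp [h, Sim.enc, Sim.pay, tl_unary])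
    (fun x a ha σ h => by simp [h, Sim.enc])
    (Poly.mono (Poly.comp hsh hctx SimIx.x) fun y => by simp) fun x F s T M Q => ?_
  rw [exec, PMF.map_comp]
  rfl

/-- The test costs one time unit, exactly as `skip` does; this is why the branches appear with a
`skip` in front. -/
theorem SimSpec.cond {m : ℕ} {e : Expr} {c c' p p' : Cmd} (he : e.bnd ≤ m)
    (h : SimSpec W X m p (.skip ;; c)) (h' : SimSpec W X m p' (.skip ;; c')) :
    SimSpec W X m (.cond (.sub (.nth 3) e) p p') (.cond e c c') := by
  obtain ⟨P, hP⟩ := h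
  obtain ⟨P', hP'⟩ := h'
  refine ⟨P + P' + 1, fun x a ha => ?_⟩
  obtain ⟨μ, h1, h3⟩ := hP x a ha
  obtain ⟨μ', h1', h3'⟩ := hP' x a ha
  rw [Polynomial.eval_add, Polynomial.eval_add, Polynomial.eval_one]
  set K := P.eval (W x)
  set K' := P'.eval (W x)
  have hmono : ∀ {q : Cmd} {ν : PMF Sim} {L : ℕ}, L ≤ K + K' → SimStep W X m q x a L ν →
      PSpec (X x).O q (a.enc (X x).ctx) (ν.map (Sim.enc (X x).ctx)) ((K + K') * (1 + a.clk))
        (a.mq + (X x).κ * a.ex) (fun d => (K + K') * d.hd.len) (potQ (X x).κ) := by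
    intro q ν L hL h
    obtain ⟨r, hr⟩ := Nat.exists_eq_add_of_le hL
    refine h.1.mono (Nat.mul_le_mul_right _ hL) (forall_support_map.2 fun a' ha' => ?_)
      fun _ _ => le_rfl
    obtain ⟨u, hu⟩ := Nat.exists_eq_add_of_le (h.2 a' ha').2
    rw [len_hd_enc, hr, hu]
    nlinarith
  set b := (a.val e).truth with hb
  have hinv : ∀ a' ∈ (if b then μ else μ').support, SimInv W m x a' ∧ a'.clk ≤ a.clk := by
    split_ifs
    exacts [h1.2, h1'.2]
  refine ⟨if b then μ else μ', ⟨PSpec.mono (PSpec.cond b (pT := fun d => (K + K') * d.hd.len)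
    (T := (K + K') * (1 + a.clk)) (fun σ h => ?_) (fun hb => ?_) fun hb => ?_) (by nlinarith)
      (forall_support_map.2 fun a' ha' => ?_) fun _ _ => le_rfl, hinv⟩, ?_⟩
  · rw [ha.sub_eval (by simp [h, Sim.enc]) he]
  · rw [hb, if_pos rfl]
    exact hmono (by omega) h1
  · rw [hb, if_neg (by simp)]
    exact hmono (by omega) h1'
  · have := (hinv a' ha').2
    rw [len_hd_enc, add_mul (K + K'), add_mul (K + K')]
    omega
  · intro T M Q F s hs hok
    have hskip : ∀ c, exec (X x).O' F (.skip ;; c) s = exec (X x).O' F c s.tick := fun c => by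
      rw [exec_seq, exec_skip, PMF.pure_bind]; rfl
    rw [exec_cond, ← absSt_val T M Q s he, hs] at hok ⊢
    split_ifs at hok ⊢
    · exact hskip c ▸ h3 T M Q F s hs (hskip c ▸ hok)
    · exact hskip c' ▸ h3' T M Q F s hs (hskip c' ▸ hok)

end

section
variable {ι : Type} {W : ι → ℕ} {X : ι → SimCtx}

/-- The outcome of the test of a loop. -/
def Sim.test (e : Expr) (a : Sim) : Bool := decide (0 < a.tick.clk) && (a.val e).truth

theorem Sim.clk_pos_of_test {e : Expr} {a : Sim} (h : a.test e = true) : 0 < a.tick.clk := by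
  simp only [Sim.test, Bool.and_eq_true, decide_eq_true_eq] at h
  exact h.1

theorem absSt_test {T M Q m : ℕ} {s : St} {e : Expr} (he : e.bnd ≤ m) (hT : s.time + 1 ≤ T) :
    (absSt T M Q m s).test e = (e.eval s.store).truth := by
  rw [Sim.test, absSt_val T M Q s he]
  simp [absSt, Sim.tick]
  intro _
  omega

theorem pTest_poly {m : ℕ} {e : Expr} (he : e.bnd ≤ m) :
    PolyD (fun y : SimIx ι W m => W y.x) (fun y => (X y.x).O) (pTest e)
      (fun y => y.a.enc (X y.x).ctx)
      (fun y => .ofBool (y.a.test e) :+ y.a.tick.enc (X y.x).ctx) := by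
  refine PolyD.seq pTick_poly ?_
  refine Poly.cond (fun y => decide (0 < y.a.tick.clk)) (fun y σ h => by
    simp [h, Sim.enc, Data.truth_unary]) (Poly.cond (fun y => (y.1.a.val e).truth) (fun y σ h => by
        rw [y.1.inv.sub_eval (by simp [h, Sim.enc, Sim.tick]) he])
      (PolyD.assign fun y σ h => ?_)
      (PolyD.assign fun y σ h => ?_))
    (PolyD.assign fun y σ h => ?_)
  · simp [h, Sim.test, y.1.2, y.2, Data.ofBool]
  · simp [h, Sim.test, y.2, Data.ofBool]
  · have h1 := y.2
    simp only [decide_eq_false_iff_not] at h1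
    simp [h, Sim.test, h1, Data.ofBool]

theorem cons_enc_injective (d ctx : Data) :
    Function.Injective fun a : Sim => Data.cons d (a.enc ctx) :=
  fun a a' h => Sim.enc_injective ctx (by simpa using h)

/-- The balance of one iteration: `n` is the clock before the body, `c` the clock after it, and the
next test takes one more unit. The allowance `G (1 + n)`, where `G` is the factor `2 K + K1 + K2 +
2`, pays for the body, the test and all later iterations, because each iteration lowers the clock.
The case `c = 0`, where the subtraction is truncated, needs `0 < n`. -/
theorem loop_time_le {K K1 K2 n c : ℕ} (h : c ≤ n) (h0 : 0 < n) :
    K * (1 + n) + K1 + (2 * K + K1 + K2 + 2) * (1 + (c - 1)) + K2 + 1 ≤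
      (2 * K + K1 + K2 + 2) * (1 + n) + K * c := by
  obtain ⟨t, rfl⟩ := Nat.exists_eq_add_of_le h
  rcases c with _ | u
  · obtain ⟨s, rfl⟩ : ∃ s, t = s + 1 := ⟨t - 1, by omega⟩
    simp only [Nat.zero_sub, Nat.zero_add]
    nlinarith [Nat.zero_le (K * s), Nat.zero_le (K1 * s), Nat.zero_le (K2 * s)]
  · simp only [Nat.add_sub_cancel]
    nlinarith [Nat.zero_le (K * t), Nat.zero_le (K1 * t), Nat.zero_le (K2 * t)]

/-- The states between the iterations of a loop. -/
def encTest (ctx : Data) (p : Bool × Sim) : Data := .ofBool p.1 :+ p.2.enc ctx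

theorem encTest_injective (ctx : Data) : Function.Injective (encTest ctx) := by
  rintro ⟨b, a⟩ ⟨b', a'⟩ h
  simp only [encTest, Data.cons.injEq] at h
  rw [Data.ofBool_injective h.1, Sim.enc_injective _ h.2]

/-- Strong induction on the clock: every test costs a unit, and the loop goes on only if time is
left. So the interpreter terminates even if the simulated loop does not. -/
theorem SimSpec.loop {m : ℕ} {e : Expr} {c : Cmd} (he : e.bnd ≤ m)
    (hctx : SBdd W fun x => (X x).ctx) {qh sh : Cmd} (h : SimSpec W X m (simulate qh sh c) c) :
    SimSpec W X m (simulate qh sh (.loop e c)) (.loop e c) := by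
  obtain ⟨P, hP⟩ := h
  have hs := SimIx.sbdd (m := m) hctx
  obtain ⟨P1, hP1⟩ := pTest_poly (X := X) he hs
  have htl : ∀ d, PolyD (fun y : SimIx ι W m => W y.x) (fun y => (X y.x).O)
    (.assign 0 (.tl (.var 0)))
    (fun y => d :+ y.a.enc (X y.x).ctx) (fun y => y.a.enc (X y.x).ctx) := fun d =>
      PolyD.assign fun y σ h => by simp [h]
  obtain ⟨P2, hP2⟩ := htl (.ofBool true) ((SBdd.const _).cons hs)
  obtain ⟨P3, hP3⟩ := htl .nil ((SBdd.const _).cons hs)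
  set body : Cmd := .assign 0 (.tl (.var 0)) ;; simulate qh sh c ;; pTest e with hbody
  -- The claim is about the state just after a test with outcome `b`, whose unit has already been
  -- deducted. On the simulated side this matches the time after `s.tick`.
  have main : ∀ x a, SimInv W m x a → ∀ b : Bool, (b = true → 0 < a.clk) → ∃ μ : PMF Sim,
      (∀ F fuel s, (2 * P.eval (W x) + P1.eval (W x) + P2.eval (W x) + 2) * (1 + a.clk) ≤ F →
        1 + a.clk ≤ fuel → s.store 0 = .ofBool b :+ a.enc (X x).ctx →
        (∀ z, 0 < z → z < body.bnd → s.store z = .nil) →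
        Meets (iter (.hd (.var 0)) (exec (X x).O F body) fuel s) s
          (μ.map fun a' => .nil :+ a'.enc (X x).ctx)
          ((2 * P.eval (W x) + P1.eval (W x) + P2.eval (W x) + 2) * (1 + a.clk))
          (a.mq + (X x).κ * a.ex)
          (fun d => (2 * P.eval (W x) + P1.eval (W x) + P2.eval (W x) + 2) * d.tl.hd.len)
          (fun d => potQ (X x).κ d.tl)) ∧
      (∀ a' ∈ μ.support, SimInv W m x a' ∧ a'.clk ≤ a.clk) ∧
      ∀ T M Q F fuel s, absSt T M Q m s.tick = a → (e.eval s.store).truth = b →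
        AllOK T M Q (iter e (exec (X x).O' F c) fuel s) →
        (iter e (exec (X x).O' F c) fuel s).map (Option.map (absSt T M Q m)) = μ.map some := by
    intro x a
    set K := P.eval (W x) with hK
    set K1 := P1.eval (W x)
    set K2 := P2.eval (W x)
    set G := 2 * K + K1 + K2 + 2 with hG
    induction hN : a.clk using Nat.strong_induction_on generalizing a with
    | _ N ih =>
    subst hN
    rintro ha (_ | _) hb
    · refine ⟨PMF.pure a, fun F fuel s _ hfuel hs0 _ => ?_, fun a' ha' => ?_,
        fun T M Q F fuel s hs ht hok => ?_⟩
      · obtain ⟨fuel, rfl⟩ : ∃ f, fuel = f + 1 := ⟨fuel - 1, by omega⟩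
        rw [iter_succ, if_neg (by simp [hs0, Data.ofBool])]
        constructor
        · rw [PMF.pure_map, PMF.pure_map, PMF.pure_map]
          simp [outD, St.tick, hs0, Data.ofBool]
        · intro o ho
          simp at ho
          refine ⟨_, ho, by simp [St.tick], ?_, ?_⟩
          · simp [St.tick, hs0]
            nlinarith
          · simp [St.tick, hs0]
      · simp at ha'
        subst ha'
        exact ⟨ha, le_rfl⟩
      · cases fuel with
        | zero =>
          obtain ⟨s', h, -⟩ := hok none (by simp [iter])
          cases h
        | succ fuel =>
          rw [iter_succ, ht, if_neg (by simp), PMF.pure_map, PMF.pure_map, Option.map_some, hs]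
    · have hclk := hb rfl
      obtain ⟨μ1, ⟨h1, h2⟩, h3⟩ := hP x a ha
      have hlt : ∀ a' ∈ μ1.support, a'.tick.clk < a.clk := fun a' ha' => by
        have := (h2 a' ha').2
        simp only [Sim.tick]; omega
      have : Nonempty (PMF Sim) := ⟨PMF.pure a⟩
      choose! ν hν1 hν2 hν3 using fun (p : Bool × Sim)
        (hp : p.2.clk < a.clk ∧ SimInv W m x p.2 ∧ (p.1 = true → 0 < p.2.clk)) =>
        ih _ hp.1 p.2 rfl hp.2.1 p.1 hp.2.2
      have hτ := fun a' ha' => show _ ∧ _ ∧ ((a'.test e, a'.tick).1 = true → _) from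
        ⟨hlt a' ha', (h2 a' ha').1.tick, Sim.clk_pos_of_test⟩
      rw [← hK] at h1
      have hG1 : K * (1 + a.clk) + K2 + 1 ≤ G * (1 + a.clk) := by
        rw [hG]; nlinarith [Nat.zero_le (K1 * (1 + a.clk)), Nat.zero_le (K2 * a.clk)]
      have hbodyS : PSpec (X x).O body (.ofBool true :+ a.enc (X x).ctx)
          ((μ1.map fun a' => (a'.test e, a'.tick)).map (encTest (X x).ctx))
          (K2 + (G * (1 + a.clk) - 1 - K2)) (0 + (a.mq + (X x).κ * a.ex))
          (fun d => G * (1 + d.tl.hd.len)) (fun d => potQ (X x).κ d.tl) := by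
        refine Spec.seqP (hP2 ⟨x, a, ha⟩) ?_
        rw [PMF.map_comp, ← PMF.bind_pure_comp]
        refine PSpec.seqM (Sim.enc_injective (X x).ctx)
          (h1.mono (T' := G * (1 + a.clk) - 1 - K2) (Q' := a.mq + (X x).κ * a.ex)
            (pT' := fun d => K1 + G * (1 + (d.hd.len - 1))) (pQ' := potQ (X x).κ)
            (by omega) (forall_support_map.2 fun a' ha' => ?_) fun _ _ => le_rfl) fun a' ha' => ?_
        · rw [len_hd_enc]
          have : K * (1 + a.clk) + K1 + G * (1 + (a'.clk - 1)) + K2 + 1 ≤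
            G * (1 + a.clk) + K * a'.clk := loop_time_le (h2 a' ha').2 hclk
          omega
        · exact Spec.potentialD (hP1 ⟨x, a', (h2 a' ha').1⟩) (by simp [encTest, Sim.tick, K1])
            (by simp [encTest, Sim.tick])
      refine ⟨μ1.bind fun a' => ν (a'.test e, a'.tick), ?_, ?_, ?_⟩
      · intro F fuel s hF hfuel hs0 hs
        obtain ⟨fuel, rfl⟩ : ∃ f, fuel = f + 1 := ⟨fuel - 1, by omega⟩
        rw [iter_succ, if_pos (by simp [hs0, Data.ofBool])]
        have h7 := hbodyS F s.tick (by omega) (by simpa [St.tick] using hs0)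
          (by simpa [St.tick] using hs)
        have h8 := Meets.bindM (g := iter (.hd (.var 0)) (exec (X x).O F body) fuel)
          (ν := fun p => (ν p).map fun a' => .nil :+ a'.enc (X x).ctx)
          (pT' := fun d => G * d.tl.hd.len) (pQ' := fun d => potQ (X x).κ d.tl)
          (encTest_injective _) h7 (forall_support_map.2 fun a' ha' s1 hs1 hs10 => ?_)
        · rw [PMF.bind_map] at h8
          rw [PMF.map_bind]
          refine h8.mono_start (fun d => by simp [St.tick]) ?_ ?_
          · have : 1 ≤ G * (1 + a.clk) := by nlinarith
            simp only [St.tick]; omega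
          · simp only [St.tick]; omega
        · have hlt := hlt a' ha'
          refine (hν1 _ (hτ a' ha') F fuel s1 ((Nat.mul_le_mul_left _ (by simp only; omega)).trans
            hF)
            (by simp only; omega) hs10 fun z hz hz' => ?_).mono (fun d _ => by simp [encTest])
            fun d _ => by simp [encTest]
          obtain ⟨s', h, h', -⟩ := h7.2 _ hs1
          cases h
          rw [h', Function.update_of_ne (by omega)]
          exact hs z hz hz'
      · intro a'' ha''
        rw [PMF.mem_support_bind_iff] at ha''
        obtain ⟨a', ha', ha''⟩ := ha''
        have h5 := hν2 _ (hτ a' ha') a'' ha''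
        exact ⟨h5.1, h5.2.trans (hlt a' ha').le⟩
      · intro T M Q F fuel s hs ht hok
        cases fuel with
        | zero =>
          obtain ⟨s', h, -⟩ := hok none (by simp [iter])
          cases h
        | succ fuel =>
          rw [iter_succ, ht, if_pos rfl] at hok ⊢
          have h6 := h3 T M Q F s.tick hs
            (hok.left fun s s' h => by have := iter_mono fuel h; omega)
          refine map_bind_andThen h6 fun s1 hs1 => ?_
          exact hν3 _ (hτ _ (mem_support_of_map h6 hs1)) T M Q F fuel s1 (absSt_tick _ _ _ _ _)
            (absSt_test he (hok.right hs1).time_lt).symm (hok.right hs1)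
  refine ⟨2 * P + P1 + P2 + 2 + P1 + P3 + 1, fun x a ha => ?_⟩
  have htick : a.tick.clk ≤ a.clk := by simp [Sim.tick]
  obtain ⟨μ, h1, h2, h3⟩ := main x a.tick ha.tick (a.test e) Sim.clk_pos_of_test
  have hE : (2 * P + P1 + P2 + 2 + P1 + P3 + 1).eval (W x) = 2 * P.eval (W x) + P1.eval (W x) +
      P2.eval (W x) + 2 + P1.eval (W x) + P3.eval (W x) + 1 := by simp
  rw [hE]
  set G := 2 * P.eval (W x) + P1.eval (W x) + P2.eval (W x) + 2 with hG
  set K1 := P1.eval (W x)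
  set K3 := P3.eval (W x)
  have hmul : ∀ c1 c2, c2 ≤ c1 → c1 ≤ a.clk →
      G * (1 + c1) + K3 + (G + K1 + K3 + 1) * c2 + K1 ≤ (G + K1 + K3 + 1) * (1 + a.clk) + G *
        c2 := by
    intro c1 c2 h h'
    nlinarith [Nat.mul_le_mul_left G h', Nat.mul_le_mul_left K1 (h.trans h'),
      Nat.mul_le_mul_left K3 (h.trans h')]
  have h6 := hmul a.tick.clk 0 (Nat.zero_le _) htick
  simp only [Nat.mul_zero, Nat.add_zero] at h6
  have h7 : 1 + a.tick.clk ≤ G * (1 + a.tick.clk) := Nat.le_mul_of_pos_left _ (by omega)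
  refine ⟨μ, ⟨?_, fun a' ha' => ⟨(h2 a' ha').1, (h2 a' ha').2.trans htick⟩⟩, ?_⟩
  · refine PSpec.mono (T := K1 + ((G + K1 + K3 + 1) * (1 + a.clk) - K1))
      (Q := 0 + (a.mq + (X x).κ * a.ex))
      (pT := fun d => (G + K1 + K3 + 1) * d.hd.len) (pQ := potQ (X x).κ) (Spec.seqP (hP1 ⟨x, a, ha⟩)
        (PSpec.seqM (cons_enc_injective .nil (X x).ctx) (ν := fun a' => PMF.pure (a'.enc (X x).ctx))
          (pT := fun d => K3 + (G + K1 + K3 + 1) * d.tl.hd.len) (pQ := fun d => potQ (X x).κ d.tl)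
          (fun F s hF hs0 hs => ?_) fun a' ha' =>
            Spec.potentialD (hP3 ⟨x, a', (h2 a' ha').1⟩) (by simp [K3]) (by simp)))
      (by omega) (fun _ _ => by omega) fun _ _ => by simp
    rw [exec_loop]
    refine (h1 F F s (by omega) (by omega) hs0 fun z hz hz' => hs z hz (lt_of_lt_of_le hz'
      (le_max_right _ _))).mono (forall_support_map.2 fun a' ha' => ?_) fun _ _ => le_rfl
    have := hmul a.tick.clk a'.clk (h2 a' ha').2 htick
    simp only [Data.tl_cons, len_hd_enc]
    omega
  · intro T M Q F s hs hok
    rw [exec_loop] at hok ⊢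
    exact h3 T M Q F F s (by rw [absSt_tick, hs]) (by rw [← hs, absSt_test he hok.time_lt]) hok

theorem SimSpec.simulate {m : ℕ} (hctx : SBdd W fun x => (X x).ctx) {qh sh : Cmd}
    (hq : Answers W X qh) (hsh : Draws W X sh) :
    ∀ c : Cmd, c.bnd ≤ m → SimSpec W X m (simulate qh sh c) c
  | .skip, _ => SimSpec.skip hctx
  | .assign _ _, h => SimSpec.assign h hctx qh sh
  | .seq c c', h => by
    simp only [Cmd.bnd, max_le_iff] at h
    exact (SimSpec.simulate hctx hq hsh c h.1).seq (SimSpec.simulate hctx hq hsh c' h.2)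
  | .cond e c c', h => by
    simp only [Cmd.bnd, max_le_iff] at h
    exact SimSpec.cond h.1 ((SimSpec.skip hctx).seq (SimSpec.simulate hctx hq hsh c h.2.1))
      ((SimSpec.skip hctx).seq (SimSpec.simulate hctx hq hsh c' h.2.2))
  | .loop e c, h => by
    simp only [Cmd.bnd, max_le_iff] at h
    exact SimSpec.loop h.1 hctx (SimSpec.simulate hctx hq hsh c h.2)
  | .flip _, h => SimSpec.flip h hctx qh sh
  | .query _ _, h => SimSpec.query h hctx hq sh
  | .sample _, h => SimSpec.sample h hctx hsh qh

end

section
variable {ι : Type} {W : ι → ℕ} {X : ι → SimCtx}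

theorem Bdd.of_le_comp {W W' g : ι → ℕ} (h : Bdd W g) (hW : ∀ x, W x ≤ W' x) : Bdd W' g := by
  obtain ⟨P, hP⟩ := h
  exact ⟨P, fun x => (hP x).trans (eval_mono P (hW x))⟩

theorem Poly.of_le_comp {O : ι → Oracle} {c : Cmd} {inp : ι → Data} {μ : ι → PMF Data}
    {Q W' : ι → ℕ} (h : Poly W O c inp μ Q) (hs : SBdd W inp) (hW : ∀ x, W x ≤ W' x) :
    Poly W' O c inp μ Q := fun _ => by
  obtain ⟨P, hP⟩ := h hs
  exact ⟨P, fun x => (hP x).mono (eval_mono P (hW x)) le_rfl⟩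

/-- A run within the bounds `T`, `M` and `Q` has an output distributed as `μ`. -/
def RunsAs (A : Cmd) (O : Oracle) (inp : Data) (T M Q : ℕ) (μ : PMF Data) : Prop :=
  ∀ F, AllOK T M Q (run A O inp F) → (run A O inp F).map outD = μ.map some

/-- A list expression of `m` entries `nil`. -/
def Expr.nils : ℕ → Expr
  | 0 => .nil
  | m + 1 => .nil :* Expr.nils m

theorem Expr.eval_nils (σ : ℕ → Data) : ∀ m, (Expr.nils m).eval σ =
    .ofList (List.replicate m .nil)
  | 0 => rfl
  | m + 1 => by rw [Expr.nils, List.replicate_succ, Expr.eval, eval_nils σ m]; rfl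

/-- Run the program `A` on an input with bounds for its time and its queries; the input is
`(time + 1, membership queries, example queries, input, context)`. -/
def pRun (A qh sh : Cmd) : Cmd :=
  .assign 0 (.nth 0 :* .nth 1 :* .nth 2 :*
    (.nth 3 :* Expr.nils A.bnd) :* .rest 4) ;;
  simulate qh sh A ;; .assign 0 (.hd (.nth 3))

/-- The cost bounds hold whatever `A` does. Only the identification of `out` with the output of `A`
is conditional on `A` keeping to its bounds. -/
theorem pRun_poly {A qh sh : Cmd} {T M Q : ι → ℕ} {inp : ι → Data}
    (hs : SBdd W fun x => .unary (T x + 1) :+ .unary (M x) :+ .unary (Q x) :+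
      inp x :+ (X x).ctx)
    (hq : Answers W X qh) (hsh : Draws W X sh) :
    ∃ out : ι → PMF Data,
      Poly W (fun x => (X x).O) (pRun A qh sh) (fun x => .unary (T x + 1) :+
        .unary (M x) :+ .unary (Q x) :+ inp x :+ (X x).ctx) out
        (fun x => M x + (X x).κ * Q x) ∧
      ∀ x, RunsAs A (X x).O' (inp x) (T x) (M x) (Q x) (out x) := by
  obtain ⟨Pin, hPin⟩ := hs
  set W2 : ι → ℕ := fun x => W x + 4 * Pin.eval (W x) + 4 * A.bnd + 4 with hW2
  have hle : ∀ x, W x ≤ W2 x := fun x => by simp only [hW2]; omega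
  have hctx : SBdd W fun x => (X x).ctx :=
    ⟨Pin, fun x => le_trans (by simp; omega) (hPin x)⟩
  have hctx2 : SBdd W2 fun x => (X x).ctx := Bdd.of_le_comp hctx hle
  have hq2 : Answers W2 X qh := by
    obtain ⟨P, hP⟩ := hq
    exact ⟨P, fun x y => (hP x y).mono (eval_mono P (Nat.add_le_add_right (hle x) _)) le_rfl⟩
  -- One variable more than `A.bnd`, so that the input and output variable `0` exists even if `A`
  -- mentions no variable.
  obtain ⟨P, hP⟩ := SimSpec.simulate (m := A.bnd + 1) hctx2 hq2 (Poly.of_le_comp hsh hctx hle) A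
    (Nat.le_succ _)
  set a0 : ι → Sim := fun x => ⟨T x + 1, M x, Q x, inp x :: List.replicate A.bnd .nil⟩ with ha0
  have hsz : ∀ m, (Data.ofList (List.replicate m .nil)).size = 2 * m + 1 := by
    intro m
    induction m with
    | zero => rfl
    | succ m ih => rw [List.replicate_succ]; simp [ih]; ring
  have hinv : ∀ x, SimInv W2 (A.bnd + 1) x (a0 x) := by
    intro x
    have := hPin x
    simp only [Data.size, Data.size_unary] at this
    refine ⟨by simp [ha0], ?_, ?_, ?_⟩
    · simp only [ha0, hW2, Data.ofList, Data.size, hsz]; omega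
    · simp only [ha0, hW2]; omega
    · simp only [ha0, hW2]; omega
  choose μ hμ hμ3 using fun x => hP x (a0 x) (hinv x)
  have hrun : ∀ x, Spec (X x).O (simulate qh sh A) ((a0 x).enc (X x).ctx)
      ((μ x).map (Sim.enc (X x).ctx)) (P.eval (W2 x) * (1 + (a0 x).clk))
      (M x + (X x).κ * Q x) :=
    fun x => (hμ x).1.mono le_rfl (fun _ _ => by simp) (fun _ _ => by simp [ha0])
  have hW2b : Bdd W W2 := ((Bdd.self.add ((Bdd.const 4).mul ⟨Pin, fun _ => le_rfl⟩)).add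
    (Bdd.const _)).add (Bdd.const _)
  have hclk : Bdd W fun x => (a0 x).clk := ⟨Pin, fun x => le_trans (by
    simp only [ha0, Data.size, Data.size_unary]; omega) (hPin x)⟩
  refine ⟨fun x => (μ x).map fun a => (a.st.head?).getD .nil, ?_, ?_⟩
  · refine Poly.seqD (mid := fun x => (a0 x).enc (X x).ctx)
      (PolyD.assign fun x σ h => ?_) ?_
    · simp only [Expr.eval, Expr.eval_nils]
      simp [h, Sim.enc, ha0]
    · refine Poly.mono (Q := fun x => M x + (X x).κ * Q x + 0) (Poly.congr
        (Poly.seqM (α := fun _ => Sim) (μ := μ) (enc := fun x => Sim.enc (X x).ctx)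
          (ν := fun x a => PMF.pure ((a.st.head?).getD .nil))
          (fun x => Sim.enc_injective _)
          (Poly.of_bdd ((hW2b.eval P).mul ((Bdd.const 1).add hclk)) hrun) ?_)
        fun x => ?_) fun x => le_rfl
      · refine PolyD.assign ?_
        rintro ⟨x, a, ha⟩ σ h
        have h1 := ((hμ x).2 a ha).1.1
        obtain ⟨d, l, hl⟩ : ∃ d l, a.st = d :: l := by
          cases h2 : a.st with
          | nil => simp [h2] at h1
          | cons d l => exact ⟨d, l, rfl⟩
        simp [h, Sim.enc, hl]
      · rw [← PMF.bind_pure_comp]; rfl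
  · intro x F hok
    have h1 := hμ3 x (T x) (M x) (Q x) F
      ⟨Function.update (fun _ => Data.nil) 0 (inp x), 0, 0, 0⟩ (by
        simp only [ha0, absSt, List.range_succ_eq_map, List.map_cons, List.map_map]
        congr 1
        simp only [Function.update_self, List.cons.injEq, true_and]
        refine List.ext_getElem (by simp) fun i h1 h2 => by simp) hok
    have h2 := congrArg (PMF.map (Option.map fun a : Sim => (a.st.head?).getD .nil)) h1
    rw [PMF.map_comp, PMF.map_comp] at h2
    rw [PMF.map_comp, run]
    convert h2 using 2
    · funext o
      cases o with
      | none => rfl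
      | some s => simp [outD, absSt, List.range_succ_eq_map]
    · rfl

end

/-! ### Composition of programs with queries; querying assembled points -/

section
variable {ι : Type} {W : ι → ℕ} {O : ι → Oracle} {inp : ι → Data}

theorem PolyQ.out_bdd {c : Cmd} {out : ι → Data} {Q : ι → ℕ}
    (h : Poly W O c inp (fun x => PMF.pure (out x)) Q) (hs : SBdd W inp) : SBdd W out := by
  obtain ⟨P, hP⟩ := Poly.out_bdd (α := fun _ => Unit) (μ := fun _ => PMF.pure ())
    (enc := fun x _ => out x) (Poly.congr h fun x => by rw [PMF.pure_map]) hs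
  exact ⟨P, fun x => hP x () (by simp)⟩

theorem Poly.seqQ {c c' : Cmd} {mid : ι → Data} {ν : ι → PMF Data} {Q Q' : ι → ℕ}
    (h : Poly W O c inp (fun x => PMF.pure (mid x)) Q)
    (h' : Poly W O c' mid ν Q') :
    Poly W O (c ;; c') inp ν (fun x => Q x + Q' x) := fun hs => by
  obtain ⟨P', hP'⟩ := h' (PolyQ.out_bdd h hs)
  obtain ⟨P, hP⟩ := h hs
  exact ⟨P + P', fun x => by
    rw [Polynomial.eval_add]; exact (hP x).seqD (hP' x)⟩

theorem Poly.pushQ {c c' : Cmd} {e : Expr} {a a' : ι → Data} {ν : ι → PMF Data} {Q Q' : ι → ℕ}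
    (he : ∀ x, ∀ σ : ℕ → Data, σ 0 = inp x → e.eval σ = a x)
    (h : Poly W O c a (fun x => PMF.pure (a' x)) Q)
    (h' : Poly W O c' (fun x => a' x :+ inp x) ν Q') :
    Poly W O (.push e c ;; c') inp ν (fun x => Q x + Q' x) :=
  Poly.seqQ (Poly.congr (Poly.push he h) fun _ => by rw [PMF.pure_map]) h'

theorem Poly.pushM {α : ι → Type} {c c' : Cmd} {e : Expr} {a : ι → Data} {μ : ∀ x, PMF (α x)}
    {encA : ∀ x, α x → Data} {ν : ∀ x, α x → PMF Data} {Q Q' : ι → ℕ}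
    (hinj : ∀ x, Function.Injective (encA x))
    (he : ∀ x, ∀ σ : ℕ → Data, σ 0 = inp x → e.eval σ = a x)
    (h : Poly W O c a (fun x => (μ x).map (encA x)) Q)
    (h' : Poly (fun y : Σ x, {a // a ∈ (μ x).support} => W y.1) (fun y => O y.1) c'
        (fun y => encA y.1 y.2.1 :+ inp y.1) (fun y => ν y.1 y.2.1) (fun y => Q' y.1)) :
    Poly W O (.push e c ;; c') inp (fun x => (μ x).bind (ν x)) (fun x => Q x + Q' x) :=
  Poly.seqM (enc := fun x b => encA x b :+ inp x) (fun x b b' h => by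
    simp only [Data.cons.injEq, and_true] at h
    exact hinj x h) (Poly.congr (Poly.push he h) fun x => by rw [PMF.map_comp]; rfl) h'

/-- Apply `φ` coordinatewise and query the resulting point. -/
def pQZip (φ : List Bool → Bool) : Cmd := pZip φ ;; pQuery (.var 0) ;; .assign 0 (.hd (.var 0))

variable {n : ι → ℕ} {f : ∀ x, Pt (n x) → Bool} {D : ∀ x, PMF (Pt (n x))}

theorem pQZip_poly (φ : List Bool → Bool) {A : ∀ x, Pt (n x)} {B C : ι → Data} :
    Poly W (fun x => ⟨n x, f x, D x⟩) (pQZip φ)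
      (fun x => .ofVec (A x) :+ B x :+ C x)
      (fun x => PMF.pure (.ofBool (f x fun i =>
        φ [A x i, Data.toVec (n x) (B x) i, Data.toVec (n x) (C x) i]))) (fun _ => 1) := by
  refine Poly.seqD (pZip_poly φ) ?_
  refine Poly.mono (Q := fun _ => 1 + 0) (Poly.seqQ
    (pQuery_poly (y := fun x => .ofVec fun i =>
      φ [A x i, Data.toVec (n x) (B x) i, Data.toVec (n x) (C x) i])
      fun x σ h => by simp [h]) <| PolyD.assign fun x σ h => ?_) fun _ => le_rfl
  simp only [Expr.eval, h, Data.hd_cons]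
  rw [Data.toVec_ofVec]

/-- `x` on `Z` and `w` elsewhere. -/
def mux {n : ℕ} (Z x w : Pt n) : Pt n := fun i => bif Z i then x i else w i

def bMux : List Bool → Bool
  | [z, x, w] => bif z then x else w
  | _ => false

/-- Query the point that is `φ(x, y, z)` on `Z` and `w` elsewhere; the input is
`((x, y, z), (Z, w))`. -/
def pPoint (φ : List Bool → Bool) : Cmd :=
  .onFst (pZip φ) ;; .assign 0 (.nth 1 :* .nth 0 :* .rest 2) ;; pQZip bMux

theorem pPoint_poly (φ : List Bool → Bool) {x Z w : ∀ i, Pt (n i)} {y z : ι → Data} :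
    Poly W (fun x => ⟨n x, f x, D x⟩) (pPoint φ)
      (fun i => (.ofVec (x i) :+ y i :+ z i) :+
        .ofVec (Z i) :+ .ofVec (w i))
      (fun i => PMF.pure (.ofBool (f i (mux (Z i) (fun j =>
        φ [x i j, Data.toVec (n i) (y i) j, Data.toVec (n i) (z i) j]) (w i))))) (fun _ => 1) := by
  refine Poly.seqD (PolyD.onFst (pZip_poly φ)) ?_
  refine Poly.seqD (mid := fun i => .ofVec (Z i) :+ (.ofVec fun j =>
    φ [x i j, Data.toVec (n i) (y i) j, Data.toVec (n i) (z i) j]) :+ .ofVec (w i))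
    (PolyD.assign fun i σ h => by simp [h]) ?_
  refine Poly.congr (pQZip_poly bMux) fun i => ?_
  simp only [Data.toVec_ofVec]
  rfl

theorem ofUnary (n : ℕ) : Data.unary n = .ofVec fun _ : Fin n => true := by
  rw [Data.ofVec, Data.unary, List.ofFn_const]

theorem pRndU_poly :
    Poly W O pRnd (fun x => Data.unary (n x)) (fun x => (unif (n x)).map .ofVec) (fun _ => 0) := by
  have key : ∀ m m' : ℕ, m = m' → (unif m).map Data.ofVec = (unif m').map fun v => Data.ofVec
    v := by
    rintro m _ rfl
    rfl
  refine Poly.congr ?_ fun x =>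
    (key _ _ (List.length_replicate (n := n x) (a := Data.cons .nil .nil)).symm).symm
  simpa only [Data.unary_eq] using
    pRnd_poly (W := W) (O := O) (l := fun x => List.replicate (n x) (.nil :+ .nil))

/-- Three random vectors. -/
def pRnd3 : Cmd :=
  .push (.var 0) pRnd ;; .push (.rest 1) pRnd ;; .push (.rest 2) pRnd ;;
    .assign 0 (.nth 2 :* .nth 1 :* .nth 0)

def rnd3 (n : ℕ) : PMF (Pt n × Pt n × Pt n) :=
  (unif n).bind fun x => (unif n).bind fun y => (unif n).bind fun z => PMF.pure (x, y, z)

def enc3 {n : ℕ} (t : Pt n × Pt n × Pt n) : Data :=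
  .ofVec t.1 :+ .ofVec t.2.1 :+ .ofVec t.2.2

theorem enc3_injective (n : ℕ) : Function.Injective (enc3 (n := n)) := by
  rintro ⟨a, b, c⟩ ⟨a', b', c'⟩ h
  simp only [enc3, Data.cons.injEq] at h
  rw [Data.ofVec_injective _ h.1, Data.ofVec_injective _ h.2.1, Data.ofVec_injective _ h.2.2]

theorem pRnd3_poly :
    Poly W O pRnd3 (fun x => Data.unary (n x)) (fun x => (rnd3 (n x)).map enc3) (fun _ => 0) := by
  refine Poly.mono (Q := fun _ => 0 + (0 + (0 + 0)))
    (Poly.congr (Poly.pushM (Q' := fun _ => 0 + (0 + 0))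
    (α := fun x => Pt (n x)) (ν := fun x v => (unif (n x)).bind fun y => (unif (n x)).bind
      fun z => PMF.pure (enc3 (v, y, z))) (fun x => Data.ofVec_injective _)
    (fun x σ h => h) pRndU_poly ?_) fun x => ?_) fun _ => le_rfl
  · refine Poly.pushM (ι := Σ x, {v // v ∈ (unif (n x)).support}) (Q' := fun _ => 0 + 0)
      (a := fun x => .unary (n x.1)) (α := fun x => Pt (n x.1))
      (ν := fun x v => (unif (n x.1)).bind
      fun z => PMF.pure (enc3 (x.2.1, v, z))) (fun x => Data.ofVec_injective _)
      ?_ pRndU_poly ?_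
    · exact fun x σ h => by simp [h]
    refine Poly.pushM (ι := Σ y : (Σ x, {v // v ∈ (unif (n x)).support}),
      {v // v ∈ (unif (n y.1)).support})
      (Q' := fun _ => 0) (a := fun x => .unary (n x.1.1)) (α := fun x => Pt (n x.1.1))
      (ν := fun x v => PMF.pure (enc3 (x.1.2.1, x.2.1, v))) (fun x => Data.ofVec_injective _)
      ?_ pRndU_poly ?_
    · exact fun x σ h => by simp [h]
    exact PolyD.assign fun x σ h => by simp [h, enc3]
  · rw [rnd3, PMF.map_bind]
    congr 1; funext a
    rw [PMF.map_bind]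
    congr 1; funext b
    rw [PMF.map_bind]
    congr 1; funext c
    rw [PMF.pure_map]

end

/-! ### Blocks and the program of the dictator test -/

/-- A set `Z` of coordinates and two points. -/
@[ext] structure Blk (n : ℕ) where
  Z : Pt n
  a : Pt n
  b : Pt n

def Blk.enc {n : ℕ} (B : Blk n) : Data := .ofVec B.Z :+ .ofVec B.a :+ .ofVec B.b

theorem Blk.enc_injective (n : ℕ) : Function.Injective (Blk.enc (n := n)) := by
  intro B B' h
  simp only [enc, Data.cons.injEq] at h
  exact Blk.ext (Data.ofVec_injective _ h.1) (Data.ofVec_injective _ h.2.1)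
    (Data.ofVec_injective _ h.2.2)

/-- The function `x ↦ f(x on Z, a elsewhere)`. -/
def Blk.res {n : ℕ} (B : Blk n) (f : Pt n → Bool) (x : Pt n) : Bool :=
  f (mux B.Z x B.a)

def dictBits : List (List Bool → Bool) :=
  [fun l => l.getD 0 false, fun l => l.getD 0 false ^^ l.getD 1 false,
    fun l => l.getD 0 false ^^ l.getD 2 false,
    fun l => l.getD 0 false ^^ (l.getD 1 false ^^ l.getD 2 false),
    fun l => l.getD 0 false ^^ (l.getD 1 false && l.getD 2 false),
    fun l => l.getD 0 false ^^ true]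

/-- The verdict of one round of the dictator test: the values are those at `x`, `x + y`, `x + z`,
`x + y + z`, `x + y z` and `x + 1`. -/
def dictOK : List Bool → Bool
  | [p0, p1, p2, p3, p4, p5] => ((p3 ^^ p0) == ((p1 ^^ p0) ^^ (p2 ^^ p0))) &&
      ((p4 ^^ p0) == ((p1 ^^ p0) && (p2 ^^ p0))) && (p5 ^^ p0)
  | _ => false

def dictRound {n : ℕ} (g : Pt n → Bool)
    (t : Pt n × Pt n × Pt n) : Bool :=
  dictOK (dictBits.map fun φ => g fun j => φ [t.1 j, t.2.1 j, t.2.2 j])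

section
variable {ι : Type} {W : ι → ℕ}
variable {n : ι → ℕ} {f : ∀ x, Pt (n x) → Bool} {D : ∀ x, PMF (Pt (n x))}

/-- The answers of `f` at the points given by a list of functions; the input is
`((x, y, z), (B, _))`. -/
def pPoints : List (List Bool → Bool) → Cmd
  | [] => .assign 0 .nil
  | φ :: l => .push (.nth 0 :* .hd (.nth 1) :* .hd (.tl (.nth 1))) (pPoint φ) ;;
      .push (.rest 1) (pPoints l) ;; .assign 0 (.nth 1 :* .nth 0)

theorem pPoints_poly {t : ∀ x, Pt (n x) × Pt (n x) × Pt (n x)}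
    {B : ∀ x, Blk (n x)} {env : ι → Data} :
    ∀ l : List (List Bool → Bool), Poly W (fun x => ⟨n x, f x, D x⟩) (pPoints l)
      (fun x => enc3 (t x) :+ (B x).enc :+ env x)
      (fun x => PMF.pure (.ofBits (l.map fun φ =>
        (B x).res (f x) fun j => φ [(t x).1 j, (t x).2.1 j, (t x).2.2 j]))) (fun _ => l.length)
  | [] => PolyD.assign fun x σ h => rfl
  | φ :: l => by
    refine Poly.mono (Q := fun _ => 1 + (l.length + 0)) (Poly.pushQ (a := fun x =>
      enc3 (t x) :+ .ofVec (B x).Z :+ .ofVec (B x).a) (fun x σ h => by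
        simp [h, Blk.enc]) (pPoint_poly (Z := fun x => (B x).Z) (w := fun x => (B x).a) φ)
          <| Poly.pushQ (fun x σ h => by simp [h]) (pPoints_poly (t := t) (B := B) (env := env)
            l) <| PolyD.assign fun x σ h => ?_)
          fun _ => by simp; omega
    simp [h, Data.ofBits, Blk.res, Data.toVec_ofVec]

end

/-- The dictator test for one block. -/
def dictBlk {n : ℕ} (f : Pt n → Bool) (B : Blk n) : PMF Bool :=
  foldK (fun _ ok => (rnd3 n).map fun t => dictRound (B.res f) t && ok)
    (List.replicate 128 Data.nil) true

/-- The dictator test for all blocks. -/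
def dictAll {n : ℕ} (f : Pt n → Bool) (l : List (Blk n)) : PMF Bool :=
  foldK (fun B ok => (dictBlk f B).map fun b => b && ok) l true

def pDictRound : Cmd :=
  .push (.rest 3) pRnd3 ;; .push (.nth 0 :* .nth 3 :* .nil) (pPoints dictBits) ;;
    pBit (fun l => dictOK (l.take 6) && l.getD 6 false)
      [.hd (.nth 0), .hd (.drop 1 (.nth 0)), .hd (.drop 2 (.nth 0)), .hd (.drop 3 (.nth 0)),
        .hd (.drop 4 (.nth 0)), .hd (.drop 5 (.nth 0)), .nth 3] ;;
    .assign 0 (.nth 0)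

def pDictBlk : Cmd :=
  .assign 0 (.lit (.ofList (List.replicate 128 .nil)) :* .tt :* .var 0) ;;
    .forEach pDictRound

/-- The input is `(blocks, n)`. -/
def pDictAll : Cmd :=
  .assign 0 (.nth 0 :* .tt :* .rest 1) ;;
    .forEach (.push (.nth 0 :* .rest 2) pDictBlk ;;
      pBit (fun l => l.getD 0 false && l.getD 1 false) [.nth 0, .nth 2] ;; .assign 0 (.nth 0))

section
variable {ι : Type} {W : ι → ℕ}
variable {n : ι → ℕ} {f : ∀ x, Pt (n x) → Bool} {D : ∀ x, PMF (Pt (n x))}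

theorem pDictRound_poly {e : ι → Data} {ok : ι → Bool} {B : ∀ x, Blk (n x)} :
    Poly W (fun x => ⟨n x, f x, D x⟩) pDictRound
      (fun x => e x :+ .ofBool (ok x) :+ (B x).enc :+ .unary (n x))
      (fun x => ((rnd3 (n x)).map fun t => dictRound ((B x).res (f x)) t && ok x).map Data.ofBool)
      (fun _ => 6) := by
  refine Poly.mono (Q := fun _ => 0 + (6 + 0)) (Poly.congr (Poly.pushM (Q' := fun _ => 6 + 0)
    (α := fun x => Pt (n x) × Pt (n x) × Pt (n x))
    (encA := fun x => enc3) (a := fun x => .unary (n x)) (μ := fun x => rnd3 (n x))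
    (ν := fun x t => PMF.pure (.ofBool (dictRound ((B x).res (f x)) t && ok x)))
      (fun x => enc3_injective _) ?_ pRnd3_poly ?_) fun x => ?_) fun _ => le_rfl
  · exact fun x σ h => by simp [h]
  · refine Poly.pushQ (ι := Σ x, {t // t ∈ (rnd3 (n x)).support}) (a := fun x => enc3 x.2.1 :+
      (B x.1).enc :+ .nil)
      (a' := fun x => .ofBits (dictBits.map fun φ => (B x.1).res (f x.1) fun j =>
          φ [x.2.1.1 j, x.2.1.2.1 j, x.2.1.2.2 j])) ?_ (?_) ?_
    · exact fun x σ h => by simp [h]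
    · have := pPoints_poly (W := fun x => W x.1) (env := fun _ => .nil)
        (ι := Σ x, {t // t ∈ (rnd3 (n x)).support}) (n := fun x => n x.1)
        (f := fun x => f x.1) (D := fun x => D x.1) (t := fun x => x.2.1) (B := fun x => B x.1)
          dictBits
      exact this
    · refine Poly.bit (fun x => (dictBits.map fun φ => (B x.1).res (f x.1) fun j =>
          φ [x.2.1.1 j, x.2.1.2.1 j, x.2.1.2.2 j]) ++ [ok x.1]) ?_ ?_
      · intro x σ h
        simp [h, dictBits, Data.ofBits, Expr.drop]
      · refine PolyD.assign ?_
        intro x σ h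
        simp [h, dictRound, dictBits]
  · rw [PMF.map_comp, ← PMF.bind_pure_comp]
    rfl

theorem pDictBlk_poly {B : ∀ x, Blk (n x)} :
    Poly W (fun x => ⟨n x, f x, D x⟩) pDictBlk (fun x => (B x).enc :+ .unary (n x))
      (fun x => (dictBlk (f x) (B x)).map Data.ofBool) (fun _ => 128 * 6) := by
  refine Poly.mono (Q := fun _ => 128 * 6) (Poly.seqD (mid := fun x => .ofList (List.replicate 128
    .nil) :+ .ofBool true :+ (B x).enc :+ .unary (n x))
    (PolyD.assign fun x σ h => ?_) ?_) fun _ => by omega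
  · simp only [Expr.eval, Expr.eval_lit, h, Expr.tt, Data.ofBool_true]
  · refine Poly.loop (α := fun _ => Bool) (β := fun _ => Data) (fun _ => Data.ofBool)
      (fun _ => id) (fun _ => Data.ofBool_injective) (fun _ => List.replicate 128 .nil)
      (fun _ _ _ => True) (fun x _ ok => (rnd3 (n x)).map fun t => dictRound ((B x).res (f x)) t &&
        ok)
      (fun _ => true) (fun x => (B x).enc :+ .unary (n x)) (fun _ => 6)
      (fun x => by rw [List.map_id]) (fun x => rfl) (fun x => by simp) ?_ (fun _ _ _ _ _ _ _ _ =>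
        trivial)
      (fun _ => trivial) ?_
    · exact ⟨Polynomial.C 3, fun x j a _ => by simpa using Data.size_ofBool_le a⟩
    · exact pDictRound_poly (ι := LoopIx ι (fun _ => Bool) (fun _ => Data)
        (fun _ => List.replicate 128 .nil) fun _ _ _ => True) (n := fun y => n y.x)
        (f := fun y => f y.x) (D := fun y => D y.x) (e := fun y => y.b) (ok := fun y => y.a)
        (B := fun y => B y.x)

theorem pDictAll_poly {l : ∀ x, List (Blk (n x))} :
    Poly W (fun x => ⟨n x, f x, D x⟩) pDictAll
      (fun x => .ofList ((l x).map Blk.enc) :+ .unary (n x))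
      (fun x => (dictAll (f x) (l x)).map Data.ofBool) (fun x => (l x).length * (128 * 6)) := by
  refine Poly.mono (Q := fun x => (l x).length * (128 * 6)) (Poly.seqD (mid := fun x => .ofList
    ((l x).map Blk.enc) :+ .ofBool true :+ .unary (n x))
    (PolyD.assign fun x σ h => by simp [h]) ?_) fun _ => le_rfl
  refine Poly.loop (α := fun _ => Bool) (β := fun x => Blk (n x)) (fun _ => Data.ofBool)
    (fun _ => Blk.enc) (fun _ => Data.ofBool_injective) l
    (fun _ _ _ => True) (fun x B ok => (dictBlk (f x) B).map fun b => b && ok)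
    (fun _ => true) (fun x => .unary (n x)) (fun _ => 128 * 6)
    (fun x => rfl) (fun x => rfl) (fun x => le_rfl) ?_ (fun _ _ _ _ _ _ _ _ => trivial)
    (fun _ => trivial) ?_
  · exact ⟨Polynomial.C 3, fun x j a _ => by simpa using Data.size_ofBool_le a⟩
  · refine Poly.mono (Q := fun _ => 128 * 6 + 0) (Poly.congr (Poly.pushM
      (ι := LoopIx ι (fun _ => Bool) (fun x => Blk (n x)) l fun _ _ _ => True) (Q' := fun _ => 0)
      (α := fun _ => Bool) (encA := fun _ => Data.ofBool) (a := fun y => y.b.enc :+ .unary (n y.x))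
      (μ := fun y => dictBlk (f y.x) y.b) (ν := fun y b => PMF.pure (.ofBool (b && y.a)))
        (fun _ => Data.ofBool_injective) ?_ pDictBlk_poly ?_)
      fun y => ?_) fun _ => le_rfl
    · exact fun x σ h => by simp [h]
    · refine Poly.bit (fun x => [x.2.1, x.1.a]) (fun x σ h => by simp [h])
        <| PolyD.assign fun x σ h => by simp [h]
    · rw [PMF.map_comp, ← PMF.bind_pure_comp]
      rfl

end

/-! ### Programs for the search for blocks -/

/-- One step of the search for a part of `Z` on which `a` and `b` may differ. -/
def searchStep {n : ℕ} (f : Pt n → Bool) (R : Pt n) (s : Blk n) : Blk n :=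
  if f (mux R s.a s.b) ^^ f s.b then ⟨fun i => s.Z i && R i, mux R s.a s.b, s.b⟩
  else ⟨fun i => s.Z i && !R i, s.a, mux R s.a s.b⟩

def vand {n : ℕ} (x y : Pt n) : Pt n := fun i => x i && y i
def vor {n : ℕ} (x y : Pt n) : Pt n := fun i => x i || y i

/-- The points `u` and `vand u X` agree on `X`, so the complement of `X` is a valid first candidate;
each mask then splits it once. -/
def search {n : ℕ} (f : Pt n → Bool) (R : List (Pt n)) (X u : Pt n) :
    Blk n :=
  R.foldl (fun s R => searchStep f R s) ⟨fun i => !X i, u, vand u X⟩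

def bFst (l : List Bool) : Bool := l.getD 0 false
def bAnd (l : List Bool) : Bool := l.getD 0 false && l.getD 1 false
def bOr (l : List Bool) : Bool := l.getD 0 false || l.getD 1 false
def bXor (l : List Bool) : Bool := l.getD 0 false ^^ l.getD 1 false
def bAndN (l : List Bool) : Bool := l.getD 0 false && !l.getD 1 false
def bNot (l : List Bool) : Bool := !l.getD 0 false

/-- The input is `(R, (Z, a, b), env)`, the output `(Z, a, b)`. -/
def pSearchStep : Cmd :=
  .push (.nth 0 :* .hd (.tl (.nth 1)) :* .tl (.tl (.nth 1))) (pZip bMux) ;;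
  .push (.nth 0 :* .nil :* .nil) (pQZip bFst) ;;
  .push (.tl (.tl (.nth 3)) :* .nil :* .nil) (pQZip bFst) ;;
  pBit bXor [.nth 0, .nth 1] ;;
  .cond (.nth 0)
    (.push (.hd (.nth 5) :* .nth 4 :* .nil) (pZip bAnd) ;;
      .assign 0 (.nth 0 :* .nth 4 :* .tl (.tl (.nth 6))))
    (.push (.hd (.nth 5) :* .nth 4 :* .nil) (pZip bAndN) ;;
      .assign 0 (.nth 0 :* .hd (.tl (.nth 6)) :* .nth 4))

/-- The input is `(masks, X, u)`. -/
def pSearch : Cmd :=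
  .push (.rest 2 :* .nth 1 :* .nil) (pZip bAnd) ;;
  .push (.nth 2 :* .nil :* .nil) (pZip bNot) ;;
  .assign 0 (.nth 2 :* (.nth 0 :* .rest 4 :* .nth 1) :* .nil) ;;
  .forEach pSearchStep

section
variable {ι : Type} {W : ι → ℕ}
variable {n : ι → ℕ} {f : ∀ x, Pt (n x) → Bool} {D : ∀ x, PMF (Pt (n x))}

theorem Blk.size_enc_le {n : ℕ} (B : Blk n) : B.enc.size ≤ 12 * n + 5 := by
  have h1 := Data.size_ofVec_le B.Z
  have h2 := Data.size_ofVec_le B.a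
  have h3 := Data.size_ofVec_le B.b
  simp only [enc, Data.size]
  omega

theorem pSearchStep_poly {R : ∀ x, Pt (n x)} {B : ∀ x, Blk (n x)} {env : ι → Data} :
    Poly W (fun x => ⟨n x, f x, D x⟩) pSearchStep
      (fun x => .ofVec (R x) :+ (B x).enc :+ env x)
      (fun x => PMF.pure (searchStep (f x) (R x) (B x)).enc) (fun _ => 2) := by
  refine Poly.mono (Q := fun _ => 0 + (1 + (1 + 0))) (Poly.pushQ
    (a := fun x => .ofVec (R x) :+ .ofVec (B x).a :+ .ofVec (B x).b)
    (fun x σ h => by simp [h, Blk.enc]) (pZip_poly bMux) ?_) fun _ => le_rfl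
  simp only [Data.toVec_ofVec]
  refine Poly.pushQ (a := fun x => .ofVec (mux (R x) (B x).a (B x).b) :+ .nil :+ .nil)
    (fun x σ h => by simp [h]; rfl) (pQZip_poly bFst) ?_
  refine Poly.pushQ (a := fun x => .ofVec (B x).b :+ .nil :+ .nil)
    (fun x σ h => by simp [h, Blk.enc]) (pQZip_poly bFst) ?_
  refine Poly.bit (fun x => [f x (B x).b, f x (mux (R x) (B x).a (B x).b)])
    (fun x σ h => by simp [h, bFst]) ?_
  refine Poly.cond (fun x => f x (mux (R x) (B x).a (B x).b) ^^ f x (B x).b)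
    (fun x σ h => by simp [h, bXor, Bool.xor_comm]) ?_ ?_
  · refine Poly.mono (Q := fun _ => 0 + 0) (Poly.pushQ
      (a := fun x => .ofVec (B x.1).Z :+ .ofVec (R x.1) :+ .nil)
      (fun x σ h => by simp [h, Blk.enc]) (pZip_poly bAnd) <| PolyD.assign ?_)
      fun _ => le_rfl
    intro x σ h
    have := x.2
    simp only [searchStep, this, if_true]
    simp [h, Blk.enc, Data.toVec_ofVec, bAnd]
    rfl
  · refine Poly.mono (Q := fun _ => 0 + 0) (Poly.pushQ
      (a := fun x => .ofVec (B x.1).Z :+ .ofVec (R x.1) :+ .nil)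
      (fun x σ h => by simp [h, Blk.enc]) (pZip_poly bAndN) <| PolyD.assign ?_)
      fun _ => le_rfl
    intro x σ h
    have := x.2
    simp only [searchStep, this]
    simp [h, Blk.enc, Data.toVec_ofVec, bAndN]
    rfl

theorem pSearch_poly {R : ∀ x, List (Pt (n x))} {X u : ∀ x, Pt (n x)} :
    Poly W (fun x => ⟨n x, f x, D x⟩) pSearch
      (fun x => .ofList ((R x).map .ofVec) :+ .ofVec (X x) :+ .ofVec (u x))
      (fun x => PMF.pure (search (f x) (R x) (X x) (u x)).enc) (fun x => (R x).length *
        2) := Poly.intro fun hs => by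
  refine Poly.mono (Q := fun x => 0 + (0 + (R x).length * 2)) (Poly.pushQ
    (a := fun x => .ofVec (u x) :+ .ofVec (X x) :+ .nil)
    (fun x σ h => by simp [h]) (pZip_poly bAnd) <| Poly.pushQ
      (a := fun x => .ofVec (X x) :+ .nil :+ .nil) (fun x σ h => by simp [h])
      (pZip_poly bNot) ?_) fun _ => by omega
  refine Poly.seqD (mid := fun x => .ofList ((R x).map .ofVec) :+
    Blk.enc ⟨fun i => !X x i, u x, vand (u x) (X x)⟩ :+ .nil)
    (PolyD.assign fun x σ h => ?_) ?_
  · simp [h, Blk.enc, Data.toVec_ofVec, bNot, bAnd]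
    rfl
  · have hn : Bdd W n := hs.snd.snd.of_ofVec
    refine Poly.loop (α := fun x => Blk (n x)) (β := fun x => Pt (n x))
      (fun _ => Blk.enc) (fun _ => .ofVec) (fun _ => Blk.enc_injective _) R (fun _ _ _ => True)
      (fun x R s => PMF.pure (searchStep (f x) R s)) (fun x => ⟨fun i => !X x i, u x, vand (u x)
        (X x)⟩)
      (fun _ => .nil) (fun _ => 2) (fun _ => rfl)
      (fun x => by rw [foldK_pure, PMF.pure_map]; rfl) (fun _ => le_rfl)
      (Bdd.acc (((Bdd.const 12).mul hn).add (Bdd.const 5)) fun x j a _ => a.size_enc_le)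
      (fun _ _ _ _ _ _ _ _ => trivial) (fun _ => trivial) ?_
    refine Poly.congr (pSearchStep_poly (ι := LoopIx ι (fun x => Blk (n x))
      (fun x => Pt (n x)) R fun _ _ _ => True) (n := fun y => n y.x) (f := fun y => f y.x)
      (D := fun y => D y.x) (R := fun y => y.b) (B := fun y => y.a) (env := fun _ => .nil))
      fun y => by rw [PMF.pure_map]

end

/-- The state of the search for blocks: remaining trials for the next block, remaining number of
blocks, union of the blocks, blocks that are still to be verified and verified blocks. -/
@[ext] structure PState (n : ℕ) where
  t : ℕ
  kc : ℕ
  X : Pt n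
  unv : List (Blk n)
  ver : List (Blk n)

namespace PState
variable {n : ℕ}

def enc (s : PState n) : Data :=
  .unary s.t :+ .unary s.kc :+ .ofVec s.X :+
    .ofList (s.unv.map Blk.enc) :+ .ofList (s.ver.map Blk.enc)

theorem enc_injective : Function.Injective (enc (n := n)) := by
  intro s s' h
  simp only [enc, Data.cons.injEq] at h
  exact PState.ext (Data.unary_injective h.1) (Data.unary_injective h.2.1)
    (Data.ofVec_injective _ h.2.2.1)
    (List.map_injective_iff.2 (Blk.enc_injective n) (Data.ofList_injective h.2.2.2.1))
    (List.map_injective_iff.2 (Blk.enc_injective n) (Data.ofList_injective h.2.2.2.2))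

/-- The default value plays no role, since `step` calls `verify` only if `unv` is not empty. -/
def top (s : PState n) : Blk n := s.unv.headD ⟨s.X, s.X, s.X⟩

variable (f : Pt n → Bool) (D : PMF (Pt n)) (R : List (Pt n)) (m : ℕ)

/-- Add the block that is found from the point `u`. -/
def add (u : Pt n) (s : PState n) : PState n :=
  ⟨m, s.kc - 1, vor s.X (search f R s.X u).Z, search f R s.X u :: s.unv, s.ver⟩

/-- Verify the first block, or add another one. -/
def verify (s : PState n) : PState n :=
  if f (vand s.top.a s.X) ^^ f (vand s.top.b s.X) then
    { s with unv := s.unv.tail, ver := ⟨s.top.Z, vand s.top.a s.X, vand s.top.b s.X⟩ :: s.ver }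
  else add f R m (if f s.top.a ^^ f (vand s.top.a s.X) then s.top.a else s.top.b) s

/-- Try to find a block from the point `u`. -/
def try' (u : Pt n) (s : PState n) : PState n :=
  if f u ^^ f (vand u s.X) then add f R m u s else { s with t := s.t - 1 }

def step (s : PState n) : PMF (PState n) :=
  if s.unv.isEmpty then if 0 < s.t then D.map fun u => try' f R m u s else PMF.pure s
  else PMF.pure (verify f R m s)

end PState

/-- The input is `(u, state, masks, m)`. -/
def pAddBlk : Cmd :=
  .push (.nth 2 :* .hd (.drop 2 (.nth 1)) :* .nth 0) pSearch ;;
  .push (.hd (.drop 2 (.nth 2)) :* .hd (.nth 0) :* .nil) (pZip bOr) ;;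
  .assign 0 (.rest 5 :* .tl (.hd (.drop 1 (.nth 3))) :* .nth 0 :*
    (.nth 1 :* .hd (.drop 3 (.nth 3))) :* .drop 4 (.nth 3))

/-- The input is `(u, state, masks, m)`. -/
def pTry : Cmd :=
  .push (.nth 0 :* .nil :* .nil) (pQZip bFst) ;;
  .push (.nth 1 :* .hd (.drop 2 (.nth 2)) :* .nil) (pQZip bAnd) ;;
  pBit bXor [.nth 0, .nth 1] ;;
  .cond (.nth 0) (.assign 0 (.rest 3) ;; pAddBlk)
    (.assign 0 (.tl (.hd (.nth 4)) :* .tl (.nth 4)))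

/-- The input is `(state, masks, m)`. -/
def pVerify : Cmd :=
  .push (.hd (.drop 1 (.hd (.hd (.drop 3 (.nth 0))))) :* .hd (.drop 2 (.nth 0)) :* .nil)
    (pQZip bAnd) ;;
  .push (.drop 2 (.hd (.hd (.drop 3 (.nth 1)))) :* .hd (.drop 2 (.nth 1)) :* .nil)
    (pQZip bAnd) ;;
  pBit bXor [.nth 0, .nth 1] ;;
  .cond (.nth 0)
    (.push (.hd (.drop 1 (.hd (.hd (.drop 3 (.nth 3))))) :*
        .hd (.drop 2 (.nth 3)) :* .nil) (pZip bAnd) ;;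
      .push (.drop 2 (.hd (.hd (.drop 3 (.nth 4)))) :* .hd (.drop 2 (.nth 4)) :* .nil)
        (pZip bAnd) ;;
      .assign 0 (.hd (.nth 5) :* .hd (.drop 1 (.nth 5)) :* .hd (.drop 2 (.nth 5)) :*
        .tl (.hd (.drop 3 (.nth 5))) :* (.hd (.hd (.hd (.drop 3 (.nth 5)))) :*
          .nth 1 :* .nth 0) :* .drop 4 (.nth 5)))
    (.push (.hd (.drop 1 (.hd (.hd (.drop 3 (.nth 3))))) :* .nil :* .nil) (pQZip bFst) ;;
      pBit bXor [.nth 0, .nth 3] ;;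
      .cond (.nth 0) (.assign 0 (.hd (.drop 1 (.hd (.hd (.drop 3 (.nth 5))))) :* .rest 5))
        (.assign 0 (.drop 2 (.hd (.hd (.drop 3 (.nth 5)))) :* .rest 5)) ;;
      pAddBlk)

/-- The input is `(_, state, masks, m)`. -/
def pStep : Cmd :=
  .cond (.hd (.drop 3 (.nth 1))) (.assign 0 (.rest 1) ;; pVerify)
    (.cond (.hd (.nth 1)) (.assign 0 (.rest 1) ;; pSample ;; pTry) (.assign 0 (.nth 1)))

section
variable {ι : Type} {W : ι → ℕ}
variable {n : ι → ℕ} {f : ∀ x, Pt (n x) → Bool} {D : ∀ x, PMF (Pt (n x))}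

theorem pAddBlk_poly {u : ∀ x, Pt (n x)} {s : ∀ x, PState (n x)}
    {R : ∀ x, List (Pt (n x))} {m : ι → ℕ} :
    Poly W (fun x => ⟨n x, f x, D x⟩) pAddBlk
      (fun x => .ofVec (u x) :+ (s x).enc :+ .ofList ((R x).map .ofVec) :+
        .unary (m x))
      (fun x => PMF.pure ((s x).add (f x) (R x) (m x) (u x)).enc) (fun x => (R x).length * 2) := by
  refine Poly.mono (Q := fun x => (R x).length * 2 + (0 + 0)) (Poly.pushQ
    (a := fun x => .ofList ((R x).map .ofVec) :+ .ofVec (s x).X :+ .ofVec (u x))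
    (fun x σ h => by simp [h, PState.enc, Expr.drop]) pSearch_poly <| Poly.pushQ
      (a := fun x => .ofVec (s x).X :+ .ofVec (search (f x) (R x) (s x).X (u x)).Z :+ .nil)
      (fun x σ h => by simp [h, PState.enc, Expr.drop, Blk.enc]) (pZip_poly bOr) <|
        PolyD.assign fun x σ h => ?_) fun x => le_rfl
  simp [h, PState.enc, Expr.drop, PState.add, Data.toVec_ofVec, bOr, tl_unary]
  rfl

theorem pTry_poly {u : ∀ x, Pt (n x)} {s : ∀ x, PState (n x)}
    {R : ∀ x, List (Pt (n x))} {m : ι → ℕ} :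
    Poly W (fun x => ⟨n x, f x, D x⟩) pTry
      (fun x => .ofVec (u x) :+ (s x).enc :+ .ofList ((R x).map .ofVec) :+
        .unary (m x))
      (fun x => PMF.pure ((s x).try' (f x) (R x) (m x) (u x)).enc)
      (fun x => (R x).length * 2 + 2) := by
  refine Poly.mono (Q := fun x => 1 + (1 + (0 + (R x).length * 2))) (Poly.pushQ
    (a := fun x => .ofVec (u x) :+ .nil :+ .nil) (fun x σ h => by simp [h])
    (pQZip_poly bFst) <| Poly.pushQ
      (a := fun x => .ofVec (u x) :+ .ofVec (s x).X :+ .nil)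
      (fun x σ h => by simp [h, PState.enc, Expr.drop]) (pQZip_poly bAnd) <|
    Poly.seqQ (Q := fun _ => 0)
      (pBit_poly _ _ (fun x => [f x (vand (u x) (s x).X), f x (u x)]) fun x σ h => ?_)
      <| Poly.cond (fun x => f x (u x) ^^ f x (vand (u x) (s x).X))
        (fun x σ h => by simp [h, bXor, Bool.xor_comm]) ?_ ?_) fun x => by omega
  · simp [h, bFst, bAnd, Data.toVec_ofVec]
    rfl
  · refine Poly.mono (Q := fun x => (R x.1).length * 2) (Poly.seqD
      (mid := fun x => .ofVec (u x.1) :+ (s x.1).enc :+ .ofList ((R x.1).map .ofVec) :+ .unary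
        (m x.1))
      (PolyD.assign fun x σ h => by simp [h]) <|
        Poly.congr (pAddBlk_poly (ι := {x // _ = true}) (n := fun x => n x.1) (f := fun x => f x.1)
          (D := fun x => D x.1) (u := fun x => u x.1) (s := fun x => s x.1) (R := fun x => R x.1)
          (m := fun x => m x.1)) fun x => ?_) fun x => le_rfl
    have := x.2
    simp only [PState.try', this, if_true]
  · refine Poly.mono (Q := fun x => 0) (PolyD.assign fun x σ h => ?_)
      fun x => Nat.zero_le _
    have := x.2
    simp only [PState.try', this]
    simp [h, PState.enc, tl_unary]

theorem pVerify_poly {s : ∀ x, PState (n x)} (hne : ∀ x, (s x).unv ≠ [])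
    {R : ∀ x, List (Pt (n x))} {m : ι → ℕ} :
    Poly W (fun x => ⟨n x, f x, D x⟩) pVerify
      (fun x => (s x).enc :+ .ofList ((R x).map .ofVec) :+ .unary (m x))
      (fun x => PMF.pure ((s x).verify (f x) (R x) (m x)).enc)
      (fun x => (R x).length * 2 + 3) := by
  have hunv : ∀ x, Data.ofList ((s x).unv.map Blk.enc) =
      (s x).top.enc :+ .ofList ((s x).unv.tail.map Blk.enc) := by
    intro x
    unfold PState.top
    cases h : (s x).unv with
    | nil => exact absurd h (hne x)
    | cons B l => rfl
  refine Poly.mono (Q := fun x => 1 + (1 + (0 + ((R x).length * 2 + 1)))) (Poly.pushQ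
    (a := fun x => .ofVec (s x).top.a :+ .ofVec (s x).X :+ .nil)
    (fun x σ h => by simp [h, PState.enc, Expr.drop, hunv, Blk.enc]) (pQZip_poly bAnd) <|
      Poly.pushQ (a := fun x => .ofVec (s x).top.b :+ .ofVec (s x).X :+ .nil)
      (fun x σ h => by simp [h, PState.enc, Expr.drop, hunv, Blk.enc]) (pQZip_poly bAnd) <|
    Poly.seqQ (Q := fun _ => 0)
      (pBit_poly _ _ (fun x => [f x (vand (s x).top.b (s x).X), f x (vand (s x).top.a (s x).X)])
        fun x σ h => ?_)
      <| Poly.cond (fun x => f x (vand (s x).top.a (s x).X) ^^ f x (vand (s x).top.b (s x).X))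
        (fun x σ h => by simp [h, bXor, Bool.xor_comm]) ?_ ?_) fun x => by omega
  · simp [h, bAnd, Data.toVec_ofVec]
    exact ⟨rfl, rfl⟩
  · refine Poly.mono (Q := fun x => 0 + (0 + 0)) (Poly.pushQ
      (a := fun x => .ofVec (s x.1).top.a :+ .ofVec (s x.1).X :+ .nil)
      (fun x σ h => by simp [h, PState.enc, Expr.drop, hunv, Blk.enc]) (pZip_poly bAnd) <|
      Poly.pushQ (a := fun x => .ofVec (s x.1).top.b :+ .ofVec (s x.1).X :+ .nil)
      (fun x σ h => by simp [h, PState.enc, Expr.drop, hunv, Blk.enc]) (pZip_poly bAnd) <|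
      PolyD.assign fun x σ h => ?_) fun _ => Nat.zero_le _
    have := x.2
    simp only [PState.verify, this, if_true]
    simp [h, PState.enc, Expr.drop, hunv, Blk.enc, bAnd, Data.toVec_ofVec]
    exact ⟨rfl, rfl⟩
  · refine Poly.mono (Q := fun x => 1 + (0 + (0 + (R x.1).length * 2))) ?_ fun x => by omega
    refine Poly.pushQ
      (a := fun x => .ofVec (s x.1).top.a :+ .nil :+ .nil)
      (fun x σ h => by simp [h, PState.enc, Expr.drop, hunv, Blk.enc])
      (a' := fun x => .ofBool (f x.1 (s x.1).top.a)) (?_) ?_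
    · exact pQZip_poly (ι := {x // (f x (vand (s x).top.a (s x).X) ^^
        f x (vand (s x).top.b (s x).X)) = false}) (n := fun x => n x.1) (f := fun x => f x.1)
        (D := fun x => D x.1) bFst
    refine Poly.seqQ (Q := fun _ => 0) (pBit_poly _ _
        (fun x => [f x.1 (s x.1).top.a, f x.1 (vand (s x.1).top.a (s x.1).X)]) fun x σ h => ?_)
      ?_
    · simp [h, bAnd, Data.toVec_ofVec]
      rfl
    refine Poly.seqQ (Q := fun _ => 0) (mid := fun x => .ofVec
          (if f x.1 (s x.1).top.a ^^ f x.1 (vand (s x.1).top.a (s x.1).X) then (s x.1).top.a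
            else (s x.1).top.b) :+
          (s x.1).enc :+ .ofList ((R x.1).map .ofVec) :+ .unary (m x.1))
        (Poly.cond (fun x => f x.1 (s x.1).top.a ^^ f x.1 (vand (s x.1).top.a (s x.1).X))
          (fun x σ h => by simp [h, bXor]) ?_ ?_) <|
        Poly.congr (pAddBlk_poly (ι := {x // _ = false}) (n := fun x => n x.1)
          (f := fun x => f x.1) (D := fun x => D x.1) (s := fun x => s x.1) (R := fun x => R x.1)
          (m := fun x => m x.1)) fun x => ?_
    · refine PolyD.assign fun x σ h => ?_
      simp only [x.2, if_true]
      simp [h, PState.enc, Expr.drop, hunv, Blk.enc]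
    · refine PolyD.assign fun x σ h => ?_
      simp only [x.2]
      simp [h, PState.enc, Expr.drop, hunv, Blk.enc]
    · have := x.2
      simp only [PState.verify, this]
      rfl

theorem pTrial_poly {s : ∀ x, PState (n x)} {R : ∀ x, List (Pt (n x))} {m : ι → ℕ} :
    Poly W (fun x => ⟨n x, f x, D x⟩) (pSample ;; pTry)
      (fun x => (s x).enc :+ .ofList ((R x).map .ofVec) :+ .unary (m x))
      (fun x => ((D x).map fun u => (s x).try' (f x) (R x) (m x) u).map PState.enc)
      (fun x => (R x).length * 2 + 3) := Poly.intro fun hs => by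
  have hn : Bdd W n := hs.fst.snd.snd.fst.of_ofVec
  refine Poly.mono (Q := fun x => 1 + ((R x).length * 2 + 2)) (Poly.congr (Poly.seqM
    (α := fun x => Pt (n x)) (μ := D)
    (enc := fun x v => .ofVec v :+ (s x).enc :+
      .ofList ((R x).map .ofVec) :+ .unary (m x))
    (ν := fun x u => PMF.pure ((s x).try' (f x) (R x) (m x) u).enc)
    (Q' := fun x => (R x).length * 2 + 2) ?_ (pSample_poly hn) <|
      pTry_poly (ι := Σ x, {v // v ∈ (D x).support}) (n := fun x => n x.1) (f := fun x => f x.1)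
        (D := fun x => D x.1) (u := fun x => x.2.1) (s := fun x => s x.1)
        (R := fun x => R x.1) (m := fun x => m x.1)) fun x => ?_) fun x => by omega
  · intro x v v' h
    simp only [Data.cons.injEq, and_true] at h
    exact Data.ofVec_injective _ h
  · rw [PMF.map_comp, ← PMF.bind_pure_comp]
    rfl

theorem pStep_poly {e : ι → Data} {s : ∀ x, PState (n x)}
    {R : ∀ x, List (Pt (n x))} {m : ι → ℕ} :
    Poly W (fun x => ⟨n x, f x, D x⟩) pStep
      (fun x => e x :+ (s x).enc :+ .ofList ((R x).map .ofVec) :+ .unary (m x))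
      (fun x => ((s x).step (f x) (D x) (R x) (m x)).map PState.enc)
      (fun x => (R x).length * 2 + 3) := by
  refine Poly.cond (fun x => !(s x).unv.isEmpty) (fun x σ h => ?_) ?_
    (Poly.cond (fun x => decide (0 < (s x.1).t)) (fun x σ h => ?_) ?_ ?_)
  · simp [h, PState.enc, Expr.drop]
    cases (s x).unv <;> simp
  · refine Poly.congr (Poly.seqD (mid := fun x => (s x.1).enc :+
      .ofList ((R x.1).map .ofVec) :+ .unary (m x.1))
      (PolyD.assign fun x σ h => by simp [h]) <|
        pVerify_poly (ι := {x // (!(s x).unv.isEmpty) = true}) (n := fun x => n x.1)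
          (f := fun x => f x.1) (D := fun x => D x.1)
          (s := fun x => s x.1) (fun x h => ?_) (R := fun x => R x.1) (m := fun x => m x.1))
      fun x => ?_
    · have := x.2
      simp [h] at this
    · have := x.2
      simp only [Bool.not_eq_true'] at this
      rw [PState.step, this, if_neg (by simp), PMF.pure_map]
  · simp [h, PState.enc, Data.truth_unary]
  · refine Poly.mono (Q := fun x => (R x.1.1).length * 2 + 3) (Poly.congr (Poly.seqD
      (mid := fun x => (s x.1.1).enc :+
      .ofList ((R x.1.1).map .ofVec) :+ .unary (m x.1.1))
      (PolyD.assign fun x σ h => by simp [h]) <|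
        pTrial_poly (ι := {x : {x // _ = false} // _ = true}) (n := fun x => n x.1.1)
          (f := fun x => f x.1.1) (D := fun x => D x.1.1) (s := fun x => s x.1.1)
          (R := fun x => R x.1.1) (m := fun x => m x.1.1)) fun x => ?_) fun x => by omega
    have h1 := x.1.2
    have h2 := x.2
    simp only [Bool.not_eq_false'] at h1
    simp only [decide_eq_true_eq] at h2
    rw [PState.step, h1, if_pos rfl, if_pos h2]
  · refine Poly.mono (Q := fun _ => 0) (Poly.congr (PolyD.assign
      (out := fun x => (s x.1.1).enc)
      fun x σ h => by simp [h]) fun x => ?_) fun _ => Nat.zero_le _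
    have h1 := x.1.2
    have h2 := x.2
    simp only [Bool.not_eq_false'] at h1
    simp only [decide_eq_false_iff_not] at h2
    rw [PState.step, h1, if_pos rfl, if_neg h2, PMF.pure_map]

end

/-! ### Masks, decoding of points and unions of blocks -/

section
variable {n : ℕ} (f : Pt n → Bool) (D : PMF (Pt n))

/-- `s` random vectors. -/
def masks (n s : ℕ) : PMF (List (Pt n)) :=
  foldK (fun _ l => (unif n).map fun v => v :: l) (List.replicate s (Data.cons .nil .nil)) []

/-- The search for blocks. -/
def findBlks (R : List (Pt n)) (m K N : ℕ) : PMF (PState n) :=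
  foldK (fun _ s => s.step f D R m) (List.replicate N (Data.cons .nil .nil))
    ⟨m, K, fun _ => false, [], []⟩

/-- The bits that are seen at the relevant coordinate of `u` in the block. -/
def decBlk (u : Pt n) (L : ℕ) (B : Blk n) : PMF (Bool × Bool) :=
  foldK (fun _ s => (unif n).map fun b =>
    (s.1 || !(B.res f (fun i => b i ^^ u i) ^^ B.res f b),
      s.2 || (B.res f (fun i => b i ^^ u i) ^^ B.res f b)))
    (List.replicate L (Data.cons .nil .nil)) (false, false)

def decStep (u : Pt n) (L : ℕ) (B : Blk n) (a : List Bool × Bool) : PMF (List Bool × Bool) :=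
  (decBlk f u L B).map fun s => (s.2 :: a.1, a.2 || (s.1 && s.2))

/-- The relevant coordinates of `u` in the blocks, and whether an inconsistency was found. -/
def decode (u : Pt n) (L : ℕ) (l : List (Blk n)) : PMF (List Bool × Bool) :=
  foldK (decStep f u L) l.reverse ([], false)

/-- The union of the blocks that are selected by `y`. -/
def unite (l : List (Blk n)) (y : Data) : Pt n :=
  (l.foldl (fun (a : Data × Pt n) B =>
    (a.1.tl, if a.1.hd.truth then vor B.Z a.2 else a.2)) (y, fun _ => false)).2

end

/-- The input is `(s, n)`. -/
def pMasks : Cmd :=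
  .assign 0 (.nth 0 :* .nil :* .rest 1) ;;
    .forEach (.push (.rest 2) pRnd ;; .assign 0 (.nth 0 :* .nth 2))

/-- The input is `(_, flags, u, B, n)`. -/
def pDecRound : Cmd :=
  .push (.rest 4) pRnd ;;
  .push ((.nth 0 :* .nth 3 :* .nil) :* .hd (.nth 4) :* .hd (.drop 1 (.nth 4)))
    (pPoint bXor) ;;
  .push ((.nth 1 :* .nil :* .nil) :* .hd (.nth 5) :* .hd (.drop 1 (.nth 5)))
    (pPoint bFst) ;;
  pBit bXor [.nth 0, .nth 1] ;;
  pBit (fun l => l.getD 1 false || !l.getD 0 false) [.nth 0, .hd (.nth 5)] ;;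
  pBit bOr [.tl (.nth 6), .nth 1] ;;
  .assign 0 (.nth 1 :* .nth 0)

/-- The input is `(B, (bits, bad), u, blocks, reversed blocks, L, n)`. -/
def pDecStep : Cmd :=
  .push (.nth 5 :* (.nil :* .nil) :* .nth 2 :* .nth 0 :* .rest 6)
    (.forEach pDecRound) ;;
  pBit (fun l => l.getD 0 false || (l.getD 1 false && l.getD 2 false))
    [.tl (.nth 2), .hd (.nth 0), .tl (.nth 0)] ;;
  .assign 0 ((.tl (.nth 1) :* .hd (.nth 3)) :* .nth 0)

/-- The input is `(u, blocks, reversed blocks, L, n)`. -/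
def pDecode : Cmd :=
  .assign 0 (.nth 2 :* (.nil :* .nil) :* .var 0) ;; .forEach pDecStep

/-- The input is `(y, blocks, reversed blocks, L, n)`. -/
def pUnite : Cmd :=
  .push (.rest 4 :* .nil :* .nil) (pZip fun _ => false) ;;
  .assign 0 (.nth 2 :* (.nth 1 :* .nth 0) :* .nil) ;;
  .forEach (.cond (.hd (.hd (.nth 1)))
    (.push (.hd (.nth 0) :* .tl (.nth 1) :* .nil) (pZip bOr) ;;
      .assign 0 (.tl (.hd (.nth 2)) :* .nth 0))
    (.assign 0 (.tl (.hd (.nth 1)) :* .tl (.nth 1)))) ;;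
  .assign 0 (.tl (.var 0))

def ctxD {n : ℕ} (l : List (Blk n)) (L : ℕ) : Data :=
  .cons (.ofList (l.map Blk.enc)) (.ofList (l.reverse.map Blk.enc) :+
    .unary L :+ .unary n)

section
variable {ι : Type} {W : ι → ℕ}
variable {n : ι → ℕ} {f : ∀ x, Pt (n x) → Bool} {D : ∀ x, PMF (Pt (n x))}

theorem Data.size_map_ofVec_le {n : ℕ} (l : List (Pt n)) :
    (Data.ofList (l.map .ofVec)).size ≤ 1 + l.length * (4 * n + 2) := by
  have := Data.size_ofList_le (l := l.map .ofVec) (B := 4 * n + 1) (by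
    intro d hd
    rw [List.mem_map] at hd
    obtain ⟨v, -, rfl⟩ := hd
    exact Data.size_ofVec_le v)
  rwa [List.length_map] at this

theorem Data.size_map_blk_le {n : ℕ} (l : List (Blk n)) :
    (Data.ofList (l.map Blk.enc)).size ≤ 1 + l.length * (12 * n + 6) := by
  have := Data.size_ofList_le (l := l.map Blk.enc) (B := 12 * n + 5) (by
    intro d hd
    rw [List.mem_map] at hd
    obtain ⟨v, -, rfl⟩ := hd
    exact v.size_enc_le)
  rwa [List.length_map] at this

theorem pMasks_poly {O : ι → Oracle} {s : ι → ℕ} :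
    Poly W O pMasks (fun x => .unary (s x) :+ .unary (n x))
      (fun x => (masks (n x) (s x)).map fun l => .ofList (l.map .ofVec)) (fun _ => 0) := Poly.intro
        fun hs => by
  have hn : Bdd W n := hs.snd.of_unary
  have hS : Bdd W s := hs.fst.of_unary
  refine Poly.mono (Q := fun x => 0) (Poly.seqD (mid := fun x => .unary (s x) :+ .nil :+ .unary
    (n x))
    (PolyD.assign fun x σ h => by simp [h]) ?_) fun _ => le_rfl
  refine Poly.loop (α := fun x => List (Pt (n x))) (β := fun _ => Data)
    (fun _ l => .ofList (l.map .ofVec)) (fun _ => id) (fun x l l' h =>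
      List.map_injective_iff.2 (Data.ofVec_injective _) (Data.ofList_injective h))
    (fun x => List.replicate (s x) (.nil :+ .nil)) (fun x j l => l.length + j ≤ s x)
    (fun x _ l => (unif (n x)).map fun v => v :: l) (fun _ => []) (fun x => .unary (n x))
      (fun _ => 0)
    (fun x => by rw [List.map_id, Data.unary_eq (s x)]; rfl) (fun x => rfl) (fun x => by simp)
    (Bdd.acc ((Bdd.const 1).add (hS.mul (((Bdd.const 4).mul hn).add (Bdd.const 2)))) ?_) ?_
      (by simp)
    ?_
  · intro x j l hl
    refine (Data.size_map_ofVec_le l).trans ?_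
    have : l.length ≤ s x := by omega
    gcongr
  · intro x j b _ a ha a' ha'
    rw [PMF.mem_support_map_iff] at ha'
    obtain ⟨v, -, rfl⟩ := ha'
    simp; omega
  · refine Poly.mono (Q := fun _ => 0 + 0) (Poly.congr (Poly.pushM (ι := LoopIx ι _ _ _ _)
      (Q' := fun _ => 0)
      (α := fun y => Pt (n y.x)) (encA := fun _ => .ofVec) (a := fun y => .unary (n y.x))
      (μ := fun y => unif (n y.x)) (ν := fun y v => PMF.pure (.ofList ((v :: y.a).map .ofVec)))
        (fun _ => Data.ofVec_injective _) ?_ pRndU_poly <|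
        PolyD.assign ?_)
      fun y => ?_) fun _ => le_rfl
    · exact fun x σ h => by simp [h]
    · exact fun x σ h => by simp [h]
    · rw [PMF.map_comp, ← PMF.bind_pure_comp]
      rfl

/-- A step adds at most one block, so there are never more than `N x` of them; this bounds the state
without any assumption on `f`. -/
theorem findBlks_poly {s : ι → Data} {R : ∀ x, List (Pt (n x))} {m K N : ι → ℕ}
    (hinp : ∀ x, s x = .unary (N x) :+
      PState.enc (⟨m x, K x, fun _ => false, [], []⟩ : PState (n x)) :+
        .ofList ((R x).map .ofVec) :+ .unary (m x)) :
    Poly W (fun x => ⟨n x, f x, D x⟩) (.forEach pStep) s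
      (fun x => (findBlks (f x) (D x) (R x) (m x) (K x) (N x)).map PState.enc)
      (fun x => N x * ((R x).length * 2 + 3)) := Poly.intro fun hs => by
  have hs0 : SBdd W fun x => Data.cons (.unary (N x))
      (PState.enc (⟨m x, K x, fun _ => false, [], []⟩ : PState (n x)) :+
        .ofList ((R x).map .ofVec) :+ .unary (m x)) := hs.of_le fun x => by rw [hinp x]
  have hN : Bdd W N := hs0.fst.of_unary
  have hm : Bdd W m := hs0.snd.fst.fst.of_unary
  have hK : Bdd W K := hs0.snd.fst.snd.fst.of_unary
  have hn : Bdd W n := hs0.snd.fst.snd.snd.fst.of_ofVec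
  refine Poly.loop (α := fun x => PState (n x)) (β := fun _ => Data)
    (fun _ => PState.enc) (fun _ => id) (fun x => PState.enc_injective)
    (fun x => List.replicate (N x) (.nil :+ .nil))
    (fun x j s => s.t ≤ m x ∧ s.kc ≤ K x ∧ s.unv.length + s.ver.length + j ≤ N x)
    (fun x _ s => s.step (f x) (D x) (R x) (m x)) (fun x => ⟨m x, K x, fun _ => false, [], []⟩)
    (fun x => .ofList ((R x).map .ofVec) :+ .unary (m x)) (fun x => (R x).length * 2 + 3)
    (fun x => by rw [List.map_id, hinp, Data.unary_eq (N x)]) (fun x => rfl) (fun x => by simp)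
    (Bdd.acc (((((Bdd.const 4).mul hm).add ((Bdd.const 4).mul hK)).add ((Bdd.const 4).mul hn)).add
      (((hN.mul (((Bdd.const 12).mul hn).add (Bdd.const 6))).add
      (hN.mul (((Bdd.const 12).mul hn).add (Bdd.const 6)))).add (Bdd.const 9))) ?_) ?_
      (fun x => by simp) ?_
  · rintro x j s ⟨h1, h2, h3⟩
    have h4 := Data.size_map_blk_le s.unv
    have h5 := Data.size_map_blk_le s.ver
    have h6 := Data.size_ofVec_le s.X
    have h7 : s.unv.length * (12 * n x + 6) ≤ N x * (12 * n x + 6) :=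
      Nat.mul_le_mul_right _ (by omega)
    have h8 : s.ver.length * (12 * n x + 6) ≤ N x * (12 * n x + 6) :=
      Nat.mul_le_mul_right _ (by omega)
    simp only [PState.enc, Data.size, Data.size_unary]
    omega
  · rintro x j b - s ⟨h1, h2, h3⟩ s' hz'
    have hadd : ∀ u, (s.add (f x) (R x) (m x) u).t ≤ m x ∧ (s.add (f x) (R x) (m x) u).kc ≤ K x ∧
        (s.add (f x) (R x) (m x) u).unv.length + (s.add (f x) (R x) (m x) u).ver.length + j ≤
          N x := by
      intro u
      simp only [PState.add, List.length_cons]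
      omega
    unfold PState.step at hz'
    split_ifs at hz' with h4 h5
    · rw [PMF.mem_support_map_iff] at hz'
      obtain ⟨u, -, rfl⟩ := hz'
      unfold PState.try'
      split_ifs
      · exact hadd u
      · simp only; omega
    · simp at hz'
      subst hz'
      omega
    · simp at hz'
      subst hz'
      unfold PState.verify
      split_ifs
      · simp only [List.length_cons, List.length_tail]
        have : s.unv.length ≠ 0 := fun h => h4 (by simpa using h)
        omega
      all_goals exact hadd _
  · exact pStep_poly (ι := LoopIx ι (fun x => PState (n x)) (fun _ => Data)
      (fun x => List.replicate (N x) (.nil :+ .nil))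
      fun x j s => s.t ≤ m x ∧ s.kc ≤ K x ∧ s.unv.length + s.ver.length + j ≤ N x)
      (n := fun y => n y.x) (f := fun y => f y.x) (D := fun y => D y.x) (e := fun y => y.b)
      (s := fun y => y.a) (R := fun y => R y.x) (m := fun y => m y.x)

end

theorem pair_injective {α β : Type} {e : α → Data} {e' : β → Data} (h : Function.Injective e)
    (h' : Function.Injective e') :
    Function.Injective fun p : α × β => Data.cons (e p.1) (e' p.2) := by
  rintro ⟨a, b⟩ ⟨a', b'⟩ hab
  simp only [Data.cons.injEq] at hab
  rw [h hab.1, h' hab.2]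

def encFlags (s : Bool × Bool) : Data := .ofBool s.1 :+ .ofBool s.2

theorem encFlags_injective : Function.Injective encFlags :=
  pair_injective Data.ofBool_injective Data.ofBool_injective

def encDec (a : List Bool × Bool) : Data := .ofBits a.1 :+ .ofBool a.2

theorem encDec_injective : Function.Injective encDec :=
  pair_injective Data.ofBits_injective Data.ofBool_injective

section
variable {ι : Type} {W : ι → ℕ}
variable {n : ι → ℕ} {f : ∀ x, Pt (n x) → Bool} {D : ∀ x, PMF (Pt (n x))}

theorem pDecRound_poly {e : ι → Data} {s : ι → Bool × Bool} {u : ∀ x, Pt (n x)}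
    {B : ∀ x, Blk (n x)} :
    Poly W (fun x => ⟨n x, f x, D x⟩) pDecRound
      (fun x => e x :+ encFlags (s x) :+ .ofVec (u x) :+
        (B x).enc :+ .unary (n x))
      (fun x => ((unif (n x)).map fun b =>
        ((s x).1 || !((B x).res (f x) (fun i => b i ^^ u x i) ^^ (B x).res (f x) b),
          (s x).2 || ((B x).res (f x) (fun i => b i ^^ u x i) ^^ (B x).res (f x) b))).map encFlags)
      (fun _ => 2) := by
  refine Poly.mono (Q := fun _ => 0 + 2) (Poly.congr (Poly.pushM (Q' := fun _ => 2)
    (α := fun x => Pt (n x)) (encA := fun x => .ofVec) (a := fun x => .unary (n x))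
    (μ := fun x => unif (n x)) (ν := fun x b => PMF.pure (encFlags
      ((s x).1 || !((B x).res (f x) (fun i => b i ^^ u x i) ^^ (B x).res (f x) b),
          (s x).2 || ((B x).res (f x) (fun i => b i ^^ u x i) ^^ (B x).res (f x) b))))
            (fun x => Data.ofVec_injective _) ?_ pRndU_poly ?_) fun x => ?_) fun _ => le_rfl
  · exact fun x σ h => by simp [h]
  · refine Poly.mono (Q := fun _ => 1 + (1 + (0 + 0))) (Poly.pushQ
      (ι := Σ x, {b // b ∈ (unif (n x)).support})
      (a := fun x => (.ofVec x.2.1 :+ .ofVec (u x.1) :+ .nil) :+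
        .ofVec (B x.1).Z :+ .ofVec (B x.1).a)
      (a' := fun x => .ofBool ((B x.1).res (f x.1) fun i => x.2.1 i ^^ u x.1 i))
      (fun x σ h => by simp [h, Blk.enc, Expr.drop]) (?_) ?_) fun _ => le_rfl
    · refine Poly.congr (pPoint_poly (ι := Σ x, {b // b ∈ (unif (n x)).support})
        (n := fun x => n x.1) (f := fun x => f x.1) (D := fun x => D x.1) (x := fun x => x.2.1)
        (Z := fun x => (B x.1).Z) (w := fun x => (B x.1).a) (y := fun x => .ofVec (u x.1))
        (z := fun _ => .nil) bXor) fun x => ?_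
      simp [Data.toVec_ofVec, bXor, Blk.res]
    · refine Poly.pushQ (ι := Σ x, {b // b ∈ (unif (n x)).support})
        (a := fun x => (.ofVec x.2.1 :+ .nil :+ .nil) :+
          .ofVec (B x.1).Z :+ .ofVec (B x.1).a)
        (a' := fun x => .ofBool ((B x.1).res (f x.1) x.2.1))
        (fun x σ h => by simp [h, Blk.enc, Expr.drop]) (?_) ?_
      · refine Poly.congr (pPoint_poly (ι := Σ x, {b // b ∈ (unif (n x)).support})
          (n := fun x => n x.1) (f := fun x => f x.1) (D := fun x => D x.1) (x := fun x => x.2.1)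
          (Z := fun x => (B x.1).Z) (w := fun x => (B x.1).a) (y := fun x => .nil)
          (z := fun _ => .nil) bFst) fun x => ?_
        simp [bFst, Blk.res]
      · refine Poly.bit (fun x : Σ x, {b // b ∈ (unif (n x)).support} =>
          [(B x.1).res (f x.1) x.2.1, (B x.1).res (f x.1) fun i => x.2.1 i ^^ u x.1 i])
            (fun x σ h => by simp [h]) ?_
        refine Poly.bit (fun x : Σ x, {b // b ∈ (unif (n x)).support} =>
          [(B x.1).res (f x.1) x.2.1 ^^ (B x.1).res (f x.1) fun i => x.2.1 i ^^ u x.1 i,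
            (s x.1).1]) (fun x σ h => by simp [h, bXor, encFlags]) ?_
        refine Poly.bit (fun x : Σ x, {b // b ∈ (unif (n x)).support} =>
          [(s x.1).2, (B x.1).res (f x.1) x.2.1 ^^ (B x.1).res (f x.1) fun i => x.2.1 i ^^ u x.1
            i]) (fun x σ h => by simp [h, bXor, encFlags]) ?_
        exact PolyD.assign fun x σ h => by simp [h, encFlags, bOr, Bool.xor_comm]
  · rw [PMF.map_comp, ← PMF.bind_pure_comp]
    rfl

theorem pDecBlk_poly {u : ∀ x, Pt (n x)} {B : ∀ x, Blk (n x)} {L : ι → ℕ} :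
    Poly W (fun x => ⟨n x, f x, D x⟩) (.forEach pDecRound)
      (fun x => .unary (L x) :+ encFlags (false, false) :+ .ofVec (u x) :+
        (B x).enc :+ .unary (n x))
      (fun x => (decBlk (f x) (u x) (L x) (B x)).map encFlags) (fun x => L x * 2) := by
  refine Poly.loop (α := fun _ => Bool × Bool) (β := fun _ => Data)
    (fun _ => encFlags) (fun _ => id) (fun x => encFlags_injective)
    (fun x => List.replicate (L x) (.nil :+ .nil)) (fun _ _ _ => True)
    (fun x _ s => (unif (n x)).map fun b =>
        (s.1 || !((B x).res (f x) (fun i => b i ^^ u x i) ^^ (B x).res (f x) b),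
          s.2 || ((B x).res (f x) (fun i => b i ^^ u x i) ^^ (B x).res (f x) b)))
    (fun x => (false, false)) (fun x => .ofVec (u x) :+ (B x).enc :+ .unary (n x))
    (fun x => 2) (fun x => by rw [List.map_id, Data.unary_eq (L x)]) (fun x => by rw [decBlk])
    (fun x => by simp) ?_ (fun _ _ _ _ _ _ _ _ => trivial) (fun _ => trivial) ?_
  · refine ⟨Polynomial.C 7, fun x j a _ => ?_⟩
    have h1 := Data.size_ofBool_le a.1
    have h2 := Data.size_ofBool_le a.2
    simp [encFlags]; omega
  · exact pDecRound_poly (ι := LoopIx ι (fun x => Bool × Bool) (fun _ => Data)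
      (fun x => List.replicate (L x) (.nil :+ .nil)) fun x j s => True)
      (n := fun y => n y.x) (f := fun y => f y.x) (D := fun y => D y.x) (e := fun y => y.b)
      (s := fun y => y.a) (u := fun y => u y.x) (B := fun y => B y.x)

theorem pDecStep_poly {B : ∀ x, Blk (n x)} {a : ι → List Bool × Bool} {u : ∀ x, Pt (n x)}
    {d d' : ι → Data} {L : ι → ℕ} :
    Poly W (fun x => ⟨n x, f x, D x⟩) pDecStep
      (fun x => (B x).enc :+ encDec (a x) :+ .ofVec (u x) :+ d x :+
        d' x :+ .unary (L x) :+ .unary (n x))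
      (fun x => (decStep (f x) (u x) (L x) (B x) (a x)).map encDec) (fun x => L x * 2) := by
  refine Poly.mono (Q := fun x => L x * 2 + 0) (Poly.congr (Poly.pushM (Q' := fun _ => 0)
    (α := fun x => Bool × Bool) (encA := fun x => encFlags) (a := fun x => .unary (L x) :+
      encFlags (false, false) :+ .ofVec (u x) :+ (B x).enc :+ .unary (n x))
    (μ := fun x => decBlk (f x) (u x) (L x) (B x)) (ν := fun x s => PMF.pure (encDec
      (s.2 :: (a x).1, (a x).2 || (s.1 && s.2)))) (fun x => encFlags_injective) ?_ pDecBlk_poly ?_)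
        fun x => ?_) fun _ => le_rfl
  · exact fun x σ h => by simp [h, encFlags]
  · refine Poly.bit (fun x : Σ x,
      {s // s ∈ (decBlk (f x) (u x) (L x) (B x)).support} => [(a x.1).2, x.2.1.1, x.2.1.2])
        (fun x σ h => by simp [h, encDec, encFlags]) <| PolyD.assign fun x σ h => ?_
    simp [h, encDec, encFlags, Data.ofBits]
  · rw [decStep, PMF.map_comp, ← PMF.bind_pure_comp]
    rfl

theorem length_of_mem_decode {n : ℕ} {f : Pt n → Bool} {u : Pt n} {L : ℕ} :
    ∀ {l : List (Blk n)} {a a' : List Bool × Bool}, a' ∈ (foldK (decStep f u L) l a).support →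
      a'.1.length = a.1.length + l.length
  | [], a, a', h => by simp [foldK] at h; simp [h]
  | B :: l, a, a', h => by
    rw [foldK, PMF.mem_support_bind_iff] at h
    obtain ⟨a1, h1, h2⟩ := h
    rw [decStep, PMF.mem_support_map_iff] at h1
    obtain ⟨s, -, rfl⟩ := h1
    rw [length_of_mem_decode h2]
    simp; omega

theorem pDecode_poly {u : ∀ x, Pt (n x)} {l : ∀ x, List (Blk (n x))} {L : ι → ℕ} :
    Poly W (fun x => ⟨n x, f x, D x⟩) pDecode
      (fun x => .ofVec (u x) :+ ctxD (l x) (L x))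
      (fun x => (decode (f x) (u x) (L x) (l x)).map encDec)
      (fun x => (l x).length * (L x * 2)) := Poly.intro fun hs => by
  refine Poly.mono (Q := fun x => (l x).length * (L x * 2)) (Poly.seqD (mid := fun x =>
    .ofList ((l x).reverse.map Blk.enc) :+ encDec ([], false) :+
      .ofVec (u x) :+ ctxD (l x) (L x)) (PolyD.assign fun x σ h => by
        simp [h, ctxD, encDec, Data.ofBits]) ?_) fun _ => le_rfl
  have hl : Bdd W fun x => (l x).length := by
    have := hs.snd.fst.length
    simpa using this
  refine Poly.loop (α := fun _ => List Bool × Bool) (β := fun x => Blk (n x))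
    (fun _ => encDec) (fun _ => Blk.enc) (fun x => encDec_injective)
    (fun x => (l x).reverse) (fun x j a => a.1.length + j ≤ (l x).length)
    (fun x => decStep (f x) (u x) (L x))
    (fun x => ([], false)) (fun x => .ofVec (u x) :+ ctxD (l x) (L x))
    (fun x => L x * 2) (fun x => rfl) (fun x => rfl)
    (fun x => by simp) (Bdd.acc (((Bdd.const 4).mul hl).add (Bdd.const 5)) ?_) ?_ (by simp)
    ?_
  · rintro x j a h
    have h1 := Data.size_ofBool_le a.2
    have h2 := Data.size_ofBits_le a.1
    simp only [encDec, Data.size]; omega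
  · rintro x j B - a h a' ha'
    rw [decStep, PMF.mem_support_map_iff] at ha'
    obtain ⟨s, -, rfl⟩ := ha'
    simp; omega
  · exact pDecStep_poly (ι := LoopIx ι (fun x => List Bool × Bool) (fun x => Blk (n x))
      (fun x => (l x).reverse) fun x j a => a.1.length + j ≤ (l x).length)
      (n := fun y => n y.x) (f := fun y => f y.x) (D := fun y => D y.x) (B := fun y => y.b)
      (a := fun y => y.a) (u := fun y => u y.x) (L := fun y => L y.x)
      (d := fun y => .ofList ((l y.x).map Blk.enc))
      (d' := fun y => .ofList ((l y.x).reverse.map Blk.enc))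

theorem pUnite_poly {O : ι → Oracle} {y : ι → Data} {l : ∀ x, List (Blk (n x))} {L : ι → ℕ} :
    PolyD W O pUnite (fun x => y x :+ ctxD (l x) (L x))
      (fun x => .ofVec (unite (l x) (y x))) := Poly.intro fun hs => by
  have hn : Bdd W n := hs.snd.snd.snd.snd.of_unary
  refine PolyD.seq (PolyD.push (a := fun x => (.ofVec fun _ : Fin (n x) => true) :+
    .nil :+ .nil) (fun x σ h => by simp [h, ctxD, ofUnary]) (pZip_poly _)) ?_
  let enc : ∀ x, Data × Pt (n x) → Data := fun x p => p.1 :+ .ofVec p.2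
  refine PolyD.seq (PolyD.assign (out := fun x => .ofList ((l x).map Blk.enc) :+
    enc x (y x, fun _ => false) :+ .nil) fun x σ h => by simp [h, ctxD, enc]) ?_
  refine PolyD.seq (mid := fun x => enc x ((l x).foldl (fun (a : Data × Pt (n x)) B =>
    (a.1.tl, if a.1.hd.truth then vor B.Z a.2 else a.2)) (y x, fun _ => false))) ?_ <|
      PolyD.assign fun x σ h => by simp [h, enc, unite]
  refine PolyD.loop (α := fun x => Data × Pt (n x)) (β := fun x => Blk (n x)) enc
    (fun _ => Blk.enc) (fun x => pair_injective (e := fun d => d) (fun _ _ h => h)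
      (Data.ofVec_injective _)) l
    (fun x j a => a.1.size ≤ (y x).size)
    (fun x B a => (a.1.tl, if a.1.hd.truth then vor B.Z a.2 else a.2))
    (fun x => (y x, fun _ => false)) (fun x => .nil)
    (fun x => rfl) (fun x => rfl) (Bdd.acc (hs.fst.add (((Bdd.const 4).mul hn).add (Bdd.const 2)))
      ?_)
    ?_ (by simp) ?_
  · rintro x j a h
    have h2 := Data.size_ofVec_le a.2
    simp only [enc, Data.size]; omega
  · intro x j B _ a h
    exact (Data.size_tl_le _).trans h
  · refine Poly.cond (fun y => y.a.1.hd.truth) (fun y σ h => by simp [h, enc]) ?_ ?_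
    · refine PolyD.seq (PolyD.push (a := fun y =>
        .ofVec y.1.b.Z :+ .ofVec y.1.a.2 :+ .nil) (fun y σ h => by
          simp [h, enc, Blk.enc]) <| by
            exact pZip_poly (ι := {z : LoopIx ι (fun x => Data × Pt (n x))
              (fun x => Blk (n x)) l (fun x _ a => a.1.size ≤ (y x).size) // z.a.1.hd.truth = true})
              (n := fun z => n z.1.x) (A := fun z => z.1.b.Z) bOr) <| PolyD.assign fun y σ h => ?_
      have := y.2
      simp [h, enc, this, Data.toVec_ofVec, bOr]
      rfl
    · refine PolyD.assign fun y σ h => ?_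
      have := y.2
      simp [h, enc, this]

end

/-! ### The oracles that are offered to the learner -/

theorem foldl_unite {n : ℕ} (i : Fin n) : ∀ (l : List (Blk n)) (y : Data) (P : Pt n),
    ((l.foldl (fun (a : Data × Pt n) B =>
      (a.1.tl, if a.1.hd.truth then vor B.Z a.2 else a.2)) (y, P)).2 i = true ↔
    P i = true ∨ ∃ j : ℕ, ∃ h : j < l.length, (Data.tl^[j] y).hd.truth = true ∧ (l[j]).Z i = true)
  | [], y, P => by simp
  | B :: l, y, P => by
    rw [List.foldl_cons, foldl_unite i l]
    constructor
    · rintro (h | ⟨j, hj, h⟩)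
      · simp only at h
        split_ifs at h with hy
        · simp only [vor, Bool.or_eq_true] at h
          rcases h with h | h
          · exact Or.inr ⟨0, by simp, hy, h⟩
          · exact Or.inl h
        · exact Or.inl h
      · exact Or.inr ⟨j + 1, by simpa using hj, by simpa [Function.iterate_succ_apply] using h⟩
    · rintro (h | ⟨j, hj, h⟩)
      · refine Or.inl ?_
        simp only
        split_ifs
        · simp [vor, h]
        · exact h
      · cases j with
        | zero =>
          simp only [Function.iterate_zero, id_eq, List.getElem_cons_zero] at h
          refine Or.inl ?_
          simp only [h.1, if_true, vor, h.2, Bool.true_or]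
        | succ j =>
          exact Or.inr ⟨j, by simpa using hj, by simpa [Function.iterate_succ_apply] using h⟩

theorem unite_iff {n : ℕ} (l : List (Blk n)) (y : Data) (i : Fin n) : unite l y i = true ↔
    ∃ j : Fin l.length, Data.toVec l.length y j = true ∧ (l[j]).Z i = true := by
  rw [unite, foldl_unite]
  simp only [Bool.false_eq_true, false_or]
  constructor
  · rintro ⟨j, hj, h⟩
    exact ⟨⟨j, hj⟩, h⟩
  · rintro ⟨j, h⟩
    exact ⟨j.1, j.2, h⟩

/-- The simulated learner may query an arbitrary tree. `unite` reads it in the same way as the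
oracle does, and ignores everything beyond the first `l.length` entries. -/
theorem unite_toVec {n : ℕ} (l : List (Blk n)) (y : Data) :
    unite l (.ofVec (Data.toVec l.length y)) = unite l y := by
  funext i
  rw [Bool.eq_iff_iff, unite_iff, unite_iff, Data.toVec_ofVec]

/-- The function of the blocks that is given to the learner. -/
def blkFun {n : ℕ} (f : Pt n → Bool) (l : List (Blk n)) (y : Pt l.length) : Bool :=
  f (unite l (.ofVec y))

def bitsVec (m : ℕ) (z : List Bool) : Pt m := fun i => z.getD i.1 false

theorem ofBits_eq_ofVec {m : ℕ} {z : List Bool} (h : z.length = m) :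
    Data.ofBits z = .ofVec (bitsVec m z) := by
  subst h
  rw [Data.ofVec]
  congr 1
  refine List.ext_getElem (by simp) fun i h1 h2 => ?_
  simp [bitsVec, h1]

/-- The distribution of the decoded examples. -/
def decD {n : ℕ} (f : Pt n → Bool) (D : PMF (Pt n)) (L : ℕ) (l : List (Blk n)) :
    PMF (Pt l.length) :=
  (D.bind fun u => decode f u L l).map fun a => bitsVec l.length a.1

theorem decD_map_ofVec {n : ℕ} (f : Pt n → Bool) (D : PMF (Pt n)) (L : ℕ)
    (l : List (Blk n)) : (decD f D L l).map Data.ofVec =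
      (D.bind fun u => decode f u L l).map fun a => .ofBits a.1 := by
  rw [decD, PMF.map_comp]
  refine map_congr_support _ fun a ha => ?_
  rw [PMF.mem_support_bind_iff] at ha
  obtain ⟨u, -, ha⟩ := ha
  have := length_of_mem_decode ha
  simp only [List.length_nil, Nat.zero_add, List.length_reverse] at this
  exact (ofBits_eq_ofVec this).symm

def pQueryHook : Cmd := pUnite ;; pQuery (.var 0) ;; .assign 0 (.hd (.var 0))
def pCoins : Cmd := .assign 0 (.nth 0) ;; pRnd
def pDecSample : Cmd := pSample ;; pDecode ;; .assign 0 (.hd (.var 0))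

section
variable {ι : Type} {W : ι → ℕ}
variable {n : ι → ℕ} {f : ∀ x, Pt (n x) → Bool} {D : ∀ x, PMF (Pt (n x))}

/-- The queried tree is chosen by the simulated program, so the family is indexed by pairs and its
size enters the measure. -/
theorem pQueryHook_spec {l : ∀ x, List (Blk (n x))} {L : ι → ℕ}
    (hs : SBdd W fun x => ctxD (l x) (L x)) :
    ∃ P : Polynomial ℕ, ∀ x y, Spec ⟨n x, f x, D x⟩ pQueryHook (y :+ ctxD (l x) (L x))
      (PMF.pure (.ofBool (blkFun (f x) (l x) (y.toVec (l x).length)))) (P.eval (W x + y.size))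
        1 := by
  have hs1 : SBdd (fun p : ι × Data => W p.1 + p.2.size)
      fun p => p.2 :+ ctxD (l p.1) (L p.1) := by
    refine SBdd.cons ⟨Polynomial.X, fun p => by simp⟩ ?_
    obtain ⟨P, hP⟩ := hs
    exact ⟨P, fun p => (hP p.1).trans (eval_mono P (Nat.le_add_right _ _))⟩
  have h : Poly (fun p : ι × Data => W p.1 + p.2.size) (fun p => ⟨n p.1, f p.1, D p.1⟩) pQueryHook
      (fun p => p.2 :+ ctxD (l p.1) (L p.1))
      (fun p => PMF.pure (.ofBool (blkFun (f p.1) (l p.1) (p.2.toVec (l p.1).length))))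
      (fun _ => 1 + 0) := by
    refine Poly.mono (Q := fun _ => 1 + 0) (Poly.seqD pUnite_poly <| Poly.seqQ
      (pQuery_poly (y := fun p => .ofVec (unite (l p.1) p.2)) fun x σ h => by simp [h])
      <| PolyD.assign fun p σ h => ?_) fun _ => le_rfl
    simp only [Expr.eval, h, Data.hd_cons]
    rw [Data.toVec_ofVec, blkFun, unite_toVec]
  obtain ⟨P, hP⟩ := h hs1
  exact ⟨P, fun x y => hP (x, y)⟩

theorem pCoins_poly {O : ι → Oracle} {l : ∀ x, List (Blk (n x))} {L : ι → ℕ} :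
    Poly W O pCoins (fun x => ctxD (l x) (L x))
      (fun x => (unif (l x).length).map fun v => .ofVec v) (fun _ => 0) := by
  refine Poly.seqD (mid := fun x => .ofList ((l x).map Blk.enc))
    (PolyD.assign fun x σ h => by simp [h, ctxD]) <| Poly.congr pRnd_poly fun x => ?_
  have key : ∀ m m' : ℕ, m = m' → ((unif m).map fun v => Data.ofVec v) =
      (unif m').map fun v => Data.ofVec v := by
    rintro m _ rfl
    rfl
  exact key _ _ (by simp)

theorem pSampleDecode_poly {l : ∀ x, List (Blk (n x))} {L : ι → ℕ} :
    Poly W (fun x => ⟨n x, f x, D x⟩) pDecSample (fun x => ctxD (l x) (L x))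
      (fun x => (decD (f x) (D x) (L x) (l x)).map fun v => .ofVec v)
      (fun x => 1 + (l x).length * (L x * 2)) := Poly.intro fun hs => by
  have hn : Bdd W n := hs.snd.snd.snd.of_unary
  refine Poly.mono (Q := fun x => 1 + ((l x).length * (L x * 2) + 0)) (Poly.congr (Poly.seqM
    (α := fun x => Pt (n x)) (μ := D) (enc := fun x u => .ofVec u :+ ctxD (l x) (L x))
    (ν := fun x u => (decode (f x) u (L x) (l x)).map fun a => .ofBits a.1)
    (Q' := fun x => (l x).length * (L x * 2) + 0) ?_ (pSample_poly hn) ?_) fun x => ?_)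
    fun _ => le_rfl
  · intro x v v' h
    simp only [Data.cons.injEq, and_true] at h
    exact Data.ofVec_injective _ h
  · refine Poly.congr (Poly.seqM (ι := Σ x, {u // u ∈ (D x).support})
      (α := fun _ => List Bool × Bool) (μ := fun x => decode (f x.1) x.2.1 (L x.1) (l x.1))
      (enc := fun _ => encDec) (ν := fun _ a => PMF.pure (.ofBits a.1))
      (Q := fun x => (l x.1).length * (L x.1 * 2)) (Q' := fun _ => 0) (fun _ => encDec_injective) ?_
      <| PolyD.assign fun x σ h => by simp [h, encDec]) fun x => ?_
    · exact pDecode_poly (ι := Σ x, {u // u ∈ (D x).support}) (n := fun x => n x.1)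
        (f := fun x => f x.1) (D := fun x => D x.1) (u := fun x => x.2.1) (l := fun x => l x.1)
        (L := fun x => L x.1)
    · rw [← PMF.bind_pure_comp]; rfl
  · rw [decD_map_ofVec, PMF.map_bind]

end

/-! ### Checking a hypothesis; the verdict -/

/-- One round of `check`: decode an example and compare `v` with `f`. -/
def checkStep {n : ℕ} (f : Pt n → Bool) (D : PMF (Pt n)) (L : ℕ) (l : List (Blk n))
    (v : Pt n → Bool) (a : ℕ × Bool) : PMF (ℕ × Bool) :=
  (D.bind fun u => (decode f u L l).map fun z => (z, u)).map fun p =>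
    (if v (Data.toVec n (.ofBits p.1.1)) ^^ f p.2 then a.1 + 1 else a.1, a.2 || p.1.2)

/-- The number of mismatches between `f` and `v`, and whether decoding fails for some example. -/
def check {n : ℕ} (f : Pt n → Bool) (D : PMF (Pt n)) (L N : ℕ) (l : List (Blk n))
    (v : Pt n → Bool) : PMF (ℕ × Bool) :=
  foldK (fun _ => checkStep f D L l v) (List.replicate N (Data.cons .nil .nil)) (0, false)

/-- The input is `(_, accumulator, representation, index, context)`; `E` evaluates the
representation. -/
def pCheckStep (E : Cmd) : Cmd :=
  .push (.rest 4) (pSample ;; .push (.var 0) pDecode) ;;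
  .push (.hd (.tl (.nth 0)) :* .nil :* .nil) (pQZip bFst) ;;
  .push (.drop 3 (.rest 6) :* .hd (.hd (.nth 1)) :* .nil) (pZip fun l => l.getD 1 false) ;;
  .push (.nth 6 :* .nth 5 :* .nth 0) E ;;
  pBit bXor [.nth 0, .nth 2] ;;
  pBit bOr [.tl (.nth 6), .tl (.hd (.nth 4))] ;;
  .cond (.nth 1) (.assign 0 ((.tt :* .hd (.nth 7)) :* .nth 0))
    (.assign 0 (.hd (.nth 7) :* .nth 0))

def encChk (a : ℕ × Bool) : Data := .unary a.1 :+ .ofBool a.2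

theorem encChk_injective : Function.Injective encChk :=
  pair_injective Data.unary_injective Data.ofBool_injective

section
variable {ι : Type} {W : ι → ℕ}
variable {n : ι → ℕ} {f : ∀ x, Pt (n x) → Bool} {D : ∀ x, PMF (Pt (n x))}

/-- `E` evaluates the representation `r` with index `e` of `v`. -/
def Evaluates (W : ι → ℕ) (f : ∀ x, Pt (n x) → Bool) (D : ∀ x, PMF (Pt (n x)))
    (E : Cmd) (e r : ι → Data) (v : ∀ x, Pt (n x) → Bool) : Prop :=
  ∃ P : Polynomial ℕ, ∀ x y, Spec ⟨n x, f x, D x⟩ E (e x :+ r x :+ .ofVec y)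
    (PMF.pure (.ofBool (v x y))) (P.eval (W x)) 0

theorem pExample_poly {l : ∀ x, List (Blk (n x))} {L : ι → ℕ} :
    Poly W (fun x => ⟨n x, f x, D x⟩) (pSample ;; .push (.var 0) pDecode)
      (fun x => ctxD (l x) (L x))
      (fun x => ((D x).bind fun u => (decode (f x) u (L x) (l x)).map fun z => (z, u)).map
        fun p => encDec p.1 :+ .ofVec p.2 :+ ctxD (l x) (L x))
      (fun x => 1 + (l x).length * (L x * 2)) := Poly.intro fun hs => by
  have hn : Bdd W n := hs.snd.snd.snd.of_unary
  refine Poly.congr (Poly.seqM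
    (α := fun x => Pt (n x)) (μ := D) (enc := fun x u => .ofVec u :+ ctxD (l x) (L x))
    (ν := fun x u => (decode (f x) u (L x) (l x)).map fun z =>
      encDec z :+ .ofVec u :+ ctxD (l x) (L x))
    (Q' := fun x => (l x).length * (L x * 2)) ?_ (pSample_poly hn) ?_) fun x => ?_
  · intro x v v' h
    simp only [Data.cons.injEq, and_true] at h
    exact Data.ofVec_injective _ h
  · refine Poly.congr (Poly.push (ι := Σ x, {u // u ∈ (D x).support}) ?_ <|
      pDecode_poly (ι := Σ x, {u // u ∈ (D x).support}) (n := fun x => n x.1)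
        (f := fun x => f x.1) (D := fun x => D x.1) (u := fun x => x.2.1) (l := fun x => l x.1)
        (L := fun x => L x.1)) fun x => ?_
    · exact fun x σ h => h
    · rw [PMF.map_comp]; rfl
  · simp only [PMF.map_bind, PMF.map_comp]; rfl

/-- The deterministic part of a round of `check`. -/
theorem pCheckTail_poly {E : Cmd} {e r s : ι → Data} {v : ∀ x, Pt (n x) → Bool}
    {l : ∀ x, List (Blk (n x))} {L : ι → ℕ} {a : ι → ℕ × Bool} {z : ι → List Bool × Bool}
    {u : ∀ x, Pt (n x)}
    (hE : Evaluates W f D E e r v) :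
    Poly W (fun x => ⟨n x, f x, D x⟩)
      (.push (.hd (.tl (.nth 0)) :* .nil :* .nil) (pQZip bFst) ;;
        .push (.drop 3 (.rest 6) :* .hd (.hd (.nth 1)) :* .nil)
          (pZip fun l => l.getD 1 false) ;;
        .push (.nth 6 :* .nth 5 :* .nth 0) E ;;
        pBit bXor [.nth 0, .nth 2] ;;
        pBit bOr [.tl (.nth 6), .tl (.hd (.nth 4))] ;;
        .cond (.nth 1) (.assign 0 ((.tt :* .hd (.nth 7)) :* .nth 0))
          (.assign 0 (.hd (.nth 7) :* .nth 0)))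
      (fun x => (encDec (z x) :+ .ofVec (u x) :+ ctxD (l x) (L x)) :+
        s x :+ encChk (a x) :+ r x :+ e x :+ ctxD (l x) (L x))
      (fun x => PMF.pure (encChk
        (if v x (Data.toVec (n x) (.ofBits (z x).1)) ^^ f x (u x) then (a x).1 + 1 else (a x).1,
          (a x).2 || (z x).2))) (fun _ => 1) := by
  obtain ⟨P, hP⟩ := hE
  refine Poly.mono (Q := fun _ => 1 + (0 + (0 + (0 + (0 + 0))))) (Poly.pushQ
    (a := fun x => .ofVec (u x) :+ .nil :+ .nil) (a' := fun x => .ofBool (f x (u x))) ?_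
    (Poly.congr (pQZip_poly bFst) fun x => ?_) <| Poly.pushQ
    (a := fun x => (.ofVec fun _ : Fin (n x) => true) :+ .ofBits (z x).1 :+ .nil)
    (a' := fun x => .ofVec (Data.toVec (n x) (.ofBits (z x).1))) ?_
    (PolyD.congr (pZip_poly _) fun x => ?_) <| Poly.pushQ
    (a := fun x => e x :+ r x :+ .ofVec (Data.toVec (n x) (.ofBits (z x).1)))
    (a' := fun x => .ofBool (v x (Data.toVec (n x) (.ofBits (z x).1)))) ?_
    (fun _ => ⟨P, fun x => hP x _⟩) <| Poly.bit (fun x =>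
      [v x (Data.toVec (n x) (.ofBits (z x).1)), f x (u x)]) ?_ <| Poly.bit
        (fun x => [(a x).2, (z x).2]) ?_ <| Poly.cond
      (fun x => v x (Data.toVec (n x) (.ofBits (z x).1)) ^^ f x (u x)) ?_
      (PolyD.assign ?_) (PolyD.assign ?_)) fun _ => by simp
  · exact fun x σ h => by simp [h]
  · simp [bFst]
  · exact fun x σ h => by simp [h, Expr.drop, ctxD, ofUnary, encDec]
  · rfl
  · exact fun x σ h => by simp [h]
  · exact fun x σ h => by simp [h]
  · exact fun x σ h => by simp [h, encChk, encDec]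
  · exact fun x σ h => by simp [h, bXor]
  · rintro ⟨x, hx⟩ σ h
    simp [h, encChk, hx, Data.unary_succ, bOr]
  · rintro ⟨x, hx⟩ σ h
    simp [h, encChk, hx, bOr]

theorem pCheckStep_poly {E : Cmd} {e r s : ι → Data} {v : ∀ x, Pt (n x) → Bool}
    {l : ∀ x, List (Blk (n x))} {L : ι → ℕ} {a : ι → ℕ × Bool}
    (hE : Evaluates W f D E e r v) :
    Poly W (fun x => ⟨n x, f x, D x⟩) (pCheckStep E)
      (fun x => s x :+ encChk (a x) :+ r x :+ e x :+ ctxD (l x) (L x))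
      (fun x => (checkStep (f x) (D x) (L x) (l x) (v x) (a x)).map encChk)
      (fun x => 1 + (l x).length * (L x * 2) + 1) := by
  obtain ⟨P, hP⟩ := hE
  refine Poly.congr (Poly.pushM (α := fun x => (List Bool × Bool) × Pt (n x))
    (a := fun x => ctxD (l x) (L x))
    (encA := fun x p => encDec p.1 :+ .ofVec p.2 :+ ctxD (l x) (L x))
    (ν := fun x p => PMF.pure (encChk
        (if v x (Data.toVec (n x) (.ofBits p.1.1)) ^^ f x p.2 then (a x).1 + 1 else (a x).1,
          (a x).2 || p.1.2))) (Q' := fun _ => 1) ?_ ?_ pExample_poly <|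
    pCheckTail_poly (ι := Σ x, {p // p ∈ ((D x).bind fun u =>
      (decode (f x) u (L x) (l x)).map fun z => (z, u)).support}) (n := fun x => n x.1)
      (f := fun x => f x.1) (D := fun x => D x.1) (e := fun x => e x.1) (r := fun x => r x.1)
      (s := fun x => s x.1) (v := fun x => v x.1) (l := fun x => l x.1) (L := fun x => L x.1)
      (a := fun x => a x.1) (z := fun x => x.2.1.1) (u := fun x => x.2.1.2)
      ⟨P, fun x y => hP x.1 y⟩) fun x => ?_
  · rintro x ⟨z, u⟩ ⟨z', u'⟩ h
    simp only [Data.cons.injEq, and_true] at h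
    rw [encDec_injective h.1, Data.ofVec_injective _ h.2]
  · exact fun x σ h => by simp [h]
  · rw [checkStep, PMF.map_comp, ← PMF.bind_pure_comp]; rfl

theorem pCheck_poly {E : Cmd} {e r : ι → Data} {v : ∀ x, Pt (n x) → Bool}
    {l : ∀ x, List (Blk (n x))} {L N : ι → ℕ}
    (hE : Evaluates W f D E e r v) :
    Poly W (fun x => ⟨n x, f x, D x⟩) (.forEach (pCheckStep E))
      (fun x => .unary (N x) :+ encChk (0, false) :+ r x :+ e x :+
        ctxD (l x) (L x))
      (fun x => (check (f x) (D x) (L x) (N x) (l x) (v x)).map encChk)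
      (fun x => N x * (1 + (l x).length * (L x * 2) + 1)) := Poly.intro fun hs => by
  obtain ⟨P, hP⟩ := hE
  refine Poly.loop (α := fun x => ℕ × Bool) (β := fun _ => Data) (fun _ => encChk) (fun _ => id)
    (fun x => encChk_injective) (fun x => List.replicate (N x) (.nil :+ .nil))
    (fun x j a => a.1 + j ≤ N x) (fun x _ a => checkStep (f x) (D x) (L x) (l x) (v x) a)
    (fun x => (0, false)) (fun x => r x :+ e x :+ ctxD (l x) (L x))
    (fun x => 1 + (l x).length * (L x * 2) + 1)
    (fun x => by rw [List.map_id, Data.unary_eq (N x)]) (fun x => by rw [check]) (fun x => by simp)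
    (Bdd.acc (((Bdd.const 4).mul hs.fst.of_unary).add (Bdd.const 5)) ?_) ?_
      (fun x => by simp) ?_
  · intro x j a ha
    have := Data.size_ofBool_le a.2
    simp only [encChk, Data.size, Data.size_unary]
    omega
  · intro x j b _ a ha a' ha'
    rw [checkStep, PMF.mem_support_map_iff] at ha'
    obtain ⟨p, -, rfl⟩ := ha'
    simp only
    split_ifs <;> omega
  · exact pCheckStep_poly (ι := LoopIx ι (fun x => ℕ × Bool) (fun _ => Data)
      (fun x => List.replicate (N x) (.nil :+ .nil)) fun x j a => a.1 + j ≤ N x)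
      (n := fun y => n y.x) (f := fun y => f y.x) (D := fun y => D y.x) (e := fun y => e y.x)
      (r := fun y => r y.x) (s := fun y => y.b) (v := fun y => v y.x) (l := fun y => l y.x)
      (L := fun y => L y.x) (a := fun y => y.a) ⟨P, fun y => hP y.x⟩

end

/-- The verdict on the representation `r`. -/
def verdict (R : RepClass) (i : Idx) (f : Pt i.n → Bool) (D : PMF (Pt i.n))
    (L N : ℕ) (l : List (Blk i.n)) (r : Data) : PMF Bool :=
  open Classical in if R.valid i r then
    (check f D L N l (R.val i r)).map fun c => !c.2 && !(Data.tl^[60] (.unary c.1)).truth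
  else PMF.pure false

/-- The verdict on the blocks `l`, where `out` is the output of the learner. -/
def judge (R : RepClass) (i : Idx) (f : Pt i.n → Bool) (D : PMF (Pt i.n))
    (L N : ℕ) (l : List (Blk i.n)) (out : PMF Data) : PMF Bool :=
  (dictAll f l).bind fun b => if b then out.bind (verdict R i f D L N l) else PMF.pure false

/-- The input is `(r, |l|, reversed blocks, blocks, index, _, L, N, _)`. -/
def pVerdict (V E : Cmd) : Cmd :=
  .push (.nth 4 :* .nth 0) (.clean V) ;;
  .cond (.nth 0)
    (.assign 0 (.nth 8 :* (.nil :* .nil) :* .nth 1 :* .nth 5 :*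
      .nth 4 :* .nth 3 :* .nth 7 :* .drop 2 (.nth 5)) ;;
      .forEach (pCheckStep (.clean E)) ;;
      pBit (fun l => !l.getD 0 false && !l.getD 1 false) [.tl (.var 0), .drop 60 (.hd (.var 0))] ;;
      .assign 0 (.nth 0))
    (.assign 0 .nil)

/-- The input is `(blocks, index, argument, L, N, time + 1, MQ, ExQ, _)`. -/
def pJudge (A sh V E : Cmd) : Cmd :=
  .push (.nth 0 :* .drop 2 (.nth 1)) pDictAll ;;
  .cond (.nth 0)
    (.assign 0 (.rest 1) ;; .push (.nth 0) pRev ;; .push (.nth 1 :* .nil) pAdd ;;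
      .push (.nth 7 :* .nth 8 :* .nth 9 :*
        ((.nth 3 :* .nth 0) :* .nth 4) :*
          .nth 2 :* .nth 1 :* .nth 5 :* .drop 2 (.nth 3))
        (pRun A pQueryHook sh) ;;
      pVerdict V E)
    (.assign 0 .nil)

def RepClass.VerifiedBy (R : RepClass) (V : Cmd) (P : Polynomial ℕ) : Prop :=
  ∀ (i : Idx) (r : Data),
    (R.valid i r → ComputesIn V (Data.cons i.enc r) (Data.ofBool true) (P.eval (i.len + r.size))) ∧
    (¬ R.valid i r → ComputesIn V (Data.cons i.enc r) (Data.ofBool false) (P.eval (i.len + r.size)))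

def RepClass.EvaluatedBy (R : RepClass) (E : Cmd) (P : Polynomial ℕ) : Prop :=
  ∀ (i : Idx) (r : Data) (x : Pt i.n), R.valid i r →
    ComputesIn E (Data.cons i.enc (Data.cons r (Data.ofVec x))) (Data.ofBool (R.val i r x))
      (P.eval (i.len + r.size))

section
variable {ι : Type} {W : ι → ℕ}

theorem Idx.len_le_size (i : Idx) : i.len ≤ i.enc.size := by
  have := Data.length_le_size_ofBits i.p
  simp only [Idx.len, Idx.enc, Data.size, Data.size_unary]
  omega

theorem pBit_last_poly {O : ι → Oracle} {inp : ι → Data} {es : List Expr} {φ : List Bool → Bool}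
    (bs : ι → List Bool)
    (h : ∀ x, ∀ σ : ℕ → Data, σ 0 = inp x → es.map (fun e => (e.eval σ).truth) = bs x) :
    PolyD W O (pBit φ es ;; .assign 0 (.nth 0)) inp (fun x => .ofBool (φ (bs x))) :=
  PolyD.seq (pBit_poly es φ bs h) <| PolyD.assign fun x σ h => by simp [h]

variable {R : RepClass} {i : ι → Idx} {f : ∀ x, (Fin (i x).n → Bool) → Bool}
  {D : ∀ x, PMF (Fin (i x).n → Bool)} {l : ∀ x, List (Blk (i x).n)} {L N : ι → ℕ}

theorem pCheckAll_poly {E : Cmd} {P : Polynomial ℕ} {r : ι → Data}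
    (hE : R.EvaluatedBy E P) (hv : ∀ x, R.valid (i x) (r x)) :
    Poly W (fun x => ⟨(i x).n, f x, D x⟩)
      (.forEach (pCheckStep (.clean E)) ;;
        pBit (fun l => !l.getD 0 false && !l.getD 1 false) [.tl (.var 0), .drop 60 (.hd (.var 0))] ;;
        .assign 0 (.nth 0))
      (fun x => .unary (N x) :+ encChk (0, false) :+ r x :+
        (i x).enc :+ ctxD (l x) (L x))
      (fun x => ((check (f x) (D x) (L x) (N x) (l x) (R.val (i x) (r x))).map
        fun c => !c.2 && !(Data.tl^[60] (.unary c.1)).truth).map Data.ofBool)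
      (fun x => N x * (1 + (l x).length * (L x * 2) + 1)) := Poly.intro fun hs => by
  have h1 : Bdd W fun x => (i x).len + (r x).size :=
    (Bdd.mono hs.snd.snd.snd.fst fun x => (i x).len_le_size).add hs.snd.snd.fst
  obtain ⟨P', hP'⟩ := ((h1.eval P).add (Bdd.const (2 * E.bnd))).add (Bdd.const 1)
  refine Poly.mono (Q := fun x => N x * (1 + (l x).length * (L x * 2) + 1) + 0) (Poly.congr
    (Poly.seqM (α := fun _ => ℕ × Bool) (enc := fun _ => encChk)
    (μ := fun x => check (f x) (D x) (L x) (N x) (l x) (R.val (i x) (r x)))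
    (ν := fun x c => PMF.pure (.ofBool (!c.2 && !(Data.tl^[60] (.unary c.1)).truth)))
    (Q' := fun _ => 0) (fun _ => encChk_injective) (pCheck_poly (D := D) ⟨P', fun x y => ?_⟩)
    ?_) fun x => ?_) fun _ => le_rfl
  · exact (ComputesIn.spec (hE (i x) (r x) y (hv x))).mono (hP' x) le_rfl
  · refine PolyD.congr (pBit_last_poly (ι := Σ x, {c // c ∈ (check (f x) (D x) (L x) (N x) (l x)
      (R.val (i x) (r x))).support})
      (fun y => [y.2.1.2, (Data.tl^[60] (.unary y.2.1.1)).truth]) fun x σ h => ?_) fun y => rfl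
    simp [h, encChk, Expr.eval_drop]
  · rw [PMF.map_comp, ← PMF.bind_pure_comp]
    rfl

theorem pVerdict_poly {V E : Cmd} {P P' : Polynomial ℕ} {r q s t : ι → Data}
    (hV : R.VerifiedBy V P') (hE : R.EvaluatedBy E P) :
    Poly W (fun x => ⟨(i x).n, f x, D x⟩) (pVerdict V E)
      (fun x => r x :+ q x :+ .ofList ((l x).reverse.map Blk.enc) :+
        .ofList ((l x).map Blk.enc) :+ (i x).enc :+ s x :+ .unary (L x) :+
          .unary (N x) :+ t x)
      (fun x => (verdict R (i x) (f x) (D x) (L x) (N x) (l x) (r x)).map Data.ofBool)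
      (fun x => N x * (1 + (l x).length * (L x * 2) + 1)) := Poly.intro fun hs => by
  classical
  have h1 : Bdd W fun x => (i x).len + (r x).size :=
    (Bdd.mono hs.snd.snd.snd.snd.fst fun x => (i x).len_le_size).add hs.fst
  refine Poly.mono (Q := fun x => 0 + N x * (1 + (l x).length * (L x * 2) + 1)) (Poly.pushQ
    (a := fun x => (i x).enc :+ r x) (a' := fun x => .ofBool (decide (R.valid (i x) (r x)))) ?_
    (Poly.of_bdd (((h1.eval P').add (Bdd.const (2 * V.bnd))).add (Bdd.const 1)) fun x => ?_)
    <| Poly.cond (fun x => decide (R.valid (i x) (r x))) ?_ ?_ ?_) fun _ => by omega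
  · exact fun x σ h => by simp [h]
  · by_cases hv : R.valid (i x) (r x)
    · simpa only [hv, decide_true] using ComputesIn.spec ((hV (i x) (r x)).1 hv)
    · simpa only [hv, decide_false] using ComputesIn.spec ((hV (i x) (r x)).2 hv)
  · exact fun x σ h => by simp [h]
  · refine Poly.seqD (mid := fun y => .unary (N y.1) :+
      encChk (0, false) :+ r y.1 :+ (i y.1).enc :+ ctxD (l y.1) (L y.1))
      (PolyD.assign ?_) <| Poly.congr (pCheckAll_poly
        (ι := {x // decide (R.valid (i x) (r x)) = true})
        (i := fun y => i y.1) (f := fun y => f y.1) (D := fun y => D y.1) (l := fun y => l y.1)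
        (L := fun y => L y.1) (N := fun y => N y.1) (r := fun y => r y.1)
        hE (fun y => of_decide_eq_true y.2)) ?_
    · exact fun x σ h => by simp [h, ctxD, encChk, Idx.enc, Expr.drop, Data.unary_zero]
    · exact fun y => by rw [verdict, if_pos (of_decide_eq_true y.2)]
  · refine Poly.mono (Q := fun _ => 0) (Poly.congr (PolyD.assign (out := fun _ => .nil)
      fun _ _ _ => rfl) fun y => ?_) fun _ => Nat.zero_le _
    rw [verdict, if_neg (of_decide_eq_false y.2), PMF.pure_map]
    rfl

theorem pJudge_poly {A sh V E : Cmd} {P P' : Polynomial ℕ} {arg t : ι → Data} {T M Q : ι → ℕ}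
    {D' : ∀ x, PMF (Fin (l x).length → Bool)} {κ : ι → ℕ}
    (hs : SBdd W fun x => .ofList ((l x).map Blk.enc) :+ (i x).enc :+ arg x :+
      .unary (L x) :+ .unary (N x) :+ .unary (T x + 1) :+ .unary (M x) :+
        .unary (Q x) :+ t x)
    (hV : R.VerifiedBy V P') (hE : R.EvaluatedBy E P)
    (hsh : Poly W (fun x => ⟨(i x).n, f x, D x⟩) sh
      (fun x => ctxD (l x) (L x)) (fun x => (D' x).map fun v => .ofVec v) κ) :
    ∃ out : ι → PMF Data,
      Poly W (fun x => ⟨(i x).n, f x, D x⟩) (pJudge A sh V E)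
        (fun x => .ofList ((l x).map Blk.enc) :+ (i x).enc :+ arg x :+
          .unary (L x) :+ .unary (N x) :+ .unary (T x + 1) :+ .unary (M x) :+
            .unary (Q x) :+ t x)
        (fun x => (judge R (i x) (f x) (D x) (L x) (N x) (l x) (out x)).map Data.ofBool)
        (fun x => (l x).length * (128 * 6) + (M x + κ x * Q x +
          N x * (1 + (l x).length * (L x * 2) + 1))) ∧
      ∀ x, RunsAs A ⟨(l x).length, blkFun (f x) (l x), D' x⟩
        (((i x).enc :+ .unary (l x).length) :+ arg x) (T x) (M x) (Q x) (out x) := by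
  have hl : Bdd W fun x => (l x).length := by simpa using SBdd.length hs.fst
  have hen := hs.snd.fst
  have hk : SBdd W fun x => .unary (i x).k :+ .unary (i x).n := hen.snd
  have hrev : SBdd W fun x => .ofList ((l x).reverse.map Blk.enc) := hs.fst.of_le fun x => by
    have : ∀ l l' : List Data, l.Perm l' → (Data.ofList l).size = (Data.ofList l').size := by
      intro l l' h
      induction h with
      | nil => rfl
      | cons x _ ih => simp [ih]
      | swap x y l => simp; omega
      | trans _ _ ih ih' => rw [ih, ih']
    exact (this _ _ ((List.reverse_perm _).map _)).le
  have hctx : SBdd W fun x => ctxD (l x) (L x) :=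
    hs.fst.cons (hrev.cons (hs.snd.snd.snd.fst.cons hk.snd))
  obtain ⟨out, hout, hrun⟩ := pRun_poly (A := A) (qh := pQueryHook) (sh := sh) (T := T) (M := M)
    (Q := Q) (W := W) (inp := fun x => ((i x).enc :+ .unary (l x).length) :+ arg x)
    (X := fun x => ⟨⟨(i x).n, f x, D x⟩, ⟨(l x).length, blkFun (f x) (l x), D' x⟩,
      ctxD (l x) (L x), κ x⟩)
    (hs.snd.snd.snd.snd.snd.fst.cons (hs.snd.snd.snd.snd.snd.snd.fst.cons
      (hs.snd.snd.snd.snd.snd.snd.snd.fst.cons (((hen.cons (SBdd.unary hl)).cons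
        hs.snd.snd.fst).cons hctx)))) (pQueryHook_spec hctx) hsh
  refine ⟨out, ?_, hrun⟩
  refine Poly.mono (Q := fun x => (l x).length * (128 * 6) + (M x + κ x * Q x +
          N x * (1 + (l x).length * (L x * 2) + 1))) (Poly.congr (Poly.pushM (α := fun _ => Bool)
      (μ := fun x => dictAll (f x) (l x)) (encA := fun _ => Data.ofBool)
      (a := fun x => .ofList ((l x).map Blk.enc) :+ .unary (i x).n)
      (ν := fun x b => if b then (out x).bind fun r =>
        (verdict R (i x) (f x) (D x) (L x) (N x) (l x) r).map Data.ofBool else PMF.pure .nil)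
      (Q' := fun x => M x + κ x * Q x + N x * (1 + (l x).length * (L x * 2) + 1))
      (fun _ => Data.ofBool_injective) ?_
      pDictAll_poly <| Poly.cond (fun y => y.2.1) ?_ ?_ ?_) fun x => ?_)
      fun _ => le_rfl
  · exact fun x σ h => by simp [h, Idx.enc, Expr.drop]
  · exact fun x σ h => by simp [h]
  · have key : Poly W (fun x => ⟨(i x).n, f x, D x⟩) (.assign 0 (.rest 1) ;; .push (.nth 0) pRev ;;
          .push (.nth 1 :* .nil) pAdd ;;
        .push (.nth 7 :* .nth 8 :* .nth 9 :*
          ((.nth 3 :* .nth 0) :* .nth 4) :*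
            .nth 2 :* .nth 1 :* .nth 5 :* .drop 2 (.nth 3))
          (pRun A pQueryHook sh) ;;
        pVerdict V E) (fun x => .ofBool true :+ .ofList ((l x).map Blk.enc) :+
          (i x).enc :+ arg x :+ .unary (L x) :+ .unary (N x) :+
            .unary (T x + 1) :+ .unary (M x) :+ .unary (Q x) :+ t x)
        (fun x => (out x).bind fun r =>
          (verdict R (i x) (f x) (D x) (L x) (N x) (l x) r).map Data.ofBool)
        (fun x => M x + κ x * Q x + N x * (1 + (l x).length * (L x * 2) + 1)) := by
      refine Poly.seqD (mid := fun x => .ofList ((l x).map Blk.enc) :+ (i x).enc :+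
        arg x :+ .unary (L x) :+ .unary (N x) :+ .unary (T x + 1) :+
          .unary (M x) :+ .unary (Q x) :+ t x)
        (PolyD.assign ?_) <| Poly.seqD (PolyD.push
        (a := fun x => .ofList ((l x).map Blk.enc))
        (a' := fun x => .ofList ((l x).reverse.map Blk.enc)) ?_ <| PolyD.congr
          pRev_poly ?_) <| Poly.seqD (PolyD.push
        (a := fun x => .ofList ((l x).map Blk.enc) :+ .unary 0)
        (a' := fun x => .unary (l x).length) ?_ <| PolyD.congr
          pAdd_poly ?_) <| Poly.pushM (α := fun _ => Data) (μ := out)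
            (encA := fun _ d => d)
            (ν := fun x r => (verdict R (i x) (f x) (D x) (L x) (N x) (l x) r).map Data.ofBool)
            (Q' := fun x => N x * (1 + (l x).length * (L x * 2) + 1)) (fun _ _ _ h => h)
            (a := fun x => .unary (T x + 1) :+ .unary (M x) :+ .unary (Q x) :+
              (((i x).enc :+ .unary (l x).length) :+ arg x) :+ ctxD (l x) (L x))
            ?_ (Poly.congr hout fun x => ?_) ?_
      · exact fun x σ h => by simp [h]
      · exact fun x σ h => by simp [h]
      · exact fun x => by rw [List.map_reverse]
      · exact fun x σ h => by simp [h, Data.unary_zero]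
      · exact fun x => by simp
      · exact fun x σ h => by simp [h, ctxD, Idx.enc, Expr.drop]
      · exact (PMF.map_id _).symm
      · exact pVerdict_poly (ι := Σ x, {r // r ∈ (out x).support}) (i := fun y => i y.1)
          (f := fun y => f y.1) (D := fun y => D y.1) (l := fun y => l y.1) (L := fun y => L y.1)
          (N := fun y => N y.1) (r := fun y => y.2.1) (q := fun y => .unary (l y.1).length)
          (s := fun y => arg y.1) hV hE
    refine fun _ => ?_
    obtain ⟨P, hP⟩ := key ((SBdd.ofBool fun _ => true).cons hs)
    refine ⟨P, ?_⟩
    rintro ⟨⟨x, b, hb⟩, rfl : b = true⟩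
    simpa using hP x
  · refine Poly.mono (Q := fun _ => 0) (Poly.congr (PolyD.assign (out := fun _ => .nil)
      fun _ _ _ => rfl) ?_) fun _ => Nat.zero_le _
    rintro ⟨⟨x, b, hb⟩, rfl : b = false⟩
    rfl
  · rw [judge, PMF.map_bind]
    congr 1
    funext b
    cases b
    · simp [PMF.pure_map]
    · simp [PMF.map_bind]

end

theorem length_of_mem_masks {n s : ℕ} {R : List (Pt n)} (h : R ∈ (masks n s).support) :
    R.length = s := by
  have := foldK_support (fun j l => l.length + j = s) (List.replicate s (Data.cons .nil .nil))
    (fun j b _ a ha a' ha' => by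
      rw [PMF.mem_support_map_iff] at ha'
      obtain ⟨v, -, rfl⟩ := ha'
      simp; omega) _ (fun _ h => h) [] (by simp) R h
  simpa using this

theorem PState.add_count {n m K : ℕ} (f : Pt n → Bool) (R : List (Pt n))
    (u : Pt n) {s : PState n} (h : s.kc = 0 ∨ s.unv.length + s.ver.length + s.kc = K) :
    (s.add f R m u).kc = 0 ∨
      (s.add f R m u).unv.length + (s.add f R m u).ver.length + (s.add f R m u).kc = K := by
  simp only [PState.add, List.length_cons]
  omega

/-- Holds for every `f`: until the countdown hits zero, it complements the number of blocks. With `K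
= k + 1`, a positive countdown thus means at most `k` blocks, which makes the query bound of the
later stages unconditional. -/
theorem findBlks_count {n m K N : ℕ} {f : Pt n → Bool} {D : PMF (Pt n)}
    {R : List (Pt n)} {s : PState n} (hs : s ∈ (findBlks f D R m K N).support) :
    s.kc = 0 ∨ s.unv.length + s.ver.length + s.kc = K := by
  refine foldK_support (fun _ s => s.kc = 0 ∨ s.unv.length + s.ver.length + s.kc = K) _
    (fun j b _ s h s' hs' => ?_) _ (fun _ h => h) _ (by simp) s hs
  unfold PState.step at hs'
  split_ifs at hs' with h4 h5
  · rw [PMF.mem_support_map_iff] at hs'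
    obtain ⟨u, -, rfl⟩ := hs'
    unfold PState.try'
    split_ifs
    · exact PState.add_count _ _ _ h
    · exact h
  · simp at hs'
    exact hs' ▸ h
  · simp at hs'
    subst hs'
    unfold PState.verify
    split_ifs
    · simp only [List.length_cons, List.length_tail]
      have : s.unv.length ≠ 0 := fun h => h4 (by simpa using h)
      omega
    all_goals exact PState.add_count _ _ _ h

/-! ### The tester as a program -/

/-- The numbers that the tester uses. -/
structure Params where
  L : ℕ
  N : ℕ
  T : ℕ
  M : ℕ
  Q : ℕ
  s : ℕ
  m : ℕ
  K : ℕ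
  N1 : ℕ

def Params.enc (p : Params) (e arg : Data) : Data :=
  e :+ arg :+ .unary p.L :+ .unary p.N :+ .unary (p.T + 1) :+
    .unary p.M :+ .unary p.Q :+ .unary p.s :+ .unary p.m :+
      .unary p.K :+ .unary p.N1

/-- The answer of the tester, if `ν l` is the output of the learner on the blocks `l`. -/
def testDist (C : RepClass) (i : Idx) (f : Pt i.n → Bool) (D : PMF (Pt i.n))
    (p : Params) (ν : List (Blk i.n) → PMF Data) : PMF Bool :=
  (masks i.n p.s).bind fun R => (findBlks f D R p.m p.K p.N1).bind fun s =>
    if 0 < s.kc then judge C i f D p.L p.N s.ver (ν s.ver) else PMF.pure false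

def pTester (A sh V E : Cmd) : Cmd :=
  .push (.nth 7 :* .drop 2 (.nth 0)) pMasks ;;
  .push (.drop 2 (.nth 1) :* .nil :* .nil) (pZip fun _ => false) ;;
  .push (.rest 12 :* (.nth 10 :* .nth 11 :* .nth 0 :*
    .nil :* .nil) :* .nth 1 :* .nth 10) (.forEach pStep) ;;
  .cond (.hd (.drop 1 (.nth 0)))
    (.assign 0 (.drop 4 (.nth 0) :* .rest 3) ;; pJudge A sh V E) (.assign 0 .nil)

section
variable {ι : Type} {W : ι → ℕ} {C : RepClass} {i : ι → Idx} {f : ∀ x, (Fin (i x).n → Bool) → Bool}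
  {D : ∀ x, PMF (Fin (i x).n → Bool)} {p : ι → Params} {arg : ι → Data}

/-- The stages after the search are specified for every list of at most `k` blocks, not only for
those that occur. So the output distribution of the learner is a function of the input and the list
alone. -/
abbrev SmallBlks (i : ι → Idx) : Type := Σ x, {l : List (Blk (i x).n) // l.length ≤ (i x).k}

theorem SBdd.blks (h : SBdd W fun x => (p x).enc (i x).enc (arg x)) :
    SBdd (fun y : SmallBlks i => W y.1)
      fun y => .ofList (y.2.1.map Blk.enc) :+ (p y.1).enc (i y.1).enc (arg y.1) :=
  SBdd.cons (Bdd.mono (((Bdd.const 1).add (h.fst.snd.fst.of_unary.mul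
    (((Bdd.const 12).mul h.fst.snd.snd.of_unary).add (Bdd.const 6)))).comp Sigma.fst) fun y =>
      (Data.size_map_blk_le y.2.1).trans
        (Nat.add_le_add_left (Nat.mul_le_mul_right _ y.2.2) _)) (h.comp Sigma.fst)

theorem pBlocks_poly {J : Cmd} {R : ∀ x, List (Fin (i x).n → Bool)}
    {μ : ∀ x, List (Blk (i x).n) → PMF Bool} {Q : ι → ℕ} (hR : ∀ x, (R x).length = (p x).s)
    (hK : ∀ x, (p x).K = (i x).k + 1)
    (hJ : Poly (fun y : SmallBlks i => W y.1)
      (fun y => ⟨(i y.1).n, f y.1, D y.1⟩) J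
      (fun y => .ofList (y.2.1.map Blk.enc) :+ (p y.1).enc (i y.1).enc (arg y.1))
      (fun y => (μ y.1 y.2.1).map Data.ofBool) (fun y => Q y.1)) :
    Poly W (fun x => ⟨(i x).n, f x, D x⟩)
      (.push (.drop 2 (.nth 1) :* .nil :* .nil) (pZip fun _ => false) ;;
        .push (.rest 12 :* (.nth 10 :* .nth 11 :* .nth 0 :*
          .nil :* .nil) :* .nth 1 :* .nth 10) (.forEach pStep) ;;
        .cond (.hd (.drop 1 (.nth 0)))
          (.assign 0 (.drop 4 (.nth 0) :* .rest 3) ;; J) (.assign 0 .nil))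
      (fun x => .ofList ((R x).map .ofVec) :+ (p x).enc (i x).enc (arg x))
      (fun x => (findBlks (f x) (D x) (R x) (p x).m (p x).K (p x).N1).bind fun s =>
        (if 0 < s.kc then μ x s.ver else PMF.pure false).map Data.ofBool)
      (fun x => (p x).N1 * ((p x).s * 2 + 3) + Q x) := Poly.intro fun hs => by
  refine Poly.seqD (PolyD.push (a := fun x => (.ofVec fun _ : Fin (i x).n => true) :+
    .nil :+ .nil) ?_ (pZip_poly fun _ => false)) <|
    Poly.pushM (α := fun x => PState (i x).n)
      (μ := fun x => findBlks (f x) (D x) (R x) (p x).m (p x).K (p x).N1)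
      (encA := fun _ => PState.enc) (a := fun x => .unary (p x).N1 :+
      PState.enc (⟨(p x).m, (p x).K, fun _ => false, [], []⟩ : PState (i x).n) :+
        .ofList ((R x).map .ofVec) :+ .unary (p x).m)
      (ν := fun x s => (if 0 < s.kc then μ x s.ver else PMF.pure false).map Data.ofBool)
      (fun _ => PState.enc_injective) ?_ (Poly.mono (findBlks_poly fun _ => rfl)
        fun x => by rw [hR]) <| Poly.cond (fun y => decide (0 < y.2.1.kc)) ?_ ?_ ?_
  · exact fun x σ h => by simp [h, Params.enc, Idx.enc, Expr.drop, ofUnary]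
  · exact fun x σ h => by simp [h, Params.enc, PState.enc]
  · exact fun x σ h => by simp [h, PState.enc, Expr.drop, Data.truth_unary]
  · have hc : ∀ y : {y : Σ x, {s // s ∈ (findBlks (f x) (D x) (R x) (p x).m (p x).K
        (p x).N1).support} // decide (0 < y.2.1.kc) = true},
        y.1.2.1.ver.length ≤ (i y.1.1).k := by
      rintro ⟨⟨x, s, hs⟩, h⟩
      have h1 := findBlks_count hs
      have h2 := of_decide_eq_true h
      have h3 := hK x
      simp only at h1 h2 ⊢
      omega
    refine Poly.congr (Poly.seqD (PolyD.assign
      (out := fun y => .ofList (y.1.2.1.ver.map Blk.enc) :+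
        (p y.1.1).enc (i y.1.1).enc (arg y.1.1)) ?_) <|
      hJ.comp hs.snd.blks fun y => ⟨y.1.1, y.1.2.1.ver, hc y⟩) fun y => ?_
    · exact fun x σ h => by simp [h, PState.enc, Expr.drop]
    · rw [if_pos (of_decide_eq_true y.2)]
  · refine Poly.mono (Q := fun _ => 0) (Poly.congr (PolyD.assign (out := fun _ => .nil)
      fun _ _ _ => rfl) fun y => ?_) fun _ => Nat.zero_le _
    rw [if_neg (of_decide_eq_false y.2), PMF.pure_map]
    rfl

theorem pTester_poly {A sh V E : Cmd} {P P' : Polynomial ℕ}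
    {D' : ∀ x, ∀ l : List (Blk (i x).n), PMF (Pt l.length)} {κ : ι → ℕ}
    (hV : C.VerifiedBy V P') (hE : C.EvaluatedBy E P) (hK : ∀ x, (p x).K = (i x).k + 1)
    (hsh : Poly (fun y : SmallBlks i => W y.1)
        (fun y => ⟨(i y.1).n, f y.1, D y.1⟩) sh (fun y => ctxD y.2.1 (p y.1).L)
        (fun y => (D' y.1 y.2.1).map fun v => .ofVec v) (fun y => κ y.1))
    (hs : SBdd W fun x => (p x).enc (i x).enc (arg x)) :
    ∃ ν : ∀ x, List (Blk (i x).n) → PMF Data,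
      Poly W (fun x => ⟨(i x).n, f x, D x⟩) (pTester A sh V E)
        (fun x => (p x).enc (i x).enc (arg x))
        (fun x => (testDist C (i x) (f x) (D x) (p x) (ν x)).map Data.ofBool)
        (fun x => (p x).N1 * ((p x).s * 2 + 3) + ((i x).k * (128 * 6) + ((p x).M + κ x * (p x).Q +
          (p x).N * (1 + (i x).k * ((p x).L * 2) + 1)))) ∧
      ∀ x, ∀ l : List (Blk (i x).n), l.length ≤ (i x).k →
        RunsAs A ⟨l.length, blkFun (f x) l, D' x l⟩
          (((i x).enc :+ .unary l.length) :+ arg x) (p x).T (p x).M (p x).Q (ν x l) := by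
  classical
  obtain ⟨out, h1, h2⟩ := pJudge_poly
    (ι := SmallBlks i) (W := fun y => W y.1)
    (i := fun y => i y.1) (f := fun y => f y.1) (D := fun y => D y.1) (l := fun y => y.2.1)
    (L := fun y => (p y.1).L) (N := fun y => (p y.1).N) (A := A) (arg := fun y => arg y.1)
    (T := fun y => (p y.1).T) (M := fun y => (p y.1).M) (Q := fun y => (p y.1).Q)
    (D' := fun y => D' y.1 y.2.1) (κ := fun y => κ y.1)
    (t := fun y => .unary (p y.1).s :+ .unary (p y.1).m :+
      .unary (p y.1).K :+ .unary (p y.1).N1) hs.blks hV hE hsh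
  -- Lists with more than `k` blocks get a dummy value; the tester rejects before it would be used.
  let ν : ∀ x, List (Blk (i x).n) → PMF Data := fun x l =>
    if h : l.length ≤ (i x).k then out ⟨x, l, h⟩ else PMF.pure .nil
  have hν : ∀ x l (h : l.length ≤ (i x).k), ν x l = out ⟨x, l, h⟩ := fun x l h => dif_pos h
  refine ⟨ν, ?_, fun x l h => ?_⟩
  swap
  · rw [hν x l h]
    exact h2 ⟨x, l, h⟩
  refine Poly.mono (Poly.congr (Poly.pushM (α := fun x => List (Fin (i x).n → Bool))
    (μ := fun x => masks (i x).n (p x).s) (encA := fun _ l => .ofList (l.map .ofVec))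
    (a := fun x => .unary (p x).s :+ .unary (i x).n) (Q := fun _ => 0)
    (ν := fun x R => (findBlks (f x) (D x) R (p x).m (p x).K (p x).N1).bind fun s =>
        (if 0 < s.kc then judge C (i x) (f x) (D x) (p x).L (p x).N s.ver (ν x s.ver)
          else PMF.pure false).map Data.ofBool)
    (Q' := fun x => (p x).N1 * ((p x).s * 2 + 3) + ((i x).k * (128 * 6) + ((p x).M +
      κ x * (p x).Q + (p x).N * (1 + (i x).k * ((p x).L * 2) + 1))))
    (fun _ l l' h => List.map_injective_iff.2 (Data.ofVec_injective _) (Data.ofList_injective h))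
    ?_ pMasks_poly ?_) fun x => ?_) fun x => (Nat.zero_add _).le
  · exact fun x σ h => by simp [h, Params.enc, Idx.enc, Expr.drop]
  · refine pBlocks_poly (ι := Σ x, {l // l ∈ (masks (i x).n (p x).s).support})
      (i := fun y => i y.1) (f := fun y => f y.1) (D := fun y => D y.1) (p := fun y => p y.1)
      (R := fun y => y.2.1) (arg := fun y => arg y.1)
      (μ := fun y l => judge C (i y.1) (f y.1) (D y.1) (p y.1).L (p y.1).N l (ν y.1 l))
      (Q := fun x => (i x.1).k * (128 * 6) + ((p x.1).M +
        κ x.1 * (p x.1).Q + (p x.1).N * (1 + (i x.1).k * ((p x.1).L * 2) + 1)))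
      (fun y => length_of_mem_masks y.2.2) (fun y => hK y.1) ?_
    refine Poly.comp (ι := SmallBlks i)
      (W := fun y => W y.1) (O := fun y => ⟨(i y.1).n, f y.1, D y.1⟩)
      (inp := fun y => .ofList (y.2.1.map Blk.enc) :+ (p y.1).enc (i y.1).enc (arg y.1))
      (μ := fun y => (judge C (i y.1) (f y.1) (D y.1) (p y.1).L (p y.1).N y.2.1 (ν y.1 y.2.1)).map
        Data.ofBool) (Q := fun y => (i y.1).k * (128 * 6) + ((p y.1).M +
        κ y.1 * (p y.1).Q + (p y.1).N * (1 + (i y.1).k * ((p y.1).L * 2) + 1)))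
      (Poly.mono (Poly.congr h1 fun y => ?_) fun y => ?_) hs.blks
      fun z : Σ y : (Σ x, {l // l ∈ (masks (i x).n (p x).s).support}),
        {l : List (Blk (i y.1).n) // l.length ≤ (i y.1).k} => ⟨z.1.1, z.2.1, z.2.2⟩
    · rw [hν _ _ y.2.2]
    · have := y.2.2
      gcongr
  · rw [testDist]
    simp only [PMF.map_bind]

end

/-! ## Arithmetic on the parameters -/

/-- The number `3 * b + c` for `c = [p] + [q] ≤ 2`, in binary, from the binary representation of
`b`. -/
def triple : List Bool → Bool → Bool → List Bool
  | [], p, q => if q then [false, true] else if p then [true] else []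
  | x :: l, p, q => (x ^^ p ^^ q) :: triple l (x || q) (x && p)

/-- Digitwise multiplication by `3` has carries up to `2`, coded in unary by `p` and `q`. For a
digit `x`, the number `3 x + p + q` has the low bit `x + p + q`, and the next carry is `(x or q) +
(x and p)`. -/
theorem triple_bits : ∀ (b : ℕ) (p q : Bool), (q = true → p = true) →
    triple b.bits p q = (3 * b + (p.toNat + q.toNat)).bits := by
  intro b
  induction b using Nat.strong_induction_on with
  | _ b ih =>
    intro p q hpq
    rcases Nat.eq_zero_or_pos b with rfl | hb
    · cases p <;> cases q <;> simp [triple] at hpq ⊢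
      rw [show 2 = 2 * 1 by rfl, Nat.bit0_bits 1 one_ne_zero, Nat.one_bits]
    · obtain ⟨n, hn | hn⟩ := Nat.even_or_odd' b
      · have h0 : n ≠ 0 := by omega
        rw [hn, Nat.bit0_bits n h0, triple, ih n (by omega) _ _ (by simp)]
        cases p <;> cases q <;> simp at hpq ⊢
        · rw [show 3 * (2 * n) = 2 * (3 * n) by ring, Nat.bit0_bits _ (by omega)]
        · rw [show 3 * (2 * n) + 1 = 2 * (3 * n) + 1 by ring, Nat.bit1_bits]
        · rw [show 3 * (2 * n) + 2 = 2 * (3 * n + 1) by ring, Nat.bit0_bits _ (by omega)]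
      · rw [hn, Nat.bit1_bits n, triple, ih n (by omega) _ _ (by cases p <;> cases q <;> simp)]
        cases p <;> cases q <;> simp at hpq ⊢
        · rw [show 3 * (2 * n + 1) = 2 * (3 * n + 1) + 1 by ring, Nat.bit1_bits]
        · rw [show 3 * (2 * n + 1) + 1 = 2 * (3 * n + 2) by ring, Nat.bit0_bits _ (by omega)]
        · rw [show 3 * (2 * n + 1) + 2 = 2 * (3 * n + 2) + 1 by ring, Nat.bit1_bits]

theorem triple_foldl : ∀ (l : List Bool) (p q : Bool) (o : List Bool),
    (fun a : (Bool × Bool) × List Bool => a.2.reverse ++ triple [] a.1.1 a.1.2)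
      (l.foldl (fun a x => ((x || a.1.2, x && a.1.1), (x ^^ a.1.1 ^^ a.1.2) :: a.2)) ((p, q), o)) =
      o.reverse ++ triple l p q
  | [], p, q, o => rfl
  | x :: l, p, q, o => by
    rw [List.foldl_cons, triple_foldl l]
    simp [triple]

/-- `12 b` in binary from `b` in binary. -/
def pTwelve : Cmd :=
  .assign 0 (.var 0 :* ((.nil :* .nil) :* .nil) :* .nil) ;;
  .forEach (
    pBit (fun l => l.getD 0 false ^^ l.getD 1 false ^^ l.getD 2 false)
      [.nth 0, .hd (.hd (.nth 1)), .tl (.hd (.nth 1))] ;;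
    pBit bAnd [.nth 1, .hd (.hd (.nth 2))] ;;
    pBit bOr [.nth 2, .tl (.hd (.nth 3))] ;;
    .assign 0 ((.nth 0 :* .nth 1) :* .nth 2 :* .tl (.nth 4))) ;;
  .cond (.tl (.hd (.var 0))) (.assign 0 (.tt :* .nil :* .tl (.var 0)))
    (.cond (.hd (.hd (.var 0))) (.assign 0 (.tt :* .tl (.var 0))) (.assign 0 (.tl (.var 0)))) ;;
  pRev ;; .assign 0 (.nil :* .nil :* .var 0)

/-- `unary j` to `unary (2 ^ j)`. -/
def pPow2 : Cmd :=
  .assign 0 (.var 0 :* (.tt :* .nil) :* .nil) ;;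
    .forEach (.assign 0 (.nth 1 :* .nth 1) ;; pAdd)

/-- The input is `(lists, unary c)`. -/
def pSum : Cmd :=
  .assign 0 (.hd (.var 0) :* .tl (.var 0) :* .nil) ;;
    .forEach (.assign 0 (.nth 0 :* .nth 1) ;; pAdd)

/-- `unary x` to `(unary (c * x ^ d), unary x)`. -/
def pMono (c : ℕ) : ℕ → Cmd
  | 0 => .assign 0 (.lit (.unary c) :* .var 0)
  | d + 1 => pMono c d ;; .assign 0 (.var 0 :* .tl (.var 0)) ;; .onFst pMul

/-- The input is `(lists A, B)`, the output `unary (|B| - |A| + 1)`. -/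
def pSub : Cmd :=
  .assign 0 (.hd (.var 0) :* .tl (.var 0) :* .nil) ;; .forEach (.assign 0 (.tl (.nth 1))) ;;
    .assign 0 (.var 0 :* .tt :* .nil) ;; pAdd

/-- `min x y` in unary; the input is `(unary x, unary y)`. -/
def pMin : Cmd :=
  .assign 0 (.hd (.var 0) :* (.nil :* .tl (.var 0)) :* .nil) ;;
    .forEach (.cond (.tl (.nth 1)) (.assign 0 ((.tt :* .hd (.nth 1)) :* .tl (.tl (.nth 1))))
      (.assign 0 (.nth 1))) ;;
    .assign 0 (.hd (.var 0))

/-- `min M T` in unary; the input is `(binary M, unary T)`. -/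
def pCap : Cmd :=
  .onFst pRev ;; .assign 0 (.hd (.var 0) :* .nil :* .tl (.var 0)) ;;
    .forEach (.push (.nth 1 :* .nth 1) pAdd ;;
      .cond (.nth 1) (.assign 0 ((.tt :* .nth 0) :* .rest 3))
        (.assign 0 (.nth 0 :* .rest 3)) ;; pMin)

def sizeStep (a : ℕ × ℕ × ℕ) : ℕ × ℕ × ℕ :=
  if 1 < a.1 then (a.1 - 1, a.2.1 + 1, a.2.2) else (a.2.1 + 1, a.2.1 + 1, a.2.2 + 1)

/-- A number `s` with `k < 2 ^ s ≤ 2 * k`. -/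
def pSize : Cmd :=
  .assign 0 (.var 0 :* ((.tt :* .nil) :* .nil :* .nil) :* .nil) ;;
    .forEach (.cond (.tl (.hd (.nth 1)))
      (.assign 0 (.tl (.hd (.nth 1)) :* (.tt :* .hd (.tl (.nth 1))) :*
        .tl (.tl (.nth 1))))
      (.assign 0 ((.tt :* .hd (.tl (.nth 1))) :* (.tt :* .hd (.tl (.nth 1))) :*
        .tt :* .tl (.tl (.nth 1))))) ;;
    .assign 0 (.tl (.tl (.var 0)))

section
variable {ι : Type} {W : ι → ℕ} {O : ι → Oracle}

theorem PolyD.pushD {inp out : ι → Data} {c c' : Cmd} {e : Expr} {a a' : ι → Data}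
    (he : ∀ x, ∀ σ : ℕ → Data, σ 0 = inp x → e.eval σ = a x) (h : PolyD W O c a a')
    (h' : PolyD W O c' (fun x => a' x :+ inp x) out) :
    PolyD W O (.push e c ;; c') inp out := PolyD.seq (PolyD.push he h) h'

theorem PolyD.cast {inp inp' out out' : ι → Data} {c : Cmd} (h : PolyD W O c inp out)
    (hi : ∀ x, inp' x = inp x) (ho : ∀ x, out x = out' x) : PolyD W O c inp' out' := by
  rw [funext hi, ← funext ho]
  exact h

theorem pAddU_poly {a b : ι → ℕ} :
    PolyD W O pAdd (fun x => .unary (a x) :+ .unary (b x)) (fun x => .unary (a x + b x)) :=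
  PolyD.cast (pAdd_poly (l := fun x => List.replicate (a x) (.nil :+ .nil)) (b := b))
    (fun x => by rw [Data.unary_eq (a x)])
    fun x => by rw [List.length_replicate]

theorem pMulU_poly {a b : ι → ℕ} :
    PolyD W O pMul (fun x => .unary (a x) :+ .unary (b x)) (fun x => .unary (a x * b x)) :=
  PolyD.cast (pMul_poly (l := fun x => List.replicate (a x) (.nil :+ .nil))
    (l' := fun x => List.replicate (b x) (.nil :+ .nil)))
    (fun x => by rw [Data.unary_eq (a x), Data.unary_eq (b x)])
    fun x => by rw [List.length_replicate, List.length_replicate]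

theorem pTwelve_poly {b : ι → ℕ} (hb : ∀ x, 0 < b x) :
    PolyD W O pTwelve (fun x => .binary (b x)) (fun x => .binary (12 * b x)) := Poly.intro
      fun hs => by
  let enc : (Bool × Bool) × List Bool → Data := fun a => encFlags a.1 :+ .ofBits a.2
  have hinj : Function.Injective enc := pair_injective encFlags_injective Data.ofBits_injective
  let st : Bool → (Bool × Bool) × List Bool → (Bool × Bool) × List Bool := fun x a =>
    ((x || a.1.2, x && a.1.1), (x ^^ a.1.1 ^^ a.1.2) :: a.2)
  let fin : ι → (Bool × Bool) × List Bool := fun x =>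
    (b x).bits.foldl (fun a x => st x a) ((false, false), [])
  have hfin : ∀ x, (fin x).2.reverse ++ triple [] (fin x).1.1 (fin x).1.2 =
    (3 * b x).bits := fun x =>
    (triple_foldl (b x).bits false false []).trans (by rw [triple_bits _ _ _ (by simp)]; simp)
  have hl : Bdd W fun x => (b x).bits.length := Bdd.mono hs fun x => Data.length_le_size_ofBits _
  refine PolyD.seq (PolyD.assign (out := fun x => .ofList ((b x).bits.map Data.ofBool) :+
    enc ((false, false), []) :+ .nil) fun x σ h => ?_) <| PolyD.seq
      (mid := fun x => enc (fin x)) (PolyD.loop (α := fun _ => _)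
        (β := fun _ => Bool) (fun _ => enc) (fun _ => Data.ofBool) (fun _ => hinj)
          (fun x => (b x).bits)
        (fun x j a => a.2.length + j ≤ (b x).bits.length) (fun _ => st)
          (fun _ => ((false, false), []))
        (fun _ => .nil) (fun _ => rfl) (fun _ => rfl)
        (Bdd.acc (((Bdd.const 4).mul hl).add (Bdd.const 9)) ?_) ?_ (by simp) ?_) <|
      PolyD.seq (mid := fun x => .ofList (((3 * b x).bits.reverse).map Data.ofBool))
        (Poly.cond (fun x => (fin x).1.2) (fun x σ h => by simp [h, enc, encFlags]) ?_
          (Poly.cond (fun x => (fin x).1.1) (fun x σ h => by simp [h, enc, encFlags]) ?_ ?_)) <|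
        PolyD.seq pRev_poly <| PolyD.assign fun x σ h => ?_
  · simp [h, enc, encFlags, Data.binary, Data.ofBits_eq]
  · intro x j a ha
    have := Data.size_ofBits_le a.2
    have := Data.size_ofBool_le a.1.1
    have := Data.size_ofBool_le a.1.2
    simp only [enc, encFlags, Data.size]; omega
  · intro x j b _ a ha
    simp only [st, List.length_cons]; omega
  · refine Poly.bit (fun y => [y.b, y.a.1.1, y.a.1.2]) (fun y σ h => by
      simp [h, enc, encFlags]) <| Poly.bit (fun y => [y.b, y.a.1.1])
        (fun y σ h => by simp [h, enc, encFlags]) <| Poly.bit (fun y => [y.b, y.a.1.2])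
        (fun y σ h => by simp [h, enc, encFlags]) <|
      PolyD.assign fun y σ h => by simp [h, enc, encFlags, st, bAnd, bOr]
  · refine PolyD.assign ?_
    rintro ⟨x, hx⟩ σ h
    dsimp only
    rw [← hfin x]
    simp [h, enc, hx, triple, Data.ofBits_eq]
  · refine PolyD.assign ?_
    rintro ⟨⟨x, hx⟩, hx'⟩ σ h
    dsimp only at hx' ⊢
    rw [← hfin x]
    simp [h, enc, hx, hx', triple, Data.ofBits_eq]
  · refine PolyD.assign ?_
    rintro ⟨⟨x, hx⟩, hx'⟩ σ h
    dsimp only at hx' ⊢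
    rw [← hfin x]
    simp [h, enc, hx, hx', triple, Data.ofBits_eq]
  · have := hb x
    rw [Data.binary, show 12 * b x = 2 * (2 * (3 * b x)) by ring, Nat.bit0_bits _ (by omega),
      Nat.bit0_bits _ (by omega)]
    simp [h, Data.ofBits_eq]

theorem pPow2_poly {j : ι → ℕ} (hj : Bdd W fun x => 2 ^ j x) :
    PolyD W O pPow2 (fun x => .unary (j x)) (fun x => .unary (2 ^ j x)) := by
  refine PolyD.seq (mid := fun x => .unary (j x) :+ .unary 1 :+ .nil)
    (PolyD.assign fun x σ h => by simp [h, Data.unary_succ, Data.unary_zero]) <|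
    PolyD.loop (α := fun _ => ℕ) (β := fun _ => Data) (fun _ => Data.unary) (fun _ => id)
      (fun _ => Data.unary_injective) (fun x => List.replicate (j x) (.nil :+ .nil))
      (fun x i a => a * 2 ^ i = 2 ^ j x) (fun _ _ a => a + a) (fun _ => 1) (fun _ => .nil)
      (fun x => by rw [List.map_id, Data.unary_eq (j x)]) (fun x => ?_)
      (Bdd.acc (((Bdd.const 4).mul hj).add (Bdd.const 1)) ?_) ?_ (by simp) ?_
  · have : ∀ i a : ℕ, (List.replicate i (Data.cons .nil .nil)).foldl (fun a _ => a + a) a =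
        a * 2 ^ i := by
      intro i
      induction i with
      | zero => simp
      | succ i ih => intro a; rw [List.replicate_succ, List.foldl_cons, ih]; ring
    rw [this, one_mul]
  · intro x i a h
    have : a ≤ 2 ^ j x := h ▸ Nat.le_mul_of_pos_right _ (by positivity)
    rw [Data.size_unary]; omega
  · intro x i b _ a h
    rw [← h]; ring
  · exact PolyD.seq (PolyD.assign (out := fun y => .unary y.a :+ .unary y.a)
      fun y σ h => by simp [h]) <|
      pAddU_poly (ι := LoopIx ι (fun _ => ℕ) _ _ _) (a := fun y => y.a) (b := fun y => y.a)

theorem pSum_poly {l : ι → List (List Data)} {c : ι → ℕ} :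
    PolyD W O pSum (fun x => .ofList ((l x).map .ofList) :+ .unary (c x))
      (fun x => .unary (c x + ((l x).map List.length).sum)) := Poly.intro fun hs => by
  have key : ∀ (l : List (List Data)) (a : ℕ), l.foldl (fun a d => d.length + a) a =
      a + (l.map List.length).sum := by
    intro l
    induction l with
    | nil => simp
    | cons d l ih => intro a; rw [List.foldl_cons, ih]; simp; omega
  let Z : ι → ℕ := fun x => (Data.ofList ((l x).map .ofList)).size
  have hl : Bdd W fun x => (l x).length := by simpa using SBdd.length hs.fst
  refine PolyD.seq (mid := fun x => .ofList ((l x).map .ofList) :+ .unary (c x) :+ .nil)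
    (PolyD.assign fun x σ h => by simp [h]) <|
    PolyD.loop (α := fun _ => ℕ) (β := fun _ => List Data) (fun _ => Data.unary)
      (fun _ => .ofList) (fun _ => Data.unary_injective) l
      (fun x i a => a + i * Z x ≤ c x + (l x).length * Z x)
      (fun _ d a => d.length + a) c (fun _ => .nil)
      (fun x => rfl) (fun x => by rw [key])
      (Bdd.acc (((Bdd.const 4).mul (hs.snd.of_unary.add (hl.mul hs.fst))).add (Bdd.const 1)) ?_) ?_
      (fun x => le_rfl) ?_
  · intro x i a h
    rw [Data.size_unary]
    exact Nat.add_le_add_right (Nat.mul_le_mul_left _ ((Nat.le_add_right _ _).trans h)) _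
  · intro x i d hd a h
    have h1 : d.length ≤ Z x := (length_le_size d).trans
      (Data.size_mem_le (List.mem_map.2 ⟨d, hd, rfl⟩))
    rw [Nat.add_mul, Nat.one_mul] at h
    omega
  · exact PolyD.seq (PolyD.assign (out := fun y => .ofList y.b :+ .unary y.a)
      fun y σ h => by simp [h]) <|
        pAdd_poly (ι := LoopIx ι (fun _ => ℕ) (fun _ => List Data) l _) (l := fun y => y.b)
          (b := fun y => y.a)

theorem pMono_poly (c d : ℕ) {u : ι → ℕ} :
    PolyD W O (pMono c d) (fun x => .unary (u x))
      (fun x => .unary (c * u x ^ d) :+ .unary (u x)) := by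
  induction d with
  | zero => exact PolyD.assign fun x σ h => by simp [h]
  | succ d ih =>
    refine PolyD.seq ih <| PolyD.seq (PolyD.assign (out := fun x =>
      (.unary (c * u x ^ d) :+ .unary (u x)) :+ .unary (u x))
      fun x σ h => by simp [h]) <| PolyD.congr (PolyD.onFst pMulU_poly)
        fun x => by rw [pow_succ, mul_assoc]

theorem pSub_poly {A B : ι → List Data} :
    PolyD W O pSub (fun x => .ofList (A x) :+ .ofList (B x))
      (fun x => .unary ((B x).length - (A x).length + 1)) := Poly.intro fun hs => by
  have key : ∀ (l : List Data) (a : List Data), l.foldl (fun a _ => a.tail) a = a.drop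
    l.length := by
    intro l
    induction l with
    | nil => simp
    | cons d l ih => intro a; rw [List.foldl_cons, ih]; simp
  refine PolyD.seq (mid := fun x => .ofList (A x) :+ .ofList (B x) :+ .nil)
    (PolyD.assign fun x σ h => by simp [h]) <| PolyD.seq
      (mid := fun x => .ofList ((B x).drop (A x).length))
    (PolyD.loop (α := fun _ => List Data) (β := fun _ => Data) (fun _ => Data.ofList)
      (fun _ => id) (fun _ => Data.ofList_injective) A
      (fun x i a => (Data.ofList a).size ≤ (Data.ofList (B x)).size)
      (fun _ d a => a.tail) B (fun _ => .nil)
      (fun x => by rw [List.map_id]) (fun x => by rw [key]) (Bdd.acc hs.snd fun _ _ _ h => h) ?_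
      (fun x => le_rfl) ?_) <| PolyD.seq (PolyD.assign (out := fun x =>
        .ofList ((B x).drop (A x).length) :+ .unary 1) fun x σ h => by
          simp [h, Data.unary_succ, Data.unary_zero]) <| PolyD.congr pAdd_poly fun x => by simp
  · intro x i d _ a h
    refine le_trans ?_ h
    cases a <;> simp
  · refine PolyD.assign fun y σ h => ?_
    cases ha : y.a <;> simp [h, ha]

theorem pMin_poly {u v : ι → ℕ} :
    PolyD W O pMin (fun x => .unary (u x) :+ .unary (v x))
      (fun x => .unary (min (u x) (v x))) := Poly.intro fun hs => by
  let st : ℕ × ℕ → ℕ × ℕ := fun a => if 0 < a.2 then (a.1 + 1, a.2 - 1) else a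
  let enc : ℕ × ℕ → Data := fun a => .unary a.1 :+ .unary a.2
  have key : ∀ (m a b : ℕ), (List.replicate m (Data.cons .nil .nil)).foldl (fun a _ => st a) (a, b)
    =
      (a + min m b, b - m) := by
    intro m
    induction m with
    | zero => simp
    | succ m ih =>
      intro a b
      rw [List.replicate_succ, List.foldl_cons]
      by_cases hb : 0 < b
      · simp only [st, hb, if_true, ih]
        ext <;> simp <;> omega
      · simp only [st, hb, if_false, ih]
        ext <;> simp <;> omega
  have hu := hs.fst.of_unary
  have hv := hs.snd.of_unary
  refine PolyD.seq (mid := fun x => .unary (u x) :+ enc (0, v x) :+ .nil)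
    (PolyD.assign fun x σ h => by simp [h, enc, Data.unary_zero]) <| PolyD.seq
      (mid := fun x => enc (min (u x) (v x), v x - u x))
    (PolyD.loop (α := fun _ => ℕ × ℕ) (β := fun _ => Data) (fun _ => enc)
      (fun _ => id) (fun _ => pair_injective Data.unary_injective Data.unary_injective)
      (fun x => List.replicate (u x) (.nil :+ .nil))
      (fun x i a => a.1 + i ≤ u x ∧ a.2 ≤ v x)
      (fun _ d a => st a) (fun x => (0, v x)) (fun _ => .nil)
      (fun x => by rw [List.map_id, Data.unary_eq (u x)]) (fun x => by rw [key]; simp)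
      (Bdd.acc (((Bdd.const 4).mul (hu.add hv)).add (Bdd.const 3)) ?_) ?_
      (fun x => by simp) <| Poly.cond (fun y => decide (0 < y.a.2)) ?_ ?_ ?_) <|
        PolyD.assign fun x σ h => by simp [h, enc]
  · rintro x i a ⟨h1, h2⟩
    simp only [enc, Data.size, Data.size_unary]; omega
  · rintro x i d _ a ⟨h1, h2⟩
    simp only [st]
    split_ifs <;> omega
  · exact fun y σ h => by simp [h, enc, Data.truth_unary]
  · refine PolyD.assign ?_
    rintro ⟨y, hy⟩ σ h
    obtain ⟨m, hm⟩ := Nat.exists_eq_add_of_lt (of_decide_eq_true hy)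
    simp [h, enc, st, hm, Data.unary_succ]
  · refine PolyD.assign ?_
    rintro ⟨y, hy⟩ σ h
    have := of_decide_eq_false hy
    simp [h, enc, st, this]

/-- Horner's scheme from the most significant bit, cut off at `T` after each doubling. The number
`M` may be exponentially large in its binary length and must never be written in unary. -/
theorem pCap_poly {M T : ι → ℕ} :
    PolyD W O pCap (fun x => .binary (M x) :+ .unary (T x))
      (fun x => .unary (min (M x) (T x))) := Poly.intro fun hs => by
  let enc : ℕ × ℕ → Data := fun a => .unary a.1 :+ .unary a.2
  let st : ι → Bool → ℕ → ℕ := fun x b a => min (a + a + b.toNat) (T x)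
  have key : ∀ (x : ι) (M : ℕ), M.bits.reverse.foldl (fun a b => st x b a) 0 = min M (T x) := by
    intro x M
    induction M using Nat.binaryRec' with
    | zero => simp
    | bit b n hn ih =>
      rw [Nat.bits_append_bit _ _ hn, List.reverse_cons, List.foldl_append, ih]
      cases b <;> simp [st, Nat.bit] <;> omega
  have hT := hs.snd.of_unary
  have h0 : ∀ x, .binary (M x) :+ .unary (T x) =
      Data.cons (.ofList ((M x).bits.map Data.ofBool)) (.unary (T x)) := fun x => by
    rw [← Data.ofBits_eq]; rfl
  refine PolyD.seq (mid := fun x => .ofList ((M x).bits.reverse.map Data.ofBool) :+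
    .unary (T x)) (PolyD.cast (PolyD.onFst pRev_poly) h0 fun x => by
      rw [List.map_reverse]) <| PolyD.seq (mid := fun x =>
      .ofList ((M x).bits.reverse.map Data.ofBool) :+ .unary 0 :+ .unary (T x))
    (PolyD.assign fun x σ h => by simp [h, Data.unary_zero]) <|
    PolyD.loop (α := fun _ => ℕ) (β := fun _ => Bool) (fun _ => .unary)
      (fun _ => Data.ofBool) (fun _ => Data.unary_injective) (fun x => (M x).bits.reverse)
      (fun x i a => a ≤ T x) st (fun x => 0) (fun x => .unary (T x))
      (fun x => rfl) (fun x => by rw [key])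
      (Bdd.acc (((Bdd.const 4).mul hT).add (Bdd.const 1)) ?_) ?_
      (fun x => Nat.zero_le _) <| PolyD.seq (PolyD.push
        (a := fun y => .unary y.a :+ .unary y.a) ?_ <|
          pAddU_poly (ι := LoopIx ι (fun _ => ℕ) (fun _ => Bool) _ _) (a := fun y => y.a)
            (b := fun y => y.a))
        <| PolyD.seq (mid := fun y => .unary (y.a + y.a + y.b.toNat) :+ .unary (T y.x))
          (Poly.cond (fun y => y.b) ?_ (PolyD.assign ?_) (PolyD.assign ?_))
          <| pMin_poly (ι := LoopIx ι (fun _ => ℕ) (fun _ => Bool) _ _)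
            (u := fun y => y.a + y.a + y.b.toNat) (v := fun y => T y.x)
  · intro x i a h
    rw [Data.size_unary]; omega
  · exact fun x i b _ a h => min_le_right _ _
  · exact fun y σ h => by simp [h]
  · exact fun y σ h => by simp [h]
  · rintro ⟨y, hy⟩ σ h
    simp [h, hy, Data.unary_succ]
  · rintro ⟨y, hy⟩ σ h
    simp [h, hy]

/-- The state of the program `pSize` after `t` rounds. -/
def sizeSt (t : ℕ) : ℕ × ℕ × ℕ := sizeStep^[t] (1, 0, 0)

def sizeOf' (k : ℕ) : ℕ := (sizeSt k).2.2

/-- The first component is the distance from the round number to the power `2 ^ s` above it. When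
the power is reached, `s` increases and the distance starts again at the round number. -/
theorem sizeSt_spec (t : ℕ) : 0 < (sizeSt t).1 ∧ (sizeSt t).2.1 = t ∧
    t + (sizeSt t).1 = 2 ^ (sizeSt t).2.2 ∧ (0 < t → 2 ^ (sizeSt t).2.2 ≤ 2 * t) := by
  induction t with
  | zero => simp [sizeSt]
  | succ t ih =>
    rw [sizeSt, Function.iterate_succ_apply', ← sizeSt]
    obtain ⟨h1, h2, h3, h4⟩ := ih
    unfold sizeStep
    split_ifs with h
    · exact ⟨by simp; omega, by simp [h2], by simp; omega, fun _ => by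
        rcases Nat.eq_zero_or_pos t with rfl | ht
        · simp [sizeSt] at h
        · have := h4 ht
          simp only; omega⟩
    · refine ⟨by simp, by simp [h2], ?_, fun _ => ?_⟩ <;> simp only [pow_succ, h2] <;> omega

theorem pSize_poly {k : ι → ℕ} :
    PolyD W O pSize (fun x => .unary (k x)) (fun x => .unary (sizeOf' (k x))) := Poly.intro
      fun hs => by
  let enc : ℕ × ℕ × ℕ → Data := fun a => .unary a.1 :+ .unary a.2.1 :+ .unary a.2.2
  have key : ∀ (k : ℕ) (a : ℕ × ℕ × ℕ), (List.replicate k (Data.cons .nil .nil)).foldl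
      (fun a _ => sizeStep a) a = sizeStep^[k] a := by
    intro k
    induction k with
    | zero => intro a; rfl
    | succ k ih => intro a; rw [List.replicate_succ, List.foldl_cons, ih]; rfl
  have hk := hs.of_unary
  refine PolyD.seq (mid := fun x => .unary (k x) :+ enc (1, 0, 0) :+ .nil)
    (PolyD.assign fun x σ h => by simp [h, enc, Data.unary_zero, Data.unary_succ]) <|
    PolyD.seq (mid := fun x => enc (sizeSt (k x)))
    (PolyD.loop (α := fun _ => ℕ × ℕ × ℕ) (β := fun _ => Data) (fun _ => enc) (fun _ => id)
      (fun _ => pair_injective Data.unary_injective (e' := fun p : ℕ × ℕ => .unary p.1 :+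
        .unary p.2) (pair_injective Data.unary_injective Data.unary_injective))
      (fun x => List.replicate (k x) (.nil :+ .nil))
      (fun x i a => a.1 ≤ a.2.1 + 1 ∧ a.2.1 + i ≤ k x ∧ a.2.2 + i ≤ k x)
      (fun _ _ a => sizeStep a) (fun _ => (1, 0, 0)) (fun _ => .nil)
      (fun x => by rw [List.map_id, Data.unary_eq (k x)]) (fun x => by rw [key]; rfl)
      (Bdd.acc (((Bdd.const 12).mul hk).add (Bdd.const 9)) ?_) ?_
      (fun x => by simp) <| Poly.cond (fun y => decide (1 < y.a.1)) ?_
        (PolyD.assign ?_) (PolyD.assign ?_)) <|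
        PolyD.assign fun x σ h => by simp [h, enc, sizeOf']
  · rintro x i a ⟨h1, h2, h3⟩
    simp only [enc, Data.size, Data.size_unary]; omega
  · rintro x i d _ a ⟨h1, h2, h3⟩
    simp only [sizeStep]
    split_ifs <;> simp only <;> omega
  · exact fun y σ h => by simp [h, enc, tl_unary, Data.truth_unary]
  · rintro ⟨y, hy⟩ σ h
    have := of_decide_eq_true hy
    simp [h, enc, sizeStep, this, tl_unary, Data.unary_succ]
  · rintro ⟨y, hy⟩ σ h
    have := of_decide_eq_false hy
    simp [h, enc, sizeStep, this, Data.unary_succ]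

end

/-! ### The parameters of the tester and their computation -/

/-- An input of the tester. -/
structure TIx where
  i : Idx
  a : ℕ
  b : ℕ
  ha : 0 < a
  hab : a ≤ b
  f : Pt i.n → Bool
  D : PMF (Pt i.n)

namespace TIx
variable (x : TIx)

def W : ℕ := x.i.len + fracLen x.a x.b
def O : Oracle := ⟨x.i.n, x.f, x.D⟩
def inp : Data := x.i.enc :+ frac x.a x.b

/-- `2 ^ expo` is `1/ε` up to a factor of `4`. -/
def expo : ℕ := x.b.size - x.a.size + 1
def U : ℕ := 2 ^ x.expo
-- Chosen such that `64 (k + 1) U ≤ 2 ^ L ≤ 128 k U`. An error of order `2 ^ (-L)` then survives a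
-- union bound over `k` blocks and stays small compared with `1 / U`.
def L : ℕ := sizeOf' x.i.k + (6 + x.expo)

/-- A bound for the size of the input of the learner. -/
def big : ℕ := 4 + 12 * x.U + (x.i.p.length + (x.i.k + (x.i.n + (x.a.size + x.b.size))))

/-- The parameters for a learner with time bound `c * big ^ d` and query bounds `M` and `Q`. -/
def params (c d M Q : ℕ) : Params where
  L := x.L
  N := 100 * x.U
  T := c * x.big ^ d
  M := min M (c * x.big ^ d)
  Q := min Q (c * x.big ^ d)
  s := x.L + x.L
  m := 64 * x.L * x.U
  K := x.i.k + 1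
  N1 := (2 + x.i.k) * (2 + 64 * x.L * x.U)

/-- The binary lengths give `b < 2 ^ b.size` and `2 ^ (a.size - 1) ≤ a`; the exponent `expo` is the
difference of these two exponents. -/
theorem le_U_mul : x.b ≤ x.U * x.a := by
  have h1 := x.b.lt_size_self
  have h2 : 2 ^ (x.a.size - 1) ≤ x.a := Nat.lt_size.1 (Nat.sub_lt (Nat.size_pos.2 x.ha) one_pos)
  have h3 : x.b.size = x.expo + (x.a.size - 1) := by
    have := Nat.size_le_size x.hab
    have := Nat.size_pos.2 x.ha
    simp only [expo]; omega
  rw [h3, pow_add] at h1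
  exact h1.le.trans (Nat.mul_le_mul_left _ h2)

theorem U_mul_le : x.U * x.a ≤ 4 * x.b := by
  have h1 := x.a.lt_size_self
  have h2 : 2 ^ (x.b.size - 1) ≤ x.b :=
    Nat.lt_size.1 (Nat.sub_lt (Nat.size_pos.2 (x.ha.trans_le x.hab)) one_pos)
  have h3 : x.expo + x.a.size = (x.b.size - 1) + 2 := by
    have := Nat.size_le_size x.hab
    have := Nat.size_pos.2 x.ha
    simp only [expo]; omega
  calc x.U * x.a ≤ 2 ^ x.expo * 2 ^ x.a.size := Nat.mul_le_mul_left _ h1.le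
    _ = 2 ^ (x.b.size - 1) * 4 := by rw [← pow_add, h3, pow_add]; rfl
    _ ≤ 4 * x.b := by rw [mul_comm]; exact Nat.mul_le_mul_left _ h2

theorem U_le : x.U ≤ 4 * ⌈(x.b : ℚ) / x.a⌉₊ := by
  have h1 : (x.U : ℚ) * x.a ≤ 4 * x.b := by exact_mod_cast x.U_mul_le
  have ha : (0 : ℚ) < x.a := by exact_mod_cast x.ha
  have h2 := Nat.le_ceil ((x.b : ℚ) / x.a)
  rw [div_le_iff₀ ha] at h2
  have : (x.U : ℚ) ≤ 4 * (⌈(x.b : ℚ) / x.a⌉₊ : ℕ) := by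
    refine le_of_mul_le_mul_right (h1.trans ?_) ha
    linarith
  exact_mod_cast this

theorem size_inp : SBdd W inp := by
  refine Bdd.mono (((Bdd.const 8).mul Bdd.self).add (Bdd.const 9)) fun x => ?_
  have h1 := Data.size_ofBits_le x.i.p
  have h2 := Data.size_ofBits_le x.a.bits
  have h3 := Data.size_ofBits_le x.b.bits
  rw [Nat.size_eq_bits_len] at h2 h3
  simp only [inp, Idx.enc, frac, Data.size, Data.size_unary, W, Idx.len, fracLen, Data.binary]
  omega

theorem U_bdd : Bdd W U := Bdd.mono ((Bdd.const 4).mul Bdd.self) fun x => x.U_le.trans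
  (Nat.mul_le_mul_left _ (by simp only [W, fracLen]; omega))

end TIx

def Expr.consTT : ℕ → Expr → Expr
  | 0, e => e
  | n + 1, e => .tt :* Expr.consTT n e

theorem Expr.eval_consTT {σ : ℕ → Data} {e : Expr} {m : ℕ} (h : e.eval σ = .unary m) :
    ∀ n, (Expr.consTT n e).eval σ = .unary (n + m)
  | 0 => by simp [consTT, h]
  | n + 1 => by simp [consTT, eval_consTT h n, Nat.add_right_comm n 1 m, Data.unary_succ]

def pParams (c d : ℕ) (pArg qm qq : Cmd) : Cmd :=
  .push (.nth 1 :* .rest 2) pSub ;;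
  .push (.nth 0) pPow2 ;;
  .push (.hd (.tl (.nth 2))) pSize ;;
  .push (.nth 0 :* .consTT 6 (.nth 2)) pAdd ;;
  .push (.lit (.unary 100) :* .nth 2) pMul ;;
  .push (.lit (.unary 64) :* .nth 1) pMul ;;
  .push (.nth 0 :* .nth 4) pMul ;;
  .push (.consTT 2 (.hd (.tl (.nth 7))) :* .consTT 2 (.nth 0)) pMul ;;
  .push (.nth 4 :* .nth 4) pAdd ;;
  .push (.lit (.unary 12) :* .nth 7) pMul ;;
  .push ((.hd (.nth 10) :* .hd (.tl (.nth 10)) :* .tl (.tl (.nth 10)) :*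
    .nth 11 :* .rest 12 :* .nil) :* .consTT 4 (.nth 0)) pSum ;;
  .push (.nth 0) (pMono c d ;; .assign 0 (.hd (.var 0))) ;;
  .push (.nth 13 :* .rest 14) pArg ;;
  .push (.nth 13 :* .nth 0) qm ;;
  .push (.nth 0 :* .nth 2) pCap ;;
  .push (.nth 15 :* .nth 2) qq ;;
  .push (.nth 0 :* .nth 4) pCap ;;
  .assign 0 (.nth 17 :* .nth 4 :* .nth 13 :* .nth 12 :*
    (.tt :* .nth 5) :* .nth 2 :* .nth 0 :* .nth 8 :* .nth 10 :*
      (.tt :* .hd (.tl (.nth 17))) :* .nth 9)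

theorem pParams_poly (c d : ℕ) {pArg qm qq : Cmd} {arg : TIx → Data} {M Q : TIx → ℕ}
    (hArg : PolyD TIx.W TIx.O pArg (fun x => frac x.a x.b) arg)
    (hM : PolyD TIx.W TIx.O qm (fun x => x.i.enc :+ arg x) (fun x => .binary (M x)))
    (hQ : PolyD TIx.W TIx.O qq (fun x => x.i.enc :+ arg x) (fun x => .binary (Q x))) :
    PolyD TIx.W TIx.O (pParams c d pArg qm qq) TIx.inp
      (fun x => (x.params c d (M x) (Q x)).enc x.i.enc (arg x)) := by
  have e1 : ∀ b : ℕ, Data.binary b = .ofList (b.bits.map Data.ofBool) := fun b => Data.ofBits_eq _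
  refine PolyD.pushD (a := fun x => .ofList (x.a.bits.map Data.ofBool) :+
      .ofList (x.b.bits.map Data.ofBool)) (a' := fun x => .unary x.expo)
    ?_ (PolyD.congr pSub_poly ?_) <| PolyD.pushD
      (a := fun x => .unary x.expo) (a' := fun x => .unary x.U)
    ?_ (pPow2_poly TIx.U_bdd) <| PolyD.pushD
      (a := fun x => .unary x.i.k) (a' := fun x => .unary (sizeOf' x.i.k))
    ?_ pSize_poly <| PolyD.pushD
      (a := fun x => .unary (sizeOf' x.i.k) :+ .unary (6 + x.expo)) (a' := fun x => .unary x.L)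
    ?_ (PolyD.congr pAddU_poly fun x => by rw [TIx.L]) <| PolyD.pushD
      (a := fun x => .unary 100 :+ .unary x.U) (a' := fun x => .unary (100 * x.U))
    ?_ pMulU_poly <| PolyD.pushD
      (a := fun x => .unary 64 :+ .unary x.L) (a' := fun x => .unary (64 * x.L))
    ?_ pMulU_poly <| PolyD.pushD
      (a := fun x => .unary (64 * x.L) :+ .unary x.U) (a' := fun x => .unary (64 * x.L * x.U))
    ?_ pMulU_poly <| PolyD.pushD
      (a := fun x => .unary (2 + x.i.k) :+ .unary (2 + 64 * x.L * x.U))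
      (a' := fun x => .unary ((2 + x.i.k) * (2 + 64 * x.L * x.U)))
    ?_ pMulU_poly <| PolyD.pushD
      (a := fun x => .unary x.L :+ .unary x.L) (a' := fun x => .unary (x.L + x.L))
    ?_ pAddU_poly <| PolyD.pushD
      (a := fun x => .unary 12 :+ .unary x.U) (a' := fun x => .unary (12 * x.U))
    ?_ pMulU_poly <| PolyD.pushD
      (a := fun x => .ofList ([x.i.p.map Data.ofBool, List.replicate x.i.k (.nil :+ .nil),
        List.replicate x.i.n (.nil :+ .nil), x.a.bits.map Data.ofBool,
        x.b.bits.map Data.ofBool].map .ofList) :+ .unary (4 + 12 * x.U))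
          (a' := fun x => .unary x.big)
    ?_ (PolyD.congr pSum_poly ?_) <| PolyD.pushD
      (a := fun x => .unary x.big) (a' := fun x => .unary (c * x.big ^ d))
    ?_ (PolyD.seq (pMono_poly c d) <| PolyD.assign ?_) <|
      PolyD.pushD (a := fun x => frac x.a x.b) (a' := arg)
    ?_ hArg <| PolyD.pushD
      (a := fun x => x.i.enc :+ arg x) (a' := fun x => .binary (M x))
    ?_ hM <| PolyD.pushD
      (a := fun x => .binary (M x) :+ .unary (c * x.big ^ d))
      (a' := fun x => .unary (min (M x) (c * x.big ^ d)))
    ?_ pCap_poly <| PolyD.pushD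
      (a := fun x => x.i.enc :+ arg x) (a' := fun x => .binary (Q x))
    ?_ hQ <| PolyD.pushD
      (a := fun x => .binary (Q x) :+ .unary (c * x.big ^ d))
      (a' := fun x => .unary (min (Q x) (c * x.big ^ d)))
    ?_ pCap_poly <| PolyD.assign ?_
  · exact fun x σ h => by simp [h, TIx.inp, frac, e1]
  · exact fun x => by simp [TIx.expo, Nat.size_eq_bits_len]
  all_goals intro x
  all_goals try intro σ h
  all_goals try simp [h, TIx.inp, Idx.enc, frac, e1, Data.ofBits_eq]
  · exact Expr.eval_consTT (by simp [h]) 6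
  · exact ⟨Expr.eval_consTT (by simp [h, TIx.inp, Idx.enc]) 2, Expr.eval_consTT (by simp [h]) 2⟩
  · exact ⟨⟨Data.unary_eq _, Data.unary_eq _⟩, Expr.eval_consTT (by simp [h]) 4⟩
  · simp [TIx.big, Nat.size_eq_bits_len]
  · simp [Params.enc, TIx.params, Data.unary_succ]

/-! ## The dictator test -/

def toZ (b : Bool) : ZMod 2 := if b then 1 else 0

theorem toZ_xor (a b : Bool) : toZ (a ^^ b) = toZ a + toZ b := by cases a <;> cases b <;> decide
theorem toZ_and (a b : Bool) : toZ (a && b) = toZ a * toZ b := by cases a <;> cases b <;> decide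
theorem toZ_injective : Function.Injective toZ := by intro a b; cases a <;> cases b <;> decide

/-- The sign `(-1)^t`. -/
def sgn (t : ZMod 2) : ℝ := if t = 0 then 1 else -1

theorem sgn_add : ∀ s t : ZMod 2, sgn (s + t) = sgn s * sgn t := by
  have h : ∀ s : ZMod 2, s = 0 ∨ s = 1 := by decide
  intro s t
  have h2 : (1 + 1 : ZMod 2) = 0 := by decide
  rcases h s with rfl | rfl <;> rcases h t with rfl | rfl <;> simp [sgn, h2]

theorem sgn_mul_self (s : ZMod 2) : sgn s * sgn s = 1 := by
  unfold sgn; split_ifs <;> norm_num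

section
variable {n : ℕ}

def vxor (x y : Pt n) : Pt n := fun i => x i ^^ y i

theorem vxor_cancel (x y : Pt n) : vxor x (vxor x y) = y := by
  funext i; simp [vxor]

theorem vxor_comm (x y : Pt n) : vxor x y = vxor y x := by
  funext i; simp [vxor, Bool.xor_comm]

theorem vxor_assoc (x y z : Pt n) : vxor (vxor x y) z = vxor x (vxor y z) := by
  funext i; simp [vxor]

def xorEquiv (x : Pt n) : Pt n ≃ Pt n :=
  ⟨vxor x, vxor x, vxor_cancel x, vxor_cancel x⟩

/-- The linear form with coefficient set `S`. -/
def chi (S : Finset (Fin n)) (v : Pt n) : ZMod 2 := ∑ i ∈ S, toZ (v i)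

theorem chi_xor (S : Finset (Fin n)) (v w : Pt n) : chi S (vxor v w) = chi S v + chi S w := by
  simp only [chi, vxor, toZ_xor, Finset.sum_add_distrib]

theorem sgn_chi (S : Finset (Fin n)) (v : Pt n) : sgn (chi S v) = ∏ i ∈ S, sgn (toZ (v i)) := by
  classical
  unfold chi
  induction S using Finset.induction_on with
  | empty => simp [sgn]
  | insert i S hi ih => rw [Finset.sum_insert hi, Finset.prod_insert hi, sgn_add, ih]

theorem sum_sgn_chi (v : Pt n) :
    ∑ S : Finset (Fin n), sgn (chi S v) = if v = (fun _ => false) then (2 : ℝ) ^ n else 0 := by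
  classical
  simp only [sgn_chi]
  rw [← Finset.powerset_univ, ← Finset.prod_one_add]
  split_ifs with h
  · subst h
    rw [Finset.prod_congr rfl (g := fun _ => (2 : ℝ)) fun i _ => by simp [toZ, sgn]; norm_num]
    simp
  · obtain ⟨i, hi⟩ := Function.ne_iff.1 h
    exact Finset.prod_eq_zero (Finset.mem_univ i) (by
      have : v i = true := by simpa using hi
      simp [this, toZ, sgn])

theorem parseval (K : Pt n → ℝ) :
    ∑ S : Finset (Fin n), (∑ w, K w * sgn (chi S w)) ^ 2 = 2 ^ n * ∑ w, K w ^ 2 := by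
  classical
  calc ∑ S : Finset (Fin n), (∑ w, K w * sgn (chi S w)) ^ 2
      = ∑ S : Finset (Fin n), ∑ w, ∑ w', K w * K w' * sgn (chi S (vxor w w')) := by
        refine Finset.sum_congr rfl fun S _ => ?_
        rw [sq, Finset.sum_mul_sum]
        refine Finset.sum_congr rfl fun w _ => Finset.sum_congr rfl fun w' _ => ?_
        rw [chi_xor, sgn_add]; ring
    _ = ∑ w, ∑ w', K w * K w' * ∑ S : Finset (Fin n), sgn (chi S (vxor w w')) := by
        rw [Finset.sum_comm]
        refine Finset.sum_congr rfl fun w _ => ?_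
        rw [Finset.sum_comm]
        simp only [Finset.mul_sum]
    _ = ∑ w, K w * K w * 2 ^ n := by
        refine Finset.sum_congr rfl fun w _ => ?_
        rw [Finset.sum_eq_single w]
        · rw [sum_sgn_chi, if_pos (by funext i; simp [vxor])]
        · intro w' _ hw
          rw [sum_sgn_chi, if_neg, mul_zero]
          intro h
          refine hw (funext fun i => ?_)
          have := congrFun h i
          simp only [vxor, bne_eq_false_iff_eq] at this
          exact this.symm
        · simp
    _ = 2 ^ n * ∑ w, K w ^ 2 := by
        rw [Finset.mul_sum]
        exact Finset.sum_congr rfl fun w _ => by ring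

/-- A function that is linear on most parallelograms is close to an affine function. -/
theorem exists_affine_close (g : Pt n → Bool) {δ : ℝ} (h0 : 0 ≤ δ) (h1 : 2 * δ ≤ 1)
    (h : ((2 : ℝ) ^ n) ^ 3 * (1 - 2 * δ) ≤ ∑ x, ∑ y, ∑ z, sgn (toZ (g x) + toZ (g (vxor x y)) +
      (toZ (g (vxor x z)) + toZ (g (vxor x (vxor y z)))))) :
    ∃ (S : Finset (Fin n)) (c : ZMod 2),
      (∑ v, if toZ (g v) ≠ chi S v + c then (1 : ℝ) else 0) ≤ δ * 2 ^ n := by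
  classical
  set N : ℝ := 2 ^ n with hN
  have hN0 : 0 < N := by positivity
  set G : Pt n → ℝ := fun v => sgn (toZ (g v)) with hG
  set H : Pt n → ℝ := fun w => ∑ x, G x * G (vxor x w) with hH
  set T : Finset (Fin n) → ℝ := fun S => ∑ w, G w * sgn (chi S w) with hT
  -- `H` is the autocorrelation of `G`, so its Fourier transform is the square of that of `G`.
  have e1 : ∀ S, ∑ w, H w * sgn (chi S w) = T S ^ 2 := by
    intro S
    simp only [hH, hT, Finset.sum_mul]
    rw [Finset.sum_comm, sq, Finset.sum_mul_sum]
    refine Finset.sum_congr rfl fun x _ => ?_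
    rw [← Equiv.sum_comp (xorEquiv x)]
    refine Finset.sum_congr rfl fun w _ => ?_
    change G x * G (vxor x (vxor x w)) * sgn (chi S (vxor x w)) = _
    rw [vxor_cancel, chi_xor, sgn_add]; ring
  -- The square of an autocorrelation runs over pairs of parallel edges, that is, over
  -- parallelograms.
  have e2 : ∑ w, H w ^ 2 = ∑ x, ∑ y, ∑ z, sgn (toZ (g x) + toZ (g (vxor x y)) +
      (toZ (g (vxor x z)) + toZ (g (vxor x (vxor y z))))) := by
    rw [Finset.sum_comm]
    refine Finset.sum_congr rfl fun y _ => ?_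
    rw [sq, hH, Finset.sum_mul_sum]
    refine Finset.sum_congr rfl fun x _ => ?_
    rw [← Equiv.sum_comp (xorEquiv x)]
    refine Finset.sum_congr rfl fun z _ => ?_
    change G x * G (vxor x y) * (G (vxor x z) * G (vxor (vxor x z) y)) = _
    rw [sgn_add, sgn_add, sgn_add, vxor_assoc, vxor_comm z y]
  -- Parseval for `H` gives the sum of the fourth powers of the coefficients, and Parseval for `G`
  -- gives the sum of their squares.
  have p1 : ∑ S, (T S ^ 2) ^ 2 = N * ∑ w, H w ^ 2 := by
    rw [← parseval]; exact Finset.sum_congr rfl fun S _ => by rw [e1]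
  have p2 : ∑ S, T S ^ 2 = N * N := by
    rw [hT, parseval]
    simp [hG, sq, sgn_mul_self, hN]
  -- The fourth moment is at most the largest square times the second moment, so the largest
  -- coefficient is nearly maximal; its sign determines the constant of the affine function.
  obtain ⟨S, -, hS⟩ := Finset.exists_max_image Finset.univ (fun S => T S ^ 2) Finset.univ_nonempty
  have hmax : N ^ 2 * (1 - 2 * δ) ≤ T S ^ 2 := by
    have : ∑ S', (T S' ^ 2) ^ 2 ≤ T S ^ 2 * ∑ S', T S' ^ 2 := by
      rw [Finset.mul_sum]
      refine Finset.sum_le_sum fun S' _ => ?_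
      rw [sq]
      exact mul_le_mul_of_nonneg_right (hS S' (Finset.mem_univ _)) (sq_nonneg _)
    rw [p1, p2, e2] at this
    have h2 := mul_le_mul_of_nonneg_left h hN0.le
    have h3 : N ^ 2 * (N ^ 2 * (1 - 2 * δ)) ≤ N ^ 2 * T S ^ 2 := by
      calc N ^ 2 * (N ^ 2 * (1 - 2 * δ)) = N * (N ^ 3 * (1 - 2 * δ)) := by ring
        _ ≤ T S ^ 2 * (N * N) := h2.trans this
        _ = N ^ 2 * T S ^ 2 := by ring
    exact le_of_mul_le_mul_left h3 (by positivity)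
  have hcount : ∀ c : ZMod 2, (∑ v, if toZ (g v) ≠ chi S v + c then (1 : ℝ) else 0) =
      (N - sgn c * T S) / 2 := by
    intro c
    have hz : ∀ s t u : ZMod 2, (if s ≠ t + u then (1 : ℝ) else 0) =
        (1 - sgn u * (sgn s * sgn t)) / 2 := by
      intro s t u
      have hss : s ≠ t + u ↔ s + t + u ≠ 0 := by revert s t u; decide
      rw [← mul_assoc, mul_comm (sgn u), mul_assoc, mul_comm (sgn u), ← mul_assoc, ← sgn_add, ←
        sgn_add]
      simp only [hss]
      by_cases h : s + t + u = 0
      · simp [h, sgn]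
      · simp [h, sgn]
    simp only [hz, hT, ← Finset.sum_div, Finset.sum_sub_distrib, ← Finset.mul_sum, hG]
    simp [hN]
  -- Uses `(1 - 2 δ) ^ 2 ≤ 1 - 2 δ`, which holds because `1 - 2 δ` lies between `0` and `1`.
  have hle : N * (1 - 2 * δ) ≤ |T S| := by
    refine abs_le_of_sq_le_sq' ?_ (abs_nonneg _) |>.2
    rw [sq_abs]
    refine le_trans ?_ hmax
    rw [mul_pow]
    refine mul_le_mul_of_nonneg_left ?_ (by positivity)
    nlinarith
  rcases abs_cases (T S) with ⟨h5, -⟩ | ⟨h5, -⟩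
  · refine ⟨S, 0, ?_⟩
    rw [hcount]
    simp only [sgn, if_true]
    linarith
  · refine ⟨S, 1, ?_⟩
    rw [hcount]
    simp only [sgn, one_ne_zero, if_false]
    linarith

end

section
variable {n : ℕ}

theorem pr_uniform_toReal {α : Type} [Fintype α] [Nonempty α] (E : α → Prop) [DecidablePred E] :
    (pr (PMF.uniformOfFintype α) E).toReal = (∑ a, if E a then (1 : ℝ) else 0) / Fintype.card
      α := by
  classical
  rw [pr, ex_uniform, ENNReal.toReal_mul, ENNReal.toReal_inv, ENNReal.toReal_natCast,
    ENNReal.toReal_sum (fun a _ => by split_ifs <;> simp), div_eq_inv_mul]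
  congr 1
  refine Finset.sum_congr rfl fun a _ => ?_
  by_cases h : E a <;> simp [h]

theorem rnd3_eq (n : ℕ) : rnd3 n = PMF.uniformOfFintype _ := by
  rw [← uniform_prod, ← uniform_prod, rnd3]
  simp only [PMF.map, PMF.bind_bind, Function.comp_apply, PMF.pure_bind]
  rfl

theorem unif_xor (w : Pt n) : (unif n).map (fun v => vxor v w) = unif n := by
  rw [show (fun v => vxor v w) = xorEquiv w by funext v; exact vxor_comm _ _]
  exact uniform_map_equiv _

/-- For fixed `y` and `z` the point `x + ψ y z` is a translate of the uniform point `x`; so every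
single query of a round is uniformly distributed. -/
theorem pr_rnd3_fst (ψ : Pt n → Pt n → Pt n) (E : Pt n → Prop) :
    pr (rnd3 n) (fun t => E (vxor t.1 (ψ t.2.1 t.2.2))) = pr (unif n) E := by
  have : (rnd3 n).map (fun t => vxor t.1 (ψ t.2.1 t.2.2)) = unif n := by
    rw [rnd3, PMF.bind_comm]
    simp only [PMF.map_bind, PMF.pure_map]
    calc _ = (unif n).bind fun _ => unif n := by
          congr 1; funext y
          rw [PMF.bind_comm]
          calc _ = (unif n).bind fun _ => unif n := by
                congr 1; funext z
                exact (PMF.bind_pure_comp _ _).trans (unif_xor _)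
            _ = _ := PMF.bind_const _ _
      _ = _ := PMF.bind_const _ _
  rw [← this, pr_map]

/-- Translation invariance of the uniform distribution; it is needed to move the multiplicativity
test to unit vectors. -/
theorem pr_rnd3_snd (a b : Pt n) (E : Pt n → Pt n → Prop) :
    pr (rnd3 n) (fun t => E (vxor t.2.1 a) (vxor t.2.2 b)) = pr (rnd3 n) fun t => E t.2.1
      t.2.2 := by
  have : (rnd3 n).map (fun t => (t.1, vxor t.2.1 a, vxor t.2.2 b)) = rnd3 n := by
    rw [rnd3_eq]
    refine Eq.trans ?_ (uniform_map_equiv (Equiv.prodCongr (Equiv.refl (Pt n))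
      (Equiv.prodCongr (xorEquiv a) (xorEquiv b))))
    congr 1; funext t
    simp [xorEquiv, vxor_comm]
    rfl
  conv_rhs => rw [← this, pr_map]

/-- `D_u(b) = g(u + b) + g(b)` is `u_τ` for most `b`. -/
def IsDict (g : Pt n → Bool) (τ : Fin n) : Prop :=
  ∀ u, pr (unif n) (fun b => (g (vxor b u) ^^ g b) ≠ u τ) ≤ 1 / 24

/-- The round works with the differences `g (x + v) + g x`, in which an additive constant of `g`
cancels; so negated dictators pass as well. -/
theorem dictRound_spec {g : Pt n → Bool} {x y z : Pt n}
    (h : dictRound g (x, y, z) = true) :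
    toZ (g x) + toZ (g (vxor x y)) + (toZ (g (vxor x z)) + toZ (g (vxor x (vxor y z)))) = 0 ∧
    (toZ (g (vxor x fun i => y i && z i)) + toZ (g x) =
      (toZ (g (vxor x y)) + toZ (g x)) * (toZ (g (vxor x z)) + toZ (g x))) ∧
    toZ (g (vxor x fun _ => true)) + toZ (g x) = 1 := by
  simp only [dictRound, dictBits, List.map_cons, List.map_nil, dictOK, List.getD_cons_zero,
    List.getD_cons_succ, Bool.and_eq_true, beq_iff_eq] at h
  change ((g (vxor x (vxor y z)) ^^ g x) = ((g (vxor x y) ^^ g x) ^^ (g (vxor x z) ^^ g x)) ∧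
    (g (vxor x fun i => y i && z i) ^^ g x) = ((g (vxor x y) ^^ g x) && (g (vxor x z) ^^ g x))) ∧
    (g (vxor x fun _ => true) ^^ g x) = true at h
  obtain ⟨⟨h1, h2⟩, h3⟩ := h
  have e1 := congrArg toZ h1
  have e2 := congrArg toZ h2
  have e3 := congrArg toZ h3
  simp only [toZ_xor, toZ_and] at e1 e2 e3
  refine ⟨?_, e2, e3⟩
  have hh : ∀ a b c d : ZMod 2, d + a = (b + a) + (c + a) → a + b + (c + d) = 0 := by decide
  exact hh _ _ _ _ e1

/-- With rejection probability `δ`, the linearity part puts `g` within `δ` of an affine function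
`χ_S + c`. The product and oddness parts then make `χ_S` multiplicative on most pairs and equal to
one at the all-ones vector. This leaves only one-element sets `S`. Finally `g (b + u) + g b` is
wrong only if one of two uniform queries hits the set where `g` differs from `χ_S + c`; the bound
`1/48` makes this at most `1/24`. -/
theorem exists_isDict (g : Pt n → Bool)
    (h : pr (rnd3 n) (fun t => dictRound g t = false) < 1 / 48) : ∃ τ, IsDict g τ := by
  classical
  set δ : ℝ≥0∞ := pr (rnd3 n) fun t => dictRound g t = false with hδ
  have hδt : δ ≠ ⊤ := pr_ne_top _ _
  have hδr : δ.toReal < 1 / 48 := by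
    have := (ENNReal.toReal_lt_toReal hδt (by simp)).2 h
    simpa using this
  obtain ⟨S, c, hS⟩ := exists_affine_close g (δ := δ.toReal) ENNReal.toReal_nonneg (by linarith) (by
    have h1 : ∀ s : ZMod 2, sgn s = 1 - 2 * if s ≠ 0 then 1 else 0 := fun s => by
      by_cases h : s = 0 <;> simp [sgn, h]; norm_num
    have h2 : (pr (rnd3 n) fun t => toZ (g t.1) + toZ (g (vxor t.1 t.2.1)) +
        (toZ (g (vxor t.1 t.2.2)) + toZ (g (vxor t.1 (vxor t.2.1 t.2.2)))) ≠ 0).toReal ≤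
          δ.toReal := by
      refine ENNReal.toReal_mono hδt (pr_mono fun t _ ht => ?_)
      by_contra hc
      exact ht (dictRound_spec (by simpa using hc)).1
    rw [rnd3_eq, pr_uniform_toReal, div_le_iff₀ (by positivity)] at h2
    simp only [h1, Finset.sum_sub_distrib, ← Finset.mul_sum]
    simp only [Fintype.sum_prod_type, Fintype.card_prod] at h2
    simp at h2 ⊢
    nlinarith)
  have hη : pr (unif n) (fun v => toZ (g v) ≠ chi S v + c) ≤ δ := by
    rw [← ENNReal.toReal_le_toReal (pr_ne_top _ _) hδt, unif, pr_uniform_toReal,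
      div_le_iff₀ (by positivity)]
    simpa using hS
  have hsh : ∀ ψ : Pt n → Pt n → Pt n, pr (rnd3 n) (fun t => toZ (g (vxor t.1 (ψ t.2.1 t.2.2))) ≠
      chi S (vxor t.1 (ψ t.2.1 t.2.2)) + c) ≤ δ := fun ψ =>
    (pr_rnd3_fst ψ fun v => toZ (g v) ≠ chi S v + c).le.trans hη
  have hv0 : ∀ v : Pt n, vxor v (fun _ => false) = v := fun v => by funext i; simp [vxor]
  have hg := hsh fun _ _ _ => false
  simp only [hv0] at hg
  have hcancel : ∀ a b c : ZMod 2, a + b + c + (a + c) = b := by decide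
  -- A failure needs a rejected round or a disagreement of `g` and `χ_S + c` at one of the four
  -- points involved: five events of probability at most `δ`.
  have hbil : pr (rnd3 n) (fun t => chi S (fun i => t.2.1 i && t.2.2 i) ≠
      chi S t.2.1 * chi S t.2.2) ≤ 5 * δ := by
    calc _ ≤ pr (rnd3 n) (fun t => dictRound g t = false ∨ toZ (g t.1) ≠ chi S t.1 + c ∨
          toZ (g (vxor t.1 t.2.1)) ≠ chi S (vxor t.1 t.2.1) + c ∨
          toZ (g (vxor t.1 t.2.2)) ≠ chi S (vxor t.1 t.2.2) + c ∨
          toZ (g (vxor t.1 fun i => t.2.1 i && t.2.2 i)) ≠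
            chi S (vxor t.1 fun i => t.2.1 i && t.2.2 i) + c) := by
          refine pr_mono fun t _ ht => ?_
          by_contra hc
          push Not at hc
          obtain ⟨h1, h2, h3, h4, h5⟩ := hc
          have := (dictRound_spec (x := t.1) (y := t.2.1) (z := t.2.2) (by simpa using h1)).2.1
          rw [h2, h3, h4, h5, chi_xor, chi_xor, chi_xor, hcancel, hcancel, hcancel] at this
          exact ht this
      _ ≤ δ + (δ + (δ + (δ + δ))) := by
          refine (pr_or_le _ _).trans (add_le_add le_rfl ((pr_or_le _ _).trans (add_le_add hg
            ((pr_or_le _ _).trans (add_le_add (hsh fun y _ => y) ((pr_or_le _ _).trans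
              (add_le_add (hsh fun _ z => z) (hsh fun y z i => y i && z i))))))))
      _ = 5 * δ := by ring
  have hodd : chi S (fun _ => true) = 1 := by
    by_contra hne
    -- Whether `χ_S` is one at the all-ones vector does not depend on chance, so a failure would
    -- make one of three rare events certain.
    have : (1 : ℝ≥0∞) ≤ 3 * δ := by
      calc 1 = pr (rnd3 n) (fun _ => True) := (pr_eq_one fun _ _ => trivial).symm
        _ ≤ pr (rnd3 n) (fun t => dictRound g t = false ∨ toZ (g t.1) ≠ chi S t.1 + c ∨
            toZ (g (vxor t.1 fun _ => true)) ≠ chi S (vxor t.1 fun _ => true) + c) := by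
            refine pr_mono fun t _ _ => ?_
            by_contra hc
            push Not at hc
            obtain ⟨h1, h2, h3⟩ := hc
            have := (dictRound_spec (x := t.1) (y := t.2.1) (z := t.2.2) (by simpa using h1)).2.2
            rw [h2, h3, chi_xor, hcancel] at this
            exact hne this
        _ ≤ δ + (δ + δ) := (pr_or_le _ _).trans (add_le_add le_rfl ((pr_or_le _ _).trans
            (add_le_add hg (hsh fun _ _ _ => true))))
        _ = 3 * δ := by ring
    have h3 := ENNReal.toReal_mono (by finiteness) this
    rw [ENNReal.toReal_mul] at h3
    simp at h3
    linarith
  obtain ⟨i, hi⟩ : S.Nonempty := by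
    by_contra hc
    rw [Finset.not_nonempty_iff_eq_empty] at hc
    simp [hc, chi] at hodd
  have huniq : ∀ j ∈ S, j = i := by
    intro j hj
    by_contra hij
    let e : Fin n → Pt n := fun i j => decide (j = i)
    have hce : ∀ i ∈ S, chi S (e i) = 1 := fun i hi => by
      rw [chi, Finset.sum_eq_single i (fun j _ hj => by simp [e, hj, toZ]) (fun h => (h hi).elim)]
      simp [e, toZ]
    set Q : Pt n → Pt n → Prop := fun y z =>
      chi S (fun i => y i && z i) ≠ chi S y * chi S z with hQ
    -- Polarisation: for different `i` and `j` in `S`, the defects of multiplicativity at `(y, z)`,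
    -- `(y + e i, z)`, `(y, z + e j)` and `(y + e i, z + e j)` add up to the defect at `(e i, e j)`.
    -- That one is not zero, so one of the four always fails.
    have : (1 : ℝ≥0∞) ≤ 20 * δ := by
      calc 1 = pr (rnd3 n) (fun _ => True) := (pr_eq_one fun _ _ => trivial).symm
        _ ≤ pr (rnd3 n) (fun t => Q (vxor t.2.1 fun _ => false) (vxor t.2.2 fun _ => false) ∨
            Q (vxor t.2.1 (e i)) (vxor t.2.2 fun _ => false) ∨
            Q (vxor t.2.1 fun _ => false) (vxor t.2.2 (e j)) ∨
            Q (vxor t.2.1 (e i)) (vxor t.2.2 (e j))) := by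
            refine pr_mono fun t _ _ => ?_
            by_contra hc
            simp only [hQ, hv0] at hc
            push Not at hc
            obtain ⟨h1, h2, h3, h4⟩ := hc
            have hand : ∀ a b c : Pt n, (fun i => vxor a b i && c i) =
                vxor (fun i => a i && c i) fun i => b i && c i := fun a b c => by
              funext k; simp only [vxor]; cases a k <;> cases b k <;> cases c k <;> rfl
            have hand' : ∀ a b c : Pt n, (fun i => c i && vxor a b i) =
                vxor (fun i => c i && a i) fun i => c i && b i := fun a b c => by
              funext k; simp only [vxor]; cases a k <;> cases b k <;> cases c k <;> rfl
            have h0 : chi S (fun k => e i k && e j k) = 0 := by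
              rw [chi]
              refine Finset.sum_eq_zero fun k _ => ?_
              by_cases hk : k = i
              · simp [e, hk, Ne.symm hij, toZ]
              · simp [e, hk, toZ]
            rw [hand, hand', chi_xor, hand', chi_xor, chi_xor, chi_xor, chi_xor, h0, hce i hi,
              hce j hj] at h4
            rw [hand, chi_xor, chi_xor, hce i hi] at h2
            rw [hand', chi_xor, chi_xor, hce j hj] at h3
            generalize chi S (fun i => t.2.1 i && t.2.2 i) = a at *
            generalize chi S (fun k => e i k && t.2.2 k) = b at *
            generalize chi S (fun k => t.2.1 k && e j k) = b' at *
            generalize chi S t.2.1 = u at *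
            generalize chi S t.2.2 = v at *
            revert h1 h2 h3 h4
            revert a b b' u v
            decide
        _ ≤ 5 * δ + (5 * δ + (5 * δ + 5 * δ)) := by
            refine (pr_or_le _ _).trans (add_le_add ((pr_rnd3_snd _ _ Q).le.trans hbil)
              ((pr_or_le _ _).trans (add_le_add ((pr_rnd3_snd _ _ Q).le.trans hbil)
              ((pr_or_le _ _).trans (add_le_add ((pr_rnd3_snd _ _ Q).le.trans hbil)
                ((pr_rnd3_snd _ _ Q).le.trans hbil))))))
        _ = 20 * δ := by ring
    have h3 := ENNReal.toReal_mono (by finiteness) this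
    rw [ENNReal.toReal_mul] at h3
    simp at h3
    linarith
  have hchi : ∀ v, chi S v = toZ (v i) := fun v =>
    Finset.sum_eq_single i (fun j hj hji => (hji (huniq j hj)).elim) fun h => (h hi).elim
  refine ⟨i, fun u => ?_⟩
  calc _ ≤ pr (unif n) (fun b => toZ (g (vxor b u)) ≠ chi S (vxor b u) + c ∨
        toZ (g b) ≠ chi S b + c) := by
        refine pr_mono fun b _ hb => ?_
        by_contra hc
        push Not at hc
        refine hb (toZ_injective ?_)
        rw [toZ_xor, hc.1, hc.2, chi_xor, hcancel, hchi]
    _ ≤ δ + δ := by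
        refine (pr_or_le _ _).trans (add_le_add (le_trans (le_of_eq ?_) hη) hη)
        conv_rhs => rw [← unif_xor u, pr_map]
    _ ≤ 1 / 48 + 1 / 48 := add_le_add h.le h.le
    _ = 1 / 24 := by
        rw [← ENNReal.toReal_eq_toReal_iff' (by finiteness) (by finiteness), ENNReal.toReal_add
          (by finiteness) (by finiteness)]
        norm_num

end

/-- The drift argument behind all tail bounds below: together with `pr_le_ex`, an exponential of a
counter as potential yields a Chernoff bound, and `c = 1` gives a supermartingale. -/
theorem ex_foldK {α β : Type} {st : β → α → PMF α} {V : α → ℝ≥0∞} {c : ℝ≥0∞} (Inv : α → Prop)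
    {l : List β} (hI : ∀ b ∈ l, ∀ a, Inv a → ∀ a' ∈ (st b a).support, Inv a')
    (h : ∀ b ∈ l, ∀ a, Inv a → ex (st b a) V ≤ c * V a) {a : α} (ha : Inv a) :
    ex (foldK st l a) V ≤ c ^ l.length * V a := by
  induction l generalizing a with
  | nil => simp [foldK]
  | cons b l ih =>
    rw [foldK, ex_bind]
    calc _ ≤ ex (st b a) fun a' => c ^ l.length * V a' := ex_mono fun a' ha' =>
          ih (fun b hb => hI b (by simp [hb])) (fun b hb => h b (by simp [hb])) (hI b (by simp) a
            ha a' ha')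
      _ ≤ c ^ l.length * (c * V a) := by
          rw [ex_mul]
          exact mul_le_mul_right (h b (by simp) a ha) _
      _ = _ := by rw [List.length_cons]; ring

/-! ### Error bounds for the dictator test and for decoding -/

section
variable {n : ℕ} {f : Pt n → Bool}

/-- By `exists_isDict` each of the 128 independent rounds rejects with probability at least `1/48`,
and `(47/48) ^ 128 ≤ 1/8`. -/
theorem dictBlk_le {B : Blk n} (h : ∀ τ, ¬ IsDict (B.res f) τ) :
    pr (dictBlk f B) (· = true) ≤ 1 / 8 := by
  have h1 : (1 / 48 : ℝ≥0∞) ≤ pr (rnd3 n) (fun t => dictRound (B.res f) t = false) := by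
    by_contra hc
    obtain ⟨τ, hτ⟩ := exists_isDict _ (not_le.1 hc)
    exact h τ hτ
  have h2 : pr (rnd3 n) (fun t => dictRound (B.res f) t = true) ≤ ENNReal.ofReal (47 / 48) := by
    have := pr_add_not (μ := rnd3 n) fun t => dictRound (B.res f) t = true
    simp only [Bool.not_eq_true] at this
    rw [← ENNReal.toReal_le_toReal (pr_ne_top _ _) (by finiteness), ENNReal.toReal_ofReal
      (by norm_num)]
    have h3 := congrArg ENNReal.toReal this
    rw [ENNReal.toReal_add (pr_ne_top _ _) (pr_ne_top _ _)] at h3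
    have h4 := ENNReal.toReal_mono (pr_ne_top _ _) h1
    simp at h3 h4
    linarith
  have h3 := ex_foldK (st := fun (_ : Data) ok => (rnd3 n).map fun t => dictRound (B.res f) t && ok)
    (V := fun b => if b = true then 1 else 0) (c := ENNReal.ofReal (47 / 48)) (fun _ => True)
    (l := List.replicate 128 Data.nil) (fun _ _ _ _ _ _ => trivial) (fun _ _ a _ => by
      cases a
      · simp [ex_map]
      · simp only [Bool.and_true, ex_map, mul_one, if_true]
        convert h2
        rw [pr]
        congr!) (a := true) trivial
  rw [dictBlk, pr]
  refine le_trans (le_of_eq (by congr!)) (h3.trans ?_)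
  rw [if_pos rfl, mul_one, List.length_replicate, ← ENNReal.ofReal_pow (by norm_num),
    show (1 / 8 : ℝ≥0∞) = ENNReal.ofReal (1 / 8) by
      rw [ENNReal.ofReal_div_of_pos (by norm_num)]; simp]
  exact ENNReal.ofReal_le_ofReal (by norm_num)

theorem dictAll_le {l : List (Blk n)} {B : Blk n} (hB : B ∈ l) (h : ∀ τ, ¬ IsDict (B.res f) τ) :
    pr (dictAll f l) (· = true) ≤ 1 / 8 := by
  have hle : ∀ (l : List (Blk n)) (ok : Bool), pr (foldK (fun B ok => (dictBlk f B).map fun b =>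
      b && ok) l ok) (· = true) ≤ if ok = true then 1 else 0 := by
    intro l ok
    cases ok with
    | true => simpa using pr_le_one _ _
    | false =>
      refine (pr_eq_zero fun a ha => ?_).le
      have := foldK_support (fun _ a => a = false) l (fun j b _ a ha a' ha' => by
        rw [PMF.mem_support_map_iff] at ha'
        obtain ⟨c, -, rfl⟩ := ha'
        simp [ha]) l (fun _ h => h) false rfl a ha
      simp [this]
  suffices ∀ ok, pr (foldK (fun B ok => (dictBlk f B).map fun b => b && ok) l ok) (· = true) ≤ 1 / 8
    from this true
  induction l with
  | nil => simp at hB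
  | cons B' l ih =>
    intro ok
    rw [foldK, pr_bind]
    rcases List.mem_cons.1 hB with rfl | hB
    · refine (ex_mono fun a _ => hle l a).trans (le_trans ?_ (dictBlk_le h))
      rw [ex_map, pr]
      refine ex_mono fun b _ => ?_
      cases b <;> simp
      split_ifs <;> simp
    · exact ex_le_of_support _ fun a _ => ih hB a

/-- A wrong bit without a contradiction means that the right bit was not seen in any of the `L`
rounds; a single round misses it with probability at most `1/24`. -/
theorem decBlk_wrong {B : Blk n} {τ : Fin n} (h : IsDict (B.res f) τ) (u : Pt n) (L : ℕ) :
    pr (decBlk f u L B) (fun s => s.2 ≠ u τ ∧ (s.1 && s.2) = false) ≤ (1 / 24) ^ L := by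
  set fl : Bool × Bool → Bool := fun s => if u τ then s.2 else s.1 with hfl
  calc _ ≤ ex (decBlk f u L B) (fun s => if fl s = false then 1 else 0) := by
        refine pr_le_ex fun s _ hs => ?_
        obtain ⟨s1, s2⟩ := s
        cases hu : u τ <;> cases s1 <;> cases s2 <;> simp_all [hfl]
    _ ≤ (1 / 24) ^ L * (if fl (false, false) = false then 1 else 0) := by
        have := ex_foldK (st := fun (_ : Data) (s : Bool × Bool) => (unif n).map fun b =>
            (s.1 || !(B.res f (fun i => b i ^^ u i) ^^ B.res f b),
              s.2 || (B.res f (fun i => b i ^^ u i) ^^ B.res f b)))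
          (V := fun s => if fl s = false then 1 else 0) (c := 1 / 24) (fun _ => True)
          (l := List.replicate L (Data.cons .nil .nil)) (fun _ _ _ _ _ _ => trivial)
          (fun _ _ s _ => ?_) (a := (false, false)) trivial
        · rwa [List.length_replicate] at this
        · rw [ex_map]
          split_ifs with hs
          · rw [mul_one]
            refine le_trans (le_of_eq ?_) (h u)
            rw [pr]
            refine ex_congr fun b _ => ?_
            obtain ⟨s1, s2⟩ := s
            rw [show vxor b u = fun i => b i ^^ u i from rfl]
            generalize (B.res f (fun i => b i ^^ u i) ^^ B.res f b) = c
            cases hu : u τ <;> cases c <;> simp_all [hfl]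
          · refine (ex_le_of_support _ fun b _ => ?_)
            obtain ⟨s1, s2⟩ := s
            cases hu : u τ <;> cases s1 <;> cases s2 <;> simp_all [hfl]
    _ ≤ _ := by simp [hfl]

theorem decode_flag {L : ℕ} {u : Pt n} {l : List (Blk n)} {a a' : List Bool × Bool}
    (h : a' ∈ (foldK (decStep f u L) l a).support) (ha : a.2 = true) : a'.2 = true :=
  foldK_support (fun _ a => a.2 = true) l (fun j b _ a ha a' ha' => by
    rw [decStep, PMF.mem_support_map_iff] at ha'
    obtain ⟨c, -, rfl⟩ := ha'
    simp [ha]) l (fun _ h => h) a ha a' h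

/-- Union bound over the blocks. The flag for contradictions is never cleared, so what happens after
it has been raised does not count. -/
theorem decode_wrong {l : List (Blk n)} {ts : List (Fin n)}
    (h : List.Forall₂ (fun B τ => IsDict (B.res f) τ) l ts) (u : Pt n) (L : ℕ) :
    pr (decode f u L l) (fun a => a.2 = false ∧ a.1 ≠ ts.map u) ≤ l.length * (1 / 24) ^ L := by
  have key : ∀ (l : List (Blk n)) (ts : List (Fin n)),
      List.Forall₂ (fun B τ => IsDict (B.res f) τ) l ts → ∀ a : List Bool × Bool,
      pr (foldK (decStep f u L) l a) (fun a' => a'.2 = false ∧ a'.1 ≠ (ts.map u).reverse ++ a.1) ≤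
        l.length * (1 / 24) ^ L := by
    intro l ts h
    induction h with
    | nil => intro a; simp [foldK, pr]
    | @cons B τ l ts hB _ ih =>
      intro a
      rw [foldK, List.length_cons, Nat.cast_succ, add_mul, one_mul, add_comm]
      refine pr_bind_le (E := fun a1 => a1.2 = false ∧ a1.1 ≠ u τ :: a.1) ?_ fun a1 h1 h2 => ?_
      · rw [decStep, pr_map]
        refine (pr_mono fun s _ hs => ?_).trans (decBlk_wrong hB u L)
        simp only [Bool.or_eq_false_iff, ne_eq, List.cons.injEq, and_true] at hs
        exact ⟨hs.2, hs.1.2⟩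
      · by_cases h3 : a1.2 = true
        · rw [pr_eq_zero fun a' ha' => by simp [decode_flag ha' h3]]
          exact zero_le
        · have h4 : a1.1 = u τ :: a.1 := by
            by_contra hc
            exact h2 ⟨by simpa using h3, hc⟩
          have := ih a1
          simpa [h4] using this
  have := key l.reverse ts.reverse (List.rel_reverse h) ([], false)
  rw [decode]
  simpa [List.map_reverse] using this

/-- The constant `c` cancels in the difference, so every round shows `u τ`; `0 < L` ensures that
there is at least one round. -/
theorem decBlk_exact {B : Blk n} {τ : Fin n} {c : Bool} (h : ∀ x, B.res f x = (x τ ^^ c))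
    {u : Pt n} {L : ℕ} (hL : 0 < L) {s : Bool × Bool} (hs : s ∈ (decBlk f u L B).support) :
    s = (!u τ, u τ) := by
  have := foldK_support (fun j s => s = (!u τ, u τ) ∨ s = (false, false) ∧ j = L) _
    (fun j b _ s hs s' hs' => by
      rw [PMF.mem_support_map_iff] at hs'
      obtain ⟨b, -, rfl⟩ := hs'
      simp only [h]
      left
      rcases hs with rfl | ⟨rfl, -⟩ <;> cases u τ <;> cases b τ <;> cases c <;> rfl) _
        (fun _ h => h)
    (false, false) (by simp) s hs
  rcases this with h | ⟨-, h⟩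
  · exact h
  · omega

theorem decode_exact {l : List (Blk n)} {ts : List (Fin n)}
    (h : List.Forall₂ (fun B τ => ∃ c, ∀ x, B.res f x = (x τ ^^ c)) l ts) {u : Pt n} {L : ℕ}
    (hL : 0 < L) : decode f u L l = PMF.pure (ts.map u, false) := by
  have key : ∀ (l : List (Blk n)) (ts : List (Fin n)),
      List.Forall₂ (fun B τ => ∃ c, ∀ x, B.res f x = (x τ ^^ c)) l ts → ∀ z : List Bool,
      foldK (decStep f u L) l (z, false) = PMF.pure ((ts.map u).reverse ++ z, false) := by
    intro l ts h
    induction h with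
    | nil => intro z; simp [foldK]
    | @cons B τ l ts hB _ ih =>
      intro z
      obtain ⟨c, hc⟩ := hB
      have h1 : decStep f u L B (z, false) = PMF.pure (u τ :: z, false) := by
        rw [decStep, map_congr_support (g := fun _ => (u τ :: z, false)) _ fun s hs => by
          rw [decBlk_exact hc hL hs]; simp]
        exact PMF.map_const _ _
      rw [foldK, h1, PMF.pure_bind, ih]
      simp
  have := key l.reverse ts.reverse (List.rel_reverse h) []
  rw [decode, this]
  simp [List.map_reverse]

theorem decD_exact {l : List (Blk n)} {ts : List (Fin n)}
    (h : List.Forall₂ (fun B τ => ∃ c, ∀ x, B.res f x = (x τ ^^ c)) l ts) {D : PMF (Pt n)}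
    {L : ℕ} (hL : 0 < L) : decD f D L l = D.map fun u => bitsVec l.length (ts.map u) := by
  rw [decD]
  simp only [decode_exact h hL]
  rw [PMF.map_bind]
  simp only [PMF.pure_map]
  rfl

end

/-! ### Soundness -/

theorem tl_iterate_unary (j m : ℕ) : Data.tl^[j] (.unary m) = .unary (m - j) := by
  induction j with
  | zero => rfl
  | succ j ih => rw [Function.iterate_succ_apply', ih, tl_unary]; rfl

theorem toVec_ofBits (n : ℕ) (z : List Bool) (j : Fin n) :
    Data.toVec n (.ofBits z) j = z.getD j.1 false := by
  rw [Data.toVec, Data.ofBits_eq, Data.tl_iterate_ofList, ← List.map_drop, ← Data.ofBits_eq,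
    List.getD_eq_getElem?_getD, ← List.head?_drop]
  rcases z.drop j.1 with _ | ⟨b, _⟩
  · rfl
  · cases b <;> rfl

/-- Zero projections remove the coordinates with `o j = none` one at a time; a single variable
projection then renames the others. Where that projection sends the removed coordinates is
irrelevant. -/
theorem mem_of_projections {n : ℕ} {C : Set (Pt n → Bool)} (hv : ClosedVarProj C)
    (hz : ClosedZeroProj C) {g : Pt n → Bool} (hg : g ∈ C) (o : Fin n → Option (Fin n)) :
    (fun x => g fun j => (o j).elim false x) ∈ C := by
  classical
  have h1 : ∀ S : Finset (Fin n), (fun x => g fun j => if j ∈ S then false else x j) ∈ C := by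
    intro S
    induction S using Finset.induction_on with
    | empty => simpa using hg
    | insert i S hi ih =>
      convert hz i _ ih using 3 with x
      funext j
      by_cases hj : j = i
      · subst hj; simp
      · simp [hj]
  convert hv (fun j => (o j).getD j) _ (h1 (Finset.univ.filter fun j => o j = none)) using 3 with x
  funext j
  cases h : o j <;> simp [h]

theorem elim_getElem? {n : ℕ} (ts : List (Fin n)) (u : Pt n) :
    (fun j : Fin n => (ts[j.1]?).elim false u) = Data.toVec n (.ofBits (ts.map u)) := by
  funext j
  rw [toVec_ofBits]
  cases h : ts[j.1]? <;> simp [List.getD_eq_getElem?_getD, h]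

section
variable {n : ℕ} {f : Pt n → Bool} {D : PMF (Pt n)}

/-- The potential is `2 ^ (-mismatches)`, and zero as soon as a contradiction has been seen. With
correct decoding, a mismatch of probability at least `ε` halves it; an undetected decoding error, of
probability at most `η`, can at worst hide a mismatch. -/
theorem checkStep_sound {l : List (Blk n)} {ts : List (Fin n)} {L : ℕ} {v : Pt n → Bool}
    {ε η : ℝ} (hη : 0 ≤ η) (h : List.Forall₂ (fun B τ => IsDict (B.res f) τ) l ts)
    (hL : (l.length * (1 / 24) ^ L : ℝ≥0∞) ≤ ENNReal.ofReal η)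
    (hfar : ε ≤ (pr D fun u => v (Data.toVec n (.ofBits (ts.map u))) ≠ f u).toReal) (a : ℕ × Bool) :
    ex (checkStep f D L l v a) (fun c => if c.2 then 0 else 2⁻¹ ^ c.1) ≤
      ENNReal.ofReal (1 - ε / 2 + η) * (if a.2 then 0 else 2⁻¹ ^ a.1) := by
  classical
  obtain ⟨c, r⟩ := a
  have hflag : ∀ V : ℕ × Bool → ℝ≥0∞, ex (checkStep f D L l v (c, r)) V = ex D fun u =>
      ex (decode f u L l) fun z => V (if v (Data.toVec n (.ofBits z.1)) ^^ f u then c + 1 else c,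
        r || z.2) := fun V => by
    simp only [checkStep, ex_map, ex_bind]
  rw [hflag]
  cases r with
  | true => simp
  | false =>
    simp only [Bool.false_or, Bool.false_eq_true, if_false]
    set P : ℝ≥0∞ := pr D fun u => v (Data.toVec n (.ofBits (ts.map u))) ≠ f u with hP
    set X : ℝ≥0∞ := ex D fun u => if v (Data.toVec n (.ofBits (ts.map u))) ≠ f u then 2⁻¹ else 1
      with hX
    have hXP : X + 2⁻¹ * P = 1 := by
      rw [hX, hP, pr, ← ex_mul, ← ex_add, ← ex_const D 1]
      refine ex_congr fun u _ => ?_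
      split_ifs <;> simp [ENNReal.inv_two_add_inv_two]
    have hXle : X ≤ ENNReal.ofReal (1 - ε / 2) := by
      have h1 : X ≠ ⊤ := ne_top_of_le_ne_top ENNReal.one_ne_top (hXP ▸ le_self_add)
      rw [← ENNReal.ofReal_toReal h1]
      refine ENNReal.ofReal_le_ofReal ?_
      have := congrArg ENNReal.toReal hXP
      rw [ENNReal.toReal_add h1 (ENNReal.mul_ne_top (by simp) (pr_ne_top _ _)), ENNReal.toReal_mul]
        at this
      simp at this
      linarith
    have h1 : (0 : ℝ) ≤ 1 - ε / 2 := by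
      have := ENNReal.toReal_mono ENNReal.one_ne_top (pr_le_one D fun u =>
        v (Data.toVec n (.ofBits (ts.map u))) ≠ f u)
      simp at this
      linarith
    rw [ENNReal.ofReal_add h1 hη, mul_comm]
    refine le_trans ?_ (mul_le_mul_right (add_le_add hXle le_rfl) _)
    rw [hX, ← ex_const D (ENNReal.ofReal η), ← ex_add, ← ex_mul]
    refine ex_mono fun u _ => ?_
    refine le_trans ?_ (mul_le_mul_right (add_le_add le_rfl
      ((decode_wrong h u L).trans hL)) _)
    rw [pr, ← ex_const (decode f u L l) (if v (Data.toVec n (.ofBits (ts.map u))) ≠ f u then 2⁻¹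
      else 1),
      ← ex_add, ← ex_mul]
    refine ex_mono fun z _ => ?_
    have hpow : (2⁻¹ : ℝ≥0∞) ^ (c + 1) ≤ 2⁻¹ ^ c := pow_le_pow_of_le_one zero_le (by simp)
      (by omega)
    by_cases hz2 : z.2 = true
    · simp [hz2]
    · by_cases hz1 : z.1 = ts.map u
      · by_cases hm : v (Data.toVec n (.ofBits (ts.map u))) = f u
        · simp [hz2, hz1, hm]
        · simp [hz2, hz1, hm, pow_succ]
      · have : (if v (Data.toVec n (.ofBits z.1)) ^^ f u then (2⁻¹ : ℝ≥0∞) ^ (c + 1) else 2⁻¹ ^ c) ≤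
            2⁻¹ ^ c := by split_ifs <;> simp [hpow]
        simp only [hz2, hz1, Bool.false_eq_true, if_false, ne_eq, not_false_eq_true, and_true]
        simp only [Bool.not_eq_true] at hz2
        simp only [if_true]
        calc _ ≤ (2⁻¹ : ℝ≥0∞) ^ c * 1 := by rw [mul_one]; split_ifs <;> simp [hpow]
          _ ≤ _ := mul_le_mul_right le_add_self _

theorem pow_le_exp {U : ℕ} (hU : 0 < U) {x : ℝ} (hx : -U ≤ x) (m : ℕ) :
    (1 + x / U) ^ (m * U) ≤ Real.exp (m * x) := by
  have h0 : (0 : ℝ) < U := by exact_mod_cast hU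
  calc (1 + x / U) ^ (m * U) ≤ (Real.exp (x / U)) ^ (m * U) := by
        refine pow_le_pow_left₀ ?_ ?_ _
        · rw [← sub_le_iff_le_add', zero_sub, le_div_iff₀ h0]; linarith
        · linarith [Real.add_one_le_exp (x / U)]
    _ = Real.exp (m * x) := by
        rw [← Real.exp_nat_mul]
        congr 1
        push_cast
        field_simp

/-- Each of the `100 U` rounds contracts the potential by `1 - 31 / (64 U)`, in total to at most
`exp (-775/16) ≤ 2 ^ (-62)`. Acceptance requires a potential of at least `2 ^ (-60)`, so by Markov
it has probability at most `1/4`. -/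
theorem check_sound {l : List (Blk n)} {ts : List (Fin n)} {L U : ℕ} {v : Pt n → Bool}
    (hU : 0 < U) (h : List.Forall₂ (fun B τ => IsDict (B.res f) τ) l ts)
    (hL : (l.length * (1 / 24) ^ L : ℝ≥0∞) ≤ ENNReal.ofReal (1 / (64 * U)))
    (hfar : 1 / U ≤ (pr D fun u => v (Data.toVec n (.ofBits (ts.map u))) ≠ f u).toReal) :
    pr (check f D L (100 * U) l v) (fun c => c.2 = false ∧ c.1 ≤ 60) ≤ 1 / 3 := by
  have h0 : (0 : ℝ) < U := by exact_mod_cast hU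
  have h1 := ex_foldK (st := fun (_ : Data) => checkStep f D L l v)
    (V := fun c => if c.2 then 0 else 2⁻¹ ^ c.1) (fun _ => True)
    (l := List.replicate (100 * U) (Data.cons .nil .nil)) (fun _ _ _ _ _ _ => trivial)
    (fun _ _ a _ => checkStep_sound (by positivity) h hL hfar a) (a := (0, false)) trivial
  calc _ ≤ ex (check f D L (100 * U) l v) (fun c => 2 ^ 60 * if c.2 then 0 else 2⁻¹ ^ c.1) := by
        refine pr_le_ex fun c _ hc => ?_
        rw [hc.1]
        simp only [Bool.false_eq_true, if_false]
        calc (1 : ℝ≥0∞) = 2 ^ c.1 * 2⁻¹ ^ c.1 := by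
              rw [← mul_pow, ENNReal.mul_inv_cancel (by simp) (by simp), one_pow]
          _ ≤ _ := by gcongr; exacts [by norm_num, hc.2]
    _ ≤ 2 ^ 60 * ENNReal.ofReal (1 - 1 / U / 2 + 1 / (64 * U)) ^ (100 * U) := by
        rw [ex_mul]
        refine mul_le_mul_right ?_ _
        rw [List.length_replicate] at h1
        simpa [check] using h1
    _ ≤ 2 ^ 60 * ENNReal.ofReal (1 / 2 ^ 62) := by
        refine mul_le_mul_right ?_ _
        have hU1 : (1 : ℝ) ≤ U := by exact_mod_cast hU
        have e : (1 : ℝ) - 1 / U / 2 + 1 / (64 * U) = 1 + (-(31 / 64)) / U := by field_simp; ring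
        rw [e, ← ENNReal.ofReal_pow (by
          rw [← sub_le_iff_le_add', zero_sub, le_div_iff₀ h0]; linarith)]
        refine ENNReal.ofReal_le_ofReal ((pow_le_exp hU (by linarith) 100).trans ?_)
        rw [show ((100 : ℕ) : ℝ) * (-(31 / 64)) = -(775 / 16) by norm_num, Real.exp_neg, one_div]
        refine inv_anti₀ (by positivity) ?_
        calc (2 : ℝ) ^ 62 ≤ 2.7 ^ 48 := by norm_num
          _ ≤ Real.exp 1 ^ 48 := pow_le_pow_left₀ (by norm_num) (by linarith [Real.exp_one_gt_d9]) _
          _ ≤ _ := by rw [← Real.exp_nat_mul]; exact Real.exp_le_exp.2 (by norm_num)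
    _ ≤ 1 / 3 := by
        rw [← ENNReal.toReal_le_toReal (by finiteness) (by finiteness), ENNReal.toReal_mul,
          ENNReal.toReal_ofReal (by norm_num)]
        norm_num

end

/-- Arbitrary blocks and an arbitrary output of the learner are allowed. Either some block is no
dictator and the dictator test rejects it with probability at least `7/8`; or the blocks define
coordinates `ts`, and every valid hypothesis evaluated at these coordinates is a member of the
class, hence far from `f`, so the check fails. -/
theorem judge_sound {R : RepClass} {i : Idx} (hv : ClosedVarProj (R.fns i))
    (hz : ClosedZeroProj (R.fns i)) {f : Pt i.n → Bool} {D : PMF (Pt i.n)}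
    {L U : ℕ} (hU : 0 < U) (hfar : ∀ g ∈ R.fns i, 1 / U ≤ (pr D fun u => g u ≠ f u).toReal)
    {l : List (Blk i.n)} (hL : (l.length * (1 / 24) ^ L : ℝ≥0∞) ≤ ENNReal.ofReal (1 / (64 * U)))
    (out : PMF Data) : pr (judge R i f D L (100 * U) l out) (· = true) ≤ 1 / 3 := by
  by_cases hg : ∀ B ∈ l, ∃ τ, IsDict (B.res f) τ
  · obtain ⟨ts, hts⟩ : ∃ ts, List.Forall₂ (fun B τ => IsDict (B.res f) τ) l ts := by
      clear hL
      induction l with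
      | nil => exact ⟨[], .nil⟩
      | cons B l ih =>
        obtain ⟨ts, hts⟩ := ih fun B hB => hg B (by simp [hB])
        obtain ⟨τ, hτ⟩ := hg B (by simp)
        exact ⟨τ :: ts, .cons hτ hts⟩
    rw [judge, pr_bind]
    refine ex_le_of_support _ fun b _ => ?_
    split_ifs
    · rw [pr_bind]
      refine ex_le_of_support _ fun r _ => ?_
      rw [verdict]
      split_ifs with hr
      · rw [pr_map]
        refine le_trans (pr_mono fun c _ hc => ?_) (check_sound hU hts hL
          (by simpa only [elim_getElem?] using hfar _ (mem_of_projections hv hz ⟨r, hr, rfl⟩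
            fun j => ts[j.1]?)))
        -- Dropping 60 entries of the unary counter leaves a true value exactly if there were more
        -- than 60 mismatches.
        rw [tl_iterate_unary, Data.truth_unary] at hc
        simp at hc
        exact ⟨hc.1, by omega⟩
      · simp [pr]
    · simp [pr]
  · push Not at hg
    obtain ⟨B, hB, hτ⟩ := hg
    calc _ ≤ 1 / 8 + 0 := pr_bind_le (dictAll_le hB hτ) fun b _ hb => by simp [hb, pr]
      _ ≤ 1 / 3 := by
        rw [add_zero]
        exact ENNReal.div_le_div_left (by norm_num) _

theorem testDist_sound {R : RepClass} {i : Idx} (hv : ClosedVarProj (R.fns i))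
    (hz : ClosedZeroProj (R.fns i)) {f : Pt i.n → Bool} {D : PMF (Pt i.n)}
    {U : ℕ} (hU : 0 < U) (hfar : ∀ g ∈ R.fns i, 1 / U ≤ (pr D fun u => g u ≠ f u).toReal)
    {p : Params} (hL : (i.k * (1 / 24) ^ p.L : ℝ≥0∞) ≤ ENNReal.ofReal (1 / (64 * U)))
    (hN : p.N = 100 * U) (hK : p.K = i.k + 1) (ν : List (Blk i.n) → PMF Data) :
    pr (testDist R i f D p ν) (· = true) ≤ 1 / 3 := by
  rw [testDist, pr_bind]
  refine ex_le_of_support _ fun M _ => ?_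
  rw [pr_bind]
  refine ex_le_of_support _ fun s hs => ?_
  split_ifs with h
  · rw [hN]
    refine judge_sound hv hz hU hfar (le_trans ?_ hL) _
    have := findBlks_count hs
    gcongr
    omega
  · simp [pr]

/-! ### Relevant variables, isolating blocks and the search on a junta -/

section
variable {n : ℕ} {f : Pt n → Bool}

/-- Replace the coordinates of `x` by those of `y` one at a time; a step that changed the value
would be at a relevant coordinate, but there the points agree. -/
theorem eq_of_relevant {x y : Pt n} (h : ∀ i, Relevant f i → x i = y i) : f x = f y := by
  classical
  have key : ∀ S : Finset (Fin n), f (fun j => if j ∈ S then y j else x j) = f x := by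
    intro S
    induction S using Finset.induction_on with
    | empty => simp
    | insert i S hi ih =>
      rw [← ih]
      set w : Pt n := fun j => if j ∈ S then y j else x j with hw
      have e : (fun j => if j ∈ insert i S then y j else x j) = Function.update w i (y i) := by
        funext j
        by_cases hj : j = i
        · subst hj; simp
        · simp [hj, hw]
      rw [e]
      by_contra hc
      have hr : Relevant f i := ⟨w, y i, fun h => hc h.symm⟩
      exact hc (by rw [← h i hr, show x i = w i by simp [hw, hi], Function.update_eq_self])
  simpa using (key Finset.univ).symm

theorem IsJunta.length_le {k : ℕ} (hk : IsJunta k f) {l : List (Fin n)} (hl : l.Nodup)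
    (h : ∀ i ∈ l, Relevant f i) : l.length ≤ k := by
  obtain ⟨S, hS, hf⟩ := hk
  rw [← List.toFinset_card_of_nodup hl]
  refine (Finset.card_le_card fun i hi => ?_).trans hS
  obtain ⟨a, b, hab⟩ := h i (by simpa using hi)
  by_contra hc
  exact hab (hf _ _ fun j hj => by rw [Function.update_of_ne fun (e : j = i) => hc (e ▸ hj)])

/-- `τ` is the only relevant variable in the block, and it is the only one in which the two points
of the block differ; `f` has different values there. -/
def Blk.Isolates (f : Pt n → Bool) (B : Blk n) (τ : Fin n) : Prop :=
  B.Z τ = true ∧ f B.a ≠ f B.b ∧ ∀ j, Relevant f j → (B.Z j = true → j = τ) ∧ (j ≠ τ → B.a j = B.b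
    j)

theorem Blk.Isolates.relevant {B : Blk n} {τ : Fin n} (h : B.Isolates f τ) : Relevant f τ := by
  by_contra hc
  exact h.2.1 (eq_of_relevant fun j hj => (h.2.2 j hj).2 fun e => hc (e ▸ hj))

/-- On the relevant variables the assembled point agrees with `B.a` or with `B.b`, according to the
bit at `τ`; as the values there differ, the restriction is a literal. -/
theorem Blk.Isolates.res {B : Blk n} {τ : Fin n} (h : B.Isolates f τ) :
    ∃ c, ∀ x, B.res f x = (x τ ^^ c) := by
  obtain ⟨hZ, hab, hj⟩ := h
  have h1 : ∀ x, B.res f x = if x τ = B.a τ then f B.a else f B.b := by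
    intro x
    have hne : B.a τ ≠ B.b τ := fun e => hab (eq_of_relevant fun j hr => by
      by_cases hc : j = τ
      · exact hc ▸ e
      · exact (hj j hr).2 hc)
    split_ifs with hx
    all_goals
      refine eq_of_relevant (f := f) fun j hr => ?_
      by_cases hc : j = τ
      · subst hc
        rw [mux, hZ]
        revert hx hne
        cases x j <;> cases B.a j <;> cases B.b j <;> simp
      · rw [mux, Bool.eq_false_iff.2 fun e => hc ((hj j hr).1 e)]
        first | rfl | exact (hj j hr).2 hc
  refine ⟨B.a τ ^^ f B.a, fun x => ?_⟩
  rw [h1]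
  revert hab
  cases x τ <;> cases B.a τ <;> cases f B.a <;> cases f B.b <;> simp

/-- Bisection: the mixed point differs in value from `b` or from `a`, and the pair kept can differ
only on one side of the mask. Hence in the end every mask is constant on `Z`. -/
theorem search_spec (R : List (Pt n)) : ∀ s : Blk n, f s.a ≠ f s.b →
    (∀ j, s.Z j = false → s.a j = s.b j) →
    ∀ s', s' = R.foldl (fun s R => searchStep f R s) s →
      f s'.a ≠ f s'.b ∧ (∀ j, s'.Z j = false → s'.a j = s'.b j) ∧ (∀ j, s'.Z j = true → s.Z j =
        true) ∧
      ∀ v ∈ R, ∀ i j, s'.Z i = true → s'.Z j = true → v i = v j := by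
  induction R with
  | nil => rintro s h1 h2 s' rfl; exact ⟨h1, h2, fun _ h => h, by simp⟩
  | cons v R ih =>
    intro s h1 h2 s' hs'
    have h3 : ∃ c, ∀ j, (searchStep f v s).Z j = (s.Z j && (v j ^^ c)) := by
      unfold searchStep
      split_ifs
      · exact ⟨false, by simp⟩
      · exact ⟨true, by simp⟩
    obtain ⟨g1, g2, g3, g4⟩ := ih (searchStep f v s) (by
      unfold searchStep
      split_ifs with h
      · simpa using h
      · simp only [Bool.not_eq_true, bne_eq_false_iff_eq] at h
        rwa [h]) (fun j => by
      unfold searchStep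
      split_ifs <;> simp only [mux] <;> intro hj <;> cases hv : v j <;> simp_all) s' hs'
    obtain ⟨c, h3⟩ := h3
    refine ⟨g1, g2, fun j hj => ?_, ?_⟩
    · have := g3 j hj
      rw [h3] at this
      simp at this
      exact this.1
    · simp only [List.mem_cons, forall_eq_or_imp]
      refine ⟨fun i j hi hj => ?_, g4⟩
      have e1 := g3 i hi
      have e2 := g3 j hj
      rw [h3] at e1 e2
      revert e1 e2
      cases v i <;> cases v j <;> cases c <;> simp

/-- Any two relevant variables are separated by one of the masks. -/
def Separates (f : Pt n → Bool) (R : List (Pt n)) : Prop :=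
  ∀ i j, Relevant f i → Relevant f j → (∀ v ∈ R, v i = v j) → i = j

variable {R : List (Pt n)}

/-- The final block contains a relevant variable because `f` differs at its two points, and not two
of them because the masks are constant on it but separate relevant variables. -/
theorem search_isolates (hR : Separates f R) {X u : Pt n} (h : f u ≠ f (vand u X)) :
    ∃ τ, (search f R X u).Isolates f τ ∧ ∀ j, (search f R X u).Z j = true → X j = false := by
  obtain ⟨g1, g2, g3, g4⟩ := search_spec R ⟨fun i => !X i, u, vand u X⟩ h
    (fun j hj => by simp at hj; simp [vand, hj]) _ rfl
  change f (search f R X u).a ≠ _ at g1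
  have h1 : ∃ τ, Relevant f τ ∧ (search f R X u).Z τ = true := by
    by_contra hc
    push Not at hc
    exact g1 (eq_of_relevant fun j hj => g2 j (Bool.eq_false_iff.2 (hc j hj)))
  obtain ⟨τ, hτ, hZ⟩ := h1
  have h2 : ∀ j, Relevant f j → (search f R X u).Z j = true → j = τ := fun j hj hz =>
    hR j τ hj hτ fun v hv => g4 v hv j τ hz hZ
  exact ⟨τ, ⟨hZ, g1, fun j hj => ⟨h2 j hj, fun hn => g2 j (Bool.eq_false_iff.2 fun e =>
    hn (h2 j hj e))⟩⟩, fun j hj => by simpa using g3 j hj⟩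

namespace PState

/-- The blocks isolate different relevant variables, `X` contains exactly these relevant variables,
and the points of the verified blocks vanish outside `X`. -/
structure Good (f : Pt n → Bool) (k : ℕ) (s : PState n) (us ts : List (Fin n)) : Prop where
  unv : List.Forall₂ (Blk.Isolates f) s.unv us
  ver : List.Forall₂ (Blk.Isolates f) s.ver ts
  nodup : (us ++ ts).Nodup
  mem : ∀ j, Relevant f j → (s.X j = true ↔ j ∈ us ++ ts)
  sub : ∀ B ∈ s.ver, ∀ j, (B.a j = true → s.X j = true) ∧ (B.b j = true → s.X j = true)
  card : us.length + ts.length + s.kc = k + 1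

theorem forall₂_relevant {l : List (Blk n)} {ts : List (Fin n)}
    (h : List.Forall₂ (Blk.Isolates f) l ts) : ∀ τ ∈ ts, Relevant f τ := by
  induction h with
  | nil => simp
  | cons h _ ih => simpa using ⟨h.relevant, ih⟩

variable {k m : ℕ} {s : PState n} {us ts : List (Fin n)}

/-- The blocks belong to different relevant variables, of which there are at most `k`, whereas the
countdown starts at `k + 1`; so a `k`-junta is never rejected for too many blocks. -/
theorem Good.kc_pos (hk : IsJunta k f) (h : s.Good f k us ts) : 0 < s.kc := by
  have := hk.length_le h.nodup fun i hi => (List.mem_append.1 hi).elim (forall₂_relevant h.unv i)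
    (forall₂_relevant h.ver i)
  have := h.card
  simp at *
  omega

theorem Good.add (hk : IsJunta k f) (hR : Separates f R) (h : s.Good f k us ts) {u : Pt n}
    (hu : f u ≠ f (vand u s.X)) : ∃ τ, (s.add f R m u).Good f k (τ :: us) ts := by
  obtain ⟨τ, hτ, hX⟩ := search_isolates hR hu
  refine ⟨τ, .cons hτ h.unv, h.ver, ?_, fun j hj => ?_, fun B hB j => ?_, ?_⟩
  · rw [List.cons_append, List.nodup_cons, ← h.mem τ hτ.relevant, hX τ hτ.1]
    exact ⟨by simp, h.nodup⟩
  · have := h.mem j hj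
    simp only [PState.add, vor, Bool.or_eq_true, List.cons_append, List.mem_cons, this]
    constructor
    · rintro (h | h)
      · exact Or.inr h
      · exact Or.inl ((hτ.2.2 j hj).1 h)
    · rintro (rfl | h)
      · exact Or.inr hτ.1
      · exact Or.inl h
  · have := h.sub B hB j
    simp only [PState.add, vor, Bool.or_eq_true]
    exact ⟨fun h => Or.inl (this.1 h), fun h => Or.inl (this.2 h)⟩
  · have := h.kc_pos hk
    have := h.card
    simp only [PState.add, List.length_cons]
    omega

/-- The number of steps that remain at most. -/
def rank (m : ℕ) (s : PState n) : ℕ := s.kc * (m + 2) + s.unv.length + s.t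

/-- A new block adds one unverified block and resets the trials to `m`; the weight `m + 2` of the
countdown outweighs both. -/
theorem rank_add (R : List (Pt n)) (u : Pt n) (h : 0 < s.kc) :
    (s.add f R m u).rank m < s.rank m := by
  obtain ⟨c, hc⟩ : ∃ c, s.kc = c + 1 := ⟨s.kc - 1, by omega⟩
  simp only [rank, PState.add, List.length_cons, hc, Nat.add_sub_cancel, Nat.succ_mul]
  omega

/-- The points of the block have different values. If this persists after cutting them down to `X`,
the cut points are the witnesses of the verified block. If not, cutting has changed the value of one
of them, and that point reveals a relevant variable outside `X`. -/
theorem Good.verify (hk : IsJunta k f) (hR : Separates f R) (h : s.Good f k us ts)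
  (hs : s.unv ≠ []) :
    (∃ us' ts', (s.verify f R m).Good f k us' ts') ∧ (s.verify f R m).rank m < s.rank m ∧
    ((s.verify f R m).X = s.X ∧ (s.verify f R m).kc = s.kc ∧ (s.verify f R m).t = s.t ∨
      ∃ u, s.verify f R m = s.add f R m u) := by
  rcases s with ⟨t, kc, X, _ | ⟨B, l⟩, ver⟩
  · simp at hs
  · obtain ⟨h1, h2, h3, h4, h5, h6⟩ := h
    cases h1 with
    | @cons _ τ _ us hB hl =>
    by_cases hc : (f (vand B.a X) ^^ f (vand B.b X)) = true
    · rw [show PState.verify f R m ⟨t, kc, X, B :: l, ver⟩ =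
        ⟨t, kc, X, l, ⟨B.Z, vand B.a X, vand B.b X⟩ :: ver⟩ from if_pos hc]
      refine ⟨⟨us, τ :: ts, hl, .cons ⟨hB.1, by simpa using hc, fun j hj => ⟨(hB.2.2 j hj).1,
        fun hn => by simp only [vand, (hB.2.2 j hj).2 hn]⟩⟩ h2, ?_, fun j hj => ?_, ?_, ?_⟩,
        by simp [rank], by simp⟩
      · exact List.perm_middle.nodup_iff.2 h3
      · rw [h4 j hj]; simp; tauto
      · simp only [List.mem_cons, forall_eq_or_imp]
        exact ⟨fun j => by simp [vand], h5⟩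
      · simp at *; omega
    · have hg : Good f k ⟨t, kc, X, B :: l, ver⟩ (τ :: us) ts := ⟨.cons hB hl, h2, h3, h4, h5, h6⟩
      have hu : f (if f B.a ^^ f (vand B.a X) then B.a else B.b) ≠
          f (vand (if f B.a ^^ f (vand B.a X) then B.a else B.b) X) := by
        have := hB.2.1
        split_ifs with ha
        · simpa using ha
        · revert hc ha this
          cases f B.a <;> cases f B.b <;> cases f (vand B.a X) <;> cases f (vand B.b X) <;> simp
      obtain ⟨τ', hτ'⟩ := hg.add (m := m) hk hR hu
      rw [show PState.verify f R m ⟨t, kc, X, B :: l, ver⟩ = _ from if_neg hc]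
      exact ⟨⟨_, _, hτ'⟩, rank_add _ _ (hg.kc_pos hk), Or.inr ⟨_, rfl⟩⟩

theorem Good.try' (hk : IsJunta k f) (hR : Separates f R) (h : s.Good f k us ts) (ht : 0 < s.t)
    (u : Pt n) : (∃ us' ts', (s.try' f R m u).Good f k us' ts') ∧
      (s.try' f R m u).rank m < s.rank m := by
  unfold PState.try'
  split_ifs with hc
  · obtain ⟨τ, hτ⟩ := h.add (m := m) hk hR (u := u) (by simpa using hc)
    exact ⟨⟨_, _, hτ⟩, rank_add _ _ (h.kc_pos hk)⟩
  · exact ⟨⟨us, ts, h.1, h.2, h.3, h.4, h.5, h.6⟩, by simp only [rank]; omega⟩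

theorem Good.step {D : PMF (Pt n)} (hk : IsJunta k f) (hR : Separates f R)
    (h : s.Good f k us ts) {s' : PState n} (hs : s' ∈ (s.step f D R m).support) :
    (∃ us' ts', s'.Good f k us' ts') ∧ (s'.rank m < s.rank m ∨ s' = s ∧ s.unv = [] ∧ s.t = 0) := by
  unfold PState.step at hs
  split_ifs at hs with h1 h2
  · rw [PMF.mem_support_map_iff] at hs
    obtain ⟨u, -, rfl⟩ := hs
    exact (h.try' hk hR h2 u).imp id Or.inl
  · simp at hs
    exact ⟨⟨us, ts, hs ▸ h⟩, Or.inr ⟨hs, by simpa using h1, by omega⟩⟩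
  all_goals
    simp at hs
    have := h.verify (m := m) hk hR (by simpa using h1)
    exact hs ▸ ⟨this.1, Or.inl this.2.1⟩

end PState

/-- As long as the search is not finished, its rank is at most the number of remaining steps. At the
end this would force rank zero, which is impossible because the countdown is positive. -/
theorem findBlks_good {D : PMF (Pt n)} {k m N : ℕ} (hk : IsJunta k f) (hR : Separates f R)
    (hN : (k + 1) * (m + 2) + m ≤ N) {s : PState n} (hs : s ∈ (findBlks f D R m (k + 1) N).support)
      :
    s.t = 0 ∧ s.unv = [] ∧ ∃ ts, s.Good f k [] ts := by
  have := foldK_support (fun j s => (∃ us ts, s.Good f k us ts) ∧ (s.rank m ≤ j ∨ s.unv = [] ∧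
    s.t = 0))
    _ (fun j b _ s ⟨⟨us, ts, h⟩, hr⟩ s' hs' => by
      obtain ⟨h1, h2⟩ := h.step hk hR hs'
      refine ⟨h1, ?_⟩
      rcases h2 with h2 | ⟨rfl, h2⟩
      · rcases hr with hr | hr
        · left; omega
        · unfold PState.step at hs'
          simp [hr.1, hr.2] at hs'
          exact Or.inr (hs' ▸ hr)
      · exact Or.inr h2) _ (fun _ h => h) _
          ⟨⟨[], [], .nil, .nil, by simp, by simp, by simp, by simp⟩,
        Or.inl (by simpa [PState.rank] using hN)⟩ s hs
  obtain ⟨⟨us, ts, h⟩, hr⟩ := this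
  have hr : s.unv = [] ∧ s.t = 0 := by
    refine hr.resolve_left fun hr => ?_
    have := h.kc_pos hk
    simp [PState.rank] at hr
    omega
  have hu := h.unv
  rw [hr.1, List.forall₂_nil_left_iff] at hu
  exact ⟨hr.2, hr.1, ts, hu ▸ h⟩

end

/-! ### Failure probabilities of the masks and of the search -/

theorem pr_unif_eq {n : ℕ} {i j : Fin n} (h : i ≠ j) : pr (unif n) (fun v => v i = v j) = 1 /
  2 := by
  have h1 : pr (unif n) (fun v => ¬ v i = v j) = pr (unif n) fun v => v i = v j := by
    conv_lhs => rw [← unif_xor (fun t => decide (t = i)), pr_map]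
    refine pr_congr fun v _ => ?_
    simp only [vxor, h.symm, decide_true, decide_false]
    cases v i <;> cases v j <;> simp
  have h2 := pr_add_not (μ := unif n) fun v => v i = v j
  rw [h1, ← two_mul] at h2
  rw [ENNReal.eq_div_iff (by simp) (by simp), h2]

/-- Union bound over at most `k * k` pairs of relevant variables; each of the `s` independent masks
fails to separate a given pair with probability `1/2`. -/
theorem pr_not_separates {n k s : ℕ} {f : Pt n → Bool} (hk : IsJunta k f) :
    pr (masks n s) (fun R => ¬ Separates f R) ≤ k * k * (1 / 2) ^ s := by
  classical
  set J : Finset (Fin n) := Finset.univ.filter (Relevant f) with hJ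
  have hJk : J.card ≤ k := by
    have := hk.length_le J.nodup_toList (by simp [hJ])
    simpa using this
  calc _ ≤ pr (masks n s) (fun R => ∃ p ∈ (J ×ˢ J).filter (fun p => p.1 ≠ p.2),
        ∀ v ∈ R, v p.1 = v p.2) := by
        refine pr_mono fun R _ h => ?_
        unfold Separates at h
        push Not at h
        obtain ⟨i, j, hi, hj, hv, hij⟩ := h
        exact ⟨(i, j), by simp [hJ, hi, hj, hij], hv⟩
    _ ≤ ∑ p ∈ (J ×ˢ J).filter (fun p => p.1 ≠ p.2), pr (masks n s) (fun R => ∀ v ∈ R, v p.1 = v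
      p.2) :=
        pr_exists_mem_le _ _
    _ ≤ ∑ p ∈ (J ×ˢ J).filter (fun p => p.1 ≠ p.2), (1 / 2) ^ s := by
        refine Finset.sum_le_sum fun p hp => ?_
        have := ex_foldK (st := fun (_ : Data) (l : List (Pt n)) => (unif n).map fun v => v :: l)
          (V := fun R => if ∀ v ∈ R, v p.1 = v p.2 then 1 else 0) (c := 1 / 2) (fun _ => True)
          (l := List.replicate s (Data.cons .nil .nil)) (fun _ _ _ _ _ _ => trivial)
          (fun _ _ R _ => by
            rw [ex_map, ← pr_unif_eq (Finset.mem_filter.1 hp).2, pr]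
            by_cases hR : ∀ v ∈ R, v p.1 = v p.2
            · rw [if_pos hR, mul_one]
              refine ex_mono fun v _ => ?_
              by_cases hv : v p.1 = v p.2
              · rw [if_pos hv]
                split_ifs <;> simp
              · simp [hv]
            · refine (ex_le_of_support _ fun v _ => ?_).trans zero_le
              rw [if_neg fun h => hR fun w hw => h w (by simp [hw])]) (a := []) trivial
        simp only [List.length_replicate, List.not_mem_nil, false_imp_iff, implies_true, if_true,
          mul_one] at this
        refine le_trans (le_of_eq ?_) this
        rw [pr, masks]
        congr!
    _ ≤ _ := by
        rw [Finset.sum_const, nsmul_eq_mul]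
        gcongr
        calc _ ≤ (((J ×ˢ J).card : ℕ) : ℝ≥0∞) := by exact_mod_cast Finset.card_filter_le _ _
          _ ≤ _ := by rw [Finset.card_product]; push_cast; gcongr

section
variable {n : ℕ} {f : Pt n → Bool} {D : PMF (Pt n)} {R : List (Pt n)}

open Classical in
/-- A bound for the probability that the search ends while `f` and its restriction to `X` often
differ. -/
def missPot (f : Pt n → Bool) (D : PMF (Pt n)) (q : ℝ≥0∞) (m : ℕ) (s : PState n) :
    ℝ≥0∞ :=
  (if pr D (fun u => f u = f (vand u s.X)) < q then q ^ s.t else 0) + s.kc * q ^ m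

/-- A new block lowers the countdown and thereby releases `q ^ m`, which covers the term of the
fresh series of `m` trials. -/
theorem missPot_add {q : ℝ≥0∞} {m : ℕ} {s : PState n} (h : 0 < s.kc) (u : Pt n) :
    missPot f D q m (s.add f R m u) ≤ s.kc * q ^ m := by
  obtain ⟨c, hc⟩ : ∃ c, s.kc = c + 1 := ⟨s.kc - 1, by omega⟩
  simp only [missPot, PState.add, hc, Nat.add_sub_cancel]
  push_cast
  rw [add_mul, one_mul, add_comm]
  gcongr
  split_ifs <;> simp

/-- The potential is a supermartingale: while its first term is present, a trial fails with
probability less than `q`, which compensates for the trial used up; a successful trial is covered by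
`missPot_add`. -/
theorem missPot_step {k m : ℕ} {q : ℝ≥0∞} (hk : IsJunta k f) (hR : Separates f R) {s : PState n}
    {us ts : List (Fin n)} (h : s.Good f k us ts) :
    ex (s.step f D R m) (missPot f D q m) ≤ missPot f D q m s := by
  have hkc := h.kc_pos hk
  unfold PState.step
  split_ifs with h1 h2
  · rw [ex_map]
    obtain ⟨t, ht⟩ : ∃ t, s.t = t + 1 := ⟨s.t - 1, by omega⟩
    calc _ ≤ ex D fun u => (if pr D (fun u => f u = f (vand u s.X)) < q then q ^ t else 0) *
          (if f u = f (vand u s.X) then 1 else 0) + s.kc * q ^ m := by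
          refine ex_mono fun u _ => ?_
          unfold PState.try'
          by_cases hu : f u = f (vand u s.X)
          · simp [hu, missPot, ht]
          · rw [if_pos (by simpa using hu)]
            exact (missPot_add hkc u).trans le_add_self
      _ ≤ missPot f D q m s := by
          rw [ex_add, ex_mul, ex_const]
          change _ * ex D _ + _ ≤ (if _ then _ else _) + _
          gcongr
          split_ifs with hq
          · rw [ht, pow_succ]
            gcongr
            refine le_trans (le_of_eq ?_) hq.le
            rw [pr]
            congr!
          · simp
  · simp
  all_goals
    rw [ex_pure]
    obtain ⟨-, -, ⟨e1, e2, e3⟩ | ⟨u, e⟩⟩ := h.verify (m := m) hk hR (by simpa using h1)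
    · rw [missPot, e1, e2, e3]; rfl
    · rw [e]
      exact (missPot_add hkc u).trans le_add_self

/-- At the end no trials are left, so a bad outcome has potential at least one, while the initial
potential is at most `(k + 2) * q ^ m`; Markov's inequality finishes. -/
theorem pr_findBlks_miss {k m N : ℕ} {q : ℝ≥0∞} (hk : IsJunta k f) (hR : Separates f R)
    (hN : (k + 1) * (m + 2) + m ≤ N) :
    pr (findBlks f D R m (k + 1) N) (fun s => pr D (fun u => f u = f (vand u s.X)) < q) ≤
      (k + 2) * q ^ m := by
  have := ex_foldK (st := fun (_ : Data) (s : PState n) => s.step f D R m) (V := missPot f D q m)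
    (c := 1)
    (fun s => ∃ us ts, s.Good f k us ts) (l := List.replicate N (Data.cons .nil .nil))
    (fun _ _ s ⟨us, ts, h⟩ s' hs' => (h.step hk hR hs').1)
    (fun _ _ s ⟨us, ts, h⟩ => by rw [one_mul]; exact missPot_step hk hR h)
    (a := ⟨m, k + 1, fun _ => false, [], []⟩)
    ⟨[], [], .nil, .nil, by simp, by simp, by simp, by simp⟩
  rw [one_pow, one_mul] at this
  refine (pr_le_ex fun s hs hq => ?_).trans (this.trans ?_)
  · rw [missPot, if_pos hq, (findBlks_good hk hR hN hs).1, pow_zero]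
    exact le_self_add
  · simp only [missPot]
    calc _ ≤ q ^ m + ((k + 1 : ℕ) : ℝ≥0∞) * q ^ m := by gcongr; split_ifs <;> simp
      _ = _ := by push_cast; ring

end

/-! ### The function of the blocks belongs to `C(Y)` -/

section
variable {n : ℕ} {f : Pt n → Bool} {k : ℕ} {s : PState n} {ts : List (Fin n)}

theorem Forall₂.getElem {α β : Type} {r : α → β → Prop} {l : List α} {l' : List β}
    (h : List.Forall₂ r l l') (j : ℕ) (hj : j < l.length) : r l[j] (l'[j]'(h.length_eq ▸ hj)) :=
  h.get hj _

/-- The relevant coordinates of a point that is assembled from isolating blocks. -/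
theorem unite_relevant {l : List (Blk n)} (h : List.Forall₂ (Blk.Isolates f) l ts)
    (y : Pt l.length) {j : Fin n} (hj : Relevant f j) :
    unite l (.ofVec y) j = true ↔ ∃ p : Fin l.length, ts[p.1]? = some j ∧ y p = true := by
  rw [unite_iff, Data.toVec_ofVec]
  refine exists_congr fun p => ?_
  have hB := Forall₂.getElem h p.1 p.2
  rw [List.getElem?_eq_getElem (h.length_eq ▸ p.2), Option.some.injEq, and_comm]
  exact and_congr_left fun _ => ⟨fun hz => ((hB.2.2 j hj).1 hz).symm, fun e => e ▸ hB.1⟩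

/-- The union of the blocks selected by the bits of `a` at `ts` agrees with `a` on all relevant
variables; those outside `ts` are zero on both sides. -/
theorem blkFun_eq {l : List (Blk n)} (h : List.Forall₂ (Blk.Isolates f) l ts)
    {a : Pt n} (ha : ∀ j, Relevant f j → a j = true → j ∈ ts) :
    blkFun f l (bitsVec l.length (ts.map a)) = f a := by
  refine eq_of_relevant (f := f) fun j hj => ?_
  rw [Bool.eq_iff_iff, unite_relevant h _ hj]
  constructor
  · rintro ⟨p, h1, h2⟩
    simpa [bitsVec, h1] using h2
  · intro h1
    obtain ⟨p, hp, rfl⟩ := List.mem_iff_getElem.1 (ha j hj h1)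
    exact ⟨⟨p, h.length_eq ▸ hp⟩, by simp, by simpa [bitsVec, hp] using h1⟩

/-- The blocks that the search delivers, their relevant variables and the set `X`. -/
structure Found (f : Pt n → Bool) (l : List (Blk n)) (ts : List (Fin n)) (X : Pt n) :
    Prop where
  iso : List.Forall₂ (Blk.Isolates f) l ts
  nodup : ts.Nodup
  mem : ∀ j, Relevant f j → (X j = true ↔ j ∈ ts)
  sub : ∀ B ∈ l, ∀ j, (B.a j = true → X j = true) ∧ (B.b j = true → X j = true)

variable {l : List (Blk n)} {X : Pt n}

theorem Found.blkFun_vand (h : Found f l ts X) (u : Pt n) :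
    blkFun f l (bitsVec l.length (ts.map u)) = f (vand u X) := by
  rw [← blkFun_eq h.iso (a := vand u X) fun j hj hu => (h.mem j hj).1 (by
    simp [vand] at hu; exact hu.2)]
  congr 2
  refine List.map_congr_left fun j hj => ?_
  simp [vand, (h.mem j (PState.forall₂_relevant h.iso j hj)).2 hj]

/-- This is what the verification of blocks is for. The two points of block `j` vanish outside `X`,
so `blkFun` can express them; their bit vectors differ in the coordinate `j` only, and the values of
`f` are different. -/
theorem Found.relevant (h : Found f l ts X) (j : Fin l.length) : Relevant (blkFun f l) j := by
  have hl := h.iso.length_eq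
  have hB := Forall₂.getElem h.iso j.1 j.2
  have hs := h.sub _ (List.getElem_mem j.2)
  have ha : blkFun f l (bitsVec l.length (ts.map l[j.1].a)) = f l[j.1].a :=
    blkFun_eq h.iso fun i hi e => (h.mem i hi).1 ((hs i).1 e)
  have hb : blkFun f l (bitsVec l.length (ts.map l[j.1].b)) = f l[j.1].b :=
    blkFun_eq h.iso fun i hi e => (h.mem i hi).1 ((hs i).2 e)
  refine ⟨bitsVec l.length (ts.map l[j.1].a), bitsVec l.length (ts.map l[j.1].b) j, fun e => hB.2.1
    ?_⟩
  rw [← ha, ← hb, e]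
  congr 1
  funext p
  by_cases hp : p = j
  · subst hp; simp
  · rw [Function.update_of_ne hp]
    have hp' : p.1 < ts.length := hl ▸ p.2
    have hr := PState.forall₂_relevant h.iso ts[p.1] (List.getElem_mem hp')
    simpa [bitsVec, hp'] using (hB.2.2 _ hr).2 fun e => hp (Fin.ext ((h.nodup.getElem_inj_iff).1 e))

/-- On the relevant variables, assembling blocks amounts to substituting the variable with the index
of its block for each element of `ts` and zero for the others. So the lifted function is obtained
from `f` by projections. -/
theorem Found.mem_onVars {R : RepClass} {i : Idx} (hv : ClosedVarProj (R.fns i))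
    (hz : ClosedZeroProj (R.fns i)) {f : Pt i.n → Bool} (hf : f ∈ R.fns i)
    {l : List (Blk i.n)} {ts : List (Fin i.n)} {X : Pt i.n} (h : Found f l ts X)
    (hq : l.length ≤ i.n) : blkFun f l ∈ R.onVars i hq := by
  classical
  refine ⟨h.relevant, ?_⟩
  have hl := h.iso.length_eq
  convert mem_of_projections hv hz hf fun j => if hj : j ∈ ts then
    some ⟨ts.idxOf j, (hl ▸ List.idxOf_lt_length_of_mem hj : _ < l.length).trans_le hq⟩ else none
      using 1
  funext x
  refine eq_of_relevant (f := f) fun j hj => ?_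
  rw [Bool.eq_iff_iff, unite_relevant h.iso _ hj]
  constructor
  · rintro ⟨p, h1, h2⟩
    obtain ⟨hp', rfl⟩ := List.getElem?_eq_some_iff.1 h1
    have h2 : x ⟨p, p.2.trans_le hq⟩ = true := h2
    simpa [h.nodup.idxOf_getElem] using h2
  · intro h1
    by_cases hj' : j ∈ ts
    · have := List.idxOf_lt_length_of_mem hj'
      exact ⟨⟨ts.idxOf j, hl ▸ this⟩, by simp [this], by simpa [hj'] using h1⟩
    · simp [hj'] at h1

end

/-! ### Completeness -/

section
variable {n : ℕ} {f : Pt n → Bool} {D : PMF (Pt n)} {l : List (Blk n)}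
  {ts : List (Fin n)} {X : Pt n}

theorem Blk.Isolates.forall₂_res (h : List.Forall₂ (Blk.Isolates f) l ts) :
    List.Forall₂ (fun B τ => ∃ c, ∀ x, B.res f x = (x τ ^^ c)) l ts :=
  h.imp fun _ _ h => h.res

theorem dictAll_complete (h : List.Forall₂ (Blk.Isolates f) l ts) :
    pr (dictAll f l) (fun b => ¬ b = true) = 0 := by
  refine pr_eq_zero fun b hb => not_not.2 ?_
  have key : ∀ (l : List (Blk n)) (ts : List (Fin n)), List.Forall₂ (Blk.Isolates f) l ts →
      ∀ B ∈ l, ∀ b ∈ (dictBlk f B).support, b = true := by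
    intro l ts h B hB b hb
    obtain ⟨τ, -, hτ⟩ : ∃ τ ∈ ts, B.Isolates f τ := by
      induction h with
      | nil => simp at hB
      | cons h _ ih =>
        rcases List.mem_cons.1 hB with rfl | hB
        · exact ⟨_, by simp, h⟩
        · obtain ⟨τ, h1, h2⟩ := ih hB
          exact ⟨τ, by simp [h1], h2⟩
    obtain ⟨c, hc⟩ := hτ.res
    refine foldK_support (fun _ b => b = true) _ (fun j _ _ b hb b' hb' => ?_) _ (fun _ h => h) _
      rfl b hb
    rw [PMF.mem_support_map_iff] at hb'
    obtain ⟨t, -, rfl⟩ := hb'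
    simp only [dictRound, dictBits, dictOK, List.map_cons, List.map_nil, hc, hb]
    simp only [List.getD_cons_zero, List.getD_cons_succ]
    cases t.1 τ <;> cases t.2.1 τ <;> cases t.2.2 τ <;> cases c <;> rfl
  refine foldK_support (fun _ b => b = true) l (fun j B hB b hb b' hb' => ?_) _ (fun _ h => h) _
    rfl b hb
  rw [PMF.mem_support_map_iff] at hb'
  obtain ⟨c, hc, rfl⟩ := hb'
  simp [key l ts h B hB c hc, hb]

/-- Decoding is exact, so only mismatches matter. With the potential `2 ^ mismatches`, the `100 U`
rounds give an expectation of at most `exp 35 ≤ 2 ^ 57`. Rejection needs 61 mismatches, hence has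
probability at most `2 ^ (-4)`. -/
theorem check_complete (h : List.Forall₂ (Blk.Isolates f) l ts) {L U : ℕ} (hL : 0 < L)
    {v : Pt n → Bool} (hU : 0 < U)
    (hv : pr D (fun u => v (Data.toVec n (.ofBits (ts.map u))) ≠ f u) ≤ ENNReal.ofReal
      (67 / 192 / U)) :
    pr (check f D L (100 * U) l v) (fun c => ¬ (c.2 = false ∧ c.1 ≤ 60)) ≤ 1 / 12 := by
  classical
  have hst : ∀ a, checkStep f D L l v a = D.map fun u =>
      (if v (Data.toVec n (.ofBits (ts.map u))) ^^ f u then a.1 + 1 else a.1, a.2) := by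
    intro a
    simp only [checkStep, decode_exact (Blk.Isolates.forall₂_res h) hL, PMF.pure_map]
    rw [PMF.map_bind]
    simp only [PMF.pure_map, Bool.or_false]
    rfl
  have hI : ∀ b ∈ List.replicate (100 * U) (Data.cons .nil .nil), ∀ a : ℕ × Bool, a.2 = false →
      ∀ a' ∈ (checkStep f D L l v a).support, a'.2 = false := by
    intro _ _ a ha a' ha'
    rw [hst, PMF.mem_support_map_iff] at ha'
    obtain ⟨u, -, rfl⟩ := ha'
    exact ha
  have h1 := ex_foldK (st := fun (_ : Data) => checkStep f D L l v) (V := fun c => 2 ^ c.1)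
    (c := ENNReal.ofReal (1 + 67 / 192 / U)) (fun a => a.2 = false) hI (fun _ _ a _ => by
      rw [hst, ex_map, ENNReal.ofReal_add zero_le_one (by positivity), ENNReal.ofReal_one, mul_comm]
      calc _ ≤ ex D fun u => 2 ^ a.1 * (1 + if v (Data.toVec n (.ofBits (ts.map u))) ≠ f u then 1
        else 0) := by
            refine ex_mono fun u _ => ?_
            by_cases hm : v (Data.toVec n (.ofBits (ts.map u))) = f u
            · simp [hm]
            · simp [hm, pow_succ, one_add_one_eq_two]
        _ ≤ _ := by
            rw [ex_mul, ex_add, ex_const]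
            gcongr
            refine le_trans (le_of_eq ?_) hv
            rw [pr]
            congr!) (a := (0, false)) rfl
  rw [List.length_replicate, pow_zero, mul_one] at h1
  calc _ ≤ ex (check f D L (100 * U) l v) (fun c => 2⁻¹ ^ 61 * 2 ^ c.1) := by
        refine pr_le_ex fun c hc hc' => ?_
        have hc2 : c.2 = false := foldK_support (fun _ a => a.2 = false) _ (fun _ => hI) _
          (fun _ h => h)
          _ rfl c hc
        have hc1 : 61 ≤ c.1 := by
          by_contra h
          exact hc' ⟨hc2, by omega⟩
        calc (1 : ℝ≥0∞) = 2⁻¹ ^ 61 * 2 ^ 61 := by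
              rw [← mul_pow, ENNReal.inv_mul_cancel (by simp) (by simp), one_pow]
          _ ≤ _ := by gcongr; norm_num
    _ ≤ 2⁻¹ ^ 61 * ENNReal.ofReal (2 ^ 57) := by
        rw [ex_mul]
        refine mul_le_mul_right (h1.trans ?_) _
        rw [← ENNReal.ofReal_pow (by positivity)]
        refine ENNReal.ofReal_le_ofReal ((pow_le_exp hU (by
          have : (0 : ℝ) ≤ U := by positivity
          linarith) 100).trans ?_)
        calc _ ≤ Real.exp 1 ^ 35 := by
              rw [← Real.exp_nat_mul]; exact Real.exp_le_exp.2 (by norm_num)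
          _ ≤ 2.7182818286 ^ 35 := pow_le_pow_left₀ (by positivity) Real.exp_one_lt_d9.le _
          _ ≤ _ := by norm_num
    _ ≤ 1 / 12 := by
        rw [← ENNReal.toReal_le_toReal (by finiteness) (by finiteness), ENNReal.toReal_mul,
          ENNReal.toReal_ofReal (by norm_num)]
        norm_num

end

section
variable {R : RepClass} {i : Idx} {f : Pt i.n → Bool} {D : PMF (Pt i.n)}
  {U L : ℕ}

/-- A mismatch has two possible sources: the error `1 / (3 U)` of the hypothesis, and the error `1 /
(64 U)` made by cutting `u` down to `X`. Together they give `67 / (192 U)`. -/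
theorem verdict_complete {l : List (Blk i.n)} {ts : List (Fin i.n)} {X : Pt i.n}
    (h : Found f l ts X) (hL : 0 < L) (hU : 0 < U)
    (hX : pr D (fun u => f u ≠ f (vand u X)) ≤ ENNReal.ofReal (1 / (64 * U))) (hq : l.length ≤ i.n)
    {r : Data} (hr : R.valid i r) {g : Pt l.length → Bool} (hg : R.val i r = lift hq g)
    (he : pr (D.map fun u => bitsVec l.length (ts.map u)) (fun y => g y ≠ blkFun f l y) ≤
      ENNReal.ofReal (1 / (3 * U))) :
    pr (verdict R i f D L (100 * U) l r) (· = false) ≤ 1 / 12 := by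
  rw [verdict, if_pos hr, pr_map]
  refine le_trans (pr_mono fun c _ hc => ?_) (check_complete h.iso hL hU ?_)
  · rw [tl_iterate_unary, Data.truth_unary] at hc
    rintro ⟨h1, h2⟩
    simp [h1] at hc
    omega
  · rw [pr_map] at he
    have h0 : (0 : ℝ) < U := by exact_mod_cast hU
    calc _ ≤ _ := pr_mono (E' := fun u => g (bitsVec l.length (ts.map u)) ≠
          blkFun f l (bitsVec l.length (ts.map u)) ∨ f u ≠ f (vand u X)) fun u _ hu => by
            by_contra hc
            push Not at hc
            refine hu ?_
            rw [hc.2, ← h.blkFun_vand, ← hc.1, hg, lift]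
            congr 1
            funext j
            exact toVec_ofBits _ _ _
      _ ≤ _ := pr_or_le _ _
      _ ≤ _ := add_le_add he hX
      _ ≤ _ := by
          rw [← ENNReal.ofReal_add (by positivity) (by positivity)]
          refine ENNReal.ofReal_le_ofReal (le_of_eq ?_)
          field_simp
          norm_num

theorem testDist_complete {ν : List (Blk i.n) → PMF Data} {p : Params}
    (hk : IsJunta i.k f) (hL : 0 < p.L) (hU : 0 < U) (hN : p.N = 100 * U) (hK : p.K = i.k + 1)
    (hN1 : (i.k + 1) * (p.m + 2) + p.m ≤ p.N1) (hs : (i.k * i.k * (1 / 2) ^ p.s : ℝ≥0∞) ≤ 1 / 12)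
    (hm : (i.k + 2) * ENNReal.ofReal (1 - 1 / (64 * U)) ^ p.m ≤ 1 / 12)
    (hν : ∀ l ts X, Found f l ts X → l.length ≤ i.k → ∀ hq : l.length ≤ i.n,
      pr (ν l) (fun r => ¬ (R.valid i r ∧ ∃ g, R.val i r = lift hq g ∧
        pr (D.map fun u => bitsVec l.length (ts.map u)) (fun y => g y ≠ blkFun f l y) ≤
          ENNReal.ofReal (1 / (3 * U)))) ≤ 1 / 12) :
    pr (testDist R i f D p ν) (· = false) ≤ 1 / 3 := by
  -- In this order: masks that do not separate, a search that ends too early, the dictator test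
  -- (which never fails here), the learner, and the comparison with `f`.
  have h4 : (1 / 12 : ℝ≥0∞) + (1 / 12 + (0 + (1 / 12 + 1 / 12))) ≤ 1 / 3 := by
    rw [← ENNReal.toReal_le_toReal (by finiteness) (by finiteness)]
    rw [ENNReal.toReal_add, ENNReal.toReal_add, ENNReal.toReal_add, ENNReal.toReal_add] <;>
      norm_num
  refine le_trans ?_ h4
  refine pr_bind_le ((pr_not_separates hk).trans hs) fun M _ hM => ?_
  rw [not_not] at hM
  rw [hK]
  refine pr_bind_le ((pr_findBlks_miss hk hM hN1).trans hm) fun s hs hq => ?_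
  obtain ⟨-, hu, ts, h⟩ := findBlks_good hk hM hN1 hs
  have hF : Found f s.ver ts s.X := ⟨h.ver, by simpa using h.nodup, by simpa using h.mem, h.sub⟩
  have hl := h.ver.length_eq
  rw [if_pos (h.kc_pos hk), judge]
  refine pr_bind_le (dictAll_complete h.ver).le fun b _ hb => ?_
  rw [if_pos (not_not.1 hb), hN]
  have hlen : s.ver.length ≤ i.k := hl ▸ hk.length_le hF.nodup (PState.forall₂_relevant h.ver)
  have hn : s.ver.length ≤ i.n := hl ▸ (by simpa using hF.nodup.length_le_card)
  refine pr_bind_le (hν _ _ _ hF hlen hn) fun r _ hr => ?_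
  obtain ⟨hr, g, hg, he⟩ := not_not.1 hr
  refine verdict_complete hF hL hU ?_ hn hr hg he
  have h1 := pr_add_not (μ := D) fun u => f u = f (vand u s.X)
  rw [not_lt] at hq
  have h0 : (1 : ℝ) ≤ U := by exact_mod_cast hU
  have h2 : ENNReal.ofReal (1 - 1 / (64 * U)) + ENNReal.ofReal (1 / (64 * U)) = 1 := by
    rw [← ENNReal.ofReal_add _ (by positivity)]
    · simp
    · rw [sub_nonneg, div_le_one (by positivity)]; linarith
  refine ENNReal.le_of_add_le_add_left (a := ENNReal.ofReal (1 - 1 / (64 * U))) (by finiteness) ?_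
  rw [h2, ← h1]
  exact add_le_add_left hq _

end

/-! ### Numerical estimates for the parameters -/

theorem eval_le_mul_pow (P : Polynomial ℕ) {y : ℕ} (hy : 1 ≤ y) :
    P.eval y ≤ P.eval 1 * y ^ P.natDegree := by
  rw [Polynomial.eval_eq_sum_range, Polynomial.eval_eq_sum_range, Finset.sum_mul]
  refine Finset.sum_le_sum fun j hj => ?_
  rw [one_pow, mul_one]
  exact Nat.mul_le_mul_left _ (Nat.pow_le_pow_right hy (by simp at hj; omega))

theorem pr_outputIn {p : PMF (Option St)} {μ : PMF Data} (h : p.map outD = μ.map some)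
  (S : Set Data) :
    pr p (fun o => o ∉ outputIn S) = pr μ fun r => r ∉ S := by
  have e := congrArg (fun q => pr q fun o : Option Data => ¬ ∃ r, o = some r ∧ r ∈ S) h
  simp only [pr_map] at e
  simp only [Option.some.injEq, exists_eq_left'] at e
  rw [← e]
  refine pr_congr fun o _ => not_congr ?_
  cases o <;> simp [outputIn, outD]

/-- A query takes time, so cutting the query budgets off at the time bound loses nothing. The tester
has to do so because it writes its budgets in unary. -/
theorem allOK_min {A : Cmd} {O : Oracle} {d : Data} {F T T' M Q : ℕ} (hT : T ≤ T')
    (h : ∀ o ∈ (run A O d F).support, ∃ s, o = some s ∧ s.time ≤ T ∧ s.mq ≤ M ∧ s.exq ≤ Q) :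
    AllOK T' (min M T') (min Q T') (run A O d F) := by
  intro o ho
  obtain ⟨s, rfl, h1, h2, h3⟩ := h o ho
  have h4 := exec_mono ho
  simp only [Nat.add_zero, Nat.zero_add] at h4
  exact ⟨s, rfl, by omega, by omega, by omega⟩

namespace TIx
variable (x : TIx)

theorem U_pos : 0 < x.U := Nat.two_pow_pos _

theorem le_two_pow_L : 64 * (x.i.k + 1) * x.U ≤ 2 ^ x.L := by
  obtain ⟨h1, h2, h3, -⟩ := sizeSt_spec x.i.k
  rw [L, pow_add, pow_add, ← U, sizeOf', ← h3]
  nlinarith [Nat.zero_le x.U]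

theorem two_pow_L_le : 2 ^ x.L ≤ 128 * (x.i.k * x.U) := by
  obtain ⟨-, -, -, h⟩ := sizeSt_spec x.i.k
  have := Nat.mul_le_mul_right (64 * x.U) (h x.i.one_le_k)
  rw [L, pow_add, pow_add, ← U, sizeOf']
  linarith

theorem le_two_pow_L' : 64 * ((x.i.k : ℝ) + 1) * x.U ≤ 2 ^ x.L := by
  exact_mod_cast x.le_two_pow_L

theorem one_le_U : (1 : ℝ) ≤ x.U := by exact_mod_cast x.U_pos

/-- The probability of an undetected decoding error has to be small compared with the distance `1 /
U` that the check must detect. -/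
theorem k_mul_le : (x.i.k * (1 / 24) ^ x.L : ℝ≥0∞) ≤ ENNReal.ofReal (1 / (64 * x.U)) := by
  rw [ENNReal.le_ofReal_iff_toReal_le (by finiteness) (by positivity)]
  simp only [ENNReal.toReal_mul, ENNReal.toReal_natCast, ENNReal.toReal_pow, ENNReal.toReal_div,
    ENNReal.toReal_one, ENNReal.toReal_ofNat]
  have hU := x.one_le_U
  calc (x.i.k : ℝ) * (1 / 24) ^ x.L ≤ x.i.k * (1 / 2) ^ x.L := by gcongr; norm_num
    _ ≤ 1 / (64 * x.U) := by
      rw [one_div_pow, mul_one_div, div_le_div_iff₀ (by positivity) (by positivity)]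
      nlinarith [x.le_two_pow_L']

/-- There are `2 L` masks so that each of the two factors `k` is absorbed by its own `2 ^ (-L)`. -/
theorem masks_le : (x.i.k * x.i.k * (1 / 2) ^ (x.L + x.L) : ℝ≥0∞) ≤ 1 / 12 := by
  rw [← ENNReal.toReal_le_toReal (by finiteness) (by finiteness)]
  simp only [ENNReal.toReal_mul, ENNReal.toReal_natCast, ENNReal.toReal_pow, ENNReal.toReal_div,
    ENNReal.toReal_one, ENNReal.toReal_ofNat]
  have h1 : (x.i.k : ℝ) * (1 / 2) ^ x.L ≤ 1 / 64 := by
    rw [one_div_pow, mul_one_div, div_le_div_iff₀ (by positivity) (by positivity)]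
    nlinarith [x.le_two_pow_L', x.one_le_U, Nat.cast_nonneg (α := ℝ) x.i.k]
  calc _ = ((x.i.k : ℝ) * (1 / 2) ^ x.L) * (x.i.k * (1 / 2) ^ x.L) := by rw [pow_add]; ring
    _ ≤ 1 / 64 * (1 / 64) := by gcongr
    _ ≤ _ := by norm_num

/-- The number `64 L U` of trials makes the power at most `exp (-L) ≤ 2 ^ (-L)`. -/
theorem miss_le : (x.i.k + 2) * ENNReal.ofReal (1 - 1 / (64 * x.U)) ^ (64 * x.L * x.U) ≤ 1 /
  12 := by
  have hU := x.one_le_U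
  have h1 : (0 : ℝ) ≤ 1 - 1 / (64 * x.U) := by
    rw [sub_nonneg, div_le_one (by positivity)]; linarith
  have h2 : (1 - 1 / (64 * x.U) : ℝ) ^ (64 * x.L * x.U) ≤ 1 / 2 ^ x.L := by
    have := pow_le_exp x.U_pos (x := -(1 / 64)) (by linarith) (64 * x.L)
    calc _ = (1 + -(1 / 64) / x.U : ℝ) ^ (64 * x.L * x.U) := by congr 1; ring
      _ ≤ _ := this
      _ = 1 / Real.exp 1 ^ x.L := by
        rw [← Real.exp_nat_mul, eq_div_iff (Real.exp_pos _).ne', ← Real.exp_add,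
          Real.exp_eq_one_iff]
        push_cast
        ring
      _ ≤ _ := by gcongr; linarith [Real.exp_one_gt_d9]
  rw [← ENNReal.toReal_le_toReal (by finiteness) (by finiteness)]
  rw [ENNReal.toReal_mul, ENNReal.toReal_pow, ENNReal.toReal_ofReal h1,
    ENNReal.toReal_add (by finiteness) (by finiteness)]
  simp only [ENNReal.toReal_natCast, ENNReal.toReal_div, ENNReal.toReal_one, ENNReal.toReal_ofNat]
  calc _ ≤ ((x.i.k : ℝ) + 2) * (1 / 2 ^ x.L) := by gcongr
    _ ≤ _ := by
      rw [mul_one_div, div_le_div_iff₀ (by positivity) (by positivity)]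
      nlinarith [x.le_two_pow_L', Nat.cast_nonneg (α := ℝ) x.i.k]

theorem one_div_U_le : (1 : ℝ) / x.U ≤ x.a / x.b := by
  have hb : (0 : ℝ) < x.b := by exact_mod_cast x.ha.trans_le x.hab
  have hU := x.one_le_U
  rw [div_le_div_iff₀ (by positivity) hb, one_mul, mul_comm]
  exact_mod_cast x.le_U_mul

/-- The tester works with the power of two `U ≤ 4 / ε`; with this loss of a factor `4`, the accuracy
`ε / 12` of the learner still leaves a third of `1 / U`. -/
theorem div_le_one_div_U : (x.a : ℝ) / (12 * x.b) ≤ 1 / (3 * x.U) := by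
  have hb : (0 : ℝ) < x.b := by exact_mod_cast x.ha.trans_le x.hab
  have hU := x.one_le_U
  rw [div_le_div_iff₀ (by positivity) (by positivity)]
  have : (x.U : ℝ) * x.a ≤ 4 * x.b := by exact_mod_cast x.U_mul_le
  linarith

/-- The number of queries that are not asked by the learner. -/
def rest : ℕ := (2 + x.i.k) * (2 + 64 * x.L * x.U) * ((x.L + x.L) * 2 + 3) + (x.i.k * (128 * 6) +
  100 * x.U * (1 + x.i.k * (x.L * 2) + 1))

/-- The quantity `k / ε`. -/
def load : ℝ := x.i.k / ((x.a / x.b : ℚ) : ℝ)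

theorem k_mul_U_le : (x.i.k : ℝ) * x.U ≤ 4 * x.load := by
  have ha : (0 : ℝ) < x.a := by exact_mod_cast x.ha
  have h : (x.U : ℝ) * x.a ≤ 4 * x.b := by exact_mod_cast x.U_mul_le
  have hk : (0 : ℝ) ≤ x.i.k := Nat.cast_nonneg _
  rw [load]
  push_cast
  rw [div_div_eq_mul_div, mul_div_assoc', le_div_iff₀ ha]
  nlinarith

theorem one_le_load : 1 ≤ x.load := by
  have ha : (0 : ℝ) < x.a := by exact_mod_cast x.ha
  have hab : (x.a : ℝ) ≤ x.b := by exact_mod_cast x.hab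
  have hk : (1 : ℝ) ≤ x.i.k := by exact_mod_cast x.i.one_le_k
  rw [load]
  push_cast
  rw [div_div_eq_mul_div, le_div_iff₀ ha]
  nlinarith

/-- Take logarithms in `2 ^ L ≤ 128 k U ≤ 2 ^ 9 * load`. -/
theorem L_le : (x.L : ℝ) ≤ 9 * (1 + Real.log x.load) := by
  have h0 := x.one_le_load
  have h1 : (2 : ℝ) ^ x.L ≤ 2 ^ 9 * x.load := by
    have : (2 : ℝ) ^ x.L ≤ 128 * (x.i.k * x.U) := by exact_mod_cast x.two_pow_L_le
    linarith [x.k_mul_U_le]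
  have h2 := Real.log_le_log (by positivity) h1
  rw [Real.log_pow, Real.log_mul (by positivity) (by positivity), Real.log_pow] at h2
  have h3 := Real.log_two_gt_d9
  have h4 := Real.log_nonneg h0
  push_cast at h2
  nlinarith

theorem rest_le : (x.rest : ℝ) ≤ 700000 * x.load * (1 + Real.log x.load) ^ 2 := by
  -- The constant is `3 * 66 * 5` for the search, `128 * 6` for the dictator tests and `100 * 4` for
  -- the check. Inserting the bounds for `k U` and `L` then multiplies it by `4 * 81`, which stays
  -- below 700000.
  have h1 : x.rest ≤ 2158 * (x.i.k * x.U) * x.L ^ 2 := by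
    have hk := x.i.one_le_k
    have hU : 1 ≤ x.U := x.U_pos
    have hL : 3 ≤ x.L := by rw [L]; omega
    rw [rest]
    calc _ ≤ (3 * x.i.k) * (66 * x.L * x.U) * (5 * x.L) + (x.i.k * (128 * 6) +
          100 * x.U * (4 * x.i.k * x.L)) := by
          gcongr
          · omega
          · nlinarith
          · omega
          · nlinarith
      _ ≤ _ := by
          have e1 : x.i.k * 1 * 1 ≤ x.i.k * x.U * x.L ^ 2 := by gcongr; nlinarith
          have e2 : x.i.k * x.U * x.L ≤ x.i.k * x.U * x.L ^ 2 := by gcongr; nlinarith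
          nlinarith
  have h2 : (x.rest : ℝ) ≤ 2158 * (x.i.k * x.U) * x.L ^ 2 := by exact_mod_cast h1
  have h0 := x.one_le_load
  have h4 := Real.log_nonneg h0
  calc _ ≤ _ := h2
    _ ≤ 2158 * (4 * x.load) * (9 * (1 + Real.log x.load)) ^ 2 := by
      refine mul_le_mul (mul_le_mul_of_nonneg_left x.k_mul_U_le (by norm_num))
        (pow_le_pow_left₀ (Nat.cast_nonneg _) x.L_le 2) (by positivity) (by linarith)
    _ ≤ _ := by
      have : 0 ≤ x.load * (1 + Real.log x.load) ^ 2 := by positivity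
      nlinarith

/-- The left side is the argument of the learner's time polynomial at accuracy `ε / 12`; multiplying
the denominator by 12 adds at most four bits. -/
theorem len_le_big : x.i.len + fracLen x.a (12 * x.b) ≤ x.big := by
  have h1 : ⌈((12 * x.b : ℕ) : ℚ) / x.a⌉₊ ≤ 12 * x.U := by
    rw [Nat.ceil_le, div_le_iff₀ (by exact_mod_cast x.ha)]
    have := x.le_U_mul
    exact_mod_cast (by nlinarith : 12 * x.b ≤ 12 * x.U * x.a)
  have h2 : (12 * x.b).size ≤ 4 + x.b.size := by
    rw [Nat.size_le, pow_add]
    have := x.b.lt_size_self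
    omega
  simp only [Idx.len, fracLen, big]
  omega

theorem big_bdd : Bdd W big :=
  Bdd.mono (((Bdd.const 4).add ((Bdd.const 12).mul U_bdd)).add Bdd.self) fun x => by
    simp only [big, W, Idx.len, fracLen]
    omega

/-- Replaces the time polynomial of the learner by a single monomial in `big`, whose value the
tester can compute as the initial clock. -/
theorem eval_le_big (P : Polynomial ℕ) {y : ℕ} (hy : y ≤ x.big) :
    P.eval y ≤ P.eval 1 * x.big ^ P.natDegree :=
  (eval_mono P hy).trans (eval_le_mul_pow P (by rw [big]; omega))

end TIx

/-! ### Assembling the testers -/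

/-- A term that grows with `c` times a power of its logarithm is dominated by `softO`. -/
theorem mul_le_softO {c : ℕ} {z S T y : ℝ} {j : ℕ} (hT : 1 ≤ T) (hTS : T ≤ S) (hy : 0 ≤ y)
    (hz : z ≤ y * S * (1 + Real.log T) ^ j) (hj : j ≤ c) : z ≤ y * (S * (1 + Real.log S) ^ c) := by
  have h1 := Real.log_nonneg hT
  have h2 := Real.log_le_log (by linarith) hTS
  have h3 : (1 + Real.log T) ^ j ≤ (1 + Real.log S) ^ c :=
    (pow_le_pow_left₀ (by linarith : 0 ≤ 1 + Real.log T) (by linarith : _ ≤ 1 + Real.log S) _).trans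
      (pow_le_pow_right₀ (by linarith) hj)
  calc z ≤ _ := hz
    _ ≤ y * S * (1 + Real.log S) ^ c :=
      mul_le_mul_of_nonneg_left h3 (mul_nonneg hy (by linarith))
    _ = _ := by ring

/-- The program `sh` draws from `D' x l`, asking for at most `κ x` examples. -/
def DrawsBlks (sh : Cmd) (D' : ∀ x : TIx, ∀ l : List (Blk x.i.n), PMF (Pt l.length))
    (κ : TIx → ℕ) : Prop :=
  Poly (fun y : SmallBlks TIx.i => y.1.W) (fun y => y.1.O) sh (fun y => ctxD y.2.1 y.1.L)
    (fun y => (D' y.1 y.2.1).map fun v => .ofVec v) (fun y => κ y.1)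

/-- The common part of the three testers; they differ in the argument of the learner, its budgets,
and the source `sh` of its examples. The guarantee `hrun` is required only where the learner has
one: for isolating blocks whose function lies in `C(Y)`. -/
theorem isPolyTester {mod : Model} {R : RepClass} (hV : R.Verifiable) (hE : R.Evaluable)
    (hv : ∀ i, ClosedVarProj (R.fns i)) (hz : ∀ i, ClosedZeroProj (R.fns i))
    (hj : ∀ i, ∀ f ∈ R.fns i, IsJunta i.k f) {A sh pArg qm qq : Cmd} {c d : ℕ} {arg : TIx → Data}
    {M Q κ : TIx → ℕ} {D' : ∀ x : TIx, ∀ l : List (Blk x.i.n), PMF (Pt l.length)}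
    {bound : Idx → ℚ → ℝ}
    (hArg : PolyD TIx.W TIx.O pArg (fun x => frac x.a x.b) arg)
    (hM : PolyD TIx.W TIx.O qm (fun x => x.i.enc :+ arg x) (fun x => .binary (M x)))
    (hQ : PolyD TIx.W TIx.O qq (fun x => x.i.enc :+ arg x) (fun x => .binary (Q x)))
    (hsh : DrawsBlks sh D' κ)
    (hrun : ∀ x : TIx, x.D ∈ mod.dists x.i.n → ∀ l ts X, Found x.f l ts X → l.length ≤ x.i.k →
      ∀ hq : l.length ≤ x.i.n, blkFun x.f l ∈ R.onVars x.i hq → ∃ F T,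
        let μ := run A ⟨l.length, blkFun x.f l, D' x l⟩
          ((x.i.enc :+ .unary l.length) :+ arg x) F
        T ≤ c * x.big ^ d ∧
        (∀ o ∈ μ.support, ∃ s, o = some s ∧ s.time ≤ T ∧ s.mq ≤ M x ∧ s.exq ≤ Q x) ∧
        1 - ((1 : ℕ) : ℝ) / (24 : ℕ) ≤ prob μ (outputIn {r | R.valid x.i r ∧ ∃ g, R.val x.i r =
          lift hq g ∧
          pr (x.D.map fun u => bitsVec l.length (ts.map u)) (fun y => g y ≠ blkFun x.f l y) ≤
            ENNReal.ofReal (1 / (3 * x.U))}))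
    (hb : ∀ x : TIx, ((x.rest + (M x + κ x * Q x) : ℕ) : ℝ) ≤ bound x.i (x.a / x.b)) :
    ∃ B, IsPolyTester mod R B bound := by
  obtain ⟨V, P', hV⟩ := hV
  obtain ⟨E, P, hE⟩ := hE
  have h1 := pParams_poly c d hArg hM hQ
  obtain ⟨ν, h2, hν⟩ := pTester_poly (ι := TIx) (W := TIx.W) (i := TIx.i) (f := TIx.f) (D := TIx.D)
    (p := fun x => x.params c d (M x) (Q x)) (arg := arg) (A := A) (sh := sh) (D' := D') (κ := κ)
    hV hE (fun _ => rfl) hsh (h1.out_bdd TIx.size_inp)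
  obtain ⟨PT, h3⟩ := Poly.seqD h1 h2 TIx.size_inp
  refine ⟨pParams c d pArg qm qq ;; pTester A sh V E, PT, fun i a b ha hab f D hD => ?_⟩
  let x : TIx := ⟨i, a, b, ha, hab, f, D⟩
  have hsp := h3 x (PT.eval x.W) ⟨Function.update (fun _ => Data.nil) 0 x.inp, 0, 0, 0⟩ le_rfl
    (by simp) (fun y hy _ => by simp [hy.ne'])
  obtain ⟨hm, hsupp⟩ := hsp
  have key : ∀ S : Set Data, ∀ t : Bool, (∀ b' : Bool, Data.ofBool b' ∈ S ↔ b' ≠ t) →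
      pr (testDist R i f D (x.params c d (M x) (Q x)) (ν x)) (· = t) ≤ 1 / 3 →
      2 / 3 ≤ prob (run (pParams c d pArg qm qq ;; pTester A sh V E) ⟨i.n, f, D⟩ (Data.cons i.enc
        (frac a b)) (PT.eval (i.len + fracLen a b)))
        (outputIn S) := by
    intro S t hS h
    have := le_prob_of_pr_not_le (b := 1 / 3) (by norm_num)
      ((pr_outputIn hm S).trans_le ((pr_map _ _ _).trans_le (le_trans (pr_mono fun b' _ hb' => by
        rw [hS, not_not] at hb'; exact hb') (h.trans (by
          rw [ENNReal.ofReal_div_of_pos (by norm_num)]; simp)))))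
    norm_num at this
    exact this
  refine ⟨fun o ho => ?_, fun hf => ?_, fun hfar => ?_⟩
  · obtain ⟨s, rfl, -, h5, h6⟩ := hsupp o ho
    simp only [Nat.add_zero, Nat.zero_add] at h5 h6
    refine ⟨s, rfl, h5, le_trans ?_ (hb x)⟩
    have hM' : min (M x) (c * x.big ^ d) ≤ M x := min_le_left _ _
    have hQ' : κ x * min (Q x) (c * x.big ^ d) ≤ κ x * Q x := Nat.mul_le_mul_left _
      (min_le_left _ _)
    simp only [TIx.params] at h6
    rw [TIx.rest]
    exact_mod_cast (by omega)
  · refine key _ false (fun b' => by cases b' <;> simp [Data.ofBool, Data.truth]) ?_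
    refine testDist_complete (hj i f hf) (by simp only [TIx.params, TIx.L]; omega) x.U_pos rfl rfl
      ?_ x.masks_le x.miss_le fun l ts X hF hl hq => ?_
    · simp only [TIx.params]
      change (i.k + 1) * _ + _ ≤ (2 + i.k) * _
      nlinarith
    · obtain ⟨F, T, hT, hok, hpr⟩ := hrun x hD l ts X hF hl hq (hF.mem_onVars (hv i) (hz i) hf hq)
      refine (pr_outputIn (hν x l hl F (allOK_min hT hok)) _).symm.trans_le
        ((pr_not_le_of_le_prob (by norm_num) hpr).trans ?_)
      -- The learner fails with probability at most `1/24`, well within its share of `1/12`.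
      rw [ENNReal.ofReal_le_iff_le_toReal (by finiteness)]
      norm_num
  · refine key _ true (fun b' => by cases b' <;> simp [Data.ofBool, Data.truth]) ?_
    refine testDist_sound (hv i) (hz i) x.U_pos (fun g hg => ?_) x.k_mul_le rfl rfl (ν x)
    refine x.one_div_U_le.trans ((hfar g hg).trans (le_of_eq ?_))
    rw [errProb, prob_eq]
    congr 1
    exact pr_congr fun u _ => ne_comm

theorem PolyD.of_computesIn {ι : Type} {W : ι → ℕ} {O : ι → Oracle} {c : Cmd} {inp out : ι → Data}
    {T : ι → ℕ} (hT : Bdd W T) (h : ∀ x, ComputesIn c (inp x) (out x) (T x)) :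
    PolyD W O (.clean c) inp out :=
  Poly.of_bdd ((hT.add (Bdd.const (2 * c.bnd))).add (Bdd.const 1)) fun x => (h x).spec

/-- The input of a learner with `1/12` of the accuracy and confidence `23/24`. -/
def pArg : Cmd := .push (.tl (.var 0)) pTwelve ;;
  .assign 0 ((.nth 1 :* .nth 0) :* .lit (frac 1 24))

theorem pArg_poly : PolyD TIx.W TIx.O pArg (fun x => frac x.a x.b)
    (fun x => frac x.a (12 * x.b) :+ frac 1 24) := by
  refine PolyD.pushD (a := fun x => .binary x.b) (a' := fun x => .binary (12 * x.b)) ?_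
    (pTwelve_poly fun x => x.ha.trans_le x.hab) <| PolyD.assign ?_
  · exact fun x σ h => by simp [h, frac]
  · exact fun x σ h => by simp [h, frac]

theorem PolyBound.poly {M : Idx → ℚ → ℚ → ℕ} (h : PolyBound M) :
    ∃ c, PolyD TIx.W TIx.O c (fun x => x.i.enc :+ frac x.a (12 * x.b) :+ frac 1 24)
      (fun x => .binary (M x.i (x.a / x.b / 12) (1 / 24))) := by
  obtain ⟨A, h⟩ := h
  obtain ⟨P, h⟩ := h 1 24 one_pos (by norm_num)
  refine ⟨.clean A, PolyD.of_computesIn ((TIx.big_bdd.mono TIx.len_le_big).eval P) fun x => ?_⟩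
  have hb := x.ha.trans_le x.hab
  have hab := x.hab
  have := h x.i x.a (12 * x.b) x.ha (by omega)
  convert this using 3
  · push_cast; rw [div_div, mul_comm]
  · norm_num

/-- In the uniform model the learner's examples are coin flips and cost no query. The exact learner
uses the same source, although its example budget is zero. -/
theorem drawsBlks_coins : DrawsBlks pCoins (fun _ l => unif l.length) fun _ => 0 :=
  pCoins_poly (n := fun y : SmallBlks TIx.i => y.1.i.n)

/-- One example of the learner costs one example of `f` and `2 L` membership queries for each of at
most `k` blocks. -/
theorem drawsBlks_decSample : DrawsBlks pDecSample (fun x => decD x.f x.D x.L)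
    fun x => 1 + x.i.k * (x.L * 2) :=
  Poly.mono (pSampleDecode_poly (n := fun y : SmallBlks TIx.i => y.1.i.n)
    (f := fun y => y.1.f) (D := fun y => y.1.D)) fun y =>
      Nat.add_le_add_left (Nat.mul_le_mul_right _ y.2.2) _

theorem prob_mono {α : Type} {p : PMF α} {S S' : Set α} (h : S ⊆ S') : prob p S ≤ prob p S' := by
  rw [prob_eq, prob_eq]
  exact ENNReal.toReal_mono (pr_ne_top _ _) (pr_mono fun a _ ha => h ha)

theorem uniform_map_fst {α β : Type} [Fintype α] [Nonempty α] [Fintype β] [Nonempty β] :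
    (PMF.uniformOfFintype (α × β)).map Prod.fst = PMF.uniformOfFintype α := by
  rw [← uniform_prod, PMF.map_bind]
  simp only [PMF.map_comp]
  exact (congrArg _ (funext fun a => PMF.map_const _ _)).trans (PMF.bind_pure _)

/-- The relevant coordinates of a uniform point are uniform. -/
theorem unif_map_bitsVec {n m : ℕ} {ts : List (Fin n)} (hts : ts.Nodup) (hm : m = ts.length) :
    (unif n).map (fun u => bitsVec m (ts.map u)) = unif m := by
  subst hm
  have e : (fun u : Pt n => bitsVec ts.length (ts.map u)) = fun u j => u ts[j.1] := by
    funext u j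
    simp [bitsVec]
  rw [e]
  classical
  let s : Set (Fin n) := Set.range fun j : Fin ts.length => ts[j.1]
  let e1 : Fin ts.length ≃ s := Equiv.ofInjective _ fun a b h =>
    Fin.ext ((hts.getElem_inj_iff).1 h)
  have e2 : (fun (u : Pt n) (j : Fin ts.length) => u ts[j.1]) =
      (Equiv.arrowCongr e1.symm (Equiv.refl Bool)) ∘ Prod.fst ∘
        (Equiv.piEquivPiSubtypeProd (· ∈ s) fun _ => Bool) := rfl
  rw [e2, ← PMF.map_comp, ← PMF.map_comp, unif, uniform_map_equiv, uniform_map_fst]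
  exact uniform_map_equiv _

theorem errProb_le_iff {q : ℕ} {D : PMF (Pt q)} {g h : Pt q → Bool} {b : ℝ}
    (hb : 0 ≤ b) : errProb D h g ≤ b ↔ pr D (fun y => h y ≠ g y) ≤ ENNReal.ofReal b := by
  rw [errProb, prob_eq, ENNReal.le_ofReal_iff_toReal_le (pr_ne_top _ _) hb]
  rfl

section
variable {R : RepClass}

/-- An exact learner asks for no examples, and its hypothesis equals the target, so its error is
zero under every distribution. This is why the same argument serves both models. -/
theorem exact_tester (hV : R.Verifiable) (hE : R.Evaluable)
    (hv : ∀ i, ClosedVarProj (R.fns i)) (hz : ∀ i, ClosedZeroProj (R.fns i))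
    (hj : ∀ i, ∀ f ∈ R.fns i, IsJunta i.k f) {A : Cmd} {M : Idx → ℚ → ℕ} (hM : PolyBoundExact M)
    (hA : ExactLearns R A M) (mod : Model) {bound : Idx → ℚ → ℝ}
    (hb : ∀ x : TIx, ((x.rest + M x.i (1 / 24) : ℕ) : ℝ) ≤ bound x.i (x.a / x.b)) :
    ∃ B, IsPolyTester mod R B bound := by
  obtain ⟨c, hc⟩ := hM
  obtain ⟨P, hP⟩ := hc 1 24 one_pos (by norm_num)
  obtain ⟨P', hA⟩ := hA 1 24 one_pos (by norm_num)
  have e : ((1 : ℕ) : ℚ) / (24 : ℕ) = 1 / 24 := by norm_num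
  rw [e] at hA hP
  have hlen : Bdd TIx.W fun x => x.i.len := Bdd.mono Bdd.self fun x => Nat.le_add_right _ _
  have hlen' : ∀ x : TIx, x.i.len ≤ x.big := fun x => (Nat.le_add_right _ _).trans x.len_le_big
  refine isPolyTester hV hE hv hz hj (A := A) (pArg := .assign 0 (.lit (frac 1 24)))
    (qq := .assign 0 .nil)
    (M := fun x => M x.i (1 / 24)) (Q := fun _ => 0) (κ := fun _ => 0) (c := P'.eval 1)
    (d := P'.natDegree) (D' := fun _ l => unif l.length)
    (PolyD.assign (out := fun _ => frac 1 24) fun x σ h => by simp)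
    (PolyD.of_computesIn (hlen.eval P) fun x => hP x.i)
    (PolyD.assign fun x σ h => rfl)
    drawsBlks_coins (fun x hD l ts X hF hl hq hg => ?_) fun x => by simpa using hb x
  obtain ⟨h1, h2⟩ := hA x.i l.length hq hl _ hg
  refine ⟨P'.eval x.i.len, _, x.eval_le_big P' (hlen' x), fun o ho => ?_, h2.trans (prob_mono ?_)⟩
  · obtain ⟨s, rfl, h3, h4, h5⟩ := h1 o ho
    exact ⟨s, rfl, h3, h4, h5.le⟩
  · rintro o ⟨s, rfl, hs1, hs2⟩
    exact ⟨s, rfl, hs1, _, hs2, by simp [pr]⟩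

/-- `hD'` says that, for isolating blocks, the examples offered to the learner are distributed as
the relevant coordinates of an example of `f`. Hence the learner's error bound is an error bound
under `D`. -/
theorem pac_tester (hV : R.Verifiable) (hE : R.Evaluable)
    (hv : ∀ i, ClosedVarProj (R.fns i)) (hz : ∀ i, ClosedZeroProj (R.fns i))
    (hj : ∀ i, ∀ f ∈ R.fns i, IsJunta i.k f) {A : Cmd} {M Q : Idx → ℚ → ℚ → ℕ} (hM : PolyBound M)
    (hQ : PolyBound Q) {mod : Model} (hA : PACLearns mod R A M Q) {sh : Cmd} {κ : TIx → ℕ}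
    {D' : ∀ x : TIx, ∀ l : List (Blk x.i.n), PMF (Pt l.length)}
    (hsh : DrawsBlks sh D' κ)
    (hD' : ∀ x : TIx, x.D ∈ mod.dists x.i.n → ∀ l ts X, Found x.f l ts X →
      D' x l ∈ mod.dists l.length ∧ D' x l = x.D.map fun u => bitsVec l.length (ts.map u))
    {bound : Idx → ℚ → ℝ}
    (hb : ∀ x : TIx, ((x.rest + (M x.i (x.a / x.b / 12) (1 / 24) + κ x * Q x.i (x.a / x.b / 12)
      (1 / 24)) :
      ℕ) : ℝ) ≤ bound x.i (x.a / x.b)) :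
    ∃ B, IsPolyTester mod R B bound := by
  obtain ⟨qm, hqm⟩ := hM.poly
  obtain ⟨qq, hqq⟩ := hQ.poly
  obtain ⟨P, hA⟩ := hA 1 24 one_pos (by norm_num)
  refine isPolyTester hV hE hv hz hj (A := A) (c := P.eval 1) (d := P.natDegree) pArg_poly hqm hqq
    hsh
    (fun x hD l ts X hF hl hq hg => ?_) hb
  obtain ⟨hD1, hD2⟩ := hD' x hD l ts X hF
  have hb0 := x.ha.trans_le x.hab
  have hab := x.hab
  obtain ⟨h1, h2⟩ := hA x.i x.a (12 * x.b) x.ha (by omega) l.length hq hl _ hg _ hD1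
  have e : (x.a : ℚ) / (12 * x.b : ℕ) = x.a / x.b / 12 := by push_cast; rw [div_div, mul_comm]
  have e' : ((1 : ℕ) : ℚ) / (24 : ℕ) = 1 / 24 := by norm_num
  rw [e, e'] at h1
  refine ⟨P.eval (x.i.len + fracLen x.a (12 * x.b)), _, x.eval_le_big P x.len_le_big, h1, h2.trans
    (prob_mono ?_)⟩
  rintro o ⟨s, rfl, hs1, g, hg1, hg2⟩
  refine ⟨s, rfl, hs1, g, hg1, ?_⟩
  rw [← hD2, ← errProb_le_iff (by positivity)]
  refine hg2.trans ?_
  push_cast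
  exact x.div_le_one_div_U

end

end ConciseTest
end

open ConciseTest in
theorem mainTheorem2 :
    ∃ c : ℕ, ∀ R : RepClass,
      R.Verifiable → R.Evaluable →
      (∀ i : Idx, ClosedVarProj (R.fns i)) → (∀ i : Idx, ClosedZeroProj (R.fns i)) →
      (∀ i : Idx, ∀ f ∈ R.fns i, IsJunta i.k f) →
      -- exact learning
      (∀ (A : Cmd) (M : Idx → ℚ → ℕ), PolyBoundExact M → ExactLearns R A M →
        ∀ mod : Model, ∃ B : Cmd, IsPolyTester mod R B fun i ε =>
          M i (1 / 24) + softO c (i.k / ε)) ∧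
      -- PAC learning, uniform model
      (∀ (A : Cmd) (M Q : Idx → ℚ → ℚ → ℕ), PolyBound M → PolyBound Q →
        PACLearns Model.uniform R A M Q →
        ∃ B : Cmd, IsPolyTester Model.uniform R B fun i ε =>
          softO c (M i (ε / 12) (1 / 24) + Q i (ε / 12) (1 / 24) + i.k / ε)) ∧
      -- PAC learning, distribution-free model
      (∀ (A : Cmd) (M Q : Idx → ℚ → ℚ → ℕ), PolyBound M → PolyBound Q →
        PACLearns Model.distFree R A M Q →
        ∃ B : Cmd, IsPolyTester Model.distFree R B fun i ε =>
          softO c (M i (ε / 12) (1 / 24) + i.k * Q i (ε / 12) (1 / 24) + i.k / ε)) := by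
  -- 700000 bounds the queries outside the learner, and the margin covers those made for it. The
  -- same number serves as exponent, of which only 2 is needed; it is kept opaque so that no power
  -- with this exponent is evaluated.
  obtain ⟨c, hc⟩ : ∃ c : ℕ, c = 800000 := ⟨_, rfl⟩
  have hc' : (c : ℝ) = 800000 := by rw [hc]; norm_num
  refine ⟨c, fun R hV hE hv hz hj => ⟨fun A M hM hA mod => exact_tester hV hE hv hz hj hM hA mod
    fun x => ?_, fun A M Q hM hQ hA => pac_tester hV hE hv hz hj hM hQ hA
      (κ := fun _ => 0) (D' := fun _ l => unif l.length) drawsBlks_coins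
      (fun x hD l ts X hF => ?_) fun x => ?_, fun A M Q hM hQ hA => pac_tester hV hE hv hz hj hM hQ hA
      (κ := fun x => 1 + x.i.k * (x.L * 2)) (D' := fun x l => decD x.f x.D x.L l)
        drawsBlks_decSample (fun x _ l ts X hF => ⟨trivial, decD_exact (Blk.Isolates.forall₂_res hF.iso)
          (by rw [TIx.L]; omega)⟩) fun x => ?_⟩⟩
  · have h0 := x.one_le_load
    have h1 := mul_le_softO (c := c) h0 le_rfl (by norm_num) x.rest_le (by omega)
    have h2 := Real.log_nonneg h0
    have h3 : 0 ≤ x.load * (1 + Real.log x.load) ^ c := by positivity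
    change _ ≤ _ + softO c x.load
    rw [softO, hc']
    push_cast
    linarith
  -- In the uniform model the relevant coordinates of a uniform point are again uniform, which
  -- justifies replacing examples by coins.
  · rw [show x.D = unif _ from hD]
    exact ⟨rfl, (unif_map_bitsVec hF.nodup hF.iso.length_eq).symm⟩
  · have h0 := x.one_le_load
    generalize M x.i (x.a / x.b / 12) (1 / 24) = m
    generalize Q x.i (x.a / x.b / 12) (1 / 24) = q
    change _ ≤ softO c (m + q + x.load)
    have hS : x.load ≤ m + q + x.load := by
      have : (0 : ℝ) ≤ m + q := by positivity
      linarith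
    have h2 := Real.log_nonneg (h0.trans hS)
    have h4 : (1 : ℝ) ≤ (1 + Real.log (m + q + x.load)) ^ c := one_le_pow₀ (by linarith)
    have h1 := mul_le_softO (c := c) (S := m + q + x.load) h0 hS (by norm_num) (y := 700000) (j := 2)
      (x.rest_le.trans (by gcongr)) (by omega)
    rw [softO, hc']
    push_cast
    nlinarith
  · have h0 := x.one_le_load
    generalize M x.i (x.a / x.b / 12) (1 / 24) = m
    generalize Q x.i (x.a / x.b / 12) (1 / 24) = q
    change _ ≤ softO c (m + x.i.k * q + x.load)
    have hm : (0 : ℝ) ≤ m := Nat.cast_nonneg _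
    have hkq : (0 : ℝ) ≤ x.i.k * q := by positivity
    have hS : x.load ≤ m + x.i.k * q + x.load := by linarith
    have h2 := Real.log_nonneg (h0.trans hS)
    have h2' := Real.log_nonneg h0
    have h4 : (1 : ℝ) ≤ (1 + Real.log (m + x.i.k * q + x.load)) ^ c := one_le_pow₀ (by linarith)
    have h1 := mul_le_softO (c := c) (S := m + x.i.k * q + x.load) h0 hS (by norm_num) (y := 700000)
      (j := 2) (x.rest_le.trans (by gcongr)) (by omega)
    -- The price of the decoded examples: `L` contributes only a logarithm, so `k q` remains up to
    -- logarithmic factors; the constant 27 below is `3 * 9`, with the 9 from `L_le`.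
    have h5 : ((1 + x.i.k * (x.L * 2)) * q : ℝ) ≤ 3 * x.L * (x.i.k * q) := by
      have h6 : 1 ≤ x.i.k * x.L := Nat.mul_pos x.i.one_le_k (by rw [TIx.L]; omega)
      have h6 : (1 : ℝ) ≤ x.i.k * x.L := by exact_mod_cast h6
      have := mul_le_mul_of_nonneg_right h6 (Nat.cast_nonneg (α := ℝ) q)
      linarith
    have h7 := mul_le_softO (c := c) (z := (1 + x.i.k * (x.L * 2)) * q) (S := m + x.i.k * q + x.load)
      h0 hS (by norm_num) (y := 27) (j := 1) (h5.trans (by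
        calc 3 * x.L * (x.i.k * q) ≤ 3 * (9 * (1 + Real.log x.load)) * (x.i.k * q) := by
              gcongr; exact x.L_le
          _ ≤ 3 * (9 * (1 + Real.log x.load)) * (m + x.i.k * q + x.load) :=
              mul_le_mul_of_nonneg_left (by linarith) (by linarith)
          _ = _ := by ring)) (by omega)
    rw [softO, hc']
    push_cast
    nlinarith
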